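/- Let $l=-\frac{d^2}{dx^2}+q$ on $(0,1)$ be regular singular: $q$ is real and, for some integer $N\ge 1$ and real functions $a_0,a_1\in C^\infty([0,1))$ with $a_0(0),a_1(0)\ge -\tfrac14$, $$q(x)=x^{-2}a_0(x^{1/N})=(1-x)^{-2}a_1((1-x)^{1/N}),\qquad 0<x<1 .$$ Let $l_{\max}$ be the maximal operator of $l$ in $L^2[0,1]$. At $0$ impose one of the boundary conditions $R_0f=0$: - (Dirichlet) $R_0f=\lim_{x\to0}\psi_{\nu_0}(x)^{-1}f(x)$, where $\nu_0=\sqrt{a_0(0)+1/4}$, $\psi_{\nu}(x)=x^{1/2-\nu}/(2\nu)$ for $\nu>0$ and $\psi_0(x)=-x^{1/2}\log x$ (this is $R_0f=f(0)$ if $q$ is continuous at $0$); - (generalized Neumann, only if $q$ is continuous at $0$) $R_0f=f'(0)+Af(0)$ with $A\in\mathbb R$; then $\nu_0:=-\tfrac12$. Assume that $q$ is continuous at $1$, i.e. has a finite limit there. Let $I\subset\mathbb R$ be a nondegenerate interval, $a\in C^\infty(I,\mathbb R)$, $R_{1,t}f=f'(1)+a(t)f(1)$, and let $L_t=(l,R_0,R_{1,t})$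 be the restriction of $l_{\max}$ to $\{f\in\mathcal D(l_{\max}) : R_0f=0,\ R_{1,t}f=0\}$. Let $\varphi_t,\psi_t:(0,1)\to\mathbb R$ be the normalized solutions at $0$ and at $1$: $l\varphi_t=0$, $R_0\varphi_t=0$, $x^{-\nu_0-1/2}\varphi_t(x)\to1$ as $x\to0$; and $l\psi_t=0$, $R_{1,t}\psi_t=0$, $\psi_t(x)\to1$ as $x\to1$. Put $W(\psi_t,\varphi_t)=\psi_t\varphi_t'-\psi_t'\varphi_t$. For every $t\in I$ the zeta function $\zeta_{L_t}(s)=\sum_{\lambda\in\operatorname{spec}L_t\setminus\{0\}}\lambda^{-s}$ (with multiplicity, $\operatorname{Re}s$ large, $\lambda^{-s}=e^{-i\pi s}|\lambda|^{-s}$ for $\lambda<0$) continues meromorphically to a half-plane containing $0$ and is regular at $0$; put $T(L_t)=-\zeta_{L_t}'(0)$. If $t\in I$ and $L_t$ is invertible, then $W(\psi_t,\varphi_t)\ne0$, the functions $T(L_t)$ and $\log W(\psi_t,\varphi_t)$ are differentiable at $t$, and $$\frac{d}{dt}T(L_t)=\frac{d}{dt}\log W(\psi_t,\varphi_t).$$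 (The principal logarithm is used; derivatives at end points of $I$ are one-sided.) -/

import Mathlib

open Set Filter Topology MeasureTheory
open scoped ContDiff

noncomputable section

namespace SturmLiouville

/-! ### Regular singular potentials and boundary conditions -/

/-- `q` is a regular singular potential on `(0,1)`: with a positive integer `N` and real functions
`a₀`, `a₁` smooth on `[0,1)` (up to the end point `0`),
`q x = x⁻² a₀ (x^{1/N}) = (1-x)⁻² a₁ ((1-x)^{1/N})`, and the leading coefficients at both ends
are at least `-1/4`. -/
structure RegularSingular (N : ℕ) (a₀ a₁ q : ℝ → ℝ) : Prop where
  pos : 0 < N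
  smooth_left : ContDiffOn ℝ ∞ a₀ (Ico 0 1)
  smooth_right : ContDiffOn ℝ ∞ a₁ (Ico 0 1)
  eq_left : ∀ x ∈ Ioo (0 : ℝ) 1, q x = a₀ (x ^ (1 / (N : ℝ))) / x ^ 2
  eq_right : ∀ x ∈ Ioo (0 : ℝ) 1, q x = a₁ ((1 - x) ^ (1 / (N : ℝ))) / (1 - x) ^ 2
  bound_left : -(1 / 4) ≤ a₀ 0
  bound_right : -(1 / 4) ≤ a₁ 0

/-- `q`, given on `(0,1)`, is continuous at the end point `0`. -/
def ContinuousAtZero (q : ℝ → ℝ) : Prop := ∃ c, Tendsto q (𝓝[>] 0) (𝓝 c)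

/-- `q`, given on `(0,1)`, is continuous at the end point `1`. -/
def ContinuousAtOne (q : ℝ → ℝ) : Prop := ∃ c, Tendsto q (𝓝[<] 1) (𝓝 c)

/-- The type of the boundary operator at `0`. -/
inductive LeftBC
  | dirichlet
  | neumann (A : ℝ)

/-- Generalized Neumann conditions are imposed at `0` only if `q` is continuous there. -/
def LeftBC.Admissible (q : ℝ → ℝ) : LeftBC → Prop
  | .dirichlet => True
  | .neumann _ => ContinuousAtZero q

/-- The number `ν₀`. If `q` is continuous at `0` then `a₀ 0 = 0`, and the value for the Dirichlet
condition is `1/2`. -/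
def LeftBC.nu (a₀ : ℝ → ℝ) : LeftBC → ℝ
  | .dirichlet => √(a₀ 0 + 1 / 4)
  | .neumann _ => -(1 / 2)

/-- The second solution `ψ_ν` of the model equation `-f'' + x⁻² (ν² - 1/4) f = 0`. -/
def psiModel (ν x : ℝ) : ℝ :=
  if ν = 0 then -(x ^ (1 / 2 : ℝ) * Real.log x) else x ^ (1 / 2 - ν) / (2 * ν)

section
variable {E : Type*} [NormedAddCommGroup E] [NormedSpace ℝ E]

/-- `R₀ f = 0`. Dirichlet: `R₀ f = lim_{x → 0} ψ_{ν₀}(x)⁻¹ f(x)`, which is `f(0)` if `q` is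
continuous at `0`, since then `ψ_{1/2} = 1`. Generalized Neumann: `R₀ f = f'(0) + A f(0)`, where
`f(0)`, `f'(0)` are the boundary values of `f`, `f'`. -/
def LeftBC.Vanishes (a₀ : ℝ → ℝ) (f : ℝ → E) : LeftBC → Prop
  | .dirichlet =>
      Tendsto (fun x => (psiModel (LeftBC.nu a₀ .dirichlet) x)⁻¹ • f x) (𝓝[>] 0) (𝓝 0)
  | .neumann A => ∃ b c : E, Tendsto f (𝓝[>] 0) (𝓝 b) ∧ Tendsto (deriv f) (𝓝[>] 0) (𝓝 c) ∧
      c + A • b = 0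

/-- `R₁ f = 0` for `R₁ f = f'(1) + a f(1)`, where `f(1)`, `f'(1)` are the boundary values of
`f`, `f'`. -/
def RightVanishes (a : ℝ) (f : ℝ → E) : Prop :=
  ∃ b c : E, Tendsto f (𝓝[<] 1) (𝓝 b) ∧ Tendsto (deriv f) (𝓝[<] 1) (𝓝 c) ∧ c + a • b = 0

lemma LeftBC.Vanishes.zero (a₀ : ℝ → ℝ) (B : LeftBC) :
    B.Vanishes a₀ (fun _ => (0 : E)) := by
  cases B with
  | dirichlet => simp [LeftBC.Vanishes]
  | neumann A => exact ⟨0, 0, tendsto_const_nhds, by simp, by simp⟩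

lemma RightVanishes.zero (a : ℝ) : RightVanishes a (fun _ => (0 : E)) :=
  ⟨0, 0, tendsto_const_nhds, by simp, by simp⟩

lemma eventually_left : ∀ᶠ x in 𝓝[>] (0 : ℝ), x ∈ Ioo (0 : ℝ) 1 :=
  Ioo_mem_nhdsGT one_pos

lemma eventually_right : ∀ᶠ x in 𝓝[<] (1 : ℝ), x ∈ Ioo (0 : ℝ) 1 :=
  Ioo_mem_nhdsLT one_pos

lemma deriv_lin {u v : ℝ → ℂ} {k x : _} (c : ℂ) (hu : DifferentiableAt ℝ u x)
    (hv : DifferentiableAt ℝ v x) (hk : k = fun x => c * u x + v x) :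
    deriv k x = c * deriv u x + deriv v x := by
  subst hk
  exact ((hu.hasDerivAt.const_mul c).add hv.hasDerivAt).deriv

lemma LeftBC.Vanishes.lin {a₀ : ℝ → ℝ} {B : LeftBC} {u v : ℝ → ℂ} (c : ℂ)
    (hu : ∀ x ∈ Ioo (0 : ℝ) 1, DifferentiableAt ℝ u x)
    (hv : ∀ x ∈ Ioo (0 : ℝ) 1, DifferentiableAt ℝ v x)
    (h₁ : B.Vanishes a₀ u) (h₂ : B.Vanishes a₀ v) :
    B.Vanishes a₀ (fun x => c * u x + v x) := by
  cases B with
  | dirichlet =>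
    have := (Tendsto.const_mul c h₁).add h₂
    simp only [mul_zero, add_zero] at this
    refine this.congr fun x => ?_
    rw [smul_add, mul_smul_comm]
  | neumann A =>
    obtain ⟨b, d, hb, hd, h⟩ := h₁
    obtain ⟨b', d', hb', hd', h'⟩ := h₂
    refine ⟨c * b + b', c * d + d', (hb.const_mul c).add hb', ?_, ?_⟩
    · refine ((hd.const_mul c).add hd').congr' ?_
      filter_upwards [eventually_left] with x hx
      exact (deriv_lin c (hu x hx) (hv x hx) rfl).symm
    · rw [smul_add, ← mul_smul_comm]
      linear_combination c * h + h'

lemma RightVanishes.lin {a : ℝ} {u v : ℝ → ℂ} (c : ℂ)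
    (hu : ∀ x ∈ Ioo (0 : ℝ) 1, DifferentiableAt ℝ u x)
    (hv : ∀ x ∈ Ioo (0 : ℝ) 1, DifferentiableAt ℝ v x)
    (h₁ : RightVanishes a u) (h₂ : RightVanishes a v) :
    RightVanishes a (fun x => c * u x + v x) := by
  obtain ⟨b, d, hb, hd, h⟩ := h₁
  obtain ⟨b', d', hb', hd', h'⟩ := h₂
  refine ⟨c * b + b', c * d + d', (hb.const_mul c).add hb', ?_, ?_⟩
  · refine ((hd.const_mul c).add hd').congr' ?_
    filter_upwards [eventually_right] with x hx
    exact (deriv_lin c (hu x hx) (hv x hx) rfl).symm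
  · rw [smul_add, ← mul_smul_comm]
    linear_combination c * h + h'

end

/-! ### The operator in `L²(0,1)` -/

/-- Lebesgue measure on `(0,1)`. -/
abbrev unitMeasure : Measure ℝ := volume.restrict (Ioo 0 1)

/-- The complex Hilbert space `L²(0,1)`. -/
abbrev H : Type := Lp ℂ 2 unitMeasure

/-- `u` and `u'` are locally absolutely continuous in `(0,1)` and `-u'' + q u = g` a.e. For
`u, g ∈ L²(0,1)` this says that `u` is in the domain of the maximal operator `l_max` of
`l = -d²/dx² + q` and `l_max u = g`. -/
structure IsMaximalPair (q : ℝ → ℝ) (u g : ℝ → ℂ) : Prop where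
  differentiable : ∀ x ∈ Ioo (0 : ℝ) 1, DifferentiableAt ℝ u x
  absCont : ∀ x ∈ Ioo (0 : ℝ) 1, ∀ y ∈ Ioo (0 : ℝ) 1,
    AbsolutelyContinuousOnInterval (deriv u) x y
  equation : ∀ᵐ x ∂unitMeasure, HasDerivAt (deriv u) (q x * u x - g x) x

lemma IsMaximalPair.lin {q : ℝ → ℝ} {u v g h k : ℝ → ℂ} (c : ℂ)
    (h₁ : IsMaximalPair q u g) (h₂ : IsMaximalPair q v h)
    (hk : k =ᵐ[unitMeasure] fun x => c * g x + h x) :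
    IsMaximalPair q (fun x => c * u x + v x) k where
  differentiable x hx := ((h₁.differentiable x hx).const_mul c).add (h₂.differentiable x hx)
  absCont x hx y hy := by
    have key := ((h₁.absCont x hx y hy).const_smul c).add (h₂.absCont x hx y hy)
    refine Tendsto.congr' ?_ key
    refine eventually_inf_principal.2 (Eventually.of_forall fun E hE => ?_)
    refine Finset.sum_congr rfl fun i hi => ?_
    have hsub : uIcc x y ⊆ Ioo (0 : ℝ) 1 := Set.ordConnected_Ioo.uIcc_subset hx hy
    have e₁ := hsub (hE.1 i hi).1
    have e₂ := hsub (hE.1 i hi).2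
    rw [deriv_lin c (h₁.differentiable _ e₁) (h₂.differentiable _ e₁) rfl,
      deriv_lin c (h₁.differentiable _ e₂) (h₂.differentiable _ e₂) rfl]
    simp
  equation := by
    filter_upwards [h₁.equation, h₂.equation, hk, ae_restrict_mem measurableSet_Ioo]
      with x e₁ e₂ e₃ hx
    have key := (e₁.const_mul c).add e₂
    have : HasDerivAt (deriv fun x => c * u x + v x)
        (c * (q x * u x - g x) + (q x * v x - h x)) x := by
      refine key.congr_of_eventuallyEq ?_
      filter_upwards [Ioo_mem_nhds hx.1 hx.2] with y hy
      exact deriv_lin c (h₁.differentiable y hy) (h₂.differentiable y hy) rfl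
    convert this using 1
    rw [e₃]; ring

/-- The graph of `L = (l, R₀, R₁)`, `R₁ f = f'(1) + a f(1)`: pairs `(f, l f)` with
`f ∈ D(l_max)`, `R₀ f = 0`, `R₁ f = 0` (`u` is the continuously differentiable representative
of `f`). -/
def opGraph (q a₀ : ℝ → ℝ) (B : LeftBC) (a : ℝ) : Submodule ℂ (H × H) where
  carrier := {p | ∃ u : ℝ → ℂ, (p.1 : ℝ → ℂ) =ᵐ[unitMeasure] u ∧ IsMaximalPair q u p.2 ∧
    B.Vanishes a₀ u ∧ RightVanishes a u}
  zero_mem' := by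
    refine ⟨fun _ => 0, Lp.coeFn_zero _ _ _, ⟨fun x _ => by simp, fun x _ y _ => ?_, ?_⟩,
      LeftBC.Vanishes.zero a₀ B, RightVanishes.zero a⟩
    · simpa [AbsolutelyContinuousOnInterval] using tendsto_const_nhds
    · filter_upwards [Lp.coeFn_zero ℂ 2 unitMeasure] with x hx
      have : ((0 : H × H).2 : ℝ → ℂ) x = 0 := hx
      simp only [this, deriv_const', mul_zero, sub_zero]
      exact hasDerivAt_const _ _
  add_mem' := by
    rintro p r ⟨u, hu, mu, lu, ru⟩ ⟨v, hv, mv, lv, rv⟩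
    refine ⟨fun x => 1 * u x + v x, ?_, mu.lin 1 mv ?_,
      lu.lin 1 mu.differentiable mv.differentiable lv,
      ru.lin 1 mu.differentiable mv.differentiable rv⟩
    · filter_upwards [Lp.coeFn_add p.1 r.1, hu, hv] with x h₁ h₂ h₃
      simp only [Prod.fst_add, h₁, Pi.add_apply, h₂, h₃, one_mul]
    · filter_upwards [Lp.coeFn_add p.2 r.2] with x h₁
      simp only [Prod.snd_add, h₁, Pi.add_apply, one_mul]
  smul_mem' := by
    rintro c p ⟨u, hu, mu, lu, ru⟩
    have m0 : IsMaximalPair q (fun _ => 0) (fun _ => 0) :=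
      ⟨fun x _ => by simp, fun x _ y _ => by
          simpa [AbsolutelyContinuousOnInterval] using tendsto_const_nhds,
        Eventually.of_forall fun x => by
          simp only [deriv_const', mul_zero, sub_zero]; exact hasDerivAt_const _ _⟩
    refine ⟨fun x => c * u x + 0, ?_, mu.lin c m0 ?_,
      lu.lin c mu.differentiable m0.differentiable (LeftBC.Vanishes.zero a₀ B),
      ru.lin c mu.differentiable m0.differentiable (RightVanishes.zero a)⟩
    · filter_upwards [Lp.coeFn_smul c p.1, hu] with x h₁ h₂
      simp only [Prod.smul_fst, h₁, Pi.smul_apply, h₂, smul_eq_mul, add_zero]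
    · filter_upwards [Lp.coeFn_smul c p.2] with x h₁
      simp only [Prod.smul_snd, h₁, Pi.smul_apply, smul_eq_mul, add_zero]

/-- The graph is single valued. -/
lemma opGraph_snd_eq_zero (q a₀ : ℝ → ℝ) (B : LeftBC) (a : ℝ) (p : H × H)
    (hp : p ∈ opGraph q a₀ B a) (h0 : p.1 = 0) : p.2 = 0 := by
  obtain ⟨u, hu, mu, -, -⟩ := hp
  have h1 : u =ᵐ[unitMeasure] fun _ => (0 : ℂ) := by
    rw [h0] at hu
    exact hu.symm.trans (Lp.coeFn_zero _ _ _)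
  have h2 : EqOn u (fun _ => (0 : ℂ)) (Ioo 0 1) :=
    Measure.eqOn_open_of_ae_eq h1 isOpen_Ioo
      (fun x hx => (mu.differentiable x hx).continuousAt.continuousWithinAt)
      continuousOn_const
  have h3 : EqOn (deriv u) (fun _ => (0 : ℂ)) (Ioo 0 1) := fun x hx => by
    have : u =ᶠ[𝓝 x] fun _ => (0 : ℂ) :=
      h2.eventuallyEq_of_mem (Ioo_mem_nhds hx.1 hx.2)
    rw [this.deriv_eq]; simp
  refine Lp.ext ?_
  filter_upwards [mu.equation, Lp.coeFn_zero ℂ 2 unitMeasure, ae_restrict_mem measurableSet_Ioo]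
    with x e₁ e₂ hx
  have h4 : deriv u =ᶠ[𝓝 x] fun _ => (0 : ℂ) :=
    h3.eventuallyEq_of_mem (Ioo_mem_nhds hx.1 hx.2)
  have h5 := e₁.unique ((hasDerivAt_const x (0 : ℂ)).congr_of_eventuallyEq h4)
  rw [h2 hx, mul_zero, zero_sub, neg_eq_zero] at h5
  rw [h5, e₂]; rfl

/-- The (unbounded) operator `L = (l, R₀, R₁)` in `L²(0,1)`, with `l = -d²/dx² + q` and
`R₁ f = f'(1) + a f(1)`. -/
def op (q a₀ : ℝ → ℝ) (B : LeftBC) (a : ℝ) : H →ₗ.[ℂ] H := (opGraph q a₀ B a).toLinearPMap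

lemma op_graph (q a₀ : ℝ → ℝ) (B : LeftBC) (a : ℝ) :
    (op q a₀ B a).graph = opGraph q a₀ B a :=
  Submodule.toLinearPMap_graph_eq _ (opGraph_snd_eq_zero q a₀ B a)

/-! ### Spectrum, zeta function and regularized determinant of an unbounded operator -/

section
variable {V : Type*} [NormedAddCommGroup V] [NormedSpace ℂ V]

/-- `z` is in the resolvent set of `A`: the map `A - z : D(A) → V` is a bijection whose inverse `S`
is a bounded operator. -/
def IsResolventPoint (A : V →ₗ.[ℂ] V) (z : ℂ) : Prop :=
  ∃ S : V →L[ℂ] V, ∀ f g : V, (f, g + z • f) ∈ A.graph ↔ S g = f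

/-- The operator has a bounded everywhere defined inverse. -/
def IsInvertible (A : V →ₗ.[ℂ] V) : Prop := IsResolventPoint A 0

/-- The spectrum of an unbounded operator. -/
def spec (A : V →ₗ.[ℂ] V) : Set ℂ := {z | ¬ IsResolventPoint A z}

/-- The eigenspace `ker (A - z)`. -/
def eigenspace (A : V →ₗ.[ℂ] V) (z : ℂ) : Submodule ℂ V :=
  A.graph.comap (LinearMap.id.prod (z • LinearMap.id))

/-- `Z` is the zeta function of `A`, continued analytically: it is meromorphic in a half-plane that
contains `0`, regular at `0`, and for all `s` of large real part it is
`∑_{z ∈ spec A \ {0}} z ^ (-s)` (with absolute convergence), each `z` repeated according to its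
multiplicity. For `z < 0` the principal power is `z ^ (-s) = e ^ (-iπs) |z| ^ (-s)`. -/
def IsZetaFunction (A : V →ₗ.[ℂ] V) (Z : ℂ → ℂ) : Prop :=
  (∃ ε > 0, MeromorphicOn Z {s | -ε < s.re}) ∧ AnalyticAt ℂ Z 0 ∧
  ∃ σ : ℝ, ∀ s : ℂ, σ < s.re →
    HasSum (fun z : {z : ℂ // z ∈ spec A ∧ z ≠ 0} =>
      (Module.finrank ℂ (eigenspace A z) : ℂ) * (z : ℂ) ^ (-s)) (Z s)

open Classical in
/-- `T(A) = -ζ_A'(0)`, the logarithm of the zeta-regularized determinant of an invertible `A`. -/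
def logDet (A : V →ₗ.[ℂ] V) : ℂ :=
  if h : ∃ Z, IsZetaFunction A Z then -deriv h.choose 0 else 0

/-- The value `-ζ_A'(0)` does not depend on the choice of the continuation. -/
lemma IsZetaFunction.logDet_eq {A : V →ₗ.[ℂ] V} {Z : ℂ → ℂ} (hZ : IsZetaFunction A Z) :
    logDet A = -deriv Z 0 := by
  have hex : ∃ Z, IsZetaFunction A Z := ⟨Z, hZ⟩
  rw [logDet, dif_pos hex]
  obtain ⟨⟨ε, hε, hm⟩, ha, σ, hs⟩ := hex.choose_spec
  obtain ⟨⟨ε', hε', hm'⟩, ha', σ', hs'⟩ := hZ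
  set Y := hex.choose
  set U : Set ℂ := {s | -(min ε ε') < s.re}
  have hU : IsPreconnected U := (convex_halfSpace_re_gt _).isPreconnected
  have hUo : IsOpen U := isOpen_lt continuous_const Complex.continuous_re
  have hd : MeromorphicOn (Y - Z) U := fun s (h : -(min ε ε') < s.re) =>
    (hm s (show -ε < s.re by linarith [min_le_left ε ε'])).sub
      (hm' s (show -ε' < s.re by linarith [min_le_right ε ε']))
  set w : ℂ := ((max 0 (max σ σ') + 1 : ℝ) : ℂ)
  have hw : w ∈ U := by
    have : 0 < min ε ε' := lt_min hε hε'
    have h2 := le_max_left 0 (max σ σ')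
    simp only [U, w, mem_ofPred_eq, Complex.ofReal_re]; linarith
  have h0 : (0 : ℂ) ∈ U := by simp [U, hε, hε']
  have hwt : meromorphicOrderAt (Y - Z) w = ⊤ := by
    rw [meromorphicOrderAt_eq_top_iff]
    apply Filter.Eventually.filter_mono nhdsWithin_le_nhds
    have : {s : ℂ | max σ σ' < s.re} ∈ 𝓝 w := by
      apply (isOpen_lt continuous_const Complex.continuous_re).mem_nhds
      have h2 := le_max_right 0 (max σ σ')
      simp only [w, mem_ofPred_eq, Complex.ofReal_re]; linarith
    filter_upwards [this] with s hss
    have e := (hs s ((le_max_left _ _).trans_lt hss)).unique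
      (hs' s ((le_max_right _ _).trans_lt hss))
    simp [e]
  have h0t : meromorphicOrderAt (Y - Z) 0 = ⊤ := by
    by_contra hne
    exact hd.meromorphicOrderAt_ne_top_of_isPreconnected hU h0 hw hne hwt
  rw [meromorphicOrderAt_eq_top_iff] at h0t
  have hev : ∀ᶠ s in 𝓝 (0 : ℂ), (Y - Z) s = 0 :=
    (ha.sub ha').frequently_zero_iff_eventually_zero.1 h0t.frequently
  have : Y =ᶠ[𝓝 0] Z := by
    filter_upwards [hev] with s h using sub_eq_zero.1 h
  rw [this.deriv_eq]

end

/-! ### Normalized solutions -/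

/-- `f` solves `-f'' + q f = 0` on `(0,1)`. -/
def IsSolution (q f : ℝ → ℝ) : Prop :=
  ∀ x ∈ Ioo (0 : ℝ) 1, DifferentiableAt ℝ f x ∧ HasDerivAt (deriv f) (q x * f x) x

/-- `φ` is a normalized solution at `0`: `l φ = 0`, `R₀ φ = 0` and `φ(x) = x^{ν₀+1/2} φ₁(x)` with
`φ₁(0) = 1`. -/
def IsNormalizedAtZero (q a₀ : ℝ → ℝ) (B : LeftBC) (φ : ℝ → ℝ) : Prop :=
  IsSolution q φ ∧ B.Vanishes a₀ φ ∧
    Tendsto (fun x => φ x / x ^ (B.nu a₀ + 1 / 2)) (𝓝[>] 0) (𝓝 1)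

/-- `ψ` is a normalized solution at `1` for the boundary operator `R₁ f = f'(1) + a f(1)`, for which
`ν₁ = -1/2`: `l ψ = 0`, `R₁ ψ = 0` and `ψ(1) = 1`. -/
def IsNormalizedAtOne (q : ℝ → ℝ) (a : ℝ) (ψ : ℝ → ℝ) : Prop :=
  IsSolution q ψ ∧ RightVanishes a ψ ∧ Tendsto ψ (𝓝[<] 1) (𝓝 1)

/-- The Wronskian `W(f, g) = f g' - f' g`. -/
def wronskian (f g : ℝ → ℝ) (x : ℝ) : ℝ := f x * deriv g x - deriv f x * g x

end SturmLiouville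

end

/-! Let φ_y be the solution of -u'' + (q + y)u = 0 normalized at 0, and put F_a(y) = φ_y'(1) + a
φ_y(1) (`charFun`). The zeros of F_a are exactly the points -λ with λ an eigenvalue of L = (l, R₀,
R₁), and F_a(0) is the Wronskian W(ψ, φ) (`IsLeftData.wronskian_eq`). The whole theorem follows from
one determinant formula, `IsLeftData.exists_zeta_logDet`: if F_a(0) ≠ 0 then T(L) = log|F_a(0)| - Λ
+ nπi, where n is the number of negative eigenvalues and the constant Λ does not depend on a. Where
n is locally constant, T and the principal logarithm of F_a(0) differ by a constant, so their
derivatives agree.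

The determinant formula has three ingredients.

(1) F_a'/F_a is the trace of the resolvent. For large y the solution φ = φ_y is positive, and the
resolvent at -y is c⟨φ,·⟩φ + P*P, where P has the bounded kernel φ(x)/φ(w), x < w, and c =
1/(φ(1)F_a(y)) (`IsLeftData.greenOp_spec`). So it is compact and nonnegative, and its trace is c‖φ‖²
plus a Hilbert–Schmidt norm squared, with no need for trace class theory
(`IsPositiveAt.hasSum_inv`). The same number is obtained by differentiating F_a in y with Wronskian
identities (`IsPositiveAt.hasDerivAt_charFun`). Integrating Σ 1/(λ + y) = F_a'/F_a and using real
analyticity of F_a gives F_a(y) = e^C ∏_{λ≤0} (λ + y) ∏_{λ>0} (1 + y/λ) for all real y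
(`IsSpectralDet.exists_const`).

(2) log F_a(y) = √y + ((1 - m)/2) log y + Λ + O(y^{-η/4}), with m = ν₀ + 1/2. This comes from
comparing φ_y with the explicit solution of u'' = (m(m - 1)/x² + z²)u, z = √y; the lower order part
of q and the number a affect only the error term (`exists_regular_asymptotics`,
`log_char_asymptotics`).

(3) If Σ log(1 + y/λ) = α√y + β log y + γ + O(y^{-ε}) for a positive sequence, then its zeta
function continues past 0 with ζ'(0) = γ. The Mellin transform of the sum at -s is ζ(s) times that
of log(1 + t), and the expansion continues it to Re s > -ε (`HasLogExpansion.exists_zeta`). With (1)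
and (2), γ = Λ - C for the positive spectrum; the finitely many negative eigenvalues contribute
log|λ| + πi each.

It remains to see that n does not jump. The sign of F_a(0) is (-1)^n, which fixes the parity of n.
The spectra for two values of a interlace (`IsLeftData.exists_eigenvalue_between`), so n changes by
at most one. Hence n is the same for all a with F_a(0) of one sign (`IsLeftData.negCount_eq`), and
no continuity of eigenvalues in the parameter is needed. -/

noncomputable section

namespace SturmLiouville

section

/-! ### Integrals of functions with a power singularity at `0` -/

section PowerBound

variable {f : ℝ → ℝ} {C p : ℝ}

lemma intervalIntegrable_of_power_bound (hp : -1 < p) (hf : ContinuousOn f (Ioo 0 1))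
    (hb : ∀ x ∈ Ioo (0 : ℝ) 1, |f x| ≤ C * x ^ p) {s : ℝ} (hs : s ∈ Icc (0 : ℝ) 1) :
    IntervalIntegrable f volume 0 s := by
  rw [intervalIntegrable_iff_integrableOn_Ioo_of_le hs.1]
  have hg : IntegrableOn (fun x : ℝ => C * x ^ p) (Ioo 0 s) := by
    have := (intervalIntegral.intervalIntegrable_rpow' hp (a := 0) (b := s)).const_mul C
    rwa [intervalIntegrable_iff_integrableOn_Ioo_of_le hs.1] at this
  have hsub : Ioo 0 s ⊆ Ioo (0 : ℝ) 1 := Ioo_subset_Ioo_right hs.2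
  refine Integrable.mono' hg ((hf.mono hsub).aestronglyMeasurable measurableSet_Ioo) ?_
  filter_upwards [ae_restrict_mem measurableSet_Ioo] with x hx using hb x (hsub hx)

lemma abs_integral_le_of_power_bound (hp : -1 < p)
    (hb : ∀ x ∈ Ioo (0 : ℝ) 1, |f x| ≤ C * x ^ p) {s : ℝ} (hs : s ∈ Icc (0 : ℝ) 1) :
    |∫ x in 0..s, f x| ≤ C * s ^ (p + 1) / (p + 1) := by
  have h1 : ‖∫ x in 0..s, f x‖ ≤ ∫ x in 0..s, C * x ^ p := by
    refine intervalIntegral.norm_integral_le_of_norm_le hs.1 ?_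
      ((intervalIntegral.intervalIntegrable_rpow' hp).const_mul C)
    have : ∀ᵐ x : ℝ, x ≠ s := by simp [ae_iff, measure_singleton]
    filter_upwards [this] with x hx hxs
    exact hb x ⟨hxs.1, (lt_of_le_of_ne hxs.2 hx).trans_le hs.2⟩
  rw [intervalIntegral.integral_const_mul, integral_rpow (Or.inl hp),
    Real.zero_rpow (by linarith)] at h1
  rw [Real.norm_eq_abs] at h1
  calc _ ≤ _ := h1
    _ = _ := by ring

lemma hasDerivAt_integral_of_power_bound (hp : -1 < p) (hf : ContinuousOn f (Ioo 0 1))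
    (hb : ∀ x ∈ Ioo (0 : ℝ) 1, |f x| ≤ C * x ^ p) {s : ℝ} (hs : s ∈ Ioo (0 : ℝ) 1) :
    HasDerivAt (fun u => ∫ x in 0..u, f x) (f s) s :=
  intervalIntegral.integral_hasDerivAt_right
    (intervalIntegrable_of_power_bound hp hf hb ⟨hs.1.le, hs.2.le⟩)
    (hf.stronglyMeasurableAtFilter isOpen_Ioo s hs) (hf.continuousAt (Ioo_mem_nhds hs.1 hs.2))

lemma continuousOn_integral_of_power_bound (hp : -1 < p) (hf : ContinuousOn f (Ioo 0 1))
    (hb : ∀ x ∈ Ioo (0 : ℝ) 1, |f x| ≤ C * x ^ p) :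
    ContinuousOn (fun u => ∫ x in 0..u, f x) (Icc 0 1) := by
  have := intervalIntegrable_of_power_bound hp hf hb (s := 1) (by simp)
  rw [intervalIntegrable_iff_integrableOn_Icc_of_le zero_le_one] at this
  have h2 := intervalIntegral.continuousOn_primitive_interval (a := 0) (b := 1) (f := f)
    (μ := volume) (by rwa [uIcc_of_le zero_le_one])
  rwa [uIcc_of_le zero_le_one] at h2

end PowerBound

/-! ### Volterra operators -/

/-- `w` is a perturbation of `m (m - 1) / x ^ 2` that is small near `0`. -/
structure IsPerturbation (m e η K : ℝ) (w : ℝ → ℝ) : Prop where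
  e_nonneg : 0 ≤ e
  e_lt_one : e < 1
  e_le : e ≤ 2 * m
  eta_pos : 0 < η
  eta_le : η ≤ 1
  cont : ContinuousOn w (Ioo 0 1)
  bound : ∀ x ∈ Ioo (0 : ℝ) 1, |w x| ≤ K * x ^ (-1 - e + η)

/-- `∫₀ˢ t^{2m} w(t) r(t) dt`. -/
def weightedPrimitive (m : ℝ) (w r : ℝ → ℝ) (s : ℝ) : ℝ := ∫ t in 0..s, t ^ (2 * m) * w t * r t

/-- `∫₀ˣ s^{-2m} ∫₀ˢ t^{2m} w(t) r(t) dt ds`. -/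
def volterraFun (m : ℝ) (w r : ℝ → ℝ) (x : ℝ) : ℝ :=
  ∫ s in 0..x, s ^ (-(2 * m)) * weightedPrimitive m w r s

variable {m e η K : ℝ} {w r : ℝ → ℝ}

namespace IsPerturbation

lemma K_nonneg (h : IsPerturbation m e η K w) : 0 ≤ K := by
  have h1 := (abs_nonneg _).trans (h.bound (1 / 2) ⟨by norm_num, by norm_num⟩)
  have h2 : (0 : ℝ) < (1 / 2 : ℝ) ^ (-1 - e + η) := Real.rpow_pos_of_pos (by norm_num) _
  exact nonneg_of_mul_nonneg_left h1 h2

lemma m_nonneg (h : IsPerturbation m e η K w) : 0 ≤ m := by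
  linarith [h.e_nonneg, h.e_le]

lemma const (h : IsPerturbation m e η K w) (y : ℝ) :
    IsPerturbation m e η |y| (fun _ => y) where
  e_nonneg := h.e_nonneg
  e_lt_one := h.e_lt_one
  e_le := h.e_le
  eta_pos := h.eta_pos
  eta_le := h.eta_le
  cont := continuousOn_const
  bound x hx := by
    have : 1 ≤ x ^ (-1 - e + η) := Real.one_le_rpow_of_pos_of_le_one_of_nonpos hx.1 hx.2.le
      (by linarith [h.e_nonneg, h.eta_le])
    nlinarith [abs_nonneg y]

lemma add {K' : ℝ} {w' : ℝ → ℝ} (h : IsPerturbation m e η K w)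
    (h' : IsPerturbation m e η K' w') :
    IsPerturbation m e η (K + K') (fun x => w x + w' x) where
  e_nonneg := h.e_nonneg
  e_lt_one := h.e_lt_one
  e_le := h.e_le
  eta_pos := h.eta_pos
  eta_le := h.eta_le
  cont := h.cont.add h'.cont
  bound x hx := by
    rw [add_mul]
    exact (abs_add_le _ _).trans (add_le_add (h.bound x hx) (h'.bound x hx))

lemma weight_continuousOn (h : IsPerturbation m e η K w) (hr : ContinuousOn r (Ioo 0 1)) :
    ContinuousOn (fun t => t ^ (2 * m) * w t * r t) (Ioo 0 1) :=
  ((continuousOn_id.rpow_const fun x hx => Or.inl hx.1.ne').mul h.cont).mul hr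

lemma weight_bound (h : IsPerturbation m e η K w) {R β : ℝ}
    (hb : ∀ x ∈ Ioo (0 : ℝ) 1, |r x| ≤ R * x ^ β) :
    ∀ x ∈ Ioo (0 : ℝ) 1, |x ^ (2 * m) * w x * r x| ≤ (K * R) * x ^ (2 * m - 1 - e + η + β) := by
  intro x hx
  have e1 : x ^ (2 * m - 1 - e + η + β) = x ^ (2 * m) * x ^ (-1 - e + η) * x ^ β := by
    rw [← Real.rpow_add hx.1, ← Real.rpow_add hx.1]; congr 1; ring
  have p1 : 0 < x ^ (2 * m) := Real.rpow_pos_of_pos hx.1 _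
  rw [e1, abs_mul, abs_mul, abs_of_pos p1]
  calc x ^ (2 * m) * |w x| * |r x|
      ≤ x ^ (2 * m) * (K * x ^ (-1 - e + η)) * (R * x ^ β) := by
        gcongr
        · exact mul_nonneg p1.le ((abs_nonneg _).trans (h.bound x hx))
        · exact h.bound x hx
        · exact hb x hx
    _ = _ := by ring

/-- The condition e ≤ 2m enters here: it makes the weight t^{2m} w(t) integrable at 0. -/
lemma exponent_gt (h : IsPerturbation m e η K w) {β : ℝ} (hβ : 0 ≤ β) :
    -1 < 2 * m - 1 - e + η + β := by linarith [h.e_le, h.eta_pos]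

lemma weight_intervalIntegrable (h : IsPerturbation m e η K w) {R : ℝ}
    (hr : ContinuousOn r (Ioo 0 1)) (hb : ∀ x ∈ Ioo (0 : ℝ) 1, |r x| ≤ R)
    {s : ℝ} (hs : s ∈ Icc (0 : ℝ) 1) :
    IntervalIntegrable (fun t => t ^ (2 * m) * w t * r t) volume 0 s :=
  intervalIntegrable_of_power_bound (h.exponent_gt le_rfl) (h.weight_continuousOn hr)
    (h.weight_bound (R := R) (β := 0) (by simpa using hb)) hs

/-- The exact denominator 2m - e + η + β is replaced by η, so that the constant is independent of β.
The growth in β needed for the factorial in `volterra_pow_le` comes from the outer integration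
alone. -/
lemma abs_weightedPrimitive_le (h : IsPerturbation m e η K w) {R β : ℝ} (hβ : 0 ≤ β)
    (hR : 0 ≤ R) (hb : ∀ x ∈ Ioo (0 : ℝ) 1, |r x| ≤ R * x ^ β) {s : ℝ} (hs : s ∈ Icc (0 : ℝ) 1) :
    |weightedPrimitive m w r s| ≤ (K * R / η) * s ^ (2 * m - e + η + β) := by
  have h1 := abs_integral_le_of_power_bound (h.exponent_gt hβ) (h.weight_bound hb) hs
  have e1 : 2 * m - 1 - e + η + β + 1 = 2 * m - e + η + β := by ring
  rw [e1] at h1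
  refine h1.trans ?_
  have hp : 0 ≤ s ^ (2 * m - e + η + β) := Real.rpow_nonneg hs.1 _
  have := h.K_nonneg
  have := h.eta_pos
  have := h.e_le
  rw [div_mul_eq_mul_div]
  gcongr
  linarith

lemma hasDerivAt_weightedPrimitive (h : IsPerturbation m e η K w) {R : ℝ}
    (hr : ContinuousOn r (Ioo 0 1)) (hb : ∀ x ∈ Ioo (0 : ℝ) 1, |r x| ≤ R)
    {s : ℝ} (hs : s ∈ Ioo (0 : ℝ) 1) :
    HasDerivAt (weightedPrimitive m w r) (s ^ (2 * m) * w s * r s) s :=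
  hasDerivAt_integral_of_power_bound (h.exponent_gt le_rfl) (h.weight_continuousOn hr)
    (h.weight_bound (R := R) (β := 0) (by simpa using hb)) hs

lemma continuousOn_weightedPrimitive (h : IsPerturbation m e η K w) {R : ℝ}
    (hr : ContinuousOn r (Ioo 0 1)) (hb : ∀ x ∈ Ioo (0 : ℝ) 1, |r x| ≤ R) :
    ContinuousOn (weightedPrimitive m w r) (Icc 0 1) :=
  continuousOn_integral_of_power_bound (h.exponent_gt le_rfl) (h.weight_continuousOn hr)
    (h.weight_bound (R := R) (β := 0) (by simpa using hb))

lemma outer_continuousOn (h : IsPerturbation m e η K w) {R : ℝ}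
    (hr : ContinuousOn r (Ioo 0 1)) (hb : ∀ x ∈ Ioo (0 : ℝ) 1, |r x| ≤ R) :
    ContinuousOn (fun s => s ^ (-(2 * m)) * weightedPrimitive m w r s) (Ioo 0 1) :=
  (continuousOn_id.rpow_const fun x hx => Or.inl hx.1.ne').mul
    ((h.continuousOn_weightedPrimitive hr hb).mono Ioo_subset_Icc_self)

lemma outer_bound (h : IsPerturbation m e η K w) {R β : ℝ} (hβ : 0 ≤ β)
    (hR : 0 ≤ R) (hb : ∀ x ∈ Ioo (0 : ℝ) 1, |r x| ≤ R * x ^ β) :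
    ∀ s ∈ Ioo (0 : ℝ) 1, |s ^ (-(2 * m)) * weightedPrimitive m w r s| ≤
      (K * R / η) * s ^ (-e + η + β) := by
  intro s hs
  have p1 : 0 < s ^ (-(2 * m)) := Real.rpow_pos_of_pos hs.1 _
  have e1 : s ^ (-e + η + β) = s ^ (-(2 * m)) * s ^ (2 * m - e + η + β) := by
    rw [← Real.rpow_add hs.1]; congr 1; ring
  rw [abs_mul, abs_of_pos p1, e1]
  have := h.abs_weightedPrimitive_le hβ hR hb ⟨hs.1.le, hs.2.le⟩
  calc _ ≤ _ := mul_le_mul_of_nonneg_left this p1.le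
    _ = _ := by ring

lemma outer_exponent (h : IsPerturbation m e η K w) {β : ℝ} (hβ : 0 ≤ β) :
    -1 < -e + η + β := by linarith [h.e_lt_one, h.eta_pos]

/-- Each application of the operator raises the power of x by 1 - e + η and divides by the new
exponent. -/
lemma abs_volterraFun_le (h : IsPerturbation m e η K w) {R β : ℝ} (hβ : 0 ≤ β)
    (hR : 0 ≤ R) (hb : ∀ x ∈ Ioo (0 : ℝ) 1, |r x| ≤ R * x ^ β) {x : ℝ} (hx : x ∈ Icc (0 : ℝ) 1) :
    |volterraFun m w r x| ≤ (K / η * R / (β + (1 - e + η))) * x ^ (β + (1 - e + η)) := by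
  have h1 := abs_integral_le_of_power_bound (h.outer_exponent hβ) (h.outer_bound hβ hR hb) hx
  have e1 : -e + η + β + 1 = β + (1 - e + η) := by ring
  rw [e1] at h1
  exact h1.trans (le_of_eq (by ring))

lemma hasDerivAt_volterraFun (h : IsPerturbation m e η K w) {R : ℝ} (hR : 0 ≤ R)
    (hr : ContinuousOn r (Ioo 0 1)) (hb : ∀ x ∈ Ioo (0 : ℝ) 1, |r x| ≤ R)
    {s : ℝ} (hs : s ∈ Ioo (0 : ℝ) 1) :
    HasDerivAt (volterraFun m w r) (s ^ (-(2 * m)) * weightedPrimitive m w r s) s :=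
  hasDerivAt_integral_of_power_bound (h.outer_exponent le_rfl) (h.outer_continuousOn hr hb)
    (h.outer_bound (β := 0) le_rfl hR (by simpa using hb)) hs

lemma continuousOn_volterraFun (h : IsPerturbation m e η K w) {R : ℝ} (hR : 0 ≤ R)
    (hr : ContinuousOn r (Ioo 0 1)) (hb : ∀ x ∈ Ioo (0 : ℝ) 1, |r x| ≤ R) :
    ContinuousOn (volterraFun m w r) (Icc 0 1) :=
  continuousOn_integral_of_power_bound (h.outer_exponent le_rfl) (h.outer_continuousOn hr hb)
    (h.outer_bound (β := 0) le_rfl hR (by simpa using hb))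

lemma outer_intervalIntegrable (h : IsPerturbation m e η K w) {R : ℝ} (hR : 0 ≤ R)
    (hr : ContinuousOn r (Ioo 0 1)) (hb : ∀ x ∈ Ioo (0 : ℝ) 1, |r x| ≤ R)
    {s : ℝ} (hs : s ∈ Icc (0 : ℝ) 1) :
    IntervalIntegrable (fun s => s ^ (-(2 * m)) * weightedPrimitive m w r s) volume 0 s :=
  intervalIntegrable_of_power_bound (h.outer_exponent le_rfl) (h.outer_continuousOn hr hb)
    (h.outer_bound (β := 0) le_rfl hR (by simpa using hb)) hs

end IsPerturbation

/-- Continuous functions on `[0,1]`. -/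
abbrev CI : Type := C(Icc (0 : ℝ) 1, ℝ)

/-- Extension of a continuous function on `[0,1]` to the line. -/
def ext (r : CI) : ℝ → ℝ := IccExtend zero_le_one r

lemma continuous_ext (r : CI) : Continuous (ext r) := r.continuous.Icc_extend'

lemma abs_ext_le (r : CI) (x : ℝ) : |ext r x| ≤ ‖r‖ := r.norm_coe_le_norm _

lemma ext_apply (r : CI) (x : Icc (0 : ℝ) 1) : ext r x = r x := IccExtend_val _ _ _

lemma ext_add (r s : CI) (x : ℝ) : ext (r + s) x = ext r x + ext s x := rfl

lemma ext_sub (r s : CI) (x : ℝ) : ext (r - s) x = ext r x - ext s x := rfl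

lemma ext_smul (c : ℝ) (r : CI) (x : ℝ) : ext (c • r) x = c * ext r x := rfl

namespace IsPerturbation

lemma weightedPrimitive_add (h : IsPerturbation m e η K w) (r s : CI) {x : ℝ}
    (hx : x ∈ Icc (0 : ℝ) 1) :
    weightedPrimitive m w (ext (r + s)) x =
      weightedPrimitive m w (ext r) x + weightedPrimitive m w (ext s) x := by
  simp only [weightedPrimitive, ext_add, mul_add]
  exact intervalIntegral.integral_add
    (h.weight_intervalIntegrable (continuous_ext r).continuousOn (fun x _ => abs_ext_le r x) hx)
    (h.weight_intervalIntegrable (continuous_ext s).continuousOn (fun x _ => abs_ext_le s x) hx)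

lemma weightedPrimitive_add_left {K' : ℝ} {w' : ℝ → ℝ} (h : IsPerturbation m e η K w)
    (h' : IsPerturbation m e η K' w') (r : CI) {x : ℝ} (hx : x ∈ Icc (0 : ℝ) 1) :
    weightedPrimitive m (fun x => w x + w' x) (ext r) x =
      weightedPrimitive m w (ext r) x + weightedPrimitive m w' (ext r) x := by
  simp only [weightedPrimitive, mul_add, add_mul]
  exact intervalIntegral.integral_add
    (h.weight_intervalIntegrable (continuous_ext r).continuousOn (fun x _ => abs_ext_le r x) hx)
    (h'.weight_intervalIntegrable (continuous_ext r).continuousOn (fun x _ => abs_ext_le r x) hx)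

end IsPerturbation

lemma weightedPrimitive_smul (c : ℝ) (r : CI) (x : ℝ) :
    weightedPrimitive m w (ext (c • r)) x = c * weightedPrimitive m w (ext r) x := by
  simp only [weightedPrimitive, ext_smul, ← intervalIntegral.integral_const_mul]
  congr 1; ext t; ring

lemma weightedPrimitive_const (y : ℝ) (r : ℝ → ℝ) (x : ℝ) :
    weightedPrimitive m (fun _ => y) r x = y * weightedPrimitive m (fun _ => 1) r x := by
  simp only [weightedPrimitive, ← intervalIntegral.integral_const_mul]
  congr 1; ext t; ring

/-- The Volterra operator on continuous functions. -/
def volterra (h : IsPerturbation m e η K w) : CI →L[ℝ] CI :=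
  LinearMap.mkContinuous
    { toFun := fun r => ⟨fun x => volterraFun m w (ext r) x,
        continuousOn_iff_continuous_domRestrict.1 (h.continuousOn_volterraFun (norm_nonneg r)
          (continuous_ext r).continuousOn (fun x _ => abs_ext_le r x))⟩
      map_add' := fun r s => by
        ext x
        simp only [ContinuousMap.coe_mk, ContinuousMap.add_apply, volterraFun]
        rw [← intervalIntegral.integral_add
          (h.outer_intervalIntegrable (norm_nonneg r) (continuous_ext r).continuousOn
            (fun x _ => abs_ext_le r x) x.2)
          (h.outer_intervalIntegrable (norm_nonneg s) (continuous_ext s).continuousOn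
            (fun x _ => abs_ext_le s x) x.2)]
        refine intervalIntegral.integral_congr fun t ht => ?_
        rw [uIcc_of_le x.2.1] at ht
        simp only [h.weightedPrimitive_add r s ⟨ht.1, ht.2.trans x.2.2⟩, mul_add]
      map_smul' := fun c r => by
        ext x
        simp only [ContinuousMap.coe_mk, ContinuousMap.smul_apply, volterraFun, smul_eq_mul,
          RingHom.id_apply, ← intervalIntegral.integral_const_mul, weightedPrimitive_smul]
        congr 1; ext t; ring }
    (K / η / (1 - e + η)) fun r => by
      have hc : 0 ≤ K / η / (1 - e + η) :=
        div_nonneg (div_nonneg h.K_nonneg h.eta_pos.le) (by linarith [h.e_lt_one, h.eta_pos])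
      rw [ContinuousMap.norm_le _ (mul_nonneg hc (norm_nonneg r))]
      intro x
      have := h.abs_volterraFun_le (r := ext r) (β := 0) le_rfl (norm_nonneg r)
        (by simpa using fun x _ _ => abs_ext_le r x) x.2
      refine this.trans ?_
      have h1 : (x : ℝ) ^ (0 + (1 - e + η)) ≤ 1 :=
        Real.rpow_le_one x.2.1 x.2.2 (by linarith [h.e_lt_one, h.eta_pos])
      have h2 : 0 ≤ K / η / (1 - e + η) * ‖r‖ := mul_nonneg hc (norm_nonneg r)
      rw [zero_add] at h1 ⊢
      calc _ = (K / η / (1 - e + η) * ‖r‖) * (x : ℝ) ^ (1 - e + η) := by ring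
        _ ≤ _ := mul_le_of_le_one_right h2 h1

lemma volterra_apply (h : IsPerturbation m e η K w) (r : CI) (x : Icc (0 : ℝ) 1) :
    volterra h r x = volterraFun m w (ext r) x := rfl

/-- The denominators produced by the iteration are (k + 1)(1 - e + η), k < n, which multiply to the
factorial. -/
lemma volterra_pow_le (h : IsPerturbation m e η K w) (r : CI) (n : ℕ) (x : Icc (0 : ℝ) 1) :
    |(volterra h ^ n) r x| ≤ ((K / η / (1 - e + η)) ^ n / n.factorial * ‖r‖) *
      (x : ℝ) ^ (n * (1 - e + η)) := by
  have hθ : 0 < 1 - e + η := by linarith [h.e_lt_one, h.eta_pos]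
  have hc : 0 ≤ K / η / (1 - e + η) := div_nonneg (div_nonneg h.K_nonneg h.eta_pos.le) hθ.le
  induction n generalizing x with
  | zero => simpa using r.norm_coe_le_norm x
  | succ n ih =>
    rw [pow_succ', mul_apply_eq_comp, volterra_apply]
    have hR : 0 ≤ (K / η / (1 - e + η)) ^ n / n.factorial * ‖r‖ := by positivity
    have := h.abs_volterraFun_le (r := ext ((volterra h ^ n) r)) (β := n * (1 - e + η))
      (by positivity) hR (fun t ht => by
        have := ih ⟨t, ht.1.le, ht.2.le⟩
        rwa [← ext_apply] at this) x.2
    refine this.trans (le_of_eq ?_)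
    have e1 : (n : ℝ) * (1 - e + η) + (1 - e + η) = ((n + 1 : ℕ) : ℝ) * (1 - e + η) := by
      push_cast; ring
    rw [e1, Nat.factorial_succ]
    congr 1
    have : ((n + 1 : ℕ) : ℝ) ≠ 0 := by positivity
    have := h.eta_pos.ne'
    have : (n.factorial : ℝ) ≠ 0 := by positivity
    rw [pow_succ]
    push_cast
    field_simp

/-- The operator T itself need not be small, but some power is, by the factorial bound. Since 1 - T
is a commuting factor of 1 - Tⁿ, it is invertible as well. -/
lemma isUnit_one_sub_volterra (h : IsPerturbation m e η K w) : IsUnit (1 - volterra h) := by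
  have hθ : 0 < 1 - e + η := by linarith [h.e_lt_one, h.eta_pos]
  have hc : 0 ≤ K / η / (1 - e + η) := div_nonneg (div_nonneg h.K_nonneg h.eta_pos.le) hθ.le
  obtain ⟨n, hn⟩ : ∃ n : ℕ, (K / η / (1 - e + η)) ^ n / n.factorial < 1 / 2 :=
    ((FloorSemiring.tendsto_pow_div_factorial_atTop _).eventually
      (gt_mem_nhds (by norm_num))).exists
  have hnorm : ‖volterra h ^ n‖ < 1 := by
    refine lt_of_le_of_lt (ContinuousLinearMap.opNorm_le_bound _ (by norm_num : (0 : ℝ) ≤ 1 / 2)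
      fun r => ?_) (by norm_num)
    rw [ContinuousMap.norm_le _ (by positivity)]
    intro x
    refine (volterra_pow_le h r n x).trans ?_
    have h1 : (x : ℝ) ^ (n * (1 - e + η)) ≤ 1 := Real.rpow_le_one x.2.1 x.2.2 (by positivity)
    have h2 : 0 ≤ (K / η / (1 - e + η)) ^ n / n.factorial * ‖r‖ := by positivity
    calc _ ≤ _ := mul_le_of_le_one_right h2 h1
      _ ≤ _ := by gcongr
  have hu : IsUnit (1 - volterra h ^ n) := isUnit_one_sub_of_norm_lt_one (x := volterra h ^ n) hnorm
  have hcomm : Commute (1 - volterra h) (∑ i ∈ Finset.range n, volterra h ^ i) := by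
    refine Commute.sum_right _ _ _ fun i _ => ?_
    exact ((Commute.one_left _).sub_left ((Commute.refl _).pow_right i))
  rw [← mul_neg_geom_sum, hcomm.isUnit_mul_iff] at hu
  exact hu.1

end

section

/-! ### The regular solution at `0` -/

/-- `φ = x ^ m (1 + o(1))`, `φ' = dφ`, solves `φ'' = Q φ` on `(0,1)`, has boundary values `φ₁`, `d₁`
for `φ`, `φ'` at `1`, and `x ^ (2m) (x ^ (-m) φ)' → b` at `0`. -/
structure IsRegularSolution (m b : ℝ) (Q φ dφ : ℝ → ℝ) (φ₁ d₁ : ℝ) : Prop where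
  hasDerivAt : ∀ x ∈ Ioo (0 : ℝ) 1, HasDerivAt φ (dφ x) x
  hasDerivAt' : ∀ x ∈ Ioo (0 : ℝ) 1, HasDerivAt dφ (Q x * φ x) x
  left : Tendsto (fun x => φ x / x ^ m) (𝓝[>] 0) (𝓝 1)
  slope : Tendsto (fun x => x ^ m * dφ x - m * x ^ (m - 1) * φ x) (𝓝[>] 0) (𝓝 b)
  right : Tendsto φ (𝓝[<] 1) (𝓝 φ₁)
  right' : Tendsto dφ (𝓝[<] 1) (𝓝 d₁)

lemma nhdsLT_one_le : 𝓝[<] (1 : ℝ) ≤ 𝓝[Icc 0 1] 1 :=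
  nhdsWithin_le_iff.2 (mem_of_superset (Ioo_mem_nhdsLT one_pos) Ioo_subset_Icc_self)

lemma nhdsGT_zero_le : 𝓝[>] (0 : ℝ) ≤ 𝓝[Icc 0 1] 0 :=
  nhdsWithin_le_iff.2 (mem_of_superset (Ioo_mem_nhdsGT one_pos) Ioo_subset_Icc_self)

variable {m e η K b : ℝ} {v w : ℝ → ℝ}

/-- Adding a constant to a perturbation. -/
lemma IsPerturbation.shift (h : IsPerturbation m e η K v) (y : ℝ) :
    IsPerturbation m e η (K + |y|) (fun x => v x + y) := h.add (h.const y)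

/-- The function `1 + b x`. -/
def startFun (b : ℝ) : CI := ⟨fun x => 1 + b * x, by fun_prop⟩

/-- The solution of the Volterra equation `r = 1 + b x + 𝒦 r`. -/
def regFactor (h : IsPerturbation m e η K w) (b : ℝ) : CI :=
  Ring.inverse (1 - volterra h) (startFun b)

lemma regFactor_eq (h : IsPerturbation m e η K w) (b : ℝ) :
    regFactor h b = startFun b + volterra h (regFactor h b) := by
  have h1 := Ring.mul_inverse_cancel _ (isUnit_one_sub_volterra h)
  have h2 := congrArg (fun T : CI →L[ℝ] CI => T (startFun b)) h1
  simp only [mul_apply_eq_comp, sub_apply, one_apply_eq_self] at h2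
  exact (sub_eq_iff_eq_add.1 h2)

lemma ext_regFactor (h : IsPerturbation m e η K w) (b : ℝ) {x : ℝ} (hx : x ∈ Icc (0 : ℝ) 1) :
    ext (regFactor h b) x = 1 + b * x + volterraFun m w (ext (regFactor h b)) x := by
  have h1 := congrArg (fun r : CI => r ⟨x, hx⟩) (regFactor_eq h b)
  simp only [ContinuousMap.add_apply, volterra_apply] at h1
  rw [← ext_apply] at h1
  exact h1

/-- The regular solution. -/
def regSol (h : IsPerturbation m e η K w) (b x : ℝ) : ℝ := x ^ m * ext (regFactor h b) x

/-- The derivative of the regular solution. -/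
def dregSol (h : IsPerturbation m e η K w) (b x : ℝ) : ℝ :=
  m * x ^ (m - 1) * ext (regFactor h b) x +
    x ^ m * (b + x ^ (-(2 * m)) * weightedPrimitive m w (ext (regFactor h b)) x)

/-- The value of the derivative of the regular solution at `1`. -/
def dregSolOne (h : IsPerturbation m e η K w) (b : ℝ) : ℝ :=
  m * ext (regFactor h b) 1 + (b + weightedPrimitive m w (ext (regFactor h b)) 1)

lemma hasDerivAt_ext_regFactor (h : IsPerturbation m e η K w) (b : ℝ) {x : ℝ}
    (hx : x ∈ Ioo (0 : ℝ) 1) :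
    HasDerivAt (ext (regFactor h b))
      (b + x ^ (-(2 * m)) * weightedPrimitive m w (ext (regFactor h b)) x) x := by
  set r := regFactor h b
  have h1 := h.hasDerivAt_volterraFun (norm_nonneg r) (continuous_ext r).continuousOn
    (fun x _ => abs_ext_le r x) hx
  have h2 : HasDerivAt (fun x => 1 + b * x + volterraFun m w (ext r) x)
      (b + x ^ (-(2 * m)) * weightedPrimitive m w (ext r) x) x := by
    exact ((((hasDerivAt_id x).const_mul b).const_add 1).add h1).congr_deriv (by simp)
  refine h2.congr_of_eventuallyEq ?_
  filter_upwards [Ioo_mem_nhds hx.1 hx.2] with t ht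
  exact ext_regFactor h b ⟨ht.1.le, ht.2.le⟩

/-- With φ = x^m r the equation becomes (x^{2m} r')' = x^{2m} w r, and two integrations from 0 give
the Volterra equation. The inhomogeneous term b x is admissible because b m = 0: it occurs only for
m = 0, where it prescribes φ'(0) = b. -/
lemma isRegularSolution_regSol (h : IsPerturbation m e η K w) (hb : b * m = 0) :
    IsRegularSolution m b (fun x => m * (m - 1) / x ^ 2 + w x) (regSol h b) (dregSol h b)
      (ext (regFactor h b) 1) (dregSolOne h b) := by
  set r := regFactor h b with hr
  have hc := (continuous_ext r).continuousOn (s := Ioo 0 1)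
  have hbd : ∀ x ∈ Ioo (0 : ℝ) 1, |ext r x| ≤ ‖r‖ := fun x _ => abs_ext_le r x
  have hJ := h.continuousOn_weightedPrimitive hc hbd
  have hpow1 : ∀ p : ℝ, Tendsto (fun x : ℝ => x ^ p) (𝓝[<] 1) (𝓝 1) := fun p => by
    have : ContinuousAt (fun x : ℝ => x ^ p) 1 :=
      Real.continuousAt_rpow_const _ _ (Or.inl one_ne_zero)
    have := this.tendsto
    rw [Real.one_rpow] at this
    exact this.mono_left nhdsWithin_le_nhds
  have hr1 : Tendsto (ext r) (𝓝[<] 1) (𝓝 (ext r 1)) :=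
    ((continuous_ext r).tendsto 1).mono_left nhdsWithin_le_nhds
  refine ⟨fun x hx => ?_, fun x hx => ?_, ?_, ?_, ?_, ?_⟩
  · exact (Real.hasDerivAt_rpow_const (Or.inl hx.1.ne')).mul (hasDerivAt_ext_regFactor h b hx)
  · have hr' := hasDerivAt_ext_regFactor h b hx
    have hJ' := h.hasDerivAt_weightedPrimitive hc hbd hx
    have hp : ∀ p : ℝ, HasDerivAt (fun x : ℝ => x ^ p) (p * x ^ (p - 1)) x :=
      fun p => Real.hasDerivAt_rpow_const (Or.inl hx.1.ne')
    have := (((hp (m - 1)).const_mul m).mul hr').add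
      ((hp m).mul (((hp (-(2 * m))).mul hJ').const_add b))
    refine this.congr_deriv ?_
    simp only [Pi.mul_apply]
    have x0 := hx.1
    have e1 : x ^ (m - 1) = x ^ m / x := Real.rpow_sub_one x0.ne' m
    have e2 : x ^ (m - 1 - 1) = x ^ m / x / x := by
      rw [Real.rpow_sub_one x0.ne', Real.rpow_sub_one x0.ne']
    have e3 : x ^ (-(2 * m) - 1) = x ^ (-(2 * m)) / x := Real.rpow_sub_one x0.ne' _
    have e4 : x ^ (-(2 * m)) * x ^ (2 * m) = 1 := by
      rw [← Real.rpow_add x0]; simp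
    rw [e1, e2, e3]
    unfold regSol
    rw [← hr]
    set A := x ^ m
    set P := x ^ (-(2 * m))
    set R := x ^ (2 * m)
    set J := weightedPrimitive m w (ext r) x
    have : A * (P * (R * w x * ext r x)) = A * w x * ext r x := by
      linear_combination A * w x * ext r x * e4
    field_simp
    -- The last summand removes the cross term 2 m b x^{m-1}, the only contribution of b x that does
    -- not cancel identically.
    linear_combination x ^ 2 * A * w x * ext r x * e4 + 2 * x * A * hb
  · have : Tendsto (ext r) (𝓝[>] 0) (𝓝 (ext r 0)) :=
      ((continuous_ext r).tendsto 0).mono_left nhdsWithin_le_nhds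
    have h0 : ext r 0 = 1 := by
      rw [ext_regFactor h b (by simp)]
      simp [volterraFun]
    rw [h0] at this
    refine this.congr' ?_
    filter_upwards [self_mem_nhdsWithin] with x hx
    have : x ^ m ≠ 0 := (Real.rpow_pos_of_pos hx m).ne'
    rw [regSol, mul_div_cancel_left₀ _ this]
  · have hJ0 : Tendsto (weightedPrimitive m w (ext r)) (𝓝[>] 0) (𝓝 0) := by
      have := (hJ 0 (by simp)).tendsto.mono_left nhdsGT_zero_le
      simpa [weightedPrimitive] using this
    have := hJ0.const_add b
    rw [add_zero] at this
    refine this.congr' ?_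
    filter_upwards [self_mem_nhdsWithin] with x hx
    have x0 : 0 < x := hx
    have e4 : x ^ m * x ^ m * x ^ (-(2 * m)) = 1 := by
      rw [← Real.rpow_add x0, ← Real.rpow_add x0]; ring_nf; simp
    have e5 : x ^ m * x ^ m * b = b := by
      rcases mul_eq_zero.1 hb with h0 | h0 <;> simp [h0]
    rw [regSol, dregSol]
    linear_combination (-weightedPrimitive m w (ext r) x) * e4 - e5
  · have := (hpow1 m).mul hr1
    rwa [one_mul] at this
  · have hJ1 := (hJ 1 (by simp)).tendsto.mono_left nhdsLT_one_le
    have := (((hpow1 (m - 1)).const_mul m).mul hr1).add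
      ((hpow1 m).mul (((hpow1 (-(2 * m))).mul hJ1).const_add b))
    simp only [mul_one, one_mul] at this
    exact this

/-! ### Dependence on the spectral parameter -/

/-- The spectral parameter enters affinely, so analyticity in y reduces to analyticity of inversion
in a Banach algebra. -/
lemma volterra_shift (h : IsPerturbation m e η K v) (y : ℝ) :
    volterra (h.shift y) = volterra h + y • volterra (h.const 1) := by
  ext r x
  simp only [add_apply, smul_apply, ContinuousMap.add_apply, ContinuousMap.smul_apply,
    volterra_apply, volterraFun, smul_eq_mul, ← intervalIntegral.integral_const_mul]
  rw [← intervalIntegral.integral_add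
    (h.outer_intervalIntegrable (norm_nonneg r) (continuous_ext r).continuousOn
      (fun x _ => abs_ext_le r x) x.2)
    (((h.const 1).outer_intervalIntegrable (norm_nonneg r) (continuous_ext r).continuousOn
      (fun x _ => abs_ext_le r x) x.2).const_mul y)]
  refine intervalIntegral.integral_congr fun t ht => ?_
  rw [uIcc_of_le x.2.1] at ht
  simp only [h.weightedPrimitive_add_left (h.const y) r ⟨ht.1, ht.2.trans x.2.2⟩,
    weightedPrimitive_const y]
  ring

lemma analyticAt_inverse_one_sub_affine {X : Type*} [NormedAddCommGroup X] [NormedSpace ℝ X]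
    [CompleteSpace X] (S T : X →L[ℝ] X) (x : X) (y : ℝ) (hu : IsUnit (1 - (S + y • T))) :
    AnalyticAt ℝ (fun y : ℝ => Ring.inverse (1 - (S + y • T)) x) y := by
  have h1 : AnalyticAt ℝ (fun y : ℝ => 1 - (S + y • T)) y :=
    analyticAt_const.sub (analyticAt_const.add (analyticAt_id.smul analyticAt_const))
  have h2 : AnalyticAt ℝ Ring.inverse (1 - (S + y • T)) :=
    analyticOnNhd_inverse (𝕜 := ℝ) (A := X →L[ℝ] X) _ hu
  have h3 : AnalyticAt ℝ (fun y : ℝ => Ring.inverse (1 - (S + y • T))) y :=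
    AnalyticAt.fun_comp (f := fun y : ℝ => 1 - (S + y • T)) h2 h1
  exact AnalyticAt.fun_comp (f := fun y : ℝ => Ring.inverse (1 - (S + y • T)))
    ((ContinuousLinearMap.apply ℝ X x).analyticAt _) h3

lemma analyticOnNhd_regFactor (h : IsPerturbation m e η K v) (b : ℝ) :
    AnalyticOnNhd ℝ (fun y => regFactor (h.shift y) b) univ := by
  intro y _
  have e1 : (fun y => regFactor (h.shift y) b) =
      fun y => (Ring.inverse (1 - (volterra h + y • volterra (h.const 1))) : CI →L[ℝ] CI)
        (startFun b) :=
    funext fun y => by rw [regFactor, volterra_shift h y]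
  rw [e1]
  refine analyticAt_inverse_one_sub_affine _ _ _ _ ?_
  have := isUnit_one_sub_volterra (h.shift y)
  rwa [volterra_shift h y] at this

/-- `r ↦ ∫₀¹ t^{2m} w(t) r(t) dt`. -/
def weightedIntegral (h : IsPerturbation m e η K w) : CI →L[ℝ] ℝ :=
  LinearMap.mkContinuous
    { toFun := fun r => weightedPrimitive m w (ext r) 1
      map_add' := fun r s => h.weightedPrimitive_add r s (by simp)
      map_smul' := fun c r => weightedPrimitive_smul c r 1 } (K / η) fun r => by
    have := h.abs_weightedPrimitive_le (r := ext r) (β := 0) le_rfl (norm_nonneg r)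
      (by simpa using fun x _ _ => abs_ext_le r x) (s := 1) (by simp)
    rw [Real.one_rpow, mul_one] at this
    exact this.trans (le_of_eq (by ring))

lemma analyticOnNhd_regSolOne (h : IsPerturbation m e η K v) (b : ℝ) :
    AnalyticOnNhd ℝ (fun y => ext (regFactor (h.shift y) b) 1) univ := by
  intro y hy
  have h1 := analyticOnNhd_regFactor h b y hy
  refine (((ContinuousMap.evalCLM ℝ (⟨1, by simp⟩ : Icc (0 : ℝ) 1)).analyticAt _).comp h1).congr
    (Eventually.of_forall fun y => ?_)
  exact (ext_apply _ ⟨1, by simp⟩).symm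

lemma analyticOnNhd_dregSolOne (h : IsPerturbation m e η K v) (b : ℝ) :
    AnalyticOnNhd ℝ (fun y => dregSolOne (h.shift y) b) univ := by
  intro y hy
  have h1 := analyticOnNhd_regFactor h b y hy
  have h2 := ((weightedIntegral h).analyticAt _).comp h1
  have h3 := ((weightedIntegral (h.const 1)).analyticAt _).comp h1
  have e1 : (fun y => dregSolOne (h.shift y) b) = fun y =>
      m * ext (regFactor (h.shift y) b) 1 + (b +
        (weightedIntegral h (regFactor (h.shift y) b) +
          y * weightedIntegral (h.const 1) (regFactor (h.shift y) b))) := by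
    ext y
    rw [dregSolOne, h.weightedPrimitive_add_left (h.const y) _ (by simp),
      weightedPrimitive_const y]
    rfl
  rw [e1]
  have h4 := analyticOnNhd_regSolOne h b y hy
  exact (analyticAt_const.mul h4).add (analyticAt_const.add (h2.add (analyticAt_id.mul h3)))

end

section

/-! ### The model equation `u'' = (m (m - 1) / x ^ 2 + 1) u` on `(0, ∞)` -/

lemma summable_of_le_inv_factorial {c : ℕ → ℝ} (hc : ∀ n, |c n| ≤ 1 / n.factorial) (s : ℝ) :
    Summable fun n => c n * s ^ n := by
  refine Summable.of_norm_bounded (Real.summable_pow_div_factorial |s|) fun n => ?_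
  rw [Real.norm_eq_abs, abs_mul, abs_pow, div_eq_inv_mul, ← one_div]
  gcongr
  exact hc n

/-- The bound 1/n! survives passage to the derived series, so termwise differentiation can be
repeated. -/
lemma shifted_le_inv_factorial {c : ℕ → ℝ} (hc : ∀ n, |c n| ≤ 1 / n.factorial) (n : ℕ) :
    |((n : ℝ) + 1) * c (n + 1)| ≤ 1 / n.factorial := by
  have h := hc (n + 1)
  have h0 : (0 : ℝ) < n.factorial := by positivity
  rw [Nat.factorial_succ] at h
  push_cast at h
  rw [abs_mul, abs_of_pos (by positivity : (0 : ℝ) < (n : ℝ) + 1)]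
  calc ((n : ℝ) + 1) * |c (n + 1)| ≤ ((n : ℝ) + 1) * (1 / (((n : ℝ) + 1) * n.factorial)) := by
        gcongr
    _ = _ := by field_simp

lemma hasDerivAt_tsum_pow {c : ℕ → ℝ} (hc : ∀ n, |c n| ≤ 1 / n.factorial) (s : ℝ) :
    HasDerivAt (fun s => ∑' n, c n * s ^ n) (∑' n : ℕ, ((n : ℝ) + 1) * c (n + 1) * s ^ n) s := by
  set R := |s| + 1
  have hu : Summable fun n : ℕ => (n : ℝ) * R ^ (n - 1) / n.factorial := by
    rw [← summable_nat_add_iff 1]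
    refine (Real.summable_pow_div_factorial R).congr fun n => ?_
    have h0 : (n.factorial : ℝ) ≠ 0 := by positivity
    have h1 : (n : ℝ) + 1 ≠ 0 := by positivity
    rw [Nat.factorial_succ]
    push_cast
    field_simp
  have hmem : s ∈ Metric.ball (0 : ℝ) R := by simp [R]
  have hb : ∀ (n : ℕ) (y : ℝ), y ∈ Metric.ball (0 : ℝ) R →
      ‖c n * (n * y ^ (n - 1))‖ ≤ (n : ℝ) * R ^ (n - 1) / n.factorial := by
    intro n y hy
    have hy' : |y| ≤ R := by simpa using (mem_ball_zero_iff.1 hy).le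
    rw [Real.norm_eq_abs, abs_mul, abs_mul, abs_pow, Nat.abs_cast]
    calc |c n| * (n * |y| ^ (n - 1)) ≤ 1 / n.factorial * (n * R ^ (n - 1)) := by
          gcongr
          exact hc n
      _ = _ := by ring
  have h := hasDerivAt_tsum_of_isPreconnected hu Metric.isOpen_ball
    (convex_ball (0 : ℝ) R).isPreconnected
    (fun n y _ => (hasDerivAt_pow n y).const_mul (c n)) hb hmem
    (summable_of_le_inv_factorial hc s) hmem
  refine h.congr_deriv ?_
  have hs : Summable fun n : ℕ => c n * (n * s ^ (n - 1)) :=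
    Summable.of_norm_bounded hu fun n => hb n s hmem
  rw [hs.tsum_eq_zero_add]
  simp only [Nat.cast_zero, zero_mul, mul_zero, zero_add]
  refine tsum_congr fun n => ?_
  simp only [Nat.add_sub_cancel]
  push_cast
  ring

/-- The coefficients of the model solution. -/
def modelCoeff (m : ℝ) : ℕ → ℝ
  | 0 => 1
  | n + 1 => modelCoeff m n / ((2 * n + 2) * (2 * n + 1 + 2 * m))

lemma modelCoeff_pos {m : ℝ} (hm : 0 ≤ m) (n : ℕ) : 0 < modelCoeff m n := by
  induction n with
  | zero => simp [modelCoeff]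
  | succ n ih => rw [modelCoeff]; positivity

lemma modelCoeff_le {m : ℝ} (hm : 0 ≤ m) (n : ℕ) : |modelCoeff m n| ≤ 1 / n.factorial := by
  rw [abs_of_pos (modelCoeff_pos hm n)]
  induction n with
  | zero => simp [modelCoeff]
  | succ n ih =>
    rw [modelCoeff, Nat.factorial_succ]
    push_cast
    have h0 : (0 : ℝ) < n.factorial := by positivity
    have hn : (0 : ℝ) ≤ n := n.cast_nonneg
    have h1 : (n : ℝ) + 1 ≤ (2 * n + 2) * (2 * n + 1 + 2 * m) := by nlinarith
    calc modelCoeff m n / ((2 * n + 2) * (2 * n + 1 + 2 * m)) ≤ (1 / n.factorial) / (n + 1) := by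
          gcongr
      _ = _ := by field_simp

/-- `∑ cₙ sⁿ` for the coefficients of the model solution. -/
def modelSeries (m s : ℝ) : ℝ := ∑' n, modelCoeff m n * s ^ n

/-- The derivative of `modelSeries`. -/
def modelSeries' (m s : ℝ) : ℝ := ∑' n : ℕ, ((n : ℝ) + 1) * modelCoeff m (n + 1) * s ^ n

/-- The second derivative of `modelSeries`. -/
def modelSeries'' (m s : ℝ) : ℝ :=
  ∑' n : ℕ, ((n : ℝ) + 1) * (((n + 1 : ℕ) : ℝ) + 1) * modelCoeff m (n + 2) * s ^ n

variable {m e : ℝ}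

lemma hasDerivAt_modelSeries (hm : 0 ≤ m) (s : ℝ) :
    HasDerivAt (modelSeries m) (modelSeries' m s) s :=
  hasDerivAt_tsum_pow (modelCoeff_le hm) s

lemma hasDerivAt_modelSeries' (hm : 0 ≤ m) (s : ℝ) :
    HasDerivAt (modelSeries' m) (modelSeries'' m s) s := by
  have := hasDerivAt_tsum_pow (shifted_le_inv_factorial (modelCoeff_le hm)) s
  refine this.congr_deriv (tsum_congr fun n => ?_)
  ring

/-- In the variable s = x² this is the model equation for x^m times the series; comparing
coefficients gives the recursion defining `modelCoeff`. -/
lemma modelSeries_ode (hm : 0 ≤ m) (s : ℝ) :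
    4 * s * modelSeries'' m s + (2 + 4 * m) * modelSeries' m s = modelSeries m s := by
  have h1 := summable_of_le_inv_factorial (shifted_le_inv_factorial (modelCoeff_le hm)) s
  have h2 := summable_of_le_inv_factorial
    (shifted_le_inv_factorial (shifted_le_inv_factorial (modelCoeff_le hm))) s
  have e1 : ∀ n : ℕ, 4 * s * (((n : ℝ) + 1) * (((n + 1 : ℕ) : ℝ) + 1) * modelCoeff m (n + 2) * s ^ n)
      = 4 * ((n + 1 : ℕ) : ℝ) * (((n + 1 : ℕ) : ℝ) + 1) * modelCoeff m (n + 1 + 1) *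
        s ^ (n + 1) := fun n => by push_cast; ring
  have h3 : Summable fun n : ℕ => 4 * (n : ℝ) * ((n : ℝ) + 1) * modelCoeff m (n + 1) * s ^ n := by
    rw [← summable_nat_add_iff 1]
    refine (h2.mul_left (4 * s)).congr fun n => ?_
    rw [← e1 n]; ring
  have h4 : 4 * s * modelSeries'' m s =
      ∑' n : ℕ, 4 * (n : ℝ) * ((n : ℝ) + 1) * modelCoeff m (n + 1) * s ^ n := by
    rw [h3.tsum_eq_zero_add, modelSeries'', ← tsum_mul_left]
    simp only [e1]
    simp
  rw [h4, modelSeries', ← tsum_mul_left, ← h3.tsum_add (h1.mul_left _), modelSeries]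
  refine tsum_congr fun n => ?_
  have h5 : modelCoeff m (n + 1) * ((2 * n + 2) * (2 * n + 1 + 2 * m)) = modelCoeff m n := by
    rw [modelCoeff, div_mul_cancel₀]
    positivity
  rw [← h5]; ring

lemma one_le_modelSeries (hm : 0 ≤ m) {s : ℝ} (hs : 0 ≤ s) : 1 ≤ modelSeries m s := by
  have h := (summable_of_le_inv_factorial (modelCoeff_le hm) s).le_tsum 0
    fun n _ => mul_nonneg (modelCoeff_pos hm n).le (pow_nonneg hs n)
  rw [modelSeries]
  simpa only [modelCoeff, pow_zero, mul_one] using h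

lemma modelSeries'_pos (hm : 0 ≤ m) {s : ℝ} (hs : 0 ≤ s) : 0 < modelSeries' m s := by
  have h := (summable_of_le_inv_factorial (shifted_le_inv_factorial
    (modelCoeff_le hm)) s).le_tsum 0 fun n _ =>
      mul_nonneg (mul_nonneg (by positivity) (modelCoeff_pos hm _).le) (pow_nonneg hs n)
  refine lt_of_lt_of_le ?_ h
  simpa using modelCoeff_pos hm 1

/-- A positive solution of the model equation together with the bounds that are used below. -/
structure IsModel (m e C L : ℝ) (u du : ℝ → ℝ) : Prop where
  hasDerivAt : ∀ x, 0 < x → HasDerivAt u (du x) x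
  hasDerivAt' : ∀ x, 0 < x → HasDerivAt du ((m * (m - 1) / x ^ 2 + 1) * u x) x
  pos : ∀ x, 0 < x → 0 < u x
  left : Tendsto (fun x => u x / x ^ m) (𝓝[>] 0) (𝓝 1)
  slope : Tendsto (fun x => x ^ m * du x - m * x ^ (m - 1) * u x) (𝓝[>] 0) (𝓝 0)
  C_pos : 0 < C
  deriv_le : ∀ x, 4 ≤ x → |du x - u x| ≤ C * u x / x ^ 2
  log_le : ∀ x, 4 ≤ x → |Real.log (u x) - x - L| ≤ C / x
  ratio_le : ∀ t s, 0 < t → t ≤ s → u t ^ 2 ≤ C * (t / s) ^ e * Real.exp (-(s - t)) * u s ^ 2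

/-- A function with nonnegative derivative on a convex set is monotone there. -/
lemma monotoneOn_of_hasDerivAt_nonneg {f f' : ℝ → ℝ} {D : Set ℝ} (hD : Convex ℝ D)
    (hf : ∀ x ∈ D, HasDerivAt f (f' x) x) (h : ∀ x ∈ D, 0 ≤ f' x) : MonotoneOn f D := by
  refine monotoneOn_of_deriv_nonneg hD (fun x hx => (hf x hx).continuousAt.continuousWithinAt)
    (fun x hx => (hf x (interior_subset hx)).differentiableAt.differentiableWithinAt)
    fun x hx => ?_
  rw [(hf x (interior_subset hx)).deriv]
  exact h x (interior_subset hx)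

/-- The function log u - x has derivative bounded by C/x². Hence subtracting C/x makes it increasing
and adding C/x makes it decreasing, and it converges at rate C/x. -/
lemma exists_log_asymptotics {u du : ℝ → ℝ} {C : ℝ}
    (hu : ∀ x, 0 < x → HasDerivAt u (du x) x) (hpos : ∀ x, 0 < x → 0 < u x)
    (hC : ∀ x, 4 ≤ x → |du x - u x| ≤ C * u x / x ^ 2) :
    ∃ L, ∀ x, 4 ≤ x → |Real.log (u x) - x - L| ≤ C / x := by
  have hd : ∀ x, 4 ≤ x → HasDerivAt (fun x => Real.log (u x) - x) (du x / u x - 1) x :=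
    fun x hx => ((hu x (by linarith)).log (hpos x (by linarith)).ne').sub (hasDerivAt_id x)
  have hb : ∀ x, 4 ≤ x → |du x / u x - 1| ≤ C / x ^ 2 := fun x hx => by
    have h0 := hpos x (by linarith)
    have e1 : du x / u x - 1 = (du x - u x) / u x := by field_simp
    rw [e1, abs_div, abs_of_pos h0, div_le_iff₀ h0]
    exact (hC x hx).trans (le_of_eq (by ring))
  have hinv : ∀ x : ℝ, 4 ≤ x → HasDerivAt (fun x : ℝ => C / x) (-(C / x ^ 2)) x := fun x hx => by
    have := (hasDerivAt_inv (by linarith : x ≠ 0)).const_mul C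
    simpa [div_eq_mul_inv] using this
  have hmono : MonotoneOn (fun x => Real.log (u x) - x - C / x) (Ici 4) :=
    monotoneOn_of_hasDerivAt_nonneg (convex_Ici 4) (fun x hx => (hd x hx).sub (hinv x hx))
      fun x hx => by linarith [(abs_le.1 (hb x hx)).1]
  have hanti : MonotoneOn (fun x => -(Real.log (u x) - x + C / x)) (Ici 4) :=
    monotoneOn_of_hasDerivAt_nonneg (convex_Ici 4) (fun x hx => ((hd x hx).add (hinv x hx)).neg)
      fun x hx => by linarith [(abs_le.1 (hb x hx)).2]
  have hC0 : 0 ≤ C := by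
    have h1 := (abs_nonneg _).trans (hb 4 le_rfl)
    have : C = 16 * (C / 4 ^ 2) := by ring
    rw [this]; positivity
  have hle : ∀ x y, 4 ≤ x → 4 ≤ y →
      Real.log (u x) - x - C / x ≤ Real.log (u y) - y + C / y := by
    intro x y hx hy
    have h1 := hmono hx (show (4 : ℝ) ≤ max x y from hx.trans (le_max_left _ _)) (le_max_left x y)
    have h2 := hanti hy (show (4 : ℝ) ≤ max x y from hx.trans (le_max_left _ _)) (le_max_right x y)
    have h3 : 0 ≤ C / max x y := div_nonneg hC0 (by linarith [le_max_left x y])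
    simp only at h1 h2
    linarith
  -- The limit is taken as the supremum of the increasing lower functions; by `hle` it lies below
  -- every upper function.
  refine ⟨⨆ x : Ici (4 : ℝ), (Real.log (u x) - x - C / x), fun x hx => ?_⟩
  have : Nonempty (Ici (4 : ℝ)) := ⟨⟨4, self_mem_Ici⟩⟩
  have hbdd : BddAbove (range fun x : Ici (4 : ℝ) => Real.log (u x) - x - C / x) := by
    refine ⟨Real.log (u 4) - 4 + C / 4, ?_⟩
    rintro _ ⟨y, rfl⟩
    exact hle y 4 y.2 le_rfl
  have h1 := le_ciSup hbdd ⟨x, hx⟩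
  have h2 : ⨆ x : Ici (4 : ℝ), (Real.log (u x) - x - C / x) ≤ Real.log (u x) - x + C / x :=
    ciSup_le fun y => hle y x y.2 hx
  simp only at h1
  rw [abs_le]; constructor <;> linarith

/-- The function D = (u' - u)eˣ has D' = κ u eˣ/x², while G = u eˣ/x² satisfies G' ≥ u eˣ/(2x²). So
2|κ|G ± D are both increasing, which bounds |D| by a multiple of G. -/
lemma exists_deriv_sub_le {u du : ℝ → ℝ} {κ : ℝ}
    (hu : ∀ x, 0 < x → HasDerivAt u (du x) x)
    (hu' : ∀ x, 0 < x → HasDerivAt du ((κ / x ^ 2 + 1) * u x) x)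
    (hpos : ∀ x, 0 < x → 0 < u x) (hdpos : ∀ x, 0 < x → 0 < du x) :
    ∃ C, 0 < C ∧ ∀ x, 4 ≤ x → |du x - u x| ≤ C * u x / x ^ 2 := by
  set D := fun x => (du x - u x) * Real.exp x
  set G := fun x => u x * Real.exp x / x ^ 2
  have hD : ∀ x, 4 ≤ x → HasDerivAt D (κ / x ^ 2 * u x * Real.exp x) x := fun x hx => by
    have x0 : 0 < x := by linarith
    refine (((hu' x x0).sub (hu x x0)).mul (Real.hasDerivAt_exp x)).congr_deriv ?_
    simp only [Pi.sub_apply]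
    ring
  have hG : ∀ x, 4 ≤ x → HasDerivAt G ((du x + u x - 2 * u x / x) * Real.exp x / x ^ 2) x :=
    fun x hx => by
    have x0 : 0 < x := by linarith
    refine (((hu x x0).mul (Real.hasDerivAt_exp x)).div (hasDerivAt_pow 2 x)
      (by positivity)).congr_deriv ?_
    simp only [Pi.mul_apply]
    field_simp
    ring
  -- The lower limit 4 serves to absorb the negative term: 2u/x ≤ u/2.
  have hG' : ∀ x, 4 ≤ x → u x * Real.exp x / (2 * x ^ 2) ≤
      (du x + u x - 2 * u x / x) * Real.exp x / x ^ 2 := fun x hx => by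
    have x0 : 0 < x := by linarith
    have h1 := hpos x x0
    have h2 := hdpos x x0
    have h3 : 2 * u x / x ≤ u x / 2 := by
      rw [div_le_div_iff₀ x0 two_pos]; nlinarith
    have h4 : u x / 2 ≤ du x + u x - 2 * u x / x := by linarith
    calc u x * Real.exp x / (2 * x ^ 2) = (u x / 2) * Real.exp x / x ^ 2 := by field_simp
      _ ≤ _ := by gcongr
  have hGpos : ∀ x, 4 ≤ x → 0 < G x := fun x hx => by
    have x0 : 0 < x := by linarith
    have h1 := hpos x x0
    positivity
  have key : ∀ σ : ℝ, |σ| = 1 → MonotoneOn (fun x => 2 * |κ| * G x + σ * D x) (Ici 4) := by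
    intro σ hσ
    have hder : ∀ x, 4 ≤ x → HasDerivAt (fun x => 2 * |κ| * G x + σ * D x)
        (2 * |κ| * ((du x + u x - 2 * u x / x) * Real.exp x / x ^ 2) +
          σ * (κ / x ^ 2 * u x * Real.exp x)) x :=
      fun x hx => ((hG x hx).const_mul _).add ((hD x hx).const_mul σ)
    refine monotoneOn_of_hasDerivAt_nonneg (convex_Ici 4) hder fun x hx' => ?_
    · have h1 := mul_le_mul_of_nonneg_left (hG' x hx') (by positivity : 0 ≤ 2 * |κ|)
      have x0 : 0 < x := by linarith [show (4 : ℝ) ≤ x from hx']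
      have h2 : -(|κ| / x ^ 2 * u x * Real.exp x) ≤ σ * (κ / x ^ 2 * u x * Real.exp x) := by
        have h3 : |σ * (κ / x ^ 2 * u x * Real.exp x)| = |κ| / x ^ 2 * u x * Real.exp x := by
          rw [abs_mul, hσ, one_mul, abs_mul, abs_mul, abs_div, abs_of_pos (hpos x x0),
            abs_of_pos (Real.exp_pos x), abs_of_pos (by positivity : 0 < x ^ 2)]
        rw [← h3]; exact neg_abs_le _
      have h4 : 2 * |κ| * (u x * Real.exp x / (2 * x ^ 2)) = |κ| / x ^ 2 * u x * Real.exp x := by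
        field_simp
      linarith
  have hGmono : ∀ x, 4 ≤ x → G 4 ≤ G x := by
    have : MonotoneOn G (Ici 4) :=
      monotoneOn_of_hasDerivAt_nonneg (convex_Ici 4) hG fun x hx => by
        have h1 := hpos x (by linarith [show (4 : ℝ) ≤ x from hx])
        exact le_trans (by positivity) (hG' x hx)
    exact fun x hx => this (show (4 : ℝ) ≤ 4 from le_rfl) hx hx
  refine ⟨|D 4| / G 4 + 2 * |κ| + 1, ?_, fun x hx => ?_⟩
  · have := hGpos 4 le_rfl
    positivity
  · have h1 := key 1 (by simp) (show (4 : ℝ) ≤ 4 from le_rfl) hx hx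
    have h2 := key (-1) (by simp) (show (4 : ℝ) ≤ 4 from le_rfl) hx hx
    simp only at h1 h2
    have g4 := hGpos 4 le_rfl
    have gx := hGpos x hx
    have h3 : |D 4| ≤ |D 4| / G 4 * G x := by
      calc |D 4| = |D 4| / G 4 * G 4 := by field_simp
        _ ≤ _ := by gcongr; exact hGmono x hx
    have h4 : 0 ≤ 2 * |κ| * G 4 := by positivity
    have h5 : |D x| ≤ (|D 4| / G 4 + 2 * |κ| + 1) * G x := by
      have := neg_abs_le (D 4)
      have := le_abs_self (D 4)
      rw [abs_le]; constructor <;> linarith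
    have h6 : |D x| = |du x - u x| * Real.exp x := by
      rw [abs_mul, abs_of_pos (Real.exp_pos x)]
    have h7 : (|D 4| / G 4 + 2 * |κ| + 1) * G x =
        ((|D 4| / G 4 + 2 * |κ| + 1) * u x / x ^ 2) * Real.exp x := by
      simp only [G]; ring
    rw [h6, h7] at h5
    exact le_of_mul_le_mul_right h5 (Real.exp_pos x)

/-- Consider f = 2 log u - e log x - x. From u'/u ≥ m/x and e ≤ 2m, f + x is increasing everywhere;
from u'/u → 1, f itself is increasing far out. So f decreases by at most a constant, and
exponentiating gives the claim. -/
lemma exists_ratio_le {u du : ℝ → ℝ} {C : ℝ} (hem : e ≤ 2 * m) (he1 : e < 1)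
    (hu : ∀ x, 0 < x → HasDerivAt u (du x) x)
    (hpos : ∀ x, 0 < x → 0 < u x) (hdu : ∀ x, 0 < x → m / x * u x ≤ du x)
    (hC0 : 0 < C) (hC : ∀ x, 4 ≤ x → |du x - u x| ≤ C * u x / x ^ 2) :
    ∃ C', 0 < C' ∧ ∀ t s, 0 < t → t ≤ s →
      u t ^ 2 ≤ C' * (t / s) ^ e * Real.exp (-(s - t)) * u s ^ 2 := by
  set X := 4 + 4 * C
  set f := fun x => 2 * Real.log (u x) - e * Real.log x - x
  have hf : ∀ x, 0 < x → HasDerivAt f (2 * (du x / u x) - e * x⁻¹ - 1) x := fun x hx =>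
    ((((hu x hx).log (hpos x hx).ne').const_mul 2).sub
      ((Real.hasDerivAt_log hx.ne').const_mul e)).sub (hasDerivAt_id x)
  have h1 : MonotoneOn (fun x => f x + x) (Ioi 0) := by
    have hder : ∀ x, 0 < x → HasDerivAt (fun x => f x + x)
        (2 * (du x / u x) - e * x⁻¹ - 1 + 1) x := fun x hx => (hf x hx).add (hasDerivAt_id x)
    refine monotoneOn_of_hasDerivAt_nonneg (convex_Ioi 0) hder fun x hx' => ?_
    · have h2 : m / x ≤ du x / u x := by
        rw [le_div_iff₀ (hpos x hx')]; exact hdu x hx'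
      have h3 : e * x⁻¹ ≤ 2 * (m / x) := by
        rw [← div_eq_mul_inv, ← mul_div_assoc]
        exact div_le_div_of_nonneg_right hem (le_of_lt hx')
      linarith
  have h2 : MonotoneOn f (Ici X) := by
    have hX : ∀ x, X ≤ x → 4 ≤ x := fun x hx => by simp only [X] at hx; linarith
    refine monotoneOn_of_hasDerivAt_nonneg (convex_Ici X)
      (fun x hx => hf x (by linarith [hX x hx])) fun x hx => ?_
    · have hx' := hX x hx
      have x0 : 0 < x := by linarith
      have hx2 : X ≤ x := hx
      have h3 : 3 / 4 ≤ du x / u x := by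
        rw [le_div_iff₀ (hpos x x0)]
        have h4 := (abs_le.1 (hC x hx')).1
        have h5 : C * u x / x ^ 2 ≤ u x / 4 := by
          rw [div_le_div_iff₀ (by positivity) (by norm_num)]
          have : C * 4 ≤ x ^ 2 := by simp only [X] at hx2; nlinarith
          nlinarith [hpos x x0]
        linarith
      have h4 : e * x⁻¹ ≤ 1 / 4 := by
        rw [← div_eq_mul_inv, div_le_iff₀ x0]; linarith
      linarith
  have hX0 : 0 < X := by positivity
  have key : ∀ t s, 0 < t → t ≤ s → f t ≤ f s + X := by
    intro t s ht hts
    rcases le_total s X with hs | hs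
    · have := h1 ht (show (0 : ℝ) < s by linarith) hts
      simp only at this
      linarith
    · rcases le_total X t with ht' | ht'
      · have := h2 ht' hs hts
        linarith
      · have a1 := h1 ht hX0 ht'
        have a2 := h2 (show X ≤ X from le_rfl) hs hs
        simp only at a1
        linarith
  refine ⟨Real.exp X, Real.exp_pos X, fun t s ht hts => ?_⟩
  have s0 : 0 < s := by linarith
  have hk := key t s ht hts
  have e1 : u t ^ 2 = Real.exp (2 * Real.log (u t)) := by
    rw [← Real.log_rpow (hpos t ht), Real.exp_log (by have := hpos t ht; positivity)]
    norm_cast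
  have e2 : u s ^ 2 = Real.exp (2 * Real.log (u s)) := by
    rw [← Real.log_rpow (hpos s s0), Real.exp_log (by have := hpos s s0; positivity)]
    norm_cast
  have e3 : (t / s) ^ e = Real.exp (e * Real.log t - e * Real.log s) := by
    rw [Real.rpow_def_of_pos (by positivity), Real.log_div ht.ne' s0.ne']
    congr 1; ring
  rw [e1, e2, e3, ← Real.exp_add, ← Real.exp_add, ← Real.exp_add]
  apply Real.exp_le_exp.2
  simp only [f] at hk
  linarith

/-- The solution is x^m times an even power series with positive coefficients, a multiple of √x
I_{m-1/2}(x). Positivity of the coefficients yields u > 0, u' > 0 and u' ≥ (m/x)u, from which all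
bounds follow. -/
theorem exists_isModel (hem : e ≤ 2 * m) (he0 : 0 ≤ e) (he1 : e < 1) :
    ∃ C L u du, IsModel m e C L u du := by
  have hm : 0 ≤ m := by linarith
  set u := fun x : ℝ => x ^ m * modelSeries m (x ^ 2)
  set du := fun x : ℝ => m * x ^ (m - 1) * modelSeries m (x ^ 2) +
    x ^ m * (2 * x * modelSeries' m (x ^ 2))
  have hp : ∀ p x : ℝ, 0 < x → HasDerivAt (fun x : ℝ => x ^ p) (p * x ^ (p - 1)) x :=
    fun p x hx => Real.hasDerivAt_rpow_const (Or.inl hx.ne')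
  have hsq : ∀ x : ℝ, HasDerivAt (fun x : ℝ => x ^ 2) (2 * x) x := fun x => by
    simpa using hasDerivAt_pow 2 x
  have hw : ∀ x : ℝ, HasDerivAt (fun x => modelSeries m (x ^ 2)) (2 * x * modelSeries' m (x ^ 2)) x :=
    fun x => (HasDerivAt.comp x (h₂ := modelSeries m) (h := fun x => x ^ 2) (hasDerivAt_modelSeries hm (x ^ 2)) (hsq x)).congr_deriv (mul_comm _ _)
  have hw' : ∀ x : ℝ, HasDerivAt (fun x => modelSeries' m (x ^ 2))
      (2 * x * modelSeries'' m (x ^ 2)) x :=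
    fun x => (HasDerivAt.comp x (h₂ := modelSeries' m) (h := fun x => x ^ 2) (hasDerivAt_modelSeries' hm (x ^ 2)) (hsq x)).congr_deriv (mul_comm _ _)
  have hu : ∀ x, 0 < x → HasDerivAt u (du x) x := fun x hx => (hp m x hx).mul (hw x)
  have hu' : ∀ x, 0 < x → HasDerivAt du ((m * (m - 1) / x ^ 2 + 1) * u x) x := fun x hx => by
    have := (((hp (m - 1) x hx).const_mul m).mul (hw x)).add
      ((hp m x hx).mul ((((hasDerivAt_id x).const_mul 2)).mul (hw' x)))
    refine this.congr_deriv ?_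
    have e1 : x ^ (m - 1) = x ^ m / x := Real.rpow_sub_one hx.ne' m
    have e2 : x ^ (m - 1 - 1) = x ^ m / x / x := by
      rw [Real.rpow_sub_one hx.ne', Real.rpow_sub_one hx.ne']
    simp only [Pi.mul_apply, id, u, e1, e2]
    rw [← modelSeries_ode hm (x ^ 2)]
    field_simp
    ring
  have hpos : ∀ x, 0 < x → 0 < u x := fun x hx =>
    mul_pos (Real.rpow_pos_of_pos hx m) (by linarith [one_le_modelSeries hm (sq_nonneg x)])
  have hdu0 : ∀ x, 0 < x → m / x * u x + x ^ m * (2 * x * modelSeries' m (x ^ 2)) = du x :=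
    fun x hx => by
      simp only [u, du, Real.rpow_sub_one hx.ne' m]; ring
  have hpos' : ∀ x, 0 < x → 0 < x ^ m * (2 * x * modelSeries' m (x ^ 2)) := fun x hx => by
    have := modelSeries'_pos hm (sq_nonneg x)
    have := Real.rpow_pos_of_pos hx m
    positivity
  have hdu : ∀ x, 0 < x → m / x * u x ≤ du x := fun x hx => by
    linarith [hpos' x hx, hdu0 x hx]
  have hdpos : ∀ x, 0 < x → 0 < du x := fun x hx => by
    have : 0 ≤ m / x * u x := mul_nonneg (div_nonneg hm hx.le) (hpos x hx).le
    linarith [hpos' x hx, hdu0 x hx]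
  obtain ⟨C₁, hC₁, h1⟩ := exists_deriv_sub_le hu hu' hpos hdpos
  obtain ⟨L, h2⟩ := exists_log_asymptotics hu hpos h1
  obtain ⟨C₂, hC₂, h3⟩ := exists_ratio_le hem he1 hu hpos hdu hC₁ h1
  have hcont : Continuous fun x => modelSeries m (x ^ 2) :=
    continuous_iff_continuousAt.2 fun x => (hw x).continuousAt
  have hcont' : Continuous fun x => modelSeries' m (x ^ 2) :=
    continuous_iff_continuousAt.2 fun x => (hw' x).continuousAt
  refine ⟨max C₁ C₂, L, u, du, hu, hu', hpos, ?_, ?_, lt_max_of_lt_left hC₁, fun x hx => ?_,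
    fun x hx => ?_, fun t s ht hts => ?_⟩
  · have h4 := (hcont.tendsto 0).mono_left (nhdsWithin_le_nhds (s := Ioi 0))
    have h5 : modelSeries m (0 ^ 2) = 1 := by
      rw [modelSeries, tsum_eq_single 0]
      · simp [modelCoeff]
      · intro n hn; simp [hn]
    rw [h5] at h4
    refine h4.congr' ?_
    filter_upwards [self_mem_nhdsWithin] with x hx
    rw [mul_div_cancel_left₀ _ (Real.rpow_pos_of_pos hx m).ne']
  · have h4 : Tendsto (fun x : ℝ => x ^ (2 * m) * (2 * x * modelSeries' m (x ^ 2))) (𝓝 0)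
        (𝓝 (0 ^ (2 * m) * (2 * 0 * modelSeries' m (0 ^ 2)))) :=
      ((Real.continuousAt_rpow_const 0 (2 * m) (Or.inr (by linarith))).tendsto).mul
        (((continuous_const.mul continuous_id).mul hcont').tendsto 0)
    simp only [mul_zero, zero_mul] at h4
    refine (h4.mono_left (nhdsWithin_le_nhds (s := Ioi 0))).congr' ?_
    filter_upwards [self_mem_nhdsWithin] with x hx
    have x0 : 0 < x := hx
    have e1 : x ^ (2 * m) = x ^ m * x ^ m := by rw [← Real.rpow_add x0]; ring_nf
    simp only [u, du, e1]
    ring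
  · have h4 := hpos x (by linarith)
    refine (h1 x hx).trans ?_
    gcongr
    exact le_max_left _ _
  · have : 0 < x := by linarith
    refine (h2 x hx).trans ?_
    gcongr
    exact le_max_left _ _
  · have h4 := hpos s (by linarith)
    have h5 : 0 ≤ (t / s) ^ e := Real.rpow_nonneg (div_nonneg ht.le (by linarith)) _
    refine (h3 t s ht hts).trans ?_
    gcongr
    exact le_max_right _ _

end

section

/-! ### Asymptotics of the regular solution for large spectral parameter -/

lemma exists_bound_of_tendsto {f : ℝ → ℝ} {A B : ℝ} (hf : ContinuousOn f (Ioo 0 1))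
    (h0 : Tendsto f (𝓝[>] 0) (𝓝 A)) (h1 : Tendsto f (𝓝[<] 1) (𝓝 B)) :
    ∃ R, ∀ x ∈ Ioo (0 : ℝ) 1, |f x| ≤ R := by
  have hc := continuousOn_Icc_extendFrom_Ioo hf h0 h1
  obtain ⟨R, hR⟩ := isCompact_Icc.exists_bound_of_continuousOn hc
  refine ⟨R, fun x hx => ?_⟩
  have := hR x (Ioo_subset_Icc_self hx)
  rwa [extendFrom_eq (by rw [closure_Ioo zero_ne_one]; exact Ioo_subset_Icc_self hx)
    (hf x hx).tendsto, Real.norm_eq_abs] at this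

/-- If g' dominates |W'|, then g - W and g + W increase, and each is compared with its limit at the
open end point 0. -/
lemma abs_sub_le_of_abs_deriv_le {W W' g g' : ℝ → ℝ} {b s : ℝ} (hs : s ∈ Ioo (0 : ℝ) 1)
    (hW : ∀ t ∈ Ioo (0 : ℝ) 1, HasDerivAt W (W' t) t)
    (hg : ∀ t ∈ Ioo (0 : ℝ) 1, HasDerivAt g (g' t) t)
    (hle : ∀ t ∈ Ioc 0 s, |W' t| ≤ g' t) (hW0 : Tendsto W (𝓝[>] 0) (𝓝 b))
    (hg0 : Tendsto g (𝓝[>] 0) (𝓝 0)) : |W s - b| ≤ g s := by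
  have hsub : ∀ t ∈ Ioc 0 s, t ∈ Ioo (0 : ℝ) 1 := fun t ht => ⟨ht.1, ht.2.trans_lt hs.2⟩
  have hev : ∀ᶠ t in 𝓝[>] (0 : ℝ), t ∈ Ioc 0 s := Ioc_mem_nhdsGT hs.1
  have m1 : MonotoneOn (fun t => g t - W t) (Ioc 0 s) :=
    monotoneOn_of_hasDerivAt_nonneg (convex_Ioc 0 s)
      (fun t ht => (hg t (hsub t ht)).sub (hW t (hsub t ht)))
      fun t ht => by linarith [(abs_le.1 (hle t ht)).2]
  have m2 : MonotoneOn (fun t => g t + W t) (Ioc 0 s) :=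
    monotoneOn_of_hasDerivAt_nonneg (convex_Ioc 0 s)
      (fun t ht => (hg t (hsub t ht)).add (hW t (hsub t ht)))
      fun t ht => by linarith [(abs_le.1 (hle t ht)).1]
  have hss : s ∈ Ioc 0 s := ⟨hs.1, le_rfl⟩
  have a1 : 0 - b ≤ g s - W s := le_of_tendsto (hg0.sub hW0)
    (hev.mono fun t ht => m1 ht hss ht.2)
  have a2 : 0 + b ≤ g s + W s := le_of_tendsto (hg0.add hW0)
    (hev.mono fun t ht => m2 ht hss ht.2)
  rw [abs_le]; constructor <;> linarith

lemma rpow_le_one_add {τ θ : ℝ} (hτ : 0 < τ) (h0 : 0 ≤ θ) (h1 : θ ≤ 1) : τ ^ θ ≤ 1 + τ := by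
  rcases le_total τ 1 with h | h
  · linarith [Real.rpow_le_one hτ.le h h0]
  · have := Real.rpow_le_rpow_of_exponent_le h h1
    rw [Real.rpow_one] at this
    linarith

section Comparison

variable {m e η K b C L z φ₁ d₁ : ℝ} {V u du φ dφ : ℝ → ℝ}

/-- The model solution with parameter `z`, normalized at `0`. -/
def scaledModel (m z : ℝ) (u : ℝ → ℝ) (x : ℝ) : ℝ := z ^ (-m) * u (z * x)

/-- The derivative of the scaled model solution. -/
def dscaledModel (m z : ℝ) (du : ℝ → ℝ) (x : ℝ) : ℝ := z ^ (-m) * (z * du (z * x))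

namespace IsModel

lemma scaled_hasDerivAt (hu : IsModel m e C L u du) (hz : 0 < z) {x : ℝ} (hx : 0 < x) :
    HasDerivAt (scaledModel m z u) (dscaledModel m z du x) x := by
  have h1 : HasDerivAt (fun x => u (z * x)) (du (z * x) * z) x := by
    refine HasDerivAt.comp x (h₂ := u) (h := fun x => z * x) (hu.hasDerivAt _ (by positivity)) ?_
    simpa using (hasDerivAt_id x).const_mul z
  exact (h1.const_mul (z ^ (-m))).congr_deriv (by rw [dscaledModel]; ring)

lemma scaled_hasDerivAt' (hu : IsModel m e C L u du) (hz : 0 < z) {x : ℝ} (hx : 0 < x) :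
    HasDerivAt (dscaledModel m z du) ((m * (m - 1) / x ^ 2 + z ^ 2) * scaledModel m z u x) x := by
  have h1 : HasDerivAt (fun x => du (z * x))
      ((m * (m - 1) / (z * x) ^ 2 + 1) * u (z * x) * z) x := by
    refine HasDerivAt.comp x (h₂ := du) (h := fun x => z * x) (hu.hasDerivAt' _ (by positivity)) ?_
    simpa using (hasDerivAt_id x).const_mul z
  refine ((h1.const_mul z).const_mul (z ^ (-m))).congr_deriv ?_
  rw [scaledModel]
  field_simp

lemma scaled_pos (hu : IsModel m e C L u du) (hz : 0 < z) {x : ℝ} (hx : 0 < x) :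
    0 < scaledModel m z u x :=
  mul_pos (Real.rpow_pos_of_pos hz _) (hu.pos _ (mul_pos hz hx))

lemma tendsto_mul_nhdsGT (hz : 0 < z) : Tendsto (fun x => z * x) (𝓝[>] 0) (𝓝[>] 0) := by
  refine tendsto_nhdsWithin_iff.2 ⟨?_, ?_⟩
  · have : Tendsto (fun x => z * x) (𝓝 0) (𝓝 (z * 0)) := (continuous_const_mul z).tendsto 0
    rw [mul_zero] at this
    exact this.mono_left nhdsWithin_le_nhds
  · filter_upwards [self_mem_nhdsWithin] with x hx using mul_pos hz hx

lemma scaled_left (hu : IsModel m e C L u du) (hz : 0 < z) :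
    Tendsto (fun x => scaledModel m z u x / x ^ m) (𝓝[>] 0) (𝓝 1) := by
  refine (hu.left.comp (tendsto_mul_nhdsGT hz)).congr' ?_
  filter_upwards [self_mem_nhdsWithin] with x hx
  have x0 : 0 < x := hx
  simp only [Function.comp, scaledModel]
  rw [Real.mul_rpow hz.le x0.le, Real.rpow_neg hz.le]
  field_simp

lemma scaled_slope (hu : IsModel m e C L u du) (hz : 0 < z) :
    Tendsto (fun x => x ^ m * dscaledModel m z du x - m * x ^ (m - 1) * scaledModel m z u x)
      (𝓝[>] 0) (𝓝 0) := by
  have := (hu.slope.comp (tendsto_mul_nhdsGT hz)).const_mul (z * (z ^ m)⁻¹ * (z ^ m)⁻¹)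
  rw [mul_zero] at this
  refine this.congr' ?_
  filter_upwards [self_mem_nhdsWithin] with x hx
  have x0 : 0 < x := hx
  have hzm : z ^ m ≠ 0 := (Real.rpow_pos_of_pos hz m).ne'
  simp only [Function.comp, scaledModel, dscaledModel]
  rw [Real.mul_rpow hz.le x0.le, Real.rpow_neg hz.le, Real.rpow_sub_one (by positivity),
    Real.rpow_sub_one x0.ne', Real.mul_rpow hz.le x0.le]
  field_simp

lemma scaled_ratio_le (hu : IsModel m e C L u du) (hz : 0 < z) {t s : ℝ} (ht : 0 < t)
    (hts : t ≤ s) : scaledModel m z u t ^ 2 ≤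
      C * (t / s) ^ e * Real.exp (-(z * (s - t))) * scaledModel m z u s ^ 2 := by
  have h := hu.ratio_le (z * t) (z * s) (by positivity) (by gcongr)
  rw [mul_div_mul_left _ _ hz.ne', ← mul_sub] at h
  have h2 : 0 ≤ (z ^ (-m)) ^ 2 := by positivity
  calc _ = (z ^ (-m)) ^ 2 * u (z * t) ^ 2 := by rw [scaledModel]; ring
    _ ≤ (z ^ (-m)) ^ 2 * _ := mul_le_mul_of_nonneg_left h h2
    _ = _ := by rw [scaledModel]; ring

/-- Only b ≠ 0 matters, and then m = e = 0. The scaled model has limit 1 at 0 in this case, so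
letting t → 0 in the ratio estimate gives exponential growth of U². -/
lemma div_scaled_sq_le (hu : IsModel m e C L u du) (he : e = 0 ∨ b = 0) (hbm : b * m = 0)
    (hz : 0 < z) {s : ℝ} (hs : 0 < s) :
    |b| / scaledModel m z u s ^ 2 ≤ |b| * C * Real.exp (-(z * s)) := by
  rcases eq_or_ne b 0 with rfl | hb
  · simp
  have he := he.resolve_right hb
  have hm : m = 0 := (mul_eq_zero.1 hbm).resolve_left hb
  have hU := hu.scaled_pos hz hs
  subst he hm
  have h1 : Tendsto (fun t => scaledModel 0 z u t ^ 2) (𝓝[>] 0) (𝓝 (1 ^ 2)) := by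
    simpa using (hu.scaled_left hz).pow 2
  have h2 : Tendsto (fun t => C * (t / s) ^ (0 : ℝ) * Real.exp (-(z * (s - t))) *
      scaledModel 0 z u s ^ 2) (𝓝[>] 0)
      (𝓝 (C * Real.exp (-(z * (s - 0))) * scaledModel 0 z u s ^ 2)) := by
    simp only [Real.rpow_zero, mul_one]
    have : Continuous fun t : ℝ => C * Real.exp (-(z * (s - t))) * scaledModel 0 z u s ^ 2 := by
      fun_prop
    exact (this.tendsto 0).mono_left nhdsWithin_le_nhds
  have h3 := le_of_tendsto_of_tendsto h1 h2 (by
    filter_upwards [Ioc_mem_nhdsGT hs] with t ht using hu.scaled_ratio_le hz ht.1 ht.2)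
  rw [sub_zero] at h3
  rw [div_le_iff₀ (by positivity)]
  calc |b| = |b| * 1 ^ 2 := by ring
    _ ≤ |b| * _ := mul_le_mul_of_nonneg_left h3 (abs_nonneg b)
    _ = _ := by ring

end IsModel

/-- Wronskian of the scaled model and the regular solution. -/
def modelWronskian (m z : ℝ) (u du φ dφ : ℝ → ℝ) (x : ℝ) : ℝ :=
  scaledModel m z u x * dφ x - dscaledModel m z du x * φ x

variable (hu : IsModel m e C L u du) (hV : IsPerturbation m e η K V) (hz : 1 ≤ z)
  (hφ : IsRegularSolution m b (fun x => m * (m - 1) / x ^ 2 + (V x + z ^ 2)) φ dφ φ₁ d₁)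
include hu hz hφ

/-- The singular term and z² are common to both equations and cancel; only the perturbation V
remains. -/
lemma hasDerivAt_modelWronskian {x : ℝ} (hx : x ∈ Ioo (0 : ℝ) 1) :
    HasDerivAt (modelWronskian m z u du φ dφ) (V x * φ x * scaledModel m z u x) x := by
  have z0 : 0 < z := by linarith
  refine (((hu.scaled_hasDerivAt z0 hx.1).mul (hφ.hasDerivAt' x hx)).sub
    ((hu.scaled_hasDerivAt' z0 hx.1).mul (hφ.hasDerivAt x hx))).congr_deriv ?_
  ring

lemma tendsto_modelWronskian : Tendsto (modelWronskian m z u du φ dφ) (𝓝[>] 0) (𝓝 b) := by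
  have z0 : 0 < z := by linarith
  have := ((hu.scaled_left z0).mul hφ.slope).sub (hφ.left.mul (hu.scaled_slope z0))
  simp only [one_mul, sub_zero] at this
  refine this.congr' ?_
  filter_upwards [self_mem_nhdsWithin] with x hx
  have x0 : 0 < x := hx
  have : x ^ m ≠ 0 := (Real.rpow_pos_of_pos x0 m).ne'
  rw [modelWronskian]
  field_simp
  ring

include hV

/-- Write W' = V (φ/U) U². The ratio estimate replaces U(t)² by U(s)² with a factor (t/s)^e
e^{-z(s-t)}; integrating the exponential against t^{η-1} gains the decay z^{-η/2}. -/
lemma abs_modelWronskian_sub_le {R : ℝ} (hR : ∀ x ∈ Ioo (0 : ℝ) 1,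
    |φ x / scaledModel m z u x| ≤ R) {s : ℝ} (hs : s ∈ Ioo (0 : ℝ) 1) :
    |modelWronskian m z u du φ dφ s - b| ≤
      R * C * K / (η / 2) * z ^ (-(η / 2)) * s ^ (η / 2 - e) * scaledModel m z u s ^ 2 := by
  have z0 : 0 < z := by linarith
  have hη := hV.eta_pos
  have hη1 := hV.eta_le
  have hR0 : 0 ≤ R := (abs_nonneg _).trans (hR s hs)
  have hK := hV.K_nonneg
  have hC := hu.C_pos
  set θ := η / 2 with hθ
  have θ0 : 0 < θ := by positivity
  set U := scaledModel m z u
  -- All factors depending only on the end point s. The majorant of W - b is c₀ z^{-θ} θ⁻¹ t^θ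
  -- e^{zt}.
  set c₀ := R * C * K * U s ^ 2 * s ^ (-e) * Real.exp (-(z * s)) with hc₀
  have hs0 := hs.1
  have hc₀' : 0 ≤ c₀ := by positivity
  have hg : ∀ t ∈ Ioo (0 : ℝ) 1,
      HasDerivAt (fun t => c₀ * (z ^ (-θ) / θ * (t ^ θ * Real.exp (z * t))))
        (c₀ * (z ^ (-θ) / θ * (θ * t ^ (θ - 1) * Real.exp (z * t) +
          t ^ θ * (Real.exp (z * t) * z)))) t := by
    intro t ht
    have h1 : HasDerivAt (fun t => Real.exp (z * t)) (Real.exp (z * t) * z) t := by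
      have : HasDerivAt (fun t => z * t) z t := by simpa using (hasDerivAt_id t).const_mul z
      exact this.exp
    exact (((Real.hasDerivAt_rpow_const (Or.inl ht.1.ne')).mul h1).const_mul _).const_mul _
  have hg0 : Tendsto (fun t => c₀ * (z ^ (-θ) / θ * (t ^ θ * Real.exp (z * t)))) (𝓝[>] 0)
      (𝓝 0) := by
    have h1 : Tendsto (fun t : ℝ => c₀ * (z ^ (-θ) / θ * (t ^ θ * Real.exp (z * t)))) (𝓝 0)
        (𝓝 (c₀ * (z ^ (-θ) / θ * (0 ^ θ * Real.exp (z * 0))))) := by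
      have h2 : Tendsto (fun t : ℝ => t ^ θ) (𝓝 0) (𝓝 (0 ^ θ)) :=
        (Real.continuousAt_rpow_const 0 θ (Or.inr θ0.le)).tendsto
      have h3 : Tendsto (fun t : ℝ => Real.exp (z * t)) (𝓝 0) (𝓝 (Real.exp (z * 0))) :=
        (by fun_prop : Continuous fun t : ℝ => Real.exp (z * t)).tendsto 0
      exact ((h2.mul h3).const_mul _).const_mul _
    rw [Real.zero_rpow θ0.ne', zero_mul, mul_zero, mul_zero] at h1
    exact h1.mono_left nhdsWithin_le_nhds
  have key := abs_sub_le_of_abs_deriv_le hs (fun t ht => hasDerivAt_modelWronskian hu hz hφ ht) hg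
    (fun t ht => ?_) (tendsto_modelWronskian hu hz hφ) hg0
  · refine key.trans (le_of_eq ?_)
    have e1 : Real.exp (-(z * s)) * Real.exp (z * s) = 1 := by rw [← Real.exp_add]; simp
    have e2 : s ^ (θ - e) = s ^ (-e) * s ^ θ := by rw [← Real.rpow_add hs0]; ring_nf
    rw [hc₀, e2]
    linear_combination (R * C * K * U s ^ 2 * s ^ (-e) * (z ^ (-θ) / θ) * s ^ θ) * e1
  · have ht1 : t ∈ Ioo (0 : ℝ) 1 := ⟨ht.1, ht.2.trans_lt hs.2⟩
    have t0 := ht.1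
    have hUt : 0 < U t := hu.scaled_pos z0 t0
    have b1 : |V t * φ t * U t| ≤ K * t ^ (-1 - e + η) * R * U t ^ 2 := by
      have : V t * φ t * U t = V t * (φ t / U t) * U t ^ 2 := by field_simp
      rw [this, abs_mul, abs_mul, abs_of_pos (by positivity : 0 < U t ^ 2)]
      have := hV.bound t ht1
      have := hR t ht1
      gcongr
    have b2 := hu.scaled_ratio_le z0 t0 ht.2
    have b3 : K * t ^ (-1 - e + η) * R * U t ^ 2 ≤ c₀ * (t ^ (η - 1) * Real.exp (z * t)) := by
      calc K * t ^ (-1 - e + η) * R * U t ^ 2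
          ≤ K * t ^ (-1 - e + η) * R * (C * (t / s) ^ e * Real.exp (-(z * (s - t))) * U s ^ 2) := by
            gcongr
        _ = c₀ * (t ^ (η - 1) * Real.exp (z * t)) := by
            have e1 : Real.exp (-(z * (s - t))) = Real.exp (-(z * s)) * Real.exp (z * t) := by
              rw [← Real.exp_add]; ring_nf
            have e2 : t ^ (η - 1) = t ^ (-1 - e + η) * t ^ e := by
              rw [← Real.rpow_add t0]; ring_nf
            rw [hc₀, e1, e2, Real.div_rpow t0.le hs0.le, Real.rpow_neg hs0.le]
            field_simp
    refine b1.trans (b3.trans (mul_le_mul_of_nonneg_left ?_ hc₀'))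
    -- What is needed is θ(zt)^θ ≤ θ + zt. Half of the exponent η is spent on the decay z^{-θ}, the
    -- other half keeps the majorant zero at t = 0.
    have hτ := rpow_le_one_add (mul_pos z0 t0) θ0.le (by linarith : θ ≤ 1)
    have e3 : t ^ (η - 1) = t ^ (θ - 1) * t ^ θ := by
      rw [← Real.rpow_add t0]; congr 1; rw [hθ]; ring
    have e4 : t ^ θ = t ^ (θ - 1) * t := by rw [Real.rpow_sub_one t0.ne']; field_simp
    rw [Real.mul_rpow z0.le t0.le] at hτ
    have hzθ : 0 < z ^ θ := Real.rpow_pos_of_pos z0 θ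
    have h5 : t ^ θ ≤ z ^ (-θ) / θ * (θ + z * t) := by
      rw [Real.rpow_neg z0.le, div_mul_eq_mul_div, le_div_iff₀ θ0, inv_mul_eq_div,
        le_div_iff₀ hzθ]
      have : θ ≤ 1 := by linarith
      calc t ^ θ * θ * z ^ θ = θ * (z ^ θ * t ^ θ) := by ring
        _ ≤ θ * (1 + z * t) := by gcongr
        _ ≤ _ := by nlinarith [mul_pos z0 t0]
    calc t ^ (η - 1) * Real.exp (z * t) = t ^ (θ - 1) * Real.exp (z * t) * t ^ θ := by
          rw [e3]; ring
      _ ≤ t ^ (θ - 1) * Real.exp (z * t) * (z ^ (-θ) / θ * (θ + z * t)) := by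
          have : 0 < t ^ (θ - 1) := Real.rpow_pos_of_pos t0 _
          gcongr
      _ = _ := by rw [e4]; ring

/-- The quotient ρ = φ/U satisfies ρ' = W/U² and tends to 1 at 0. The Wronskian estimate bounds ρ'
by |b|C e^{-zt} + A t^{η/2-e}, integrable since e < 1; the two integrals are O(1/z) and O(z^{-η/2}).
-/
lemma abs_ratio_sub_one_le (he : e = 0 ∨ b = 0) (hbm : b * m = 0) {R : ℝ}
    (hR : ∀ x ∈ Ioo (0 : ℝ) 1, |φ x / scaledModel m z u x| ≤ R) {s : ℝ}
    (hs : s ∈ Ioo (0 : ℝ) 1) :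
    |φ s / scaledModel m z u s - 1| ≤
      (|b| * C + R * (C * K / (η / 2) / (1 - e))) * z ^ (-(η / 2)) := by
  have z0 : 0 < z := by linarith
  have hη := hV.eta_pos
  have hη1 := hV.eta_le
  have he1 := hV.e_lt_one
  have hR0 : 0 ≤ R := (abs_nonneg _).trans (hR s hs)
  have hK := hV.K_nonneg
  have hC := hu.C_pos
  set θ := η / 2 with hθ
  have θ0 : 0 < θ := by positivity
  set U := scaledModel m z u
  set A := R * C * K / θ * z ^ (-θ)
  have hA : 0 ≤ A := by positivity
  have hUpos : ∀ x, 0 < x → 0 < U x := fun x hx => hu.scaled_pos z0 hx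
  have hq : 0 < θ - e + 1 := by linarith
  have hρ : ∀ t ∈ Ioo (0 : ℝ) 1, HasDerivAt (fun x => φ x / U x)
      (modelWronskian m z u du φ dφ t / U t ^ 2) t := fun t ht => by
    refine ((hφ.hasDerivAt t ht).div (hu.scaled_hasDerivAt z0 ht.1)
      (hUpos t ht.1).ne').congr_deriv ?_
    rw [modelWronskian]; ring
  have hg : ∀ t ∈ Ioo (0 : ℝ) 1,
      HasDerivAt (fun t => |b| * C / z * (1 - Real.exp (-(z * t))) +
        A / (θ - e + 1) * t ^ (θ - e + 1))
        (|b| * C * Real.exp (-(z * t)) + A * t ^ (θ - e)) t := by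
    intro t ht
    have h1 : HasDerivAt (fun t => Real.exp (-(z * t))) (Real.exp (-(z * t)) * (-z)) t := by
      have : HasDerivAt (fun t => -(z * t)) (-z) t := by
        exact ((hasDerivAt_id t).const_mul z).neg.congr_deriv (by simp)
      exact this.exp
    refine (((h1.const_sub 1).const_mul (|b| * C / z)).add
      ((Real.hasDerivAt_rpow_const (p := θ - e + 1) (Or.inl ht.1.ne')).const_mul
        (A / (θ - e + 1)))).congr_deriv ?_
    rw [add_sub_cancel_right]
    field_simp
  have hg0 : Tendsto (fun t => |b| * C / z * (1 - Real.exp (-(z * t))) +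
        A / (θ - e + 1) * t ^ (θ - e + 1)) (𝓝[>] 0) (𝓝 0) := by
    have h2 : Tendsto (fun t : ℝ => t ^ (θ - e + 1)) (𝓝 0) (𝓝 (0 ^ (θ - e + 1))) :=
      (Real.continuousAt_rpow_const 0 _ (Or.inr hq.le)).tendsto
    have h3 : Tendsto (fun t : ℝ => |b| * C / z * (1 - Real.exp (-(z * t)))) (𝓝 0)
        (𝓝 (|b| * C / z * (1 - Real.exp (-(z * 0))))) :=
      (by fun_prop : Continuous fun t : ℝ => |b| * C / z * (1 - Real.exp (-(z * t)))).tendsto 0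
    have h4 := h3.add (h2.const_mul (A / (θ - e + 1)))
    rw [Real.zero_rpow hq.ne'] at h4
    simp only [mul_zero, neg_zero, Real.exp_zero, sub_self, add_zero] at h4
    exact h4.mono_left nhdsWithin_le_nhds
  have hρ0 : Tendsto (fun x => φ x / U x) (𝓝[>] 0) (𝓝 1) := by
    have := hφ.left.div (hu.scaled_left z0) one_ne_zero
    rw [div_one] at this
    refine this.congr' ?_
    filter_upwards [self_mem_nhdsWithin] with x hx
    have x0 : 0 < x := hx
    have h1 : x ^ m ≠ 0 := (Real.rpow_pos_of_pos x0 m).ne'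
    simp only [Pi.div_apply]
    rw [div_div_div_cancel_right₀ h1]
  have key := abs_sub_le_of_abs_deriv_le hs hρ hg (fun t ht => ?_) hρ0 hg0
  · refine key.trans ?_
    have c1 : |b| * C / z * (1 - Real.exp (-(z * s))) ≤ |b| * C * z ^ (-θ) := by
      have h1 : z⁻¹ ≤ z ^ (-θ) := by
        rw [← Real.rpow_neg_one]
        exact Real.rpow_le_rpow_of_exponent_le hz (by linarith)
      have h2 : 1 - Real.exp (-(z * s)) ≤ 1 := by linarith [Real.exp_pos (-(z * s))]
      calc |b| * C / z * (1 - Real.exp (-(z * s))) ≤ |b| * C / z * 1 := by gcongr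
        _ = |b| * C * z⁻¹ := by ring
        _ ≤ _ := by gcongr
    have c2 : A / (θ - e + 1) * s ^ (θ - e + 1) ≤ R * (C * K / θ / (1 - e)) * z ^ (-θ) := by
      have h1 : s ^ (θ - e + 1) ≤ 1 := Real.rpow_le_one hs.1.le hs.2.le hq.le
      have h2 : 0 < 1 - e := by linarith
      have h3 : 0 ≤ s ^ (θ - e + 1) := Real.rpow_nonneg hs.1.le _
      calc A / (θ - e + 1) * s ^ (θ - e + 1) ≤ A / (1 - e) * 1 := by
            gcongr
            linarith
        _ = _ := by simp only [A]; ring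
    linarith
  · have ht1 : t ∈ Ioo (0 : ℝ) 1 := ⟨ht.1, ht.2.trans_lt hs.2⟩
    have hUt := hUpos t ht.1
    have h1 := abs_modelWronskian_sub_le hu hV hz hφ hR ht1
    have h2 := hu.div_scaled_sq_le he hbm z0 ht.1
    have h3 : |modelWronskian m z u du φ dφ t| ≤ |b| + A * t ^ (θ - e) * U t ^ 2 := by
      have := abs_sub_abs_le_abs_sub (modelWronskian m z u du φ dφ t) b
      have h4 : A * t ^ (θ - e) * U t ^ 2 =
        R * C * K / (η / 2) * z ^ (-(η / 2)) * t ^ (η / 2 - e) * U t ^ 2 := by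
          simp only [A, hθ]
      linarith
    rw [abs_div, abs_of_pos (by positivity : 0 < U t ^ 2)]
    calc _ ≤ (|b| + A * t ^ (θ - e) * U t ^ 2) / U t ^ 2 := by gcongr
      _ = |b| / U t ^ 2 + A * t ^ (θ - e) := by field_simp
      _ ≤ _ := by gcongr

end Comparison

end

/-! ### Boundary values at 1 of the regular solution for large spectral parameter. -/

section

lemma abs_log_le_two_mul {x : ℝ} (hx : |x - 1| ≤ 1 / 2) : |Real.log x| ≤ 2 * |x - 1| := by
  have h := abs_le.1 hx
  have x0 : 0 < x := by linarith
  have h1 := Real.log_le_sub_one_of_pos x0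
  have h2 := Real.one_sub_inv_le_log_of_pos x0
  have h3 : |1 - x⁻¹| ≤ 2 * |x - 1| := by
    have : 1 - x⁻¹ = (x - 1) / x := by field_simp
    rw [this, abs_div, abs_of_pos x0, div_le_iff₀ x0]
    nlinarith [abs_nonneg (x - 1)]
  have := (abs_le.1 h3).1
  have := le_abs_self (x - 1)
  have := abs_nonneg (x - 1)
  rw [abs_le]; constructor <;> linarith

lemma inv_le_rpow_neg {z θ : ℝ} (hz : 1 ≤ z) (hθ : θ ≤ 1) : z⁻¹ ≤ z ^ (-θ) := by
  rw [← Real.rpow_neg_one]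
  exact Real.rpow_le_rpow_of_exponent_le hz (by linarith)

variable {m e η K b C L z φ₁ d₁ : ℝ} {V u du φ dφ : ℝ → ℝ}

/-- A bootstrap: the supremum S of |φ/U| is finite because the quotient has limits at both ends, and
the previous estimate with R = S bounds S by 1 plus a small multiple of itself. -/
lemma abs_ratio_sub_one_le_of_large (hu : IsModel m e C L u du) (hV : IsPerturbation m e η K V)
    (hz : 1 ≤ z)
    (hφ : IsRegularSolution m b (fun x => m * (m - 1) / x ^ 2 + (V x + z ^ 2)) φ dφ φ₁ d₁)
    (he : e = 0 ∨ b = 0) (hbm : b * m = 0)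
    (hlarge : (|b| * C + C * K / (η / 2) / (1 - e)) * z ^ (-(η / 2)) ≤ 1 / 4) :
    ∀ x ∈ Ioo (0 : ℝ) 1, |φ x / scaledModel m z u x| ≤ 2 := by
  have z0 : 0 < z := by linarith
  have hη := hV.eta_pos
  have he1 := hV.e_lt_one
  have hK := hV.K_nonneg
  have hC := hu.C_pos
  have hB1 : 0 ≤ |b| * C := by positivity
  have hB2 : 0 ≤ C * K / (η / 2) / (1 - e) := div_nonneg (by positivity) (by linarith)
  have hp : 0 ≤ z ^ (-(η / 2)) := Real.rpow_nonneg z0.le _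
  set ρ := fun x => φ x / scaledModel m z u x
  have hU1 := hu.scaled_pos z0 one_pos
  have hUc : ∀ x, 0 < x → ContinuousAt (scaledModel m z u) x :=
    fun x hx => (hu.scaled_hasDerivAt z0 hx).continuousAt
  have hρc : ContinuousOn ρ (Ioo 0 1) := fun x hx =>
    ((hφ.hasDerivAt x hx).continuousAt.div (hUc x hx.1)
      (hu.scaled_pos z0 hx.1).ne').continuousWithinAt
  have hρ0 : Tendsto ρ (𝓝[>] 0) (𝓝 (1 / 1)) := by
    refine (hφ.left.div (hu.scaled_left z0) one_ne_zero).congr' ?_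
    filter_upwards [self_mem_nhdsWithin] with x hx
    have h1 : x ^ m ≠ 0 := (Real.rpow_pos_of_pos hx m).ne'
    simp only [Pi.div_apply, ρ]
    rw [div_div_div_cancel_right₀ h1]
  have hρ1 : Tendsto ρ (𝓝[<] 1) (𝓝 (φ₁ / scaledModel m z u 1)) :=
    hφ.right.div ((hUc 1 one_pos).tendsto.mono_left nhdsWithin_le_nhds) hU1.ne'
  obtain ⟨R₀, hR₀⟩ := exists_bound_of_tendsto hρc hρ0 hρ1
  set S := sSup ((fun x => |ρ x|) '' Ioo 0 1)
  have hbdd : BddAbove ((fun x => |ρ x|) '' Ioo 0 1) := ⟨R₀, by rintro _ ⟨x, hx, rfl⟩; exact hR₀ x hx⟩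
  have hS : ∀ x ∈ Ioo (0 : ℝ) 1, |ρ x| ≤ S := fun x hx => le_csSup hbdd ⟨x, hx, rfl⟩
  have hS0 : 0 ≤ S := (abs_nonneg _).trans (hS (1 / 2) ⟨by norm_num, by norm_num⟩)
  have hSle : S ≤ 1 + (|b| * C + S * (C * K / (η / 2) / (1 - e))) * z ^ (-(η / 2)) := by
    refine csSup_le ⟨_, ⟨1 / 2, ⟨by norm_num, by norm_num⟩, rfl⟩⟩ ?_
    rintro _ ⟨x, hx, rfl⟩
    have := abs_ratio_sub_one_le hu hV hz hφ he hbm hS hx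
    have h2 := abs_sub_abs_le_abs_sub (ρ x) 1
    rw [abs_one] at h2
    simp only
    linarith
  -- If S exceeded 2, hence 1, the estimate would give S ≤ 1 + S/4.
  have hS2 : S ≤ 2 := by
    by_contra! h
    have h1 : (|b| * C + S * (C * K / (η / 2) / (1 - e))) * z ^ (-(η / 2)) ≤
        S * ((|b| * C + C * K / (η / 2) / (1 - e)) * z ^ (-(η / 2))) := by
      linarith [mul_nonneg (mul_nonneg (by linarith : 0 ≤ S - 1) hB1) hp]
    nlinarith
  exact fun x hx => (hS x hx).trans hS2

/-- Asymptotics of the boundary values at `1` of the regular solution. The constant `L` depends only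
on the leading singularity and the type of the boundary condition at `0`. -/
theorem exists_regular_asymptotics (hV : IsPerturbation m e η K V) (he : e = 0 ∨ b = 0)
    (hbm : b * m = 0) : ∃ L M z₀ : ℝ, 0 < M ∧ 1 ≤ z₀ ∧ ∀ z, z₀ ≤ z → ∀ φ dφ φ₁ d₁,
      IsRegularSolution m b (fun x => m * (m - 1) / x ^ 2 + (V x + z ^ 2)) φ dφ φ₁ d₁ →
      (∀ x ∈ Ioo (0 : ℝ) 1, 0 < φ x) ∧ 0 < φ₁ ∧
      |Real.log φ₁ - (z - m * Real.log z + L)| ≤ M * z ^ (-(η / 2)) ∧ |d₁ / φ₁ - z| ≤ M := by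
  obtain ⟨C, L, u, du, hu⟩ := exists_isModel hV.e_le hV.e_nonneg hV.e_lt_one
  have hη := hV.eta_pos
  have hη1 := hV.eta_le
  have he1 := hV.e_lt_one
  have hK := hV.K_nonneg
  have hC := hu.C_pos
  set B1 := |b| * C with hB1d
  set B2 := C * K / (η / 2) / (1 - e) with hB2d
  have hB1 : 0 ≤ B1 := by positivity
  have hB2 : 0 ≤ B2 := div_nonneg (by positivity) (by linarith)
  set B3 := 2 * C * K / (η / 2) with hB3d
  have hB3 : 0 ≤ B3 := by positivity
  have hlim : Tendsto (fun z : ℝ => (B1 + B2) * z ^ (-(η / 2))) atTop (𝓝 ((B1 + B2) * 0)) :=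
    (tendsto_rpow_neg_atTop (by positivity)).const_mul _
  rw [mul_zero] at hlim
  obtain ⟨z₀, hz₀⟩ := eventually_atTop.1 (hlim.eventually (gt_mem_nhds (by norm_num : (0 : ℝ) < 1 / 4)))
  -- One constant for both errors: 2(B1 + 2 B2) + C is needed for the logarithm, 2(B1 + B3) + C for
  -- the logarithmic derivative.
  refine ⟨L, 2 * (B1 + 2 * B2) + C + 2 * (B1 + B3), max z₀ 4, by positivity,
    (by norm_num : (1 : ℝ) ≤ 4).trans (le_max_right _ _), fun z hzz φ dφ φ₁ d₁ hφ => ?_⟩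
  have hz4 : 4 ≤ z := (le_max_right _ _).trans hzz
  have hz : 1 ≤ z := by linarith
  have z0 : 0 < z := by linarith
  have hlarge := (hz₀ z ((le_max_left _ _).trans hzz)).le
  have hR := abs_ratio_sub_one_le_of_large hu hV hz hφ he hbm hlarge
  have hp : 0 < z ^ (-(η / 2)) := Real.rpow_pos_of_pos z0 _
  have hp1 : z ^ (-(η / 2)) ≤ 1 := Real.rpow_le_one_of_one_le_of_nonpos hz (by linarith)
  have hr : ∀ s ∈ Ioo (0 : ℝ) 1,
      |φ s / scaledModel m z u s - 1| ≤ (B1 + 2 * B2) * z ^ (-(η / 2)) := fun s hs =>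
    abs_ratio_sub_one_le hu hV hz hφ he hbm hR hs
  have hhalf : (B1 + 2 * B2) * z ^ (-(η / 2)) ≤ 1 / 2 := by nlinarith
  have hpos : ∀ x ∈ Ioo (0 : ℝ) 1, 0 < φ x := fun x hx => by
    have h1 := (abs_le.1 ((hr x hx).trans hhalf)).1
    have h2 := hu.scaled_pos z0 hx.1
    have h3 : 0 < φ x / scaledModel m z u x := by linarith
    exact (div_pos_iff_of_pos_right h2).1 h3
  have hU1 := hu.scaled_pos z0 one_pos
  have hUt : Tendsto (scaledModel m z u) (𝓝[<] 1) (𝓝 (scaledModel m z u 1)) :=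
    (hu.scaled_hasDerivAt z0 one_pos).continuousAt.tendsto.mono_left nhdsWithin_le_nhds
  have hdUt : Tendsto (dscaledModel m z du) (𝓝[<] 1) (𝓝 (dscaledModel m z du 1)) :=
    (hu.scaled_hasDerivAt' z0 one_pos).continuousAt.tendsto.mono_left nhdsWithin_le_nhds
  set ρ₁ := φ₁ / scaledModel m z u 1 with hρ₁d
  have hρ₁ : |ρ₁ - 1| ≤ (B1 + 2 * B2) * z ^ (-(η / 2)) := by
    refine le_of_tendsto (((hφ.right.div hUt hU1.ne').sub_const 1).abs) ?_
    filter_upwards [eventually_right] with x hx using hr x hx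
  have hρhalf := hρ₁.trans hhalf
  have hρpos : 1 / 2 ≤ ρ₁ := by linarith [(abs_le.1 hρhalf).1]
  have hφ₁ : φ₁ = scaledModel m z u 1 * ρ₁ := by rw [hρ₁d]; field_simp
  have hφ₁pos : 0 < φ₁ := by rw [hφ₁]; exact mul_pos hU1 (by linarith)
  have huz := hu.pos z z0
  have hC3 : C * z⁻¹ ≤ C * z ^ (-(η / 2)) :=
    mul_le_mul_of_nonneg_left (inv_le_rpow_neg hz (by linarith)) hC.le
  refine ⟨hpos, hφ₁pos, ?_, ?_⟩
  · have e1 : Real.log φ₁ = -(m * Real.log z) + Real.log (u z) + Real.log ρ₁ := by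
      rw [hφ₁, Real.log_mul hU1.ne' (by linarith), scaledModel, mul_one,
        Real.log_mul (Real.rpow_pos_of_pos z0 _).ne' huz.ne', Real.log_rpow z0]
      ring
    have h1 := hu.log_le z hz4
    have h2 := abs_log_le_two_mul hρhalf
    have e2 : Real.log φ₁ - (z - m * Real.log z + L) =
        (Real.log (u z) - z - L) + Real.log ρ₁ := by rw [e1]; ring
    rw [e2]
    rw [div_eq_mul_inv] at h1
    have h3 : 0 ≤ 2 * (B1 + B3) * z ^ (-(η / 2)) := by positivity
    refine (abs_add_le _ _).trans ?_
    linarith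
  · have hlimW : Tendsto (fun s => |modelWronskian m z u du φ dφ s - b|) (𝓝[<] 1)
        (𝓝 |scaledModel m z u 1 * d₁ - dscaledModel m z du 1 * φ₁ - b|) :=
      (((hUt.mul hφ.right').sub (hdUt.mul hφ.right)).sub_const b).abs
    have hlimB : Tendsto (fun s : ℝ => 2 * C * K / (η / 2) * z ^ (-(η / 2)) * s ^ (η / 2 - e) *
        scaledModel m z u s ^ 2) (𝓝[<] 1)
        (𝓝 (2 * C * K / (η / 2) * z ^ (-(η / 2)) * 1 ^ (η / 2 - e) *
          scaledModel m z u 1 ^ 2)) := by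
      have : Tendsto (fun s : ℝ => s ^ (η / 2 - e)) (𝓝[<] 1) (𝓝 (1 ^ (η / 2 - e))) :=
        (Real.continuousAt_rpow_const 1 _ (Or.inl one_ne_zero)).tendsto.mono_left
          nhdsWithin_le_nhds
      exact (this.const_mul _).mul (hUt.pow 2)
    have h1 := le_of_tendsto_of_tendsto hlimW hlimB (by
      filter_upwards [eventually_right] with s hs
      exact abs_modelWronskian_sub_le hu hV hz hφ hR hs)
    rw [Real.one_rpow, mul_one] at h1
    have h2 := hu.div_scaled_sq_le he hbm z0 one_pos
    have h3 : |b| / scaledModel m z u 1 ^ 2 ≤ B1 := by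
      refine h2.trans (mul_le_of_le_one_right hB1 ?_)
      rw [Real.exp_le_one_iff]; linarith
    have h4 : |b| ≤ B1 * scaledModel m z u 1 ^ 2 := by rwa [div_le_iff₀ (by positivity)] at h3
    have h5 : |scaledModel m z u 1 * d₁ - dscaledModel m z du 1 * φ₁| ≤
        (B1 + B3) * scaledModel m z u 1 ^ 2 := by
      have h6 := abs_sub_abs_le_abs_sub
        (scaledModel m z u 1 * d₁ - dscaledModel m z du 1 * φ₁) b
      have h7 : 2 * C * K / (η / 2) * z ^ (-(η / 2)) * scaledModel m z u 1 ^ 2 ≤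
          B3 * scaledModel m z u 1 ^ 2 := by
        gcongr
        exact mul_le_of_le_one_right hB3 hp1
      linarith
    -- The logarithmic derivative of φ is that of U plus the Wronskian divided by U φ; at 1 the
    -- former equals z u'(z)/u(z).
    have e1 : d₁ / φ₁ - z = (scaledModel m z u 1 * d₁ - dscaledModel m z du 1 * φ₁) /
        (scaledModel m z u 1 ^ 2 * ρ₁) + z * ((du z - u z) / u z) := by
      have e2 : scaledModel m z u 1 ^ 2 * ρ₁ = scaledModel m z u 1 * φ₁ := by rw [hφ₁]; ring
      have e3 : dscaledModel m z du 1 = z * du z / u z * scaledModel m z u 1 := by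
        rw [dscaledModel, scaledModel, mul_one]; field_simp
      rw [e2, e3]
      field_simp
      ring
    have h8 : |(scaledModel m z u 1 * d₁ - dscaledModel m z du 1 * φ₁) /
        (scaledModel m z u 1 ^ 2 * ρ₁)| ≤ 2 * (B1 + B3) := by
      have h9 : 0 < scaledModel m z u 1 ^ 2 * ρ₁ := mul_pos (by positivity) (by linarith)
      rw [abs_div, abs_of_pos h9, div_le_iff₀ h9]
      calc _ ≤ _ := h5
        _ = 2 * (B1 + B3) * (scaledModel m z u 1 ^ 2 * (1 / 2)) := by ring
        _ ≤ _ := by gcongr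
    have h10 : |z * ((du z - u z) / u z)| ≤ C := by
      have h11 := hu.deriv_le z hz4
      rw [abs_mul, abs_div, abs_of_pos huz, abs_of_pos z0]
      calc z * (|du z - u z| / u z) ≤ z * (C * u z / z ^ 2 / u z) := by gcongr
        _ = C / z := by field_simp
        _ ≤ C := div_le_self hC.le hz
    rw [e1]
    refine (abs_add_le _ _).trans ?_
    linarith

/-- From the boundary values of the regular solution to the characteristic function. -/
lemma log_char_asymptotics {θ M a : ℝ} (hθ1 : θ ≤ 1) (hM : 0 < M)
    (hz : 1 ≤ z) (hza : 2 * (M + |a|) ≤ z) (hφ₁ : 0 < φ₁)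
    (h1 : |Real.log φ₁ - (z - m * Real.log z + L)| ≤ M * z ^ (-θ)) (h2 : |d₁ / φ₁ - z| ≤ M) :
    0 < d₁ + a * φ₁ ∧ |Real.log (d₁ + a * φ₁) - (z + (1 - m) * Real.log z + L)| ≤
      (M + 2 * (M + |a|)) * z ^ (-θ) := by
  have z0 : 0 < z := by linarith
  set X := (d₁ / φ₁ + a) / z with hX
  have hX1 : |X - 1| ≤ (M + |a|) * z⁻¹ := by
    have : X - 1 = ((d₁ / φ₁ - z) + a) * z⁻¹ := by rw [hX]; field_simp; ring
    rw [this, abs_mul, abs_of_pos (inv_pos.2 z0)]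
    gcongr
    exact (abs_add_le _ _).trans (by linarith)
  have hX2 : |X - 1| ≤ 1 / 2 := by
    refine hX1.trans ?_
    rw [← div_eq_mul_inv, div_le_iff₀ z0]; linarith
  have hXpos : 0 < X := by linarith [(abs_le.1 hX2).1]
  have e1 : d₁ + a * φ₁ = φ₁ * (z * X) := by rw [hX]; field_simp
  have h3 := abs_log_le_two_mul hX2
  have h4 := mul_le_mul_of_nonneg_left (inv_le_rpow_neg hz hθ1) (by positivity : 0 ≤ M + |a|)
  refine ⟨by rw [e1]; positivity, ?_⟩
  have e2 : Real.log (d₁ + a * φ₁) - (z + (1 - m) * Real.log z + L) =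
      (Real.log φ₁ - (z - m * Real.log z + L)) + Real.log X := by
    rw [e1, Real.log_mul hφ₁.ne' (by positivity), Real.log_mul z0.ne' hXpos.ne']; ring
  rw [e2]
  refine (abs_add_le _ _).trans ?_
  linarith

end

section

open Asymptotics

/-! ### The zeta function of a sequence and its regularized characteristic function -/

lemma hasMellin_cpow_Ioi (a : ℂ) {s : ℂ} (hs : s.re + a.re < 0) :
    HasMellin (indicator (Ioi 1) (fun t : ℝ => (t : ℂ) ^ a)) s (-1 / (s + a)) := by
  have h1 : (s - 1 + a).re < -1 := by simp; linarith
  have key : ∀ t ∈ Ioi (0 : ℝ), (t : ℂ) ^ (s - 1) • (indicator (Ioi 1) (fun t : ℝ => (t : ℂ) ^ a)) t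
      = indicator (Ioi 1) (fun t : ℝ => (t : ℂ) ^ (s - 1 + a)) t := by
    intro t (ht : 0 < t)
    by_cases h : t ∈ Ioi (1 : ℝ)
    · rw [indicator_of_mem h, indicator_of_mem h, smul_eq_mul,
        ← Complex.cpow_add _ _ (by exact_mod_cast ht.ne')]
    · rw [indicator_of_notMem h, indicator_of_notMem h, smul_zero]
  have hsub : Ioi (1 : ℝ) ⊆ Ioi 0 := Ioi_subset_Ioi zero_le_one
  constructor
  · rw [MellinConvergent, integrableOn_congr_fun key measurableSet_Ioi, IntegrableOn,
      integrable_indicator_iff measurableSet_Ioi, IntegrableOn,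
      Measure.restrict_restrict_of_subset hsub]
    exact integrableOn_Ioi_cpow_of_lt h1 one_pos
  · rw [mellin, setIntegral_congr_fun measurableSet_Ioi key, integral_indicator measurableSet_Ioi,
      Measure.restrict_restrict_of_subset hsub, integral_Ioi_cpow_of_lt h1 one_pos]
    simp only [Complex.ofReal_one, Complex.one_cpow]
    congr 1; ring

lemma hasMellin_one_Ioi {s : ℂ} (hs : s.re < 0) :
    HasMellin (indicator (Ioi 1) (fun _ : ℝ => (1 : ℂ))) s (-1 / s) := by
  simpa using hasMellin_cpow_Ioi 0 (s := s) (by simpa using hs)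

/-- A logarithmic factor under the Mellin integral is differentiation in s, so the transform is the
derivative of -1/s. -/
lemma hasMellin_log_Ioi {s : ℂ} (hs : s.re < 0) :
    HasMellin (fun t : ℝ => Real.log t • indicator (Ioi 1) (fun _ : ℝ => (1 : ℂ)) t) s
      (1 / s ^ 2) := by
  have hs0 : s ≠ 0 := by rintro rfl; simp at hs
  -- The function vanishes near 0, so any exponent below Re s will do there.
  have h := mellin_hasDerivAt_of_isBigO_rpow (a := 0) (b := s.re - 1) (s := s)
    (f := indicator (Ioi 1) (fun _ : ℝ => (1 : ℂ)))
    ((continuous_const.locallyIntegrable.indicator measurableSet_Ioi).locallyIntegrableOn _)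
    (by
      refine IsBigO.of_bound 1 ?_
      filter_upwards [eventually_gt_atTop 1] with t ht
      simp [indicator_of_mem (show t ∈ Ioi (1 : ℝ) from ht)])
    (by simpa using hs)
    (by
      refine IsBigO.of_bound 1 ?_
      filter_upwards [Ioo_mem_nhdsGT (one_pos : (0 : ℝ) < 1)] with t ht
      rw [indicator_of_notMem (by simpa using ht.2.le)]
      simp)
    (by linarith)
  refine ⟨h.1, h.2.unique ?_⟩
  have h2 : HasDerivAt (fun w : ℂ => -1 / w) (1 / s ^ 2) s := by
    have := (hasDerivAt_inv hs0).neg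
    refine (this.congr_deriv (by simp)).congr_of_eventuallyEq ?_
    exact Eventually.of_forall fun w => by simp [neg_div]
  refine h2.congr_of_eventuallyEq ?_
  filter_upwards [(isOpen_lt Complex.continuous_re continuous_const).mem_nhds hs] with w hw
  exact (hasMellin_one_Ioi hw).2

lemma log_one_add_nonneg {t : ℝ} (ht : 0 ≤ t) : 0 ≤ Real.log (1 + t) :=
  Real.log_nonneg (by linarith)

lemma log_one_add_le {t : ℝ} (ht : 0 ≤ t) : Real.log (1 + t) ≤ t := by
  have := Real.log_le_sub_one_of_pos (show 0 < 1 + t by linarith)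
  linarith

lemma abs_log_one_add_sub_log_le {t : ℝ} (ht : 0 < t) : |Real.log (1 + t) - Real.log t| ≤ t⁻¹ := by
  have h : Real.log (1 + t) - Real.log t = Real.log (1 + t⁻¹) := by
    rw [← Real.log_div (by positivity) ht.ne']; congr 1; field_simp; ring
  have h0 : 0 ≤ t⁻¹ := by positivity
  rw [h, abs_of_nonneg (log_one_add_nonneg h0)]
  exact log_one_add_le h0

/-- `log (1 + t)` without its logarithmic growth at infinity. -/
def logRemainder (t : ℝ) : ℂ :=
  (Real.log (1 + t) : ℂ) - Real.log t • indicator (Ioi 1) (fun _ : ℝ => (1 : ℂ)) t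

lemma continuousOn_log_one_add : ContinuousOn (fun t : ℝ => Real.log (1 + t)) (Ici 0) := by
  refine ContinuousOn.log (by fun_prop) fun t (ht : 0 ≤ t) => by linarith

lemma locallyIntegrableOn_logRemainder : LocallyIntegrableOn logRemainder (Ioi 0) := by
  refine LocallyIntegrableOn.sub ?_ ?_
  · refine ContinuousOn.locallyIntegrableOn ?_ measurableSet_Ioi
    exact Complex.continuous_ofReal.comp_continuousOn
      (continuousOn_log_one_add.mono Ioi_subset_Ici_self)
  · refine (LocallyIntegrableOn.continuousOn_smul ?_ ?_ ?_)
    · exact isOpen_Ioi.isLocallyClosed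
    · exact (continuous_const.locallyIntegrable.indicator measurableSet_Ioi).locallyIntegrableOn _
    · exact Real.continuousOn_log.mono fun t (ht : 0 < t) => ht.ne'

lemma logRemainder_isBigO_top : logRemainder =O[atTop] (fun t : ℝ => t ^ (-(1 : ℝ))) := by
  refine IsBigO.of_bound 1 ?_
  filter_upwards [eventually_gt_atTop 1] with t ht
  have h0 : 0 < t := by linarith
  rw [logRemainder, indicator_of_mem (show t ∈ Ioi (1 : ℝ) from ht), Complex.real_smul, mul_one,
    ← Complex.ofReal_sub, Complex.norm_real, Real.norm_eq_abs, one_mul, Real.rpow_neg_one,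
    Real.norm_eq_abs, abs_of_pos (inv_pos.2 h0)]
  exact abs_log_one_add_sub_log_le h0

lemma logRemainder_isBigO_zero : logRemainder =O[𝓝[>] 0] (fun t : ℝ => t ^ (-(-1 : ℝ))) := by
  refine IsBigO.of_bound 1 ?_
  filter_upwards [Ioo_mem_nhdsGT (one_pos : (0 : ℝ) < 1)] with t ht
  rw [logRemainder, indicator_of_notMem (by simpa using ht.2.le), smul_zero, sub_zero,
    Complex.norm_real, Real.norm_eq_abs, abs_of_nonneg (log_one_add_nonneg ht.1.le), neg_neg,
    Real.rpow_one, one_mul, Real.norm_eq_abs, abs_of_pos ht.1]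
  exact log_one_add_le ht.1.le

lemma differentiableAt_mellin_logRemainder {s : ℂ} (h1 : -1 < s.re) (h2 : s.re < 1) :
    DifferentiableAt ℂ (fun s => mellin logRemainder (-s)) s := by
  have := mellin_differentiableAt_of_isBigO_rpow (s := -s) locallyIntegrableOn_logRemainder
    logRemainder_isBigO_top (by simp; linarith) logRemainder_isBigO_zero (by simp; linarith)
  exact DifferentiableAt.fun_comp' s this differentiableAt_id.neg

/-- The integral converges only for 0 < Re s < 1, but the right-hand side is defined for -1 < Re s
and exhibits the double pole at 0. -/
lemma hasMellin_log_one_add {s : ℂ} (h1 : 0 < s.re) (h2 : s.re < 1) :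
    HasMellin (fun t : ℝ => (Real.log (1 + t) : ℂ)) (-s) (mellin logRemainder (-s) + 1 / s ^ 2) := by
  have A := mellinConvergent_of_isBigO_rpow (s := -s) locallyIntegrableOn_logRemainder
    logRemainder_isBigO_top (by simp; linarith) logRemainder_isBigO_zero (by simp; linarith)
  have B := hasMellin_log_Ioi (s := -s) (by simpa using h1)
  have := hasMellin_add A B.1
  rw [B.2] at this
  simpa [logRemainder] using this

/-- `s²` times the Mellin transform of `log (1 + t)` at `-s`. -/
def mellinDenom (s : ℂ) : ℂ := 1 + s ^ 2 * mellin logRemainder (-s)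

lemma mellinDenom_zero : mellinDenom 0 = 1 := by simp [mellinDenom]

lemma analyticOnNhd_mellinDenom : AnalyticOnNhd ℂ mellinDenom {s | -1 < s.re ∧ s.re < 1} := by
  refine DifferentiableOn.analyticOnNhd (fun s hs => ?_) ?_
  · refine DifferentiableAt.differentiableWithinAt ?_
    exact ((differentiableAt_id.pow 2).mul (differentiableAt_mellin_logRemainder hs.1 hs.2)).const_add 1
  · exact (isOpen_lt continuous_const Complex.continuous_re).inter
      (isOpen_lt Complex.continuous_re continuous_const)

/-- The value 1 at 0 excludes identical vanishing on the connected strip. This suffices for dividing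
meromorphically, and the closed form π/(s sin πs) of the transform is not needed. -/
lemma eventually_mellinDenom_ne_zero {s : ℂ} (hs : s ∈ {s : ℂ | -1 < s.re ∧ s.re < 1}) :
    ∀ᶠ w in 𝓝[≠] s, mellinDenom w ≠ 0 := by
  rcases (analyticOnNhd_mellinDenom s hs).eventually_eq_zero_or_eventually_ne_zero with h | h
  · exfalso
    have hc : IsPreconnected {s : ℂ | -1 < s.re ∧ s.re < 1} :=
      ((convex_halfSpace_re_gt _).inter (convex_halfSpace_re_lt _)).isPreconnected
    have := analyticOnNhd_mellinDenom.eqOn_zero_of_preconnected_of_eventuallyEq_zero hc hs h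
      (show (0 : ℂ) ∈ _ by simp)
    simp [mellinDenom_zero] at this
  · exact h

end

/-! ### Regularized products of positive sequences and their Mellin transforms. -/

section

open Asymptotics

variable {ι : Type*} {lam : ι → ℝ}

/-- The logarithm of the regularized product `∏ (1 + y / lam i)`. -/
def logProd (lam : ι → ℝ) (y : ℝ) : ℝ := ∑' i, Real.log (1 + y / lam i)

lemma log_one_add_div_nonneg (hpos : ∀ i, 0 < lam i) {y : ℝ} (hy : 0 ≤ y) (i : ι) :
    0 ≤ Real.log (1 + y / lam i) :=
  log_one_add_nonneg (div_nonneg hy (hpos i).le)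

lemma log_one_add_div_le (hpos : ∀ i, 0 < lam i) {y : ℝ} (hy : 0 ≤ y) (i : ι) :
    Real.log (1 + y / lam i) ≤ y * (lam i)⁻¹ := by
  rw [← div_eq_mul_inv]
  exact log_one_add_le (div_nonneg hy (hpos i).le)

lemma summable_log_one_add_div (hpos : ∀ i, 0 < lam i) (hs : Summable fun i => (lam i)⁻¹)
    {y : ℝ} (hy : 0 ≤ y) : Summable fun i => Real.log (1 + y / lam i) :=
  Summable.of_nonneg_of_le (log_one_add_div_nonneg hpos hy) (log_one_add_div_le hpos hy)
    (hs.mul_left y)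

lemma logProd_nonneg (hpos : ∀ i, 0 < lam i) {y : ℝ} (hy : 0 ≤ y) : 0 ≤ logProd lam y :=
  tsum_nonneg (log_one_add_div_nonneg hpos hy)

lemma logProd_le (hpos : ∀ i, 0 < lam i) (hs : Summable fun i => (lam i)⁻¹)
    {y : ℝ} (hy : 0 ≤ y) : logProd lam y ≤ y * ∑' i, (lam i)⁻¹ := by
  rw [← tsum_mul_left]
  exact (summable_log_one_add_div hpos hs hy).tsum_le_tsum (log_one_add_div_le hpos hy)
    (hs.mul_left y)

lemma continuousOn_logProd (hpos : ∀ i, 0 < lam i) (hs : Summable fun i => (lam i)⁻¹) :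
    ContinuousOn (logProd lam) (Ioi 0) := by
  intro y (hy : 0 < y)
  have : ContinuousOn (logProd lam) (Icc 0 (y + 1)) := by
    refine continuousOn_tsum (u := fun i => (y + 1) * (lam i)⁻¹) (fun i => ?_) (hs.mul_left _)
      fun i x hx => ?_
    · refine ContinuousOn.log (by fun_prop) fun x hx => ?_
      have := div_nonneg hx.1 (hpos i).le
      linarith
    · rw [Real.norm_eq_abs, abs_of_nonneg (log_one_add_div_nonneg hpos hx.1 i)]
      refine (log_one_add_div_le hpos hx.1 i).trans ?_
      exact mul_le_mul_of_nonneg_right hx.2 (inv_nonneg.2 (hpos i).le)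
  exact (this.continuousAt (Icc_mem_nhds hy (by linarith))).continuousWithinAt

lemma countable_of_summable_inv (hpos : ∀ i, 0 < lam i) (hs : Summable fun i => (lam i)⁻¹) :
    Countable ι := by
  have h := hs.countable_support
  have : Function.support (fun i => (lam i)⁻¹) = univ := by
    ext i; simp [(hpos i).ne']
  rw [this] at h
  exact countable_univ_iff.1 h

/-- Growth of `logProd` as in the heat expansion of a one-dimensional operator. -/
structure HasLogExpansion (lam : ι → ℝ) (α β γ : ℝ) : Prop where
  pos : ∀ i, 0 < lam i
  summable : Summable fun i => (lam i)⁻¹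
  bound : ∃ ε C Y : ℝ, 0 < ε ∧ 1 ≤ Y ∧
    ∀ y, Y ≤ y → |logProd lam y - (α * √y + β * Real.log y + γ)| ≤ C * y ^ (-ε)

namespace HasLogExpansion

variable {α β γ : ℝ}

/-- With ε ≤ 1 the error O(1/t) made in replacing log t by log(1 + t) is absorbed as well. -/
lemma exists_small_exponent (h : HasLogExpansion lam α β γ) : ∃ ε C Y : ℝ, 0 < ε ∧ ε ≤ 1 ∧ 0 ≤ C ∧
    1 ≤ Y ∧ ∀ y, Y ≤ y → |logProd lam y - (α * √y + β * Real.log y + γ)| ≤ C * y ^ (-ε) := by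
  obtain ⟨ε, C, Y, hε, hY, hb⟩ := h.bound
  refine ⟨min ε 1, |C|, Y, lt_min hε one_pos, min_le_right _ _, abs_nonneg _, hY, fun y hy => ?_⟩
  have hy1 : 1 ≤ y := hY.trans hy
  refine (hb y hy).trans ?_
  have : y ^ (-ε) ≤ y ^ (-min ε 1) :=
    Real.rpow_le_rpow_of_exponent_le hy1 (by have := min_le_left ε 1; linarith)
  have h0 : 0 ≤ y ^ (-ε) := by positivity
  calc C * y ^ (-ε) ≤ |C| * y ^ (-ε) := mul_le_mul_of_nonneg_right (le_abs_self C) h0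
    _ ≤ _ := mul_le_mul_of_nonneg_left this (abs_nonneg _)

/-- `logProd` without its main terms at infinity. -/
def remainder (lam : ι → ℝ) (α β γ : ℝ) (t : ℝ) : ℂ :=
  (logProd lam t : ℂ) - (β : ℂ) • (Real.log (1 + t) : ℂ) -
    ((α : ℂ) • indicator (Ioi 1) (fun t : ℝ => (t : ℂ) ^ (1 / 2 : ℂ)) t +
      (γ : ℂ) • indicator (Ioi 1) (fun _ : ℝ => (1 : ℂ)) t)

lemma remainder_of_one_lt {t : ℝ} (ht : 1 < t) : remainder lam α β γ t =
    ((logProd lam t - (α * √t + β * Real.log t + γ) - β * (Real.log (1 + t) - Real.log t) : ℝ) : ℂ)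
    := by
  have h2 : ((√t : ℝ) : ℂ) = (t : ℂ) ^ (1 / 2 : ℂ) := by
    rw [Real.sqrt_eq_rpow, Complex.ofReal_cpow (by linarith)]; norm_num
  rw [remainder, indicator_of_mem (show t ∈ Ioi (1 : ℝ) from ht),
    indicator_of_mem (show t ∈ Ioi (1 : ℝ) from ht), ← h2]
  simp only [smul_eq_mul]
  push_cast
  ring

lemma remainder_of_le_one {t : ℝ} (ht : t ≤ 1) : remainder lam α β γ t =
    ((logProd lam t - β * Real.log (1 + t) : ℝ) : ℂ) := by
  rw [remainder, indicator_of_notMem (by simpa using ht), indicator_of_notMem (by simpa using ht)]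
  simp only [smul_eq_mul]
  push_cast
  ring

lemma locallyIntegrableOn_remainder (h : HasLogExpansion lam α β γ) :
    LocallyIntegrableOn (remainder lam α β γ) (Ioi 0) := by
  have m0 : ∀ x ∈ Ioi (0 : ℝ), x ≠ 0 := fun t (ht : 0 < t) => ht.ne'
  have A : LocallyIntegrableOn (fun t => (logProd lam t : ℂ) - (β : ℂ) • (Real.log (1 + t) : ℂ))
      (Ioi 0) := by
    refine ContinuousOn.locallyIntegrableOn ?_ measurableSet_Ioi
    refine ContinuousOn.sub ?_ (ContinuousOn.fun_const_smul ?_ _)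
    · exact Complex.continuous_ofReal.comp_continuousOn (continuousOn_logProd h.pos h.summable)
    · exact Complex.continuous_ofReal.comp_continuousOn
        (continuousOn_log_one_add.mono Ioi_subset_Ici_self)
  have B : LocallyIntegrableOn (fun t => (α : ℂ) • indicator (Ioi 1) (fun t : ℝ => (t : ℂ) ^ (1 / 2 : ℂ)) t +
      (γ : ℂ) • indicator (Ioi 1) (fun _ : ℝ => (1 : ℂ)) t) (Ioi 0) := by
    have e : (fun t => (α : ℂ) • indicator (Ioi 1) (fun t : ℝ => (t : ℂ) ^ (1 / 2 : ℂ)) t +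
      (γ : ℂ) • indicator (Ioi 1) (fun _ : ℝ => (1 : ℂ)) t) =
      indicator (Ioi 1) (fun t : ℝ => (α : ℂ) • ((√t : ℝ) : ℂ) + γ) := by
      ext t
      by_cases ht : t ∈ Ioi (1 : ℝ)
      · have h2 : ((√t : ℝ) : ℂ) = (t : ℂ) ^ (1 / 2 : ℂ) := by
          rw [Real.sqrt_eq_rpow, Complex.ofReal_cpow (zero_le_one.trans (le_of_lt ht))]; norm_num
        simp only [indicator_of_mem ht, h2, smul_eq_mul, mul_one]
      · simp only [indicator_of_notMem ht, smul_zero, add_zero]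
    rw [e]
    refine LocallyIntegrable.locallyIntegrableOn ?_ _
    refine LocallyIntegrable.indicator (Continuous.locallyIntegrable ?_) measurableSet_Ioi
    fun_prop
  exact A.sub B

lemma remainder_isBigO_zero (h : HasLogExpansion lam α β γ) :
    remainder lam α β γ =O[𝓝[>] 0] (fun t : ℝ => t ^ (-(-1 : ℝ))) := by
  refine IsBigO.of_bound (∑' i, (lam i)⁻¹ + |β|) ?_
  filter_upwards [Ioo_mem_nhdsGT (one_pos : (0 : ℝ) < 1)] with t ht
  rw [remainder_of_le_one ht.2.le, Complex.norm_real, neg_neg, Real.rpow_one, Real.norm_eq_abs,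
    Real.norm_eq_abs, abs_of_pos ht.1]
  refine (abs_sub _ _).trans ?_
  rw [abs_mul, abs_of_nonneg (logProd_nonneg h.pos ht.1.le),
    abs_of_nonneg (log_one_add_nonneg ht.1.le)]
  have := logProd_le h.pos h.summable ht.1.le
  have := mul_le_mul_of_nonneg_left (log_one_add_le ht.1.le) (abs_nonneg β)
  linarith

lemma exists_remainder_isBigO_top (h : HasLogExpansion lam α β γ) : ∃ ε : ℝ, 0 < ε ∧ ε ≤ 1 ∧
    remainder lam α β γ =O[atTop] (fun t : ℝ => t ^ (-ε)) := by
  obtain ⟨ε, C, Y, hε, hε1, hC, hY, hb⟩ := h.exists_small_exponent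
  refine ⟨ε, hε, hε1, IsBigO.of_bound (C + |β|) ?_⟩
  filter_upwards [eventually_gt_atTop Y] with t ht
  have t1 : 1 < t := by linarith
  have t0 : 0 < t := by linarith
  rw [remainder_of_one_lt t1, Complex.norm_real, Real.norm_eq_abs, Real.norm_eq_abs,
    abs_of_pos (by positivity : 0 < t ^ (-ε))]
  refine (abs_sub _ _).trans ?_
  rw [abs_mul]
  have := hb t ht.le
  have := mul_le_mul_of_nonneg_left ((abs_log_one_add_sub_log_le t0).trans
    (inv_le_rpow_neg t1.le hε1)) (abs_nonneg β)
  linarith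

lemma logProd_isBigO_top (h : HasLogExpansion lam α β γ) :
    (fun t => (logProd lam t : ℂ)) =O[atTop] (fun t : ℝ => t ^ (-(-(1 / 2) : ℝ))) := by
  obtain ⟨ε, C, Y, hε, hε1, hC, hY, hb⟩ := h.exists_small_exponent
  refine IsBigO.of_bound (C + |α| + 2 * |β| + |γ|) ?_
  filter_upwards [eventually_gt_atTop Y] with t ht
  have t1 : 1 < t := by linarith
  have t0 : 0 < t := by linarith
  rw [Complex.norm_real, neg_neg, ← Real.sqrt_eq_rpow, Real.norm_eq_abs, Real.norm_eq_abs,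
    abs_of_nonneg (Real.sqrt_nonneg t)]
  have s1 : 1 ≤ √t := Real.one_le_sqrt.2 t1.le
  have e1 : t ^ (-ε) ≤ 1 := Real.rpow_le_one_of_one_le_of_nonpos t1.le (by linarith)
  have l1 : |Real.log t| ≤ 2 * √t := by
    rw [abs_of_nonneg (Real.log_nonneg t1.le)]
    have : Real.log t = 2 * Real.log (√t) := by rw [Real.log_sqrt t0.le]; ring
    rw [this]
    have := Real.log_le_sub_one_of_pos (show 0 < √t by linarith)
    linarith
  have key : |logProd lam t| ≤ C * t ^ (-ε) + (|α| * √t + |β| * |Real.log t| + |γ|) := by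
    have e : logProd lam t = (logProd lam t - (α * √t + β * Real.log t + γ)) +
      (α * √t + β * Real.log t + γ) := by ring
    rw [e]
    refine (abs_add_le _ _).trans (add_le_add (hb t ht.le) ?_)
    refine (abs_add_le _ _).trans (add_le_add ((abs_add_le _ _).trans ?_) le_rfl)
    rw [abs_mul, abs_mul, abs_of_nonneg (Real.sqrt_nonneg t)]
  have := mul_le_mul_of_nonneg_left e1 hC
  have := mul_le_mul_of_nonneg_left l1 (abs_nonneg β)
  have := mul_le_mul_of_nonneg_left s1 hC
  have := mul_le_mul_of_nonneg_left s1 (abs_nonneg γ)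
  linarith

lemma mellinConvergent_logProd (h : HasLogExpansion lam α β γ) {s : ℂ} (h1 : 1 / 2 < s.re)
    (h2 : s.re < 1) : MellinConvergent (fun t => (logProd lam t : ℂ)) (-s) := by
  refine mellinConvergent_of_isBigO_rpow (a := -(1 / 2)) (b := -1) ?_ h.logProd_isBigO_top
    (by simp only [Complex.neg_re]; linarith) ?_ (by simp only [Complex.neg_re]; linarith)
  · exact (Complex.continuous_ofReal.comp_continuousOn
      (continuousOn_logProd h.pos h.summable)).locallyIntegrableOn measurableSet_Ioi
  · refine IsBigO.of_bound (∑' i, (lam i)⁻¹) ?_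
    filter_upwards [Ioo_mem_nhdsGT (one_pos : (0 : ℝ) < 1)] with t ht
    rw [neg_neg, Real.rpow_one, Complex.norm_real, Real.norm_eq_abs, Real.norm_eq_abs,
      abs_of_pos ht.1, abs_of_nonneg (logProd_nonneg h.pos ht.1.le), mul_comm]
    exact logProd_le h.pos h.summable ht.1.le

/-- The logarithmic term is represented by log(1 + t), so that it contributes exactly β times the
transform occurring in the zeta identity. The other terms are cut off at 1 and give α/(s - 1/2) and
γ/s; the transform of the remainder converges for -ε < Re s < 1. -/
lemma mellin_logProd (h : HasLogExpansion lam α β γ) {s : ℂ} (h1 : 1 / 2 < s.re)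
    (h2 : s.re < 1) : mellin (fun t => (logProd lam t : ℂ)) (-s) =
      mellin (remainder lam α β γ) (-s) + β * mellin (fun t : ℝ => (Real.log (1 + t) : ℂ)) (-s) +
      (α / (s - 1 / 2) + γ / s) := by
  obtain ⟨ε, hε, hε1, ht⟩ := h.exists_remainder_isBigO_top
  have R := mellinConvergent_of_isBigO_rpow (s := -s) h.locallyIntegrableOn_remainder ht
    (by simp; linarith) h.remainder_isBigO_zero (by simp; linarith)
  have L := (hasMellin_log_one_add (s := s) (by linarith) h2).1
  have P := hasMellin_cpow_Ioi (1 / 2) (s := -s) (by norm_num; linarith)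
  have O := hasMellin_one_Ioi (s := -s) (by simp; linarith)
  have L' := hasMellin_const_smul L (β : ℂ)
  have P' := hasMellin_const_smul P.1 (α : ℂ)
  have O' := hasMellin_const_smul O.1 (γ : ℂ)
  have s1 := hasMellin_add R L'.1
  have s2 := hasMellin_add P'.1 O'.1
  have s3 := hasMellin_add s1.1 s2.1
  have e : (fun t => (logProd lam t : ℂ)) = fun t => (remainder lam α β γ t +
      (β : ℂ) • (Real.log (1 + t) : ℂ)) +
      ((α : ℂ) • indicator (Ioi 1) (fun t : ℝ => (t : ℂ) ^ (1 / 2 : ℂ)) t +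
      (γ : ℂ) • indicator (Ioi 1) (fun _ : ℝ => (1 : ℂ)) t) := by
    ext t; rw [remainder]; ring
  have e1 : -s + 1 / 2 ≠ 0 := fun h0 => by
    have := congrArg Complex.re h0; norm_num at this; linarith
  have e2 : s ≠ 0 := fun h0 => by rw [h0] at h1; norm_num at h1
  have e3 : s - 1 / 2 ≠ 0 := fun h0 => e1 (by linear_combination -h0)
  rw [e, s3.2, s1.2, s2.2, L'.2, P'.2, O'.2, P.2, O.2]
  simp only [smul_eq_mul]
  have f1 : (-1 : ℂ) / (-s + 1 / 2) = 1 / (s - 1 / 2) := by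
    rw [div_eq_div_iff e1 e3]; ring
  rw [f1]
  have f2 : (-1 : ℂ) / -s = 1 / s := by rw [neg_div_neg_eq]
  rw [f2]
  ring

end HasLogExpansion

end

/-! ### Continuation of the zeta function of a sequence. -/

section

namespace HasLogExpansion

variable {ι : Type*} {lam : ι → ℝ} {α β γ : ℝ}

lemma integrableOn_rpow_mul_log_one_add {σ : ℝ} (h1 : 0 < σ) (h2 : σ < 1) :
    IntegrableOn (fun t : ℝ => t ^ (-σ - 1) * Real.log (1 + t)) (Ioi 0) := by
  have := (hasMellin_log_one_add (s := (σ : ℂ)) (by simpa) (by simpa)).1.norm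
  refine IntegrableOn.congr_fun this (fun t (ht : 0 < t) => ?_) measurableSet_Ioi
  simp only [smul_eq_mul, norm_mul, Complex.norm_real, Real.norm_eq_abs]
  rw [Complex.norm_cpow_eq_rpow_re_of_pos ht, abs_of_nonneg (log_one_add_nonneg ht.le)]
  simp

lemma integral_rpow_mul_log_one_add_pos {σ : ℝ} (h1 : 0 < σ) (h2 : σ < 1) :
    0 < ∫ t in Ioi 0, t ^ (-σ - 1) * Real.log (1 + t) := by
  rw [setIntegral_pos_iff_support_of_nonneg_ae _ (integrableOn_rpow_mul_log_one_add h1 h2)]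
  · have : Ioi (0 : ℝ) ⊆ Function.support (fun t : ℝ => t ^ (-σ - 1) * Real.log (1 + t)) ∩ Ioi 0 := by
      intro t (ht : 0 < t)
      exact ⟨(mul_pos (by positivity) (Real.log_pos (by linarith))).ne', ht⟩
    exact lt_of_lt_of_le (by simp) (measure_mono this)
  · refine (ae_restrict_iff' measurableSet_Ioi).2 (Eventually.of_forall fun t (ht : 0 < t) => ?_)
    exact mul_nonneg (by positivity) (log_one_add_nonneg ht.le)

lemma rpow_mul_log_one_add_div {σ l t : ℝ} (hl : 0 < l) (ht : 0 < t) :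
    t ^ (-σ - 1) * Real.log (1 + t / l) =
      l ^ (-σ - 1) * ((l⁻¹ * t) ^ (-σ - 1) * Real.log (1 + l⁻¹ * t)) := by
  rw [Real.mul_rpow (by positivity) ht.le, Real.inv_rpow hl.le, div_eq_inv_mul]
  have : l ^ (-σ - 1) ≠ 0 := by positivity
  field_simp

lemma integral_rpow_mul_log_one_add_div {σ l : ℝ} (hl : 0 < l) :
    ∫ t in Ioi 0, t ^ (-σ - 1) * Real.log (1 + t / l) =
      l ^ (-σ) * ∫ t in Ioi 0, t ^ (-σ - 1) * Real.log (1 + t) := by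
  rw [setIntegral_congr_fun measurableSet_Ioi fun t ht => rpow_mul_log_one_add_div hl ht,
    integral_const_mul, integral_comp_mul_left_Ioi (fun t => t ^ (-σ - 1) * Real.log (1 + t)) 0
      (inv_pos.2 hl), mul_zero, inv_inv, smul_eq_mul, ← mul_assoc, ← Real.rpow_add_one hl.ne']
  ring_nf

lemma integrableOn_rpow_mul_log_one_add_div {σ l : ℝ} (h1 : 0 < σ) (h2 : σ < 1) (hl : 0 < l) :
    IntegrableOn (fun t => t ^ (-σ - 1) * Real.log (1 + t / l)) (Ioi 0) := by
  refine IntegrableOn.congr_fun ?_ (fun t ht => (rpow_mul_log_one_add_div hl ht).symm)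
    measurableSet_Ioi
  refine Integrable.const_mul ?_ _
  have := (integrableOn_Ioi_comp_mul_left_iff (fun t => t ^ (-σ - 1) * Real.log (1 + t)) 0
    (inv_pos.2 hl)).2 (by simpa using integrableOn_rpow_mul_log_one_add h1 h2)
  exact this

lemma integrableOn_rpow_mul_logProd (h : HasLogExpansion lam α β γ) {σ : ℝ} (h1 : 1 / 2 < σ)
    (h2 : σ < 1) : IntegrableOn (fun t => t ^ (-σ - 1) * logProd lam t) (Ioi 0) := by
  have := (h.mellinConvergent_logProd (s := (σ : ℂ)) (by simpa using h1) (by simpa)).norm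
  refine IntegrableOn.congr_fun this (fun t (ht : 0 < t) => ?_) measurableSet_Ioi
  simp only [smul_eq_mul, norm_mul, Complex.norm_real, Real.norm_eq_abs]
  rw [Complex.norm_cpow_eq_rpow_re_of_pos ht, abs_of_nonneg (logProd_nonneg h.pos ht.le)]
  simp

/-- Integrating t^{-σ-1} log(1 + t/λ) gives λ^{-σ} times a positive constant. Finite partial sums of
these integrals are bounded by the integral of t^{-σ-1} `logProd`, which converges for 1/2 < σ < 1
because of the growth √t at infinity. -/
lemma summable_rpow_lt_one (h : HasLogExpansion lam α β γ) {σ : ℝ} (h1 : 1 / 2 < σ) (h2 : σ < 1) :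
    Summable fun i => lam i ^ (-σ) := by
  have h0 : 0 < σ := by linarith
  set κ := ∫ t in Ioi 0, t ^ (-σ - 1) * Real.log (1 + t) with hκ
  have κpos : 0 < κ := integral_rpow_mul_log_one_add_pos h0 h2
  refine summable_of_sum_le (c := (∫ t in Ioi 0, t ^ (-σ - 1) * logProd lam t) / κ)
    (fun i => Real.rpow_nonneg (h.pos i).le _) fun F => ?_
  rw [le_div_iff₀ κpos, Finset.sum_mul]
  have e : ∀ i, lam i ^ (-σ) * κ = ∫ t in Ioi 0, t ^ (-σ - 1) * Real.log (1 + t / lam i) :=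
    fun i => (integral_rpow_mul_log_one_add_div (h.pos i)).symm
  simp_rw [e]
  rw [← integral_finsetSum _ fun i _ => integrableOn_rpow_mul_log_one_add_div h0 h2 (h.pos i)]
  refine setIntegral_mono_on (integrable_finsetSum _ fun i _ =>
    integrableOn_rpow_mul_log_one_add_div h0 h2 (h.pos i)) (h.integrableOn_rpow_mul_logProd h1 h2)
    measurableSet_Ioi fun t (ht : 0 < t) => ?_
  rw [← Finset.mul_sum]
  refine mul_le_mul_of_nonneg_left ?_ (by positivity)
  exact (summable_log_one_add_div h.pos h.summable ht.le).sum_le_tsum _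
    fun i _ => log_one_add_div_nonneg h.pos ht.le i

lemma summable_rpow (h : HasLogExpansion lam α β γ) {σ : ℝ} (h1 : 1 / 2 < σ) :
    Summable fun i => lam i ^ (-σ) := by
  rcases lt_or_ge σ 1 with h2 | h2
  · exact h.summable_rpow_lt_one h1 h2
  · refine h.summable.of_norm_bounded_eventually ?_
    have : ∀ᶠ i in cofinite, (lam i)⁻¹ ≤ 1 :=
      (h.summable.tendsto_cofinite_zero.eventually_lt_const one_pos).mono fun i hi => hi.le
    filter_upwards [this] with i hi
    have h0 := h.pos i
    have hi' : 1 ≤ lam i := by rwa [inv_le_one₀ h0] at hi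
    rw [Real.norm_eq_abs, abs_of_nonneg (Real.rpow_nonneg h0.le _), ← Real.rpow_neg_one]
    exact Real.rpow_le_rpow_of_exponent_le hi' (by linarith)

lemma norm_term (h : HasLogExpansion lam α β γ) (i : ι) (s : ℂ) :
    ‖(lam i : ℂ) ^ (-s)‖ = lam i ^ (-s.re) := by
  rw [Complex.norm_cpow_eq_rpow_re_of_pos (h.pos i), Complex.neg_re]

lemma summable_term (h : HasLogExpansion lam α β γ) {s : ℂ} (hs : 1 / 2 < s.re) :
    Summable fun i => (lam i : ℂ) ^ (-s) := by
  refine Summable.of_norm ?_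
  simp_rw [h.norm_term]
  exact h.summable_rpow hs

lemma differentiableAt_series (h : HasLogExpansion lam α β γ) {s : ℂ} (hs : 1 / 2 < s.re) :
    DifferentiableAt ℂ (fun s => ∑' i, (lam i : ℂ) ^ (-s)) s := by
  obtain ⟨σ, h1, h2⟩ := exists_between hs
  set U : Set ℂ := {w | σ < w.re ∧ w.re < s.re + 1}
  have hU : IsOpen U := (isOpen_lt continuous_const Complex.continuous_re).inter
      (isOpen_lt Complex.continuous_re continuous_const)
  -- Elements of the sequence may lie below or above 1, so the majorant is the sum of the powers at
  -- both edges of the strip.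
  have := Complex.differentiableOn_tsum_of_summable_norm (F := fun i (w : ℂ) => (lam i : ℂ) ^ (-w))
    ((h.summable_rpow h1).add (h.summable_rpow (σ := s.re + 1) (by linarith)))
    (U := U) (fun i => ?_) hU fun i w hw => ?_
  · exact this.differentiableAt (hU.mem_nhds ⟨h2, by linarith⟩)
  · intro w _
    refine DifferentiableAt.differentiableWithinAt ?_
    exact differentiableAt_id.neg.const_cpow (Or.inl (by exact_mod_cast (h.pos i).ne'))
  · rw [h.norm_term]
    have p1 : 0 ≤ lam i ^ (-σ) := Real.rpow_nonneg (h.pos i).le _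
    have p2 : 0 ≤ lam i ^ (-(s.re + 1)) := Real.rpow_nonneg (h.pos i).le _
    rcases le_total 1 (lam i) with hl | hl
    · have := Real.rpow_le_rpow_of_exponent_le hl (show -w.re ≤ -σ by linarith [hw.1])
      linarith
    · have := Real.rpow_le_rpow_of_exponent_ge (h.pos i) hl
        (show -(s.re + 1) ≤ -w.re by linarith [hw.2])
      linarith

/-- The substitution t → λt turns the transform of log(1 + t/λ) into λ^{-s} times that of log(1 +
t). Sum and integral are interchanged by absolute convergence, which is `summable_rpow`. -/
lemma hasSum_mellin (h : HasLogExpansion lam α β γ) {s : ℂ} (h1 : 1 / 2 < s.re) (h2 : s.re < 1) :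
    HasSum (fun i => (lam i : ℂ) ^ (-s) * mellin (fun t : ℝ => (Real.log (1 + t) : ℂ)) (-s))
      (mellin (fun t => (logProd lam t : ℂ)) (-s)) := by
  have := countable_of_summable_inv h.pos h.summable
  have h0 : 0 < s.re := by linarith
  have key := hasSum_integral_of_summable_integral_norm (μ := volume.restrict (Ioi 0))
    (F := fun i (t : ℝ) => (t : ℂ) ^ (-s - 1) • (Real.log (1 + t / lam i) : ℂ)) ?_ ?_
  · have e : ∀ i, ∫ t : ℝ in Ioi 0, (t : ℂ) ^ (-s - 1) • (Real.log (1 + t / lam i) : ℂ) =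
        (lam i : ℂ) ^ (-s) * mellin (fun t : ℝ => (Real.log (1 + t) : ℂ)) (-s) := by
      intro i
      have := mellin_comp_mul_left (fun t : ℝ => (Real.log (1 + t) : ℂ)) (-s) (inv_pos.2 (h.pos i))
      rw [neg_neg, smul_eq_mul, Complex.ofReal_inv, Complex.inv_cpow, ← Complex.cpow_neg] at this
      · rw [← this, mellin]
        simp_rw [div_eq_inv_mul]
      · rw [Complex.arg_ofReal_of_nonneg (h.pos i).le]; exact Real.pi_pos.ne
    simp_rw [e] at key
    have e2 : mellin (fun t => (logProd lam t : ℂ)) (-s) = ∫ t : ℝ in Ioi 0,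
        ∑' i, (t : ℂ) ^ (-s - 1) • (Real.log (1 + t / lam i) : ℂ) := by
      refine setIntegral_congr_fun measurableSet_Ioi fun t (ht : 0 < t) => ?_
      simp only [smul_eq_mul]
      rw [tsum_mul_left, logProd, Complex.ofReal_tsum]
    rw [e2]
    exact key
  · intro i
    have := (MellinConvergent.comp_mul_left (inv_pos.2 (h.pos i))).2 (hasMellin_log_one_add h0 h2).1
    simp_rw [div_eq_inv_mul]
    exact this
  · have e : ∀ i, ∫ t : ℝ in Ioi 0, ‖(t : ℂ) ^ (-s - 1) • (Real.log (1 + t / lam i) : ℂ)‖ =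
        lam i ^ (-s.re) * ∫ t in Ioi 0, t ^ (-s.re - 1) * Real.log (1 + t) := by
      intro i
      rw [← integral_rpow_mul_log_one_add_div (h.pos i)]
      refine setIntegral_congr_fun measurableSet_Ioi fun t (ht : 0 < t) => ?_
      simp only [smul_eq_mul, norm_mul, Complex.norm_real, Real.norm_eq_abs]
      rw [Complex.norm_cpow_eq_rpow_re_of_pos ht,
        abs_of_nonneg (log_one_add_div_nonneg h.pos ht.le i)]
      simp
    simp_rw [e]
    exact (h.summable_rpow h1).mul_right _

/-- The numerator of the continued zeta function. -/
def numer (lam : ι → ℝ) (α β γ : ℝ) (s : ℂ) : ℂ :=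
  s ^ 2 * (mellin (remainder lam α β γ) (-s) + α / (s - 1 / 2)) + γ * s

/-- The factor s² clears the double pole of the transform of log(1 + t). All functions on the right
continue to the left of 0. -/
lemma series_mul_mellinDenom (h : HasLogExpansion lam α β γ) {s : ℂ} (h1 : 1 / 2 < s.re)
    (h2 : s.re < 1) :
    (∑' i, (lam i : ℂ) ^ (-s)) * mellinDenom s = β * mellinDenom s + numer lam α β γ s := by
  have h3 := (h.hasSum_mellin h1 h2).tsum_eq
  rw [tsum_mul_right, h.mellin_logProd h1 h2,
    (hasMellin_log_one_add (s := s) (by linarith) h2).2] at h3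
  have e2 : s ≠ 0 := fun h0 => by rw [h0] at h1; norm_num at h1
  have e3 : s ^ 2 * (mellin logRemainder (-s) + 1 / s ^ 2) = mellinDenom s := by
    rw [mellinDenom]; field_simp; ring
  rw [← e3, numer]
  have e4 : (γ : ℂ) * s = s ^ 2 * (γ / s) := by field_simp
  rw [e4]
  linear_combination s ^ 2 * h3

lemma exists_analyticAt_mellin_remainder (h : HasLogExpansion lam α β γ) : ∃ ε : ℝ, 0 < ε ∧ ε ≤ 1 ∧
    ∀ s : ℂ, -ε < s.re → s.re < 1 →
      AnalyticAt ℂ (fun s => mellin (remainder lam α β γ) (-s)) s := by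
  obtain ⟨ε, hε, hε1, ht⟩ := h.exists_remainder_isBigO_top
  refine ⟨ε, hε, hε1, fun s h1 h2 => ?_⟩
  set U : Set ℂ := {s | -ε < s.re ∧ s.re < 1}
  have hU : IsOpen U := (isOpen_lt continuous_const Complex.continuous_re).inter
      (isOpen_lt Complex.continuous_re continuous_const)
  refine DifferentiableOn.analyticAt (s := U) (fun w hw => ?_) (hU.mem_nhds ⟨h1, h2⟩)
  have := mellin_differentiableAt_of_isBigO_rpow (s := -w) h.locallyIntegrableOn_remainder
    ht (by simp only [Complex.neg_re]; linarith [hw.1]) h.remainder_isBigO_zero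
    (by simp only [Complex.neg_re]; linarith [hw.2])
  exact (DifferentiableAt.fun_comp' w this differentiableAt_id.neg).differentiableWithinAt

open Classical in
/-- The zeta function of a sequence with a logarithmic expansion: continuation to a neighbourhood
of `0` and the value of its derivative there. -/
theorem exists_zeta (h : HasLogExpansion lam α β γ) : ∃ Z : ℂ → ℂ,
    (∃ ε : ℝ, 0 < ε ∧ MeromorphicOn Z {s | -ε < s.re}) ∧ AnalyticAt ℂ Z 0 ∧ deriv Z 0 = γ ∧
    ∀ s : ℂ, 1 / 2 < s.re → HasSum (fun i => (lam i : ℂ) ^ (-s)) (Z s) := by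
  obtain ⟨ε, hε, hε1, hR⟩ := h.exists_analyticAt_mellin_remainder
  set Q : ℂ → ℂ := fun s => β + numer lam α β γ s / mellinDenom s with hQ
  -- Two formulas are glued: the series represents the function for all Re s > 1/2, whereas Q is
  -- controlled only for -ε < Re s < 1.
  set Z : ℂ → ℂ := fun s => if 1 / 2 < s.re then ∑' i, (lam i : ℂ) ^ (-s) else Q s with hZ
  have Zr : ∀ s : ℂ, 1 / 2 < s.re → Z s = ∑' i, (lam i : ℂ) ^ (-s) := fun s hs => if_pos hs
  have num : ∀ s : ℂ, -ε < s.re → s.re < 1 → s ≠ 1 / 2 → AnalyticAt ℂ (numer lam α β γ) s := by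
    intro s h1 h2 h3
    have a1 : AnalyticAt ℂ (fun s : ℂ => (α : ℂ) / (s - 1 / 2)) s := by
      refine analyticAt_const.div (analyticAt_id.sub analyticAt_const) (sub_ne_zero.2 h3)
    exact ((analyticAt_id.pow 2).mul ((hR s h1 h2).add a1)).add (analyticAt_const.mul analyticAt_id)
  have den : ∀ s : ℂ, -ε < s.re → s.re < 1 → AnalyticAt ℂ mellinDenom s := fun s h1 h2 =>
    analyticOnNhd_mellinDenom s ⟨by linarith, h2⟩
  have numM : ∀ s : ℂ, -ε < s.re → s.re < 1 → MeromorphicAt (numer lam α β γ) s := by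
    intro s h1 h2
    have a1 : MeromorphicAt (fun s : ℂ => (α : ℂ) / (s - 1 / 2)) s :=
      (MeromorphicAt.const _ _).div ((MeromorphicAt.id s).sub (MeromorphicAt.const _ _))
    exact ((((MeromorphicAt.id s).pow 2).mul ((hR s h1 h2).meromorphicAt.add a1))).add
      ((MeromorphicAt.const _ _).mul (MeromorphicAt.id s))
  have QM : ∀ s : ℂ, -ε < s.re → s.re < 1 → MeromorphicAt Q s := fun s h1 h2 =>
    (MeromorphicAt.const _ _).add ((numM s h1 h2).div (den s h1 h2).meromorphicAt)
  have Q0 : Z =ᶠ[𝓝 0] Q := by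
    filter_upwards [(isOpen_lt Complex.continuous_re continuous_const).mem_nhds
      (show (0 : ℂ).re < 1 / 2 by norm_num)] with s hs
    exact if_neg (not_lt.2 (le_of_lt hs))
  have d0 : mellinDenom 0 ≠ 0 := by rw [mellinDenom_zero]; exact one_ne_zero
  have n0 := num 0 (by simpa) (by simp) (by norm_num)
  have den0 := den 0 (by simpa) (by simp)
  refine ⟨Z, ⟨ε, hε, fun s (hs : -ε < s.re) => ?_⟩, ?_, ?_, fun s hs => ?_⟩
  · rcases lt_or_ge s.re 1 with h2 | h2
    · refine (QM s hs h2).congr ?_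
      have o := (isOpen_lt Complex.continuous_re continuous_const).mem_nhds h2
      -- Where 1/2 < Re s < 1 the two formulas agree off the zeros of `mellinDenom`, which is enough
      -- for meromorphy.
      filter_upwards [eventually_mellinDenom_ne_zero (s := s) ⟨by linarith, h2⟩,
        nhdsWithin_le_nhds o] with w hw (hw2 : w.re < 1)
      by_cases hw1 : 1 / 2 < w.re
      · rw [Zr w hw1]
        have := h.series_mul_mellinDenom hw1 hw2
        simp only [hQ]
        field_simp
        linear_combination -this
      · exact (if_neg hw1).symm
    · set U : Set ℂ := {s | 1 / 2 < s.re}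
      have hU : IsOpen U := isOpen_lt continuous_const Complex.continuous_re
      have hsU : U ∈ 𝓝 s := hU.mem_nhds (show 1 / 2 < s.re by linarith)
      refine (DifferentiableOn.analyticAt (s := U) (fun w hw => ?_) hsU).meromorphicAt
      refine ((h.differentiableAt_series hw).congr_of_eventuallyEq ?_).differentiableWithinAt
      filter_upwards [hU.mem_nhds hw] with v hv using Zr v hv
  · exact (analyticAt_const.add (n0.div den0 d0)).congr Q0.symm
  · rw [Q0.deriv_eq]
    have hm := (hR 0 (by simpa) (by simp)).differentiableAt
    -- Near 0 the numerator is γs + O(s²) and the denominator has value 1, so the quotient has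
    -- derivative γ.
    have hn : HasDerivAt (numer lam α β γ) (γ : ℂ) 0 := by
      have a1 : DifferentiableAt ℂ (fun s : ℂ => mellin (remainder lam α β γ) (-s) + α / (s - 1 / 2)) 0 := by
        refine hm.add ?_
        exact (differentiableAt_const _).div (differentiableAt_id.sub_const _) (by norm_num)
      have a2 := (((hasDerivAt_id (0 : ℂ)).pow 2).mul a1.hasDerivAt).add
        ((hasDerivAt_id (0 : ℂ)).const_mul (γ : ℂ))
      exact a2.congr_deriv (by simp)
    have hd := den0.differentiableAt.hasDerivAt
    have nz : numer lam α β γ 0 = 0 := by simp [numer]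
    have := (hn.div hd d0).const_add (β : ℂ)
    have := this.congr_deriv (g' := (γ : ℂ)) (by rw [nz, mellinDenom_zero]; simp)
    exact this.deriv
  · rw [Zr s hs]
    exact (h.summable_term hs).hasSum

end HasLogExpansion

end

section

/-! ### Hilbert–Schmidt operators and bounded integral kernels -/

section HilbertSchmidt

variable {E : Type*} [NormedAddCommGroup E] [InnerProductSpace ℂ E] [CompleteSpace E]

open InnerProductSpace in
lemma isCompactOperator_rankOne (x y : E) : IsCompactOperator (rankOne ℂ x y : E →L[ℂ] E) := by
  rw [rankOne_def']
  exact (isCompactOperator_of_locallyCompactSpace_rng (ContinuousLinearMap.toSpanSingleton ℂ x)).comp_clm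
    (innerSL ℂ y)

/-- Cauchy–Schwarz for the sum, then Bessel's inequality for the coefficients of f. -/
lemma norm_sum_smul_le {ι : Type*} (b : HilbertBasis ι ℂ E) (T : E →L[ℂ] E) (f : E)
    (s : Finset ι) {δ : ℝ} (hδ : ∑ i ∈ s, ‖T (b i)‖ ^ 2 ≤ δ) :
    ‖∑ i ∈ s, inner ℂ (b i) f • T (b i)‖ ≤ √δ * ‖f‖ := by
  refine (norm_sum_le _ _).trans ?_
  simp_rw [norm_smul]
  refine (Real.sum_mul_le_sqrt_mul_sqrt s _ _).trans ?_
  rw [mul_comm]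
  refine mul_le_mul (Real.sqrt_le_sqrt hδ) ?_ (Real.sqrt_nonneg _) (Real.sqrt_nonneg _)
  rw [Real.sqrt_le_left (norm_nonneg f)]
  exact b.orthonormal.sum_inner_products_le f

open InnerProductSpace in
-- The truncations along the basis have finite rank and converge in operator norm: the tail of Σ‖T
-- bᵢ‖² bounds the difference by `norm_sum_smul_le`.
lemma isCompactOperator_of_summable_norm_sq {ι : Type*} (b : HilbertBasis ι ℂ E) (T : E →L[ℂ] E)
    (hs : Summable fun i => ‖T (b i)‖ ^ 2) : IsCompactOperator T := by
  classical
  set A : Finset ι → (E →L[ℂ] E) := fun s => ∑ i ∈ s, rankOne ℂ (T (b i)) (b i) with hA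
  have hAc : ∀ s, IsCompactOperator (A s) := by
    intro s
    induction s using Finset.induction_on with
    | empty => simpa [hA] using isCompactOperator_zero
    | insert i s hi ih =>
      have : A (insert i s) = rankOne ℂ (T (b i)) (b i) + A s := by
        simp only [hA, Finset.sum_insert hi]
      rw [this]
      exact (isCompactOperator_rankOne _ _).add ih
  have hAapp : ∀ s f, A s f = ∑ i ∈ s, inner ℂ (b i) f • T (b i) := by
    intro s f
    simp [hA]
  have hlim : ∀ f, Tendsto (fun s => A s f) atTop (𝓝 (T f)) := by
    intro f
    have := (b.hasSum_repr f).mapL T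
    refine Tendsto.congr (fun s => ?_) this
    rw [hAapp]
    refine Finset.sum_congr rfl fun i _ => ?_
    have := b.repr_apply_apply f i
    simp only at this ⊢
    rw [← this]
    exact T.map_smul _ _
  refine isCompactOperator_of_tendsto (l := atTop) (F := A) ?_ (Eventually.of_forall hAc)
  rw [tendsto_iff_norm_sub_tendsto_zero]
  refine Metric.tendsto_atTop.2 fun ε hε => ?_
  obtain ⟨s, hsε⟩ := summable_iff_vanishing_norm.1 hs ((ε / 2) ^ 2) (by positivity)
  refine ⟨s, fun n hn => ?_⟩
  rw [Real.dist_eq, sub_zero, abs_of_nonneg (norm_nonneg _)]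
  refine lt_of_le_of_lt (ContinuousLinearMap.opNorm_le_bound _ (by positivity : 0 ≤ ε / 2)
    fun f => ?_) (by linarith)
  have h1 : Tendsto (fun m => ‖(A n - A m) f‖) atTop (𝓝 ‖(A n - T) f‖) := by
    simp only [ContinuousLinearMap.sub_apply]
    exact ((hlim f).const_sub _).norm
  refine le_of_tendsto h1 ?_
  filter_upwards [eventually_ge_atTop n] with m hm
  have h2 : (A n - A m) f = -∑ i ∈ m \ n, inner ℂ (b i) f • T (b i) := by
    rw [ContinuousLinearMap.sub_apply, hAapp, hAapp, ← Finset.sum_sdiff hm]; abel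
  rw [h2, norm_neg]
  have h3 : ∑ i ∈ m \ n, ‖T (b i)‖ ^ 2 ≤ (ε / 2) ^ 2 := by
    have := hsε (m \ n) (Finset.disjoint_of_subset_right hn Finset.sdiff_disjoint)
    exact (le_abs_self _).trans this.le
  have := norm_sum_smul_le b T f (m \ n) h3
  rwa [Real.sqrt_sq (by positivity)] at this

end HilbertSchmidt

instance : IsProbabilityMeasure unitMeasure := ⟨by simp⟩

/-- A bounded measurable real kernel. -/
structure IsBoundedKernel (κ : ℝ → ℝ → ℝ) (C : ℝ) : Prop where
  meas : Measurable (Function.uncurry κ)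
  bound : ∀ w x, |κ w x| ≤ C

lemma integrable_coe (f : H) : Integrable f unitMeasure :=
  (Lp.memLp f).integrable (by norm_num)

lemma integral_norm_le (f : H) : ∫ x, ‖f x‖ ∂unitMeasure ≤ ‖f‖ := by
  have h1 := (Lp.memLp f)
  have h2 : eLpNorm f 1 unitMeasure ≤ eLpNorm f 2 unitMeasure :=
    eLpNorm_le_eLpNorm_of_exponent_le (by norm_num) h1.1
  rw [Lp.norm_def, integral_norm_eq_lintegral_enorm h1.1, ← eLpNorm_one_eq_lintegral_enorm]
  exact ENNReal.toReal_mono h1.2.ne h2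

/-- The function `∫ κ(·, x) f(x) dx`. -/
def kernelFun (κ : ℝ → ℝ → ℝ) (f : ℝ → ℂ) (w : ℝ) : ℂ := ∫ x, (κ w x : ℂ) * f x ∂unitMeasure

namespace IsBoundedKernel

variable {κ : ℝ → ℝ → ℝ} {C : ℝ}

lemma swap (h : IsBoundedKernel κ C) : IsBoundedKernel (fun w x => κ x w) C :=
  ⟨h.meas.comp measurable_swap, fun w x => h.bound x w⟩

lemma nonneg (h : IsBoundedKernel κ C) : 0 ≤ C := (abs_nonneg _).trans (h.bound 0 0)

lemma measurable_left (h : IsBoundedKernel κ C) (w : ℝ) : Measurable (κ w) :=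
  h.meas.comp measurable_prodMk_left

lemma norm_le (h : IsBoundedKernel κ C) (w x : ℝ) : ‖(κ w x : ℂ)‖ ≤ C := by
  rw [Complex.norm_real]; exact h.bound w x

lemma memLp (h : IsBoundedKernel κ C) (w : ℝ) : MemLp (fun x => (κ w x : ℂ)) 2 unitMeasure :=
  MemLp.of_bound (Complex.measurable_ofReal.comp (h.measurable_left w)).aestronglyMeasurable C
    (Eventually.of_forall (h.norm_le w))

lemma integrable_mul (h : IsBoundedKernel κ C) {f : ℝ → ℂ} (hf : Integrable f unitMeasure) (w : ℝ) :
    Integrable (fun x => (κ w x : ℂ) * f x) unitMeasure :=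
  hf.bdd_mul (h.memLp w).1 (Eventually.of_forall (h.norm_le w))

lemma norm_kernelFun_le (h : IsBoundedKernel κ C) {f : ℝ → ℂ} (hf : Integrable f unitMeasure)
    (w : ℝ) : ‖kernelFun κ f w‖ ≤ C * ∫ x, ‖f x‖ ∂unitMeasure := by
  rw [← integral_const_mul]
  refine norm_integral_le_of_norm_le (hf.norm.const_mul C) (Eventually.of_forall fun x => ?_)
  rw [norm_mul]
  exact mul_le_mul_of_nonneg_right (h.norm_le w x) (norm_nonneg _)

lemma aestronglyMeasurable_kernelFun (h : IsBoundedKernel κ C) {f : ℝ → ℂ}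
    (hf : Integrable f unitMeasure) : AEStronglyMeasurable (kernelFun κ f) unitMeasure := by
  refine AEStronglyMeasurable.integral_prod_right' (f := fun p : ℝ × ℝ => (κ p.1 p.2 : ℂ) * f p.2) ?_
  refine AEStronglyMeasurable.mul ?_ hf.1.comp_snd
  exact (Complex.measurable_ofReal.comp h.meas).aestronglyMeasurable

lemma memLp_kernelFun (h : IsBoundedKernel κ C) {f : ℝ → ℂ} (hf : Integrable f unitMeasure) :
    MemLp (kernelFun κ f) 2 unitMeasure :=
  MemLp.of_bound (h.aestronglyMeasurable_kernelFun hf) _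
    (Eventually.of_forall (h.norm_kernelFun_le hf))

lemma norm_toLp_kernelFun_le (h : IsBoundedKernel κ C) (f : H) :
    ‖(h.memLp_kernelFun (integrable_coe f)).toLp‖ ≤ C * ‖f‖ := by
  have hC := mul_nonneg h.nonneg (norm_nonneg f)
  rw [Lp.norm_toLp]
  refine ENNReal.toReal_le_of_le_ofReal hC ?_
  refine (eLpNorm_le_of_ae_bound (C := C * ‖f‖) (Eventually.of_forall fun w => ?_)).trans ?_
  · refine (h.norm_kernelFun_le (integrable_coe f) w).trans ?_
    exact mul_le_mul_of_nonneg_left (integral_norm_le f) h.nonneg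
  · simp

lemma kernelFun_congr {f g : ℝ → ℂ} (hfg : f =ᵐ[unitMeasure] g) : kernelFun κ f = kernelFun κ g := by
  ext w
  refine integral_congr_ae ?_
  filter_upwards [hfg] with x hx
  rw [hx]

/-- The integral operator with kernel `κ`. -/
def toCLM (h : IsBoundedKernel κ C) : H →L[ℂ] H :=
  LinearMap.mkContinuous
    { toFun := fun f => (h.memLp_kernelFun (integrable_coe f)).toLp
      map_add' := fun f g => by
        rw [← MemLp.toLp_add]
        congr 1
        rw [kernelFun_congr (Lp.coeFn_add f g)]
        ext w
        simp only [kernelFun, Pi.add_apply, mul_add]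
        exact integral_add (h.integrable_mul (integrable_coe f) w)
          (h.integrable_mul (integrable_coe g) w)
      map_smul' := fun c f => by
        rw [RingHom.id_apply, ← MemLp.toLp_const_smul]
        congr 1
        rw [kernelFun_congr (Lp.coeFn_smul c f)]
        ext w
        simp only [kernelFun, Pi.smul_apply, smul_eq_mul, mul_left_comm _ c]
        exact integral_const_mul _ _ }
    C h.norm_toLp_kernelFun_le

lemma toCLM_ae (h : IsBoundedKernel κ C) (f : H) : h.toCLM f =ᵐ[unitMeasure] kernelFun κ f :=
  MemLp.coeFn_toLp (h.memLp_kernelFun (integrable_coe f))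

lemma adjoint_toCLM (h : IsBoundedKernel κ C) :
    ContinuousLinearMap.adjoint h.toCLM = h.swap.toCLM := by
  symm
  rw [ContinuousLinearMap.eq_adjoint_iff]
  intro f g
  rw [L2.inner_def, L2.inner_def]
  have e1 : ∀ᵐ w ∂unitMeasure, inner ℂ (h.swap.toCLM f w) (g w) =
      ∫ x, inner ℂ ((κ x w : ℂ) * f x) (g w) ∂unitMeasure := by
    filter_upwards [h.swap.toCLM_ae f] with w hw
    rw [hw, kernelFun]
    simp only [RCLike.inner_apply]
    rw [← integral_conj, ← integral_const_mul]
  have e2 : ∀ᵐ x ∂unitMeasure, inner ℂ (f x) (h.toCLM g x) =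
      ∫ w, inner ℂ ((κ x w : ℂ) * f x) (g w) ∂unitMeasure := by
    filter_upwards [h.toCLM_ae g] with x hx
    rw [hx, kernelFun]
    simp only [RCLike.inner_apply, map_mul, Complex.conj_ofReal]
    rw [← integral_mul_const]
    congr 1; ext w; ring
  rw [integral_congr_ae e1, integral_congr_ae e2]
  refine integral_integral_swap ?_
  have : Integrable (fun p : ℝ × ℝ => g p.1 * (starRingEnd ℂ) (f p.2))
      (unitMeasure.prod unitMeasure) :=
    (integrable_coe g).mul_prod (RCLike.conjCLE.integrable_comp_iff.2 (integrable_coe f))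
  have h2 := this.bdd_mul (c := C) (f := fun p : ℝ × ℝ => (κ p.2 p.1 : ℂ))
    (Complex.measurable_ofReal.comp h.swap.meas).aestronglyMeasurable
    (Eventually.of_forall fun p => h.norm_le _ _)
  refine h2.congr (Eventually.of_forall fun p => ?_)
  simp only [Function.uncurry, RCLike.inner_apply, map_mul, Complex.conj_ofReal]
  ring

/-- As the kernel is real, no conjugate appears. For fixed w, Bessel and Parseval can then be
applied to the vector κ(w, ·). -/
lemma kernelFun_eq_inner (h : IsBoundedKernel κ C) (f : H) (w : ℝ) :
    kernelFun κ f w = inner ℂ ((h.memLp w).toLp) f := by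
  rw [L2.inner_def]
  refine integral_congr_ae ?_
  filter_upwards [(h.memLp w).coeFn_toLp] with x hx
  rw [hx]
  simp [mul_comm]

lemma norm_sq_toCLM (h : IsBoundedKernel κ C) (f : H) :
    ‖h.toCLM f‖ ^ 2 = ∫ w, ‖kernelFun κ f w‖ ^ 2 ∂unitMeasure := by
  have e0 : (fun w => ‖h.toCLM f w‖ ^ 2) =ᵐ[unitMeasure] fun w => ‖kernelFun κ f w‖ ^ 2 := by
    filter_upwards [h.toCLM_ae f] with w hw
    rw [hw]
  rw [← integral_congr_ae e0]
  have := @inner_self_eq_norm_sq ℂ H _ _ _ (h.toCLM f)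
  rw [← this, L2.inner_def]
  have e : ∀ w, inner ℂ (h.toCLM f w) (h.toCLM f w) = ((‖h.toCLM f w‖ ^ 2 : ℝ) : ℂ) := by
    intro w; rw [inner_self_eq_norm_sq_to_K]; norm_cast
  simp_rw [e]
  rw [integral_complex_ofReal]
  simp

lemma integrable_norm_sq_kernelFun (h : IsBoundedKernel κ C) (f : H) :
    Integrable (fun w => ‖kernelFun κ f w‖ ^ 2) unitMeasure :=
  (memLp_two_iff_integrable_sq_norm (h.aestronglyMeasurable_kernelFun (integrable_coe f))).1
    (h.memLp_kernelFun (integrable_coe f))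

lemma norm_toLp_sq (h : IsBoundedKernel κ C) (w : ℝ) :
    ‖(h.memLp w).toLp‖ ^ 2 = ∫ x, κ w x ^ 2 ∂unitMeasure := by
  have := @inner_self_eq_norm_sq ℂ H _ _ _ ((h.memLp w).toLp)
  rw [← this, L2.inner_def]
  have e : ∀ᵐ x ∂unitMeasure, inner ℂ (((h.memLp w).toLp : H) x) (((h.memLp w).toLp : H) x) =
      ((κ w x ^ 2 : ℝ) : ℂ) := by
    filter_upwards [(h.memLp w).coeFn_toLp] with x hx
    rw [hx, inner_self_eq_norm_sq_to_K]; simp [← Complex.ofReal_pow]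
  rw [integral_congr_ae e, integral_complex_ofReal]
  simp

lemma integral_sq_le (h : IsBoundedKernel κ C) (w : ℝ) : ∫ x, κ w x ^ 2 ∂unitMeasure ≤ C ^ 2 := by
  have h2 : ∫ _x : ℝ, C ^ 2 ∂unitMeasure = C ^ 2 := by simp
  rw [← h2]
  refine integral_mono_of_nonneg (Eventually.of_forall fun x => sq_nonneg _) (integrable_const _)
    (Eventually.of_forall fun (x : ℝ) => ?_)
  exact sq_le_sq' (by have := abs_le.1 (h.bound w x); linarith) (abs_le.1 (h.bound w x)).2

lemma integrable_integral_sq (h : IsBoundedKernel κ C) :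
    Integrable (fun w => ∫ x, κ w x ^ 2 ∂unitMeasure) unitMeasure := by
  refine Integrable.of_bound (C := C ^ 2) ?_ (Eventually.of_forall fun w => ?_)
  · exact AEStronglyMeasurable.integral_prod_right' (f := fun p : ℝ × ℝ => κ p.1 p.2 ^ 2)
      (h.meas.pow_const 2).aestronglyMeasurable
  · rw [Real.norm_eq_abs, abs_of_nonneg (integral_nonneg fun (x : ℝ) => sq_nonneg (κ w x))]
    exact h.integral_sq_le w

lemma sum_norm_sq_kernelFun_le (h : IsBoundedKernel κ C) {ι : Type*} {v : ι → H}
    (hv : Orthonormal ℂ v) (s : Finset ι) (w : ℝ) :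
    ∑ i ∈ s, ‖kernelFun κ (v i) w‖ ^ 2 ≤ ∫ x, κ w x ^ 2 ∂unitMeasure := by
  rw [← h.norm_toLp_sq w]
  refine le_trans (le_of_eq ?_) (hv.sum_inner_products_le (s := s) ((h.memLp w).toLp))
  refine Finset.sum_congr rfl fun i _ => ?_
  rw [h.kernelFun_eq_inner, norm_inner_symm]

lemma sum_norm_sq_toCLM_le (h : IsBoundedKernel κ C) {ι : Type*} {v : ι → H}
    (hv : Orthonormal ℂ v) (s : Finset ι) :
    ∑ i ∈ s, ‖h.toCLM (v i)‖ ^ 2 ≤ ∫ w, ∫ x, κ w x ^ 2 ∂unitMeasure ∂unitMeasure := by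
  simp_rw [h.norm_sq_toCLM]
  rw [← integral_finsetSum _ fun i _ => h.integrable_norm_sq_kernelFun _]
  exact integral_mono (integrable_finsetSum _ fun i _ => h.integrable_norm_sq_kernelFun _)
    h.integrable_integral_sq (h.sum_norm_sq_kernelFun_le hv s)

lemma summable_norm_sq_toCLM (h : IsBoundedKernel κ C) {ι : Type*} {v : ι → H}
    (hv : Orthonormal ℂ v) : Summable fun i => ‖h.toCLM (v i)‖ ^ 2 :=
  summable_of_sum_le (fun _ => sq_nonneg _) (h.sum_norm_sq_toCLM_le hv)

lemma isCompactOperator (h : IsBoundedKernel κ C) : IsCompactOperator h.toCLM := by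
  obtain ⟨w, b, -⟩ := exists_hilbertBasis ℂ H
  exact isCompactOperator_of_summable_norm_sq b _ (h.summable_norm_sq_toCLM b.orthonormal)

/-- The Hilbert–Schmidt norm of an integral operator. -/
lemma hasSum_norm_sq_toCLM (h : IsBoundedKernel κ C) {ι : Type*} [Countable ι]
    (b : HilbertBasis ι ℂ H) : HasSum (fun i => ‖h.toCLM (b i)‖ ^ 2)
      (∫ w, ∫ x, κ w x ^ 2 ∂unitMeasure ∂unitMeasure) := by
  have e : ∀ i w, ‖‖kernelFun κ (b i) w‖ ^ 2‖ = ‖kernelFun κ (b i) w‖ ^ 2 := fun i w => by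
    rw [Real.norm_eq_abs, abs_of_nonneg (sq_nonneg _)]
  have := hasSum_integral_of_summable_integral_norm (μ := unitMeasure)
    (F := fun i w => ‖kernelFun κ (b i) w‖ ^ 2) (fun i => h.integrable_norm_sq_kernelFun _)
    (by simp_rw [e, ← h.norm_sq_toCLM]; exact h.summable_norm_sq_toCLM b.orthonormal)
  simp_rw [← h.norm_sq_toCLM] at this
  have e1 : ∫ w, ∫ x, κ w x ^ 2 ∂unitMeasure ∂unitMeasure =
      ∫ w, ∑' i, ‖kernelFun κ (b i) w‖ ^ 2 ∂unitMeasure := ?_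
  · rw [e1]; exact this
  refine integral_congr_ae (Eventually.of_forall fun w => ?_)
  simp only
  rw [← h.norm_toLp_sq w]
  -- Parseval for the section κ(w, ·), at each w separately.
  have h2 := b.hasSum_inner_mul_inner ((h.memLp w).toLp) ((h.memLp w).toLp)
  have h3 : ∀ i, inner ℂ ((h.memLp w).toLp) (b i) * inner ℂ (b i) ((h.memLp w).toLp) =
      ((‖kernelFun κ (b i) w‖ ^ 2 : ℝ) : ℂ) := by
    intro i
    rw [h.kernelFun_eq_inner, ← inner_conj_symm (b i), Complex.mul_conj, Complex.normSq_eq_norm_sq]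
  simp_rw [h3] at h2
  rw [inner_self_eq_norm_sq_to_K] at h2
  have h4 : HasSum (fun i => ‖kernelFun κ (b i) w‖ ^ 2) (‖(h.memLp w).toLp‖ ^ 2) := by
    refine Complex.hasSum_ofReal.1 ?_
    simpa using h2
  exact h4.tsum_eq.symm

end IsBoundedKernel

end

section

/-! ### The Green operator of a positive regular solution -/

/-- A regular solution that is positive on `(0,1]`. -/
structure IsPositiveSolution (m b : ℝ) (Q φ dφ : ℝ → ℝ) (φ₁ d₁ : ℝ) : Prop extends
    IsRegularSolution m b Q φ dφ φ₁ d₁ where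
  m_nonneg : 0 ≤ m
  pos : ∀ x ∈ Ioo (0 : ℝ) 1, 0 < φ x
  pos_one : 0 < φ₁

/-- The integral of `φ f` over `(0,w)`. -/
def leftIntegral (φ : ℝ → ℝ) (f : ℝ → ℂ) (w : ℝ) : ℂ := ∫ x in 0..w, (φ x : ℂ) * f x

/-- The triangle `0 < x < w < 1` of pairs `(w, x)`. -/
def triangle : Set (ℝ × ℝ) := {p | 0 < p.2 ∧ p.2 < p.1 ∧ p.1 < 1}

lemma mem_triangle {w x : ℝ} (h1 : 0 < x) (h2 : x < w) (h3 : w < 1) : (w, x) ∈ triangle :=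
  ⟨h1, h2, h3⟩

/-- The kernel `φ(x) / φ(w)`, `x < w`. -/
def greenKernel (φ : ℝ → ℝ) (w x : ℝ) : ℝ :=
  triangle.indicator (fun p => φ p.2 / φ p.1) (w, x)

variable {m b φ₁ d₁ : ℝ} {Q φ dφ : ℝ → ℝ}

lemma IsRegularSolution.continuousOn (h : IsRegularSolution m b Q φ dφ φ₁ d₁) :
    ContinuousOn φ (Ioo 0 1) :=
  fun x hx => (h.hasDerivAt x hx).continuousAt.continuousWithinAt

lemma IsRegularSolution.exists_upper_bound (h : IsRegularSolution m b Q φ dφ φ₁ d₁) :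
    ∃ C, 0 ≤ C ∧ ∀ x ∈ Ioo (0 : ℝ) 1, |φ x| ≤ C * x ^ m := by
  have hp : ∀ x ∈ Ioo (0 : ℝ) 1, 0 < x ^ m := fun x hx => Real.rpow_pos_of_pos hx.1 m
  have hc : ContinuousOn (fun x => φ x / x ^ m) (Ioo 0 1) :=
    h.continuousOn.div (continuousOn_id.rpow_const fun x hx => Or.inl (ne_of_gt hx.1))
      fun x hx => (hp x hx).ne'
  have h1 : Tendsto (fun x : ℝ => φ x / x ^ m) (𝓝[<] 1) (𝓝 (φ₁ / 1)) := by
    refine h.right.div ?_ one_ne_zero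
    have : Tendsto (fun x : ℝ => x ^ m) (𝓝 1) (𝓝 (1 ^ m)) :=
      (Real.continuousAt_rpow_const 1 m (Or.inl one_ne_zero)).tendsto
    rw [Real.one_rpow] at this
    exact this.mono_left nhdsWithin_le_nhds
  obtain ⟨R, hR⟩ := exists_bound_of_tendsto hc h.left h1
  refine ⟨R, (abs_nonneg _).trans (hR (1 / 2) (by norm_num)), fun x hx => ?_⟩
  have := hR x hx
  rwa [abs_div, abs_of_pos (hp x hx), div_le_iff₀ (hp x hx)] at this

namespace IsPositiveSolution

lemma exists_lower_bound (h : IsPositiveSolution m b Q φ dφ φ₁ d₁) :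
    ∃ c, 0 < c ∧ ∀ x ∈ Ioo (0 : ℝ) 1, c * x ^ m ≤ φ x := by
  have hp : ∀ x ∈ Ioo (0 : ℝ) 1, 0 < x ^ m := fun x hx => Real.rpow_pos_of_pos hx.1 m
  have hc : ContinuousOn (fun x => (φ x / x ^ m)⁻¹) (Ioo 0 1) :=
    (h.continuousOn.div (continuousOn_id.rpow_const fun x hx => Or.inl (ne_of_gt hx.1))
      fun x hx => (hp x hx).ne').inv₀ fun x hx => (div_pos (h.pos x hx) (hp x hx)).ne'
  have h0 := h.left.inv₀ one_ne_zero
  have h1 : Tendsto (fun x : ℝ => (φ x / x ^ m)⁻¹) (𝓝[<] 1) (𝓝 (φ₁ / 1)⁻¹) := by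
    refine Tendsto.inv₀ (h.right.div ?_ one_ne_zero) (by simpa using h.pos_one.ne')
    have : Tendsto (fun x : ℝ => x ^ m) (𝓝 1) (𝓝 (1 ^ m)) :=
      (Real.continuousAt_rpow_const 1 m (Or.inl one_ne_zero)).tendsto
    rw [Real.one_rpow] at this
    exact this.mono_left nhdsWithin_le_nhds
  obtain ⟨R, hR⟩ := exists_bound_of_tendsto hc h0 h1
  have R0 : 0 < R := by
    have h2 : (1 / 2 : ℝ) ∈ Ioo (0 : ℝ) 1 := by norm_num
    refine lt_of_lt_of_le (abs_pos.2 ?_) (hR _ h2)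
    exact (inv_pos.2 (div_pos (h.pos _ h2) (hp _ h2))).ne'
  refine ⟨R⁻¹, inv_pos.2 R0, fun x hx => ?_⟩
  have h3 := div_pos (h.pos x hx) (hp x hx)
  have := hR x hx
  rw [abs_of_pos (inv_pos.2 h3), inv_le_comm₀ h3 R0, le_div_iff₀ (hp x hx)] at this
  exact this

/-- A positive regular solution is bounded above and below by multiples of x^m, and m ≥ 0; hence
φ(x)/φ(w) is bounded by a multiple of (x/w)^m ≤ 1 for x < w. -/
lemma exists_isBoundedKernel (h : IsPositiveSolution m b Q φ dφ φ₁ d₁) :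
    ∃ C, IsBoundedKernel (greenKernel φ) C := by
  obtain ⟨c, hc, hl⟩ := h.exists_lower_bound
  obtain ⟨C, hC, hu⟩ := h.exists_upper_bound
  refine ⟨C / c, ?_, fun w x => ?_⟩
  · set ψ := (Ioo (0 : ℝ) 1).indicator φ with hψ
    have mψ : Measurable ψ := by
      have := h.continuousOn.measurable_piecewise (g := fun _ => (0 : ℝ)) continuousOn_const
        measurableSet_Ioo
      convert this using 1
      ext x
      simp [hψ, indicator, piecewise]
    have e : Function.uncurry (greenKernel φ) = triangle.indicator
        (fun p => ψ p.2 / ψ p.1) := by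
      ext ⟨w, x⟩
      simp only [Function.uncurry, greenKernel]
      by_cases hp : ((w, x) : ℝ × ℝ) ∈ triangle
      · obtain ⟨h1, h2, h3⟩ := hp
        simp only at h1 h2 h3
        rw [indicator_of_mem (mem_triangle h1 h2 h3), indicator_of_mem (mem_triangle h1 h2 h3)]
        simp only [hψ]
        rw [indicator_of_mem (show x ∈ Ioo (0 : ℝ) 1 from ⟨h1, h2.trans h3⟩),
          indicator_of_mem (show w ∈ Ioo (0 : ℝ) 1 from ⟨h1.trans h2, h3⟩)]
      · rw [indicator_of_notMem hp, indicator_of_notMem hp]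
    rw [e]
    refine Measurable.indicator ((mψ.comp measurable_snd).div (mψ.comp measurable_fst)) ?_
    exact (measurableSet_lt measurable_const measurable_snd).inter
      ((measurableSet_lt measurable_snd measurable_fst).inter
        (measurableSet_lt measurable_fst measurable_const))
  · rw [greenKernel]
    by_cases hp : ((w, x) : ℝ × ℝ) ∈ triangle
    · obtain ⟨h1, h2, h3⟩ := id hp
      simp only at h1 h2 h3
      rw [indicator_of_mem hp]
      have hx : x ∈ Ioo (0 : ℝ) 1 := ⟨h1, h2.trans h3⟩
      have hw : w ∈ Ioo (0 : ℝ) 1 := ⟨h1.trans h2, h3⟩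
      have w0 : 0 < w ^ m := Real.rpow_pos_of_pos hw.1 m
      have xw : x ^ m ≤ w ^ m := Real.rpow_le_rpow h1.le h2.le h.m_nonneg
      rw [abs_div, abs_of_pos (h.pos w hw), div_le_div_iff₀ (h.pos w hw) hc]
      calc |φ x| * c ≤ C * x ^ m * c := mul_le_mul_of_nonneg_right (hu x hx) hc.le
        _ ≤ C * w ^ m * c := by gcongr
        _ = C * (c * w ^ m) := by ring
        _ ≤ C * φ w := mul_le_mul_of_nonneg_left (hl w hw) hC
    · rw [indicator_of_notMem hp, abs_zero]
      positivity

end IsPositiveSolution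

lemma IsRegularSolution.exists_norm_bound (h : IsRegularSolution m b Q φ dφ φ₁ d₁) (hm : 0 ≤ m) :
    ∃ C, 0 ≤ C ∧ ∀ x ∈ Ioo (0 : ℝ) 1, ‖(φ x : ℂ)‖ ≤ C := by
  obtain ⟨C, hC, hu⟩ := h.exists_upper_bound
  refine ⟨C, hC, fun x hx => ?_⟩
  rw [Complex.norm_real]
  refine (hu x hx).trans ?_
  have := Real.rpow_le_one hx.1.le hx.2.le hm
  nlinarith

lemma IsRegularSolution.aestronglyMeasurable (h : IsRegularSolution m b Q φ dφ φ₁ d₁) :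
    AEStronglyMeasurable (fun x => (φ x : ℂ)) unitMeasure :=
  (Complex.continuous_ofReal.comp_continuousOn h.continuousOn).aestronglyMeasurable measurableSet_Ioo

lemma IsRegularSolution.memLp (h : IsRegularSolution m b Q φ dφ φ₁ d₁) (hm : 0 ≤ m) :
    MemLp (fun x => (φ x : ℂ)) 2 unitMeasure := by
  obtain ⟨C, -, hC⟩ := h.exists_norm_bound hm
  exact MemLp.of_bound h.aestronglyMeasurable C
    ((ae_restrict_iff' measurableSet_Ioo).2 (Eventually.of_forall hC))

lemma IsRegularSolution.integrable_mul (h : IsRegularSolution m b Q φ dφ φ₁ d₁) (hm : 0 ≤ m)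
    {f : ℝ → ℂ} (hf : Integrable f unitMeasure) :
    Integrable (fun x => (φ x : ℂ) * f x) unitMeasure := by
  obtain ⟨C, -, hC⟩ := h.exists_norm_bound hm
  exact hf.bdd_mul h.aestronglyMeasurable
    ((ae_restrict_iff' measurableSet_Ioo).2 (Eventually.of_forall hC))

lemma intervalIntegrable_of_integrable {f : ℝ → ℂ} (hf : Integrable f unitMeasure) :
    IntervalIntegrable f volume 0 1 := by
  rw [intervalIntegrable_iff_integrableOn_Ioo_of_le zero_le_one]
  exact hf

/-- The primitive of an integrable function is absolutely continuous. -/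
lemma absolutelyContinuousOnInterval_primitive {f : ℝ → ℂ} {x y : ℝ} (c : ℝ)
    (hf : IntervalIntegrable f volume x y) (hc : c ∈ uIcc x y) :
    AbsolutelyContinuousOnInterval (fun u => ∫ t in c..u, f t) x y := by
  have h1 := hf.norm.absolutelyContinuousOnInterval_intervalIntegral hc
  have hi : ∀ u ∈ uIcc x y, IntervalIntegrable f volume c u := fun u hu =>
    hf.mono_set (uIcc_subset_uIcc hc hu)
  refine squeeze_zero' (Eventually.of_forall fun E => Finset.sum_nonneg fun i _ => dist_nonneg)
    ?_ h1
  refine eventually_inf_principal.2 (Eventually.of_forall fun E hE => ?_)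
  refine Finset.sum_le_sum fun i hi' => ?_
  have e₁ := hi _ (hE.1 i hi').1
  have e₂ := hi _ (hE.1 i hi').2
  rw [dist_eq_norm, dist_eq_norm, intervalIntegral.integral_interval_sub_left e₁ e₂,
    intervalIntegral.integral_interval_sub_left e₁.norm e₂.norm]
  exact intervalIntegral.norm_integral_le_abs_integral_norm

lemma setIntegral_Ioo_eq (f : ℝ → ℂ) {x y : ℝ} (h : x ≤ y) : ∫ t in Ioo x y, f t = ∫ t in x..y, f t := by
  rw [intervalIntegral.integral_of_le h, integral_Ioc_eq_integral_Ioo]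

lemma kernelFun_greenKernel (f : ℝ → ℂ) {w : ℝ} (hw : w ∈ Ioo (0 : ℝ) 1) :
    kernelFun (greenKernel φ) f w = leftIntegral φ f w / φ w := by
  have e : ∀ x, (greenKernel φ w x : ℂ) * f x =
      (Ioo 0 w).indicator (fun x => (φ x : ℂ) * f x / φ w) x := by
    intro x
    rw [greenKernel]
    by_cases hx : x ∈ Ioo 0 w
    · rw [indicator_of_mem hx, indicator_of_mem (mem_triangle hx.1 hx.2 hw.2)]
      push_cast; ring
    · rw [indicator_of_notMem hx, indicator_of_notMem fun hp => hx ⟨hp.1, hp.2.1⟩]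
      simp
  rw [kernelFun, leftIntegral, ← setIntegral_Ioo_eq _ hw.1.le]
  simp_rw [e]
  rw [integral_indicator measurableSet_Ioo, Measure.restrict_restrict_of_subset
    (Ioo_subset_Ioo_right hw.2.le), integral_div]

lemma kernelFun_greenKernel_swap (f : ℝ → ℂ) {x : ℝ} (hx : x ∈ Ioo (0 : ℝ) 1) :
    kernelFun (fun w x => greenKernel φ x w) f x = φ x * ∫ w in x..1, f w / φ w := by
  have e : ∀ w, (greenKernel φ w x : ℂ) * f w =
      (Ioo x 1).indicator (fun w => (φ x : ℂ) * (f w / φ w)) w := by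
    intro w
    rw [greenKernel]
    by_cases hw : w ∈ Ioo x 1
    · rw [indicator_of_mem hw, indicator_of_mem (mem_triangle hx.1 hw.1 hw.2)]
      push_cast; ring
    · rw [indicator_of_notMem hw, indicator_of_notMem fun hp => hw ⟨hp.2.1, hp.2.2⟩]
      simp
  rw [kernelFun, ← setIntegral_Ioo_eq _ hx.2.le]
  simp_rw [e]
  rw [integral_indicator measurableSet_Ioo, Measure.restrict_restrict_of_subset
    (Ioo_subset_Ioo_left hx.1.le), integral_const_mul]

end

/-! ### Solving the inhomogeneous equation by the Green kernel. -/

section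

variable {m b φ₁ d₁ : ℝ} {Q φ dφ : ℝ → ℝ} {f : ℝ → ℂ}

lemma absolutelyContinuousOnInterval_of_hasDerivAt {g g' : ℝ → ℂ}
    (hg : ∀ x ∈ Ioo (0 : ℝ) 1, HasDerivAt g (g' x) x) (hc : ContinuousOn g' (Ioo 0 1))
    {x y : ℝ} (hx : x ∈ Ioo (0 : ℝ) 1) (hy : y ∈ Ioo (0 : ℝ) 1) :
    AbsolutelyContinuousOnInterval g x y := by
  have hsub : uIcc x y ⊆ Ioo (0 : ℝ) 1 := ordConnected_Ioo.uIcc_subset hx hy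
  obtain ⟨K, hK⟩ := isCompact_uIcc.exists_bound_of_continuousOn (hc.mono hsub)
  have : LipschitzOnWith K.toNNReal g (uIcc x y) := by
    refine (convex_uIcc x y).lipschitzOnWith_of_nnnorm_hasDerivWithin_le
      (fun t ht => (hg t (hsub ht)).hasDerivWithinAt) fun t ht => ?_
    rw [← NNReal.coe_le_coe, coe_nnnorm]
    exact (hK t ht).trans (Real.le_coe_toNNReal K)
  exact this.absolutelyContinuousOnInterval

/-- The integral of `φ⁻² ∫ φ f` over `(x,1)`. -/
def greenTail (φ : ℝ → ℝ) (f : ℝ → ℂ) (x : ℝ) : ℂ :=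
  ∫ w in x..1, leftIntegral φ f w / (φ w : ℂ) ^ 2

namespace IsRegularSolution

lemma continuousOn_leftIntegral (h : IsRegularSolution m b Q φ dφ φ₁ d₁) (hm : 0 ≤ m)
    (hf : Integrable f unitMeasure) : ContinuousOn (leftIntegral φ f) (Icc 0 1) := by
  have hi := intervalIntegrable_of_integrable (h.integrable_mul hm hf)
  have := intervalIntegral.continuousOn_primitive_interval (f := fun x => (φ x : ℂ) * f x)
    (a := 0) (b := 1) (μ := volume)
  rw [uIcc_of_le zero_le_one] at this
  exact this ((intervalIntegrable_iff_integrableOn_Icc_of_le zero_le_one).1 hi)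

lemma tendsto_leftIntegral_zero (h : IsRegularSolution m b Q φ dφ φ₁ d₁) (hm : 0 ≤ m)
    (hf : Integrable f unitMeasure) : Tendsto (leftIntegral φ f) (𝓝[>] 0) (𝓝 0) := by
  have h1 := (h.continuousOn_leftIntegral hm hf) 0 (by simp)
  have h2 : leftIntegral φ f 0 = 0 := by simp [leftIntegral]
  rw [ContinuousWithinAt, h2] at h1
  exact h1.mono_left nhdsGT_zero_le

lemma tendsto_leftIntegral_one (h : IsRegularSolution m b Q φ dφ φ₁ d₁) (hm : 0 ≤ m)
    (hf : Integrable f unitMeasure) :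
    Tendsto (leftIntegral φ f) (𝓝[<] 1) (𝓝 (leftIntegral φ f 1)) :=
  ((h.continuousOn_leftIntegral hm hf) 1 (by simp)).mono_left nhdsLT_one_le

lemma ae_hasDerivAt_leftIntegral (h : IsRegularSolution m b Q φ dφ φ₁ d₁) (hm : 0 ≤ m)
    (hf : Integrable f unitMeasure) :
    ∀ᵐ x ∂unitMeasure, HasDerivAt (leftIntegral φ f) (φ x * f x) x := by
  have hi := intervalIntegrable_of_integrable (h.integrable_mul hm hf)
  rw [ae_restrict_iff' measurableSet_Ioo]
  filter_upwards [hi.ae_hasDerivAt_integral] with x hx hx'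
  exact hx (by rw [uIcc_of_le zero_le_one]; exact Ioo_subset_Icc_self hx') 0 (by simp)

lemma absolutelyContinuousOnInterval_leftIntegral (h : IsRegularSolution m b Q φ dφ φ₁ d₁)
    (hm : 0 ≤ m) (hf : Integrable f unitMeasure) :
    AbsolutelyContinuousOnInterval (leftIntegral φ f) 0 1 :=
  absolutelyContinuousOnInterval_primitive 0
    (intervalIntegrable_of_integrable (h.integrable_mul hm hf)) (by simp)

end IsRegularSolution

namespace IsPositiveSolution

lemma continuousOn_tail_integrand (h : IsPositiveSolution m b Q φ dφ φ₁ d₁)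
    (hf : Integrable f unitMeasure) :
    ContinuousOn (fun w => leftIntegral φ f w / (φ w : ℂ) ^ 2) (Ioo 0 1) := by
  refine ((h.continuousOn_leftIntegral h.m_nonneg hf).mono Ioo_subset_Icc_self).div
    ((Complex.continuous_ofReal.comp_continuousOn h.continuousOn).pow 2) fun x hx => ?_
  exact pow_ne_zero 2 (by exact_mod_cast (h.pos x hx).ne')

lemma exists_tail_integrand_bound (h : IsPositiveSolution m b Q φ dφ φ₁ d₁)
    (hf : Integrable f unitMeasure) {x : ℝ} (hx : x ∈ Ioo (0 : ℝ) 1) :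
    ∃ M, ∀ w ∈ Ico x 1, ‖leftIntegral φ f w / (φ w : ℂ) ^ 2‖ ≤ M := by
  obtain ⟨R, hR⟩ := isCompact_Icc.exists_bound_of_continuousOn
    (h.continuousOn_leftIntegral h.m_nonneg hf)
  obtain ⟨c, hc, hl⟩ := h.exists_lower_bound
  have x0 := Real.rpow_pos_of_pos hx.1 m
  refine ⟨R / (c * x ^ m) ^ 2, fun w hw => ?_⟩
  have hw' : w ∈ Ioo (0 : ℝ) 1 := ⟨hx.1.trans_le hw.1, hw.2⟩
  have h1 := hR w (Ioo_subset_Icc_self hw')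
  rw [norm_div, norm_pow, Complex.norm_real, Real.norm_eq_abs, abs_of_pos (h.pos w hw')]
  have h2 : c * x ^ m ≤ φ w := (mul_le_mul_of_nonneg_left
    (Real.rpow_le_rpow hx.1.le hw.1 h.m_nonneg) hc.le).trans (hl w hw')
  have h3 : 0 < c * x ^ m := mul_pos hc x0
  gcongr
  exact (norm_nonneg _).trans h1

lemma intervalIntegrable_tail (h : IsPositiveSolution m b Q φ dφ φ₁ d₁)
    (hf : Integrable f unitMeasure) {x : ℝ} (hx : x ∈ Ioo (0 : ℝ) 1) :
    IntervalIntegrable (fun w => leftIntegral φ f w / (φ w : ℂ) ^ 2) volume x 1 := by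
  obtain ⟨M, hM⟩ := h.exists_tail_integrand_bound hf hx
  rw [intervalIntegrable_iff_integrableOn_Ioo_of_le hx.2.le]
  refine Integrable.of_bound (C := M) ?_ ?_
  · exact ((h.continuousOn_tail_integrand hf).mono (Ioo_subset_Ioo_left hx.1.le)).aestronglyMeasurable
      measurableSet_Ioo
  · exact (ae_restrict_iff' measurableSet_Ioo).2 (Eventually.of_forall fun w hw => hM w ⟨hw.1.le, hw.2⟩)

lemma hasDerivAt_greenTail (h : IsPositiveSolution m b Q φ dφ φ₁ d₁)
    (hf : Integrable f unitMeasure) {x : ℝ} (hx : x ∈ Ioo (0 : ℝ) 1) :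
    HasDerivAt (greenTail φ f) (-(leftIntegral φ f x / (φ x : ℂ) ^ 2)) x :=
  intervalIntegral.integral_hasDerivAt_left (h.intervalIntegrable_tail hf hx)
    ((h.continuousOn_tail_integrand hf).stronglyMeasurableAtFilter isOpen_Ioo x hx)
    ((h.continuousOn_tail_integrand hf).continuousAt (Ioo_mem_nhds hx.1 hx.2))

lemma tendsto_greenTail_one (h : IsPositiveSolution m b Q φ dφ φ₁ d₁)
    (hf : Integrable f unitMeasure) : Tendsto (greenTail φ f) (𝓝[<] 1) (𝓝 0) := by
  obtain ⟨M, hM⟩ := h.exists_tail_integrand_bound hf (x := 1 / 2) (by norm_num)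
  have h1 : Tendsto (fun x : ℝ => M * |1 - x|) (𝓝[<] 1) (𝓝 0) := by
    have : Tendsto (fun x : ℝ => M * |1 - x|) (𝓝 1) (𝓝 (M * |1 - 1|)) := by
      apply Continuous.tendsto; fun_prop
    simp only [sub_self, abs_zero, mul_zero] at this
    exact this.mono_left nhdsWithin_le_nhds
  refine squeeze_zero_norm' ?_ h1
  filter_upwards [Ioo_mem_nhdsLT (show (1 / 2 : ℝ) < 1 by norm_num)] with x hx
  rw [greenTail, intervalIntegral.integral_of_le hx.2.le, integral_Ioc_eq_integral_Ioo,
    ← integral_Ioc_eq_integral_Ioo]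
  have : ∀ᵐ w : ℝ, w ∈ uIoc x 1 → ‖leftIntegral φ f w / (φ w : ℂ) ^ 2‖ ≤ M := by
    have h2 : ∀ᵐ w : ℝ, w ≠ 1 := by simp [ae_iff, measure_singleton]
    filter_upwards [h2] with w hw hw'
    rw [uIoc_of_le hx.2.le] at hw'
    exact hM w ⟨hx.1.le.trans hw'.1.le, lt_of_le_of_ne hw'.2 hw⟩
  rw [← intervalIntegral.integral_of_le hx.2.le]
  exact intervalIntegral.norm_integral_le_of_norm_le_const_ae this

/-- The solution of `-u'' + Q u = f` with the Green kernel. -/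
def greenSol (φ : ℝ → ℝ) (f : ℝ → ℂ) (c : ℂ) (x : ℝ) : ℂ := φ x * (c + greenTail φ f x)

/-- The derivative of `greenSol`. -/
def dgreenSol (φ dφ : ℝ → ℝ) (f : ℝ → ℂ) (c : ℂ) (x : ℝ) : ℂ :=
  dφ x * (c + greenTail φ f x) - (φ x : ℂ)⁻¹ * leftIntegral φ f x

variable (c : ℂ)

lemma hasDerivAt_greenSol (h : IsPositiveSolution m b Q φ dφ φ₁ d₁)
    (hf : Integrable f unitMeasure) {x : ℝ} (hx : x ∈ Ioo (0 : ℝ) 1) :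
    HasDerivAt (greenSol φ f c) (dgreenSol φ dφ f c x) x := by
  have h1 := (h.hasDerivAt x hx).ofReal_comp.mul ((h.hasDerivAt_greenTail hf hx).const_add c)
  refine h1.congr_deriv ?_
  have : (φ x : ℂ) ≠ 0 := by exact_mod_cast (h.pos x hx).ne'
  rw [dgreenSol]
  field_simp
  ring

lemma deriv_greenSol (h : IsPositiveSolution m b Q φ dφ φ₁ d₁)
    (hf : Integrable f unitMeasure) :
    EqOn (deriv (greenSol φ f c)) (dgreenSol φ dφ f c) (Ioo 0 1) :=
  fun _ hx => (h.hasDerivAt_greenSol c hf hx).deriv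

lemma hasDerivAt_inv (h : IsPositiveSolution m b Q φ dφ φ₁ d₁) {x : ℝ} (hx : x ∈ Ioo (0 : ℝ) 1) :
    HasDerivAt (fun x => (φ x : ℂ)⁻¹) (-(dφ x : ℂ) / (φ x : ℂ) ^ 2) x :=
  (h.hasDerivAt x hx).ofReal_comp.fun_inv (by exact_mod_cast (h.pos x hx).ne')

lemma hasDerivAt_dφ_mul_tail (h : IsPositiveSolution m b Q φ dφ φ₁ d₁)
    (hf : Integrable f unitMeasure) {x : ℝ} (hx : x ∈ Ioo (0 : ℝ) 1) :
    HasDerivAt (fun x => (dφ x : ℂ) * (c + greenTail φ f x))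
      (((Q x * φ x : ℝ) : ℂ) * (c + greenTail φ f x) +
        dφ x * -(leftIntegral φ f x / (φ x : ℂ) ^ 2)) x :=
  (h.hasDerivAt' x hx).ofReal_comp.mul ((h.hasDerivAt_greenTail hf hx).const_add c)

/-- The equation holds only almost everywhere because f is merely integrable: the derivative of ∫ φ
f comes from Lebesgue differentiation. -/
lemma ae_hasDerivAt_dgreenSol (h : IsPositiveSolution m b Q φ dφ φ₁ d₁)
    (hf : Integrable f unitMeasure) :
    ∀ᵐ x ∂unitMeasure, HasDerivAt (dgreenSol φ dφ f c) (Q x * greenSol φ f c x - f x) x := by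
  filter_upwards [h.ae_hasDerivAt_leftIntegral h.m_nonneg hf, ae_restrict_mem measurableSet_Ioo]
    with x hx hx'
  have h1 := (h.hasDerivAt_dφ_mul_tail c hf hx').sub ((h.hasDerivAt_inv hx').mul hx)
  refine h1.congr_deriv ?_
  have : (φ x : ℂ) ≠ 0 := by exact_mod_cast (h.pos x hx').ne'
  rw [greenSol]
  push_cast
  field_simp
  ring

lemma continuousOn_dφ (h : IsPositiveSolution m b Q φ dφ φ₁ d₁) : ContinuousOn dφ (Ioo 0 1) :=
  fun x hx => (h.hasDerivAt' x hx).continuousAt.continuousWithinAt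

lemma continuousOn_greenTail (h : IsPositiveSolution m b Q φ dφ φ₁ d₁)
    (hf : Integrable f unitMeasure) : ContinuousOn (greenTail φ f) (Ioo 0 1) :=
  fun _ hx => (h.hasDerivAt_greenTail hf hx).continuousAt.continuousWithinAt

lemma absolutelyContinuousOnInterval_dgreenSol (h : IsPositiveSolution m b Q φ dφ φ₁ d₁)
    (hQ : ContinuousOn Q (Ioo 0 1)) (hf : Integrable f unitMeasure) {x y : ℝ}
    (hx : x ∈ Ioo (0 : ℝ) 1) (hy : y ∈ Ioo (0 : ℝ) 1) :
    AbsolutelyContinuousOnInterval (dgreenSol φ dφ f c) x y := by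
  have oc : ∀ {g : ℝ → ℝ}, ContinuousOn g (Ioo 0 1) → ContinuousOn (fun x => (g x : ℂ)) (Ioo 0 1) :=
    fun hg => Complex.continuous_ofReal.comp_continuousOn hg
  have cφ := oc h.continuousOn
  have cd := oc h.continuousOn_dφ
  have ct := (h.continuousOn_greenTail hf).const_add c
  have nz : ∀ x ∈ Ioo (0 : ℝ) 1, (φ x : ℂ) ^ 2 ≠ 0 := fun x hx =>
    pow_ne_zero 2 (by exact_mod_cast (h.pos x hx).ne')
  have a1 := absolutelyContinuousOnInterval_of_hasDerivAt
    (fun x hx => h.hasDerivAt_dφ_mul_tail c hf hx)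
    (((oc (hQ.mul h.continuousOn)).mul ct).add (cd.mul (h.continuousOn_tail_integrand hf).neg)) hx hy
  have a2 := absolutelyContinuousOnInterval_of_hasDerivAt (fun x hx => h.hasDerivAt_inv hx)
    (cd.neg.div (cφ.pow 2) nz) hx hy
  have a3 := (h.absolutelyContinuousOnInterval_leftIntegral h.m_nonneg hf).mono (c := x) (d := y)
    (by rw [uIcc_of_le (zero_le_one : (0 : ℝ) ≤ 1)]
        exact uIcc_subset_Icc (Ioo_subset_Icc_self hx) (Ioo_subset_Icc_self hy))
  exact a1.sub (a2.smul a3)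

lemma isMaximalPair_greenSol (h : IsPositiveSolution m b Q φ dφ φ₁ d₁)
    (hQ : ContinuousOn Q (Ioo 0 1)) (hf : Integrable f unitMeasure) {q : ℝ → ℝ} {y : ℝ}
    (hq : ∀ x ∈ Ioo (0 : ℝ) 1, Q x = q x + y) {g : ℝ → ℂ}
    (hg : g =ᵐ[unitMeasure] fun x => f x - y * greenSol φ f c x) :
    IsMaximalPair q (greenSol φ f c) g where
  differentiable x hx := (h.hasDerivAt_greenSol c hf hx).differentiableAt
  absCont x hx y hy := by
    have key := h.absolutelyContinuousOnInterval_dgreenSol c hQ hf hx hy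
    have hsub : uIcc x y ⊆ Ioo (0 : ℝ) 1 := ordConnected_Ioo.uIcc_subset hx hy
    refine Tendsto.congr' ?_ key
    refine eventually_inf_principal.2 (Eventually.of_forall fun E hE => ?_)
    refine Finset.sum_congr rfl fun i hi => ?_
    rw [h.deriv_greenSol c hf (hsub (hE.1 i hi).1), h.deriv_greenSol c hf (hsub (hE.1 i hi).2)]
  equation := by
    filter_upwards [h.ae_hasDerivAt_dgreenSol c hf, hg, ae_restrict_mem measurableSet_Ioo]
      with x h1 h2 hx
    have : HasDerivAt (deriv (greenSol φ f c)) (Q x * greenSol φ f c x - f x) x := by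
      refine h1.congr_of_eventuallyEq ?_
      filter_upwards [Ioo_mem_nhds hx.1 hx.2] with t ht using h.deriv_greenSol c hf ht
    refine this.congr_deriv ?_
    rw [h2, hq x hx]
    push_cast
    ring

/-- At 1 the tail vanishes, so the boundary values are φ₁c and d₁c - φ₁⁻¹∫φf. The stated value of c
is what R₁ = 0 requires. -/
lemma rightVanishes_greenSol (h : IsPositiveSolution m b Q φ dφ φ₁ d₁)
    (hf : Integrable f unitMeasure) {a : ℝ} (hc : c * (φ₁ * (d₁ + a * φ₁)) = leftIntegral φ f 1) :
    RightVanishes a (greenSol φ f c) := by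
  have o : ∀ {g : ℝ → ℝ} {l : ℝ}, Tendsto g (𝓝[<] 1) (𝓝 l) →
      Tendsto (fun x => (g x : ℂ)) (𝓝[<] 1) (𝓝 l) := fun hg =>
    (Complex.continuous_ofReal.tendsto _).comp hg
  have nz : (φ₁ : ℂ) ≠ 0 := by exact_mod_cast h.pos_one.ne'
  have t := (h.tendsto_greenTail_one hf).const_add c
  rw [add_zero] at t
  refine ⟨φ₁ * c, d₁ * c - (φ₁ : ℂ)⁻¹ * leftIntegral φ f 1, (o h.right).mul t, ?_, ?_⟩
  · have := ((o h.right').mul t).sub (((o h.right).inv₀ nz).mul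
      (h.tendsto_leftIntegral_one h.m_nonneg hf))
    refine this.congr' ?_
    filter_upwards [eventually_right] with x hx
    exact (h.deriv_greenSol c hf hx).symm
  · rw [← hc, Complex.real_smul]
    field_simp
    ring

end IsPositiveSolution

end

section

/-! ### The boundary condition at `0` and unique continuation -/

/-- The quotient of the second and the first solution of the model equation. -/
def modelGrowth (m x : ℝ) : ℝ := if m = 1 / 2 then -Real.log x else x ^ (1 - 2 * m) / (2 * m - 1)

variable {m b φ₁ d₁ : ℝ} {Q φ dφ : ℝ → ℝ} {f : ℝ → ℂ}

/-- Translates the Dirichlet condition into a growth condition on u/φ, since φ behaves like x^m. -/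
lemma psiModel_eq (m : ℝ) {x : ℝ} (hx : 0 < x) : psiModel (m - 1 / 2) x = x ^ m * modelGrowth m x := by
  rw [psiModel, modelGrowth]
  by_cases h : m = 1 / 2
  · rw [if_pos h, if_pos (by linarith), h]; ring
  · rw [if_neg h, if_neg (fun h' => h (by linarith)), ← mul_div_assoc, ← Real.rpow_add hx]
    congr 1
    · congr 1; ring
    · ring

lemma hasDerivAt_modelGrowth (m : ℝ) {x : ℝ} (hx : 0 < x) :
    HasDerivAt (modelGrowth m) (-x ^ (-(2 * m))) x := by
  by_cases h : m = 1 / 2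
  · have e : modelGrowth m = fun x => -Real.log x := by ext x; rw [modelGrowth, if_pos h]
    rw [e, h]
    refine (Real.hasDerivAt_log hx.ne').fun_neg.congr_deriv ?_
    rw [← Real.rpow_neg_one]; norm_num
  · have e : modelGrowth m = fun x => x ^ (1 - 2 * m) / (2 * m - 1) := by
      ext x; rw [modelGrowth, if_neg h]
    have h1 : 2 * m - 1 ≠ 0 := fun h' => h (by linarith)
    rw [e]
    refine ((Real.hasDerivAt_rpow_const (p := 1 - 2 * m) (Or.inl hx.ne')).div_const _).congr_deriv ?_
    rw [show (1 - 2 * m - 1 : ℝ) = -(2 * m) by ring]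
    field_simp
    ring

lemma tendsto_modelGrowth (hm : 1 / 2 ≤ m) : Tendsto (modelGrowth m) (𝓝[>] 0) atTop := by
  by_cases h : m = 1 / 2
  · have e : modelGrowth m = fun x => -Real.log x := by ext x; rw [modelGrowth, if_pos h]
    rw [e]
    exact tendsto_neg_atBot_atTop.comp Real.tendsto_log_nhdsGT_zero
  · have e : modelGrowth m = fun x => x ^ (1 - 2 * m) / (2 * m - 1) := by
      ext x; rw [modelGrowth, if_neg h]
    have h1 : 1 / 2 < m := lt_of_le_of_ne hm (Ne.symm h)
    rw [e]
    exact (tendsto_rpow_neg_nhdsGT_zero (by linarith)).atTop_div_const (by linarith)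

/-- A version of L'Hôpital's rule for a quotient with infinite denominator. -/
lemma tendsto_inv_modelGrowth_smul (hm : 1 / 2 ≤ m) {k k' : ℝ → ℂ}
    (hk : ∀ᶠ x in 𝓝[>] (0 : ℝ), HasDerivAt k (k' x) x)
    (h0 : Tendsto (fun x : ℝ => x ^ (2 * m) • k' x) (𝓝[>] 0) (𝓝 0)) :
    Tendsto (fun x => (modelGrowth m x)⁻¹ • k x) (𝓝[>] 0) (𝓝 0) := by
  refine Metric.tendsto_nhds.2 fun ε hε => ?_
  have h1 : ∀ᶠ x in 𝓝[>] (0 : ℝ), HasDerivAt k (k' x) x ∧ ‖k' x‖ ≤ ε / 2 * x ^ (-(2 * m)) := by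
    filter_upwards [hk, (Metric.tendsto_nhds.1 h0) (ε / 2) (by positivity), self_mem_nhdsWithin]
      with x hx hx2 (hx0 : 0 < x)
    refine ⟨hx, ?_⟩
    have p : 0 < x ^ (2 * m) := Real.rpow_pos_of_pos hx0 _
    rw [dist_zero_right, norm_smul, Real.norm_eq_abs, abs_of_pos p] at hx2
    rw [Real.rpow_neg hx0.le, ← div_eq_mul_inv, le_div_iff₀ p, mul_comm]
    exact hx2.le
  obtain ⟨δ, hδ, hδ'⟩ := mem_nhdsGT_iff_exists_Ioo_subset.1 h1
  have hδ0 : 0 < δ := hδ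
  set x₀ := δ / 2 with hx₀
  have x₀pos : 0 < x₀ := by positivity
  -- Mean value inequality on [x, x₀], where the derivative of k is bounded by -ε/2 times that of
  -- `modelGrowth`.
  have key : ∀ x ∈ Ioo 0 x₀, ‖k x₀ - k x‖ ≤ ε / 2 * (modelGrowth m x - modelGrowth m x₀) := by
    intro x hx
    have mem : ∀ t ∈ Icc x x₀, t ∈ Ioo 0 δ := fun t ht =>
      ⟨hx.1.trans_le ht.1, ht.2.trans_lt (by rw [hx₀]; linarith)⟩
    have hB : ∀ t ∈ Icc x x₀, HasDerivAt (fun t => ε / 2 * (modelGrowth m x - modelGrowth m t))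
        (ε / 2 * t ^ (-(2 * m))) t := fun t ht =>
      (((hasDerivAt_modelGrowth m (mem t ht).1).const_sub _).const_mul _).congr_deriv (by ring)
    refine image_norm_le_of_norm_deriv_right_le_deriv_boundary' (a := x) (b := x₀)
      (f := fun t => k t - k x) (f' := k')
      (B := fun t => ε / 2 * (modelGrowth m x - modelGrowth m t))
      (B' := fun t => ε / 2 * t ^ (-(2 * m)))
      ?_ ?_ (by simp) ?_ ?_ ?_ (right_mem_Icc.2 hx.2.le)
    · exact fun t ht => (((hδ' (mem t ht)).1.continuousAt.sub continuousAt_const)).continuousWithinAt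
    · exact fun t ht => ((hδ' (mem t (Ico_subset_Icc_self ht))).1.sub_const _).hasDerivWithinAt
    · exact fun t ht => (hB t ht).continuousAt.continuousWithinAt
    · exact fun t ht => (hB t (Ico_subset_Icc_self ht)).hasDerivWithinAt
    · exact fun t ht => (hδ' (mem t (Ico_subset_Icc_self ht))).2
  -- Near 0 the growth function exceeds the fixed quantities at x₀, which then cost only another
  -- ε/2.
  filter_upwards [Ioo_mem_nhdsGT x₀pos, (tendsto_modelGrowth hm).eventually_gt_atTop
    (max 0 ((‖k x₀‖ + ε / 2 * |modelGrowth m x₀|) / (ε / 2)))] with x hx hx2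
  have g0 : 0 < modelGrowth m x := (le_max_left _ _).trans_lt hx2
  have g1 := (le_max_right _ _).trans_lt hx2
  rw [div_lt_iff₀ (by positivity)] at g1
  have h3 := key x hx
  have h4 : ‖k x‖ ≤ ‖k x₀‖ + ‖k x₀ - k x‖ := by
    have := norm_sub_le (k x₀) (k x₀ - k x)
    rwa [sub_sub_cancel] at this
  have h5 : ε / 2 * -modelGrowth m x₀ ≤ ε / 2 * |modelGrowth m x₀| :=
    mul_le_mul_of_nonneg_left (neg_le_abs _) (by positivity)
  rw [dist_zero_right, norm_smul, norm_inv, Real.norm_eq_abs, abs_of_pos g0, inv_mul_lt_iff₀ g0]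
  linarith

/-! #### Unique continuation -/

/-- Uniqueness for the first order system is applied on a compact subinterval containing both
points, since Q may be unbounded at the ends. -/
lemma eqOn_zero_of_solution {v v' : ℝ → ℂ} (hQ : ContinuousOn Q (Ioo 0 1))
    (h1 : ∀ x ∈ Ioo (0 : ℝ) 1, HasDerivAt v (v' x) x)
    (h2 : ∀ x ∈ Ioo (0 : ℝ) 1, HasDerivAt v' (Q x * v x) x) {x₀ : ℝ} (hx₀ : x₀ ∈ Ioo (0 : ℝ) 1)
    (e1 : v x₀ = 0) (e2 : v' x₀ = 0) : ∀ x ∈ Ioo (0 : ℝ) 1, v x = 0 := by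
  intro x hx
  obtain ⟨a, ha0, ha⟩ := exists_between (lt_min hx.1 hx₀.1)
  obtain ⟨b, hb, hb1⟩ := exists_between (max_lt hx.2 hx₀.2)
  have hxa : x ∈ Ioo a b := ⟨ha.trans_le (min_le_left _ _), (le_max_left _ _).trans_lt hb⟩
  have hx₀a : x₀ ∈ Ioo a b := ⟨ha.trans_le (min_le_right _ _), (le_max_right _ _).trans_lt hb⟩
  have hsub : Icc a b ⊆ Ioo 0 1 := fun t ht => ⟨ha0.trans_le ht.1, ht.2.trans_lt hb1⟩
  obtain ⟨R, hR⟩ := isCompact_Icc.exists_bound_of_continuousOn (hQ.mono hsub)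
  have key := ODE_solution_unique_of_mem_Ioo (E := ℂ × ℂ) (K := max 1 R.toNNReal) (a := a) (b := b)
    (v := fun t p => (p.2, (Q t : ℂ) * p.1)) (s := fun _ => univ) (f := fun t => (v t, v' t))
    (g := fun _ => 0) (t₀ := x₀) ?_ hx₀a ?_ ?_ ?_ hxa
  · exact congrArg Prod.fst key
  · intro t ht
    refine LipschitzOnWith.of_dist_le_mul fun p _ r _ => ?_
    have hRt := hR t (Ioo_subset_Icc_self ht)
    have m0 : 0 ≤ dist p r := dist_nonneg
    have k1 : (1 : ℝ) ≤ ((max 1 R.toNNReal : NNReal) : ℝ) := by exact_mod_cast le_max_left _ _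
    have k2 : R ≤ ((max 1 R.toNNReal : NNReal) : ℝ) :=
      (Real.le_coe_toNNReal R).trans (by exact_mod_cast le_max_right _ _)
    rw [Prod.dist_eq]
    refine max_le ?_ ?_
    · have : dist p.2 r.2 ≤ dist p r := by rw [Prod.dist_eq]; exact le_max_right _ _
      nlinarith
    · have : dist p.1 r.1 ≤ dist p r := by rw [Prod.dist_eq]; exact le_max_left _ _
      rw [dist_eq_norm, ← mul_sub, norm_mul, Complex.norm_real, ← dist_eq_norm]
      exact mul_le_mul (hRt.trans k2) this dist_nonneg (by positivity)
  · intro t ht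
    have ht' := hsub (Ioo_subset_Icc_self ht)
    exact ⟨(h1 t ht').prodMk (h2 t ht'), mem_univ _⟩
  · intro t _
    exact ⟨(hasDerivAt_const t (0 : ℂ × ℂ)).congr_deriv (by ext <;> simp), mem_univ _⟩
  · simp [e1, e2]

/-- For an eigenfunction the equation holds everywhere: v' and a primitive of the continuous
function Q v are absolutely continuous with the same derivative almost everywhere, so they differ by
a constant. -/
lemma IsMaximalPair.hasDerivAt_deriv {q : ℝ → ℝ} {v : ℝ → ℂ} {y : ℝ}
    (h : IsMaximalPair q v (fun x => -(y : ℂ) * v x)) (hQ : ContinuousOn Q (Ioo 0 1))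
    (hq : ∀ x ∈ Ioo (0 : ℝ) 1, Q x = q x + y) {x : ℝ} (hx : x ∈ Ioo (0 : ℝ) 1) :
    HasDerivAt (deriv v) (Q x * v x) x := by
  obtain ⟨a, ha0, ha⟩ := exists_between hx.1
  obtain ⟨b, hb, hb1⟩ := exists_between hx.2
  have hab : a ≤ b := (ha.trans hb).le
  have hsub : Icc a b ⊆ Ioo 0 1 := fun t ht => ⟨ha0.trans_le ht.1, ht.2.trans_lt hb1⟩
  have hcv : ContinuousOn (fun t => (Q t : ℂ) * v t) (Ioo 0 1) :=
    (Complex.continuous_ofReal.comp_continuousOn hQ).mul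
      fun t ht => (h.differentiable t ht).continuousAt.continuousWithinAt
  have hi : IntervalIntegrable (fun t => (Q t : ℂ) * v t) volume a b :=
    (hcv.mono (by rwa [uIcc_of_le hab])).intervalIntegrable
  have ac := (h.absCont a (hsub (left_mem_Icc.2 hab)) b (hsub (right_mem_Icc.2 hab))).sub
    (absolutelyContinuousOnInterval_primitive a hi left_mem_uIcc)
  have hF : ∀ t ∈ Ioo a b, HasDerivAt (fun u => ∫ s in a..u, (Q s : ℂ) * v s) (Q t * v t) t := by
    intro t ht
    have ht' := hsub (Ioo_subset_Icc_self ht)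
    exact intervalIntegral.integral_hasDerivAt_right
      (hi.mono_set (by rw [uIcc_of_le hab, uIcc_of_le ht.1.le]; exact Icc_subset_Icc_right ht.2.le))
      (hcv.stronglyMeasurableAtFilter isOpen_Ioo t ht')
      (hcv.continuousAt (Ioo_mem_nhds ht'.1 ht'.2))
  obtain ⟨C, hC⟩ := ac.const_of_ae_hasDerivAt_zero (by
    have e := h.equation
    rw [ae_restrict_iff' measurableSet_Ioo] at e
    have na : ∀ᵐ t : ℝ, t ≠ a := by simp [ae_iff, measure_singleton]
    have nb : ∀ᵐ t : ℝ, t ≠ b := by simp [ae_iff, measure_singleton]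
    filter_upwards [e, na, nb] with t ht ta tb ht'
    rw [uIcc_of_le hab] at ht'
    have ht2 : t ∈ Ioo a b := ⟨lt_of_le_of_ne ht'.1 ta.symm, lt_of_le_of_ne ht'.2 tb⟩
    refine ((ht (hsub ht')).sub (hF t ht2)).congr_deriv ?_
    rw [hq t (hsub ht')]
    push_cast
    ring)
  rw [uIcc_of_le hab] at hC
  have ev : deriv v =ᶠ[𝓝 x] fun u => C + ∫ s in a..u, (Q s : ℂ) * v s := by
    filter_upwards [Ioo_mem_nhds ha hb] with t ht
    have := hC t (Ioo_subset_Icc_self ht)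
    rw [Pi.sub_apply] at this
    rw [← this]; ring
  exact ((hF x ⟨ha, hb⟩).const_add C).congr_of_eventuallyEq ev

/-! #### The parameters of the singularity at `0` -/

/-- The decomposition of the potential and of the boundary condition at `0`. -/
structure IsLeftData (q a₀ : ℝ → ℝ) (B : LeftBC) (m e η K b : ℝ) (V : ℝ → ℝ) : Prop where
  pert : IsPerturbation m e η K V
  eq_q : ∀ x ∈ Ioo (0 : ℝ) 1, q x = m * (m - 1) / x ^ 2 + V x
  e_or_b : e = 0 ∨ b = 0
  b_mul_m : b * m = 0
  nu : LeftBC.nu a₀ B + 1 / 2 = m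
  bc : (B = .dirichlet ∧ 1 / 2 ≤ m ∧ b = 0) ∨ ∃ A, B = .neumann A ∧ m = 0 ∧ b = -A

variable {q a₀ V : ℝ → ℝ} {B : LeftBC} {e η K : ℝ}

/-- Normalized solutions of `-u'' + Q u = 0`, `R₀ u = 0`. -/
lemma IsLeftData.wronskian_eq_zero (hd : IsLeftData q a₀ B m e η K b V)
    (h : IsRegularSolution m b Q φ dφ φ₁ d₁) {v v' : ℝ → ℂ}
    (h1 : ∀ x ∈ Ioo (0 : ℝ) 1, HasDerivAt v (v' x) x) (hv : B.Vanishes a₀ v) {W : ℂ}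
    (hW : ∀ x ∈ Ioo (0 : ℝ) 1, φ x * v' x - dφ x * v x = W) : W = 0 := by
  have o : ∀ {g : ℝ → ℝ} {l : ℝ}, Tendsto g (𝓝[>] 0) (𝓝 l) →
      Tendsto (fun x => (g x : ℂ)) (𝓝[>] 0) (𝓝 l) := fun hg =>
    (Complex.continuous_ofReal.tendsto _).comp hg
  rcases hd.bc with ⟨rfl, hm, hb⟩ | ⟨A, rfl, hm, hb⟩
  · have hp : ∀ᶠ x in 𝓝[>] (0 : ℝ), 0 < φ x := by
      filter_upwards [h.left.eventually_const_lt one_pos, self_mem_nhdsWithin] with x hx (hx0 : 0 < x)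
      exact (div_pos_iff_of_pos_right (Real.rpow_pos_of_pos hx0 m)).1 hx
    have hnu : LeftBC.nu a₀ .dirichlet = m - 1 / 2 := by have := hd.nu; linarith
    have hinv := (o h.left).inv₀ (by simp)
    have A1 : Tendsto (fun x => (modelGrowth m x)⁻¹ • (v x / φ x)) (𝓝[>] 0) (𝓝 0) := by
      have := Tendsto.mul hv hinv
      rw [zero_mul] at this
      refine this.congr' ?_
      filter_upwards [hp, self_mem_nhdsWithin] with x hx (hx0 : 0 < x)
      have p : (x ^ m : ℝ) ≠ 0 := (Real.rpow_pos_of_pos hx0 m).ne'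
      have p' : ((x ^ m : ℝ) : ℂ) ≠ 0 := by exact_mod_cast p
      rw [hnu, psiModel_eq m hx0, Complex.real_smul, Complex.real_smul]
      push_cast
      have : (φ x : ℂ) ≠ 0 := by exact_mod_cast hx.ne'
      rw [mul_inv]
      field_simp
    -- Since (v/φ)' = W/φ² and φ is asymptotic to x^m, the function v/φ + W g, with g the model
    -- growth, has derivative o(x^{-2m}) and is o(g). The boundary condition says that v/φ is o(g);
    -- so is W g, which forces W = 0.
    have A2 : Tendsto (fun x => (modelGrowth m x)⁻¹ • (v x / φ x + W * (modelGrowth m x : ℂ)))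
        (𝓝[>] 0) (𝓝 0) := by
      refine tendsto_inv_modelGrowth_smul hm
        (k' := fun x => W / (φ x : ℂ) ^ 2 - W * ((x ^ (-(2 * m)) : ℝ) : ℂ)) ?_ ?_
      · filter_upwards [hp, eventually_left] with x hx hx1
        have nz : (φ x : ℂ) ≠ 0 := by exact_mod_cast hx.ne'
        have d1 := (h1 x hx1).div (h.hasDerivAt x hx1).ofReal_comp nz
        have d2 := (hasDerivAt_modelGrowth m hx1.1).ofReal_comp.const_mul W
        refine (d1.add d2).congr_deriv ?_
        rw [← hW x hx1]
        push_cast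
        ring
      · have t1 : Tendsto (fun x : ℝ => W * (((φ x / x ^ m : ℝ) : ℂ)⁻¹ ^ 2 - 1)) (𝓝[>] 0) (𝓝 0) := by
          have := ((hinv.pow 2).sub_const 1).const_mul W
          simpa using this
        refine t1.congr' ?_
        filter_upwards [hp, eventually_left] with x hx hx1
        have p : 0 < x ^ m := Real.rpow_pos_of_pos hx1.1 m
        have p' : ((x ^ m : ℝ) : ℂ) ≠ 0 := by exact_mod_cast p.ne'
        have e1 : x ^ (2 * m) = (x ^ m) ^ 2 := by
          rw [← Real.rpow_natCast, ← Real.rpow_mul hx1.1.le]; congr 1; push_cast; ring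
        have nz : (φ x : ℂ) ≠ 0 := by exact_mod_cast hx.ne'
        rw [Real.rpow_neg hx1.1.le, e1, Complex.real_smul]
        push_cast at p' ⊢
        field_simp
    have A3 := A2.sub A1
    rw [sub_zero] at A3
    refine tendsto_nhds_unique ?_ A3
    refine tendsto_const_nhds.congr' ?_
    filter_upwards [(tendsto_modelGrowth hm).eventually_gt_atTop 0] with x hx
    have : (modelGrowth m x : ℂ) ≠ 0 := by exact_mod_cast hx.ne'
    rw [← smul_sub, add_sub_cancel_left, Complex.real_smul]
    push_cast
    field_simp
  · obtain ⟨β, γ, hβ, hγ, hs⟩ := hv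
    have hγ' : Tendsto v' (𝓝[>] 0) (𝓝 γ) := by
      refine hγ.congr' ?_
      filter_upwards [eventually_left] with x hx using (h1 x hx).deriv
    have l1 : Tendsto φ (𝓝[>] 0) (𝓝 1) := by simpa [hm] using h.left
    have l2 : Tendsto dφ (𝓝[>] 0) (𝓝 b) := by simpa [hm] using h.slope
    have l3 := ((o l1).mul hγ').sub ((o l2).mul hβ)
    have l4 : Tendsto (fun x => (φ x : ℂ) * v' x - dφ x * v x) (𝓝[>] 0) (𝓝 W) := by
      refine tendsto_const_nhds.congr' ?_
      filter_upwards [eventually_left] with x hx using (hW x hx).symm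
    rw [tendsto_nhds_unique l4 l3, hb]
    rw [Complex.real_smul] at hs
    push_cast
    linear_combination hs

lemma hasDerivAt_wronskian {v v' : ℝ → ℂ} (h : IsRegularSolution m b Q φ dφ φ₁ d₁)
    (h1 : ∀ x ∈ Ioo (0 : ℝ) 1, HasDerivAt v (v' x) x)
    (h2 : ∀ x ∈ Ioo (0 : ℝ) 1, HasDerivAt v' (Q x * v x) x) {x : ℝ} (hx : x ∈ Ioo (0 : ℝ) 1) :
    HasDerivAt (fun x => (φ x : ℂ) * v' x - dφ x * v x) 0 x := by
  refine (((h.hasDerivAt x hx).ofReal_comp.mul (h2 x hx)).sub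
    ((h.hasDerivAt' x hx).ofReal_comp.mul (h1 x hx))).congr_deriv ?_
  push_cast
  ring

/-- Up to a factor there is one solution that satisfies the boundary condition at `0`. -/
lemma IsLeftData.exists_eq_const_mul (hd : IsLeftData q a₀ B m e η K b V)
    (hQ : ContinuousOn Q (Ioo 0 1)) (h : IsRegularSolution m b Q φ dφ φ₁ d₁) {v v' : ℝ → ℂ}
    (h1 : ∀ x ∈ Ioo (0 : ℝ) 1, HasDerivAt v (v' x) x)
    (h2 : ∀ x ∈ Ioo (0 : ℝ) 1, HasDerivAt v' (Q x * v x) x) (hv : B.Vanishes a₀ v) :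
    ∃ c : ℂ, ∀ x ∈ Ioo (0 : ℝ) 1, v x = c * φ x := by
  obtain ⟨x₀, hp, hx₀⟩ : ∃ x, 0 < φ x ∧ x ∈ Ioo (0 : ℝ) 1 := by
    refine Eventually.exists (f := 𝓝[>] (0 : ℝ)) ?_
    filter_upwards [h.left.eventually_const_lt one_pos, eventually_left] with x hx hx0
    exact ⟨(div_pos_iff_of_pos_right (Real.rpow_pos_of_pos hx0.1 m)).1 hx, hx0⟩
  have hw : ∀ x ∈ Ioo (0 : ℝ) 1, φ x * v' x - dφ x * v x = φ x₀ * v' x₀ - dφ x₀ * v x₀ := by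
    intro x hx
    refine isOpen_Ioo.is_const_of_deriv_eq_zero isPreconnected_Ioo
      (f := fun x => (φ x : ℂ) * v' x - dφ x * v x)
      (fun t ht => (hasDerivAt_wronskian h h1 h2 ht).differentiableAt.differentiableWithinAt)
      (fun t ht => (hasDerivAt_wronskian h h1 h2 ht).deriv) hx hx₀
  have hW0 := hd.wronskian_eq_zero h h1 hv hw
  have nz : (φ x₀ : ℂ) ≠ 0 := by exact_mod_cast hp.ne'
  refine ⟨v x₀ / φ x₀, fun x hx => ?_⟩
  -- The difference v - cφ has zero Cauchy data at x₀: its value by the choice of c, its derivative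
  -- because the Wronskian vanishes.
  have := eqOn_zero_of_solution (Q := Q) (v := fun x => v x - v x₀ / φ x₀ * φ x)
    (v' := fun x => v' x - v x₀ / φ x₀ * dφ x) hQ
    (fun t ht => (h1 t ht).sub ((h.hasDerivAt t ht).ofReal_comp.const_mul _))
    (fun t ht => ((h2 t ht).sub ((h.hasDerivAt' t ht).ofReal_comp.const_mul _)).congr_deriv
      (by push_cast; ring)) hx₀ (by field_simp; ring)
    (by field_simp; linear_combination hW0) x hx
  linear_combination this

end

/-! ### The boundary condition at 0 for solutions of the inhomogeneous equation. -/

section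

variable {m b φ₁ d₁ : ℝ} {Q φ dφ : ℝ → ℝ} {f : ℝ → ℂ}
variable {q a₀ V : ℝ → ℝ} {B : LeftBC} {e η K a y : ℝ}

/-- In the Dirichlet case, x^{2m} k' → 0 makes k negligible against the growth of the second
solution. In the Neumann case m = 0: then k' → 0, and φk inherits the ratio of boundary values of φ,
so a limit of k at 0 is required in addition. -/
lemma IsLeftData.vanishes_mul (hd : IsLeftData q a₀ B m e η K b V)
    (h : IsRegularSolution m b Q φ dφ φ₁ d₁) {k k' : ℝ → ℂ}
    (hk : ∀ x ∈ Ioo (0 : ℝ) 1, HasDerivAt k (k' x) x)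
    (h0 : Tendsto (fun x : ℝ => x ^ (2 * m) • k' x) (𝓝[>] 0) (𝓝 0))
    (hlim : m = 0 → ∃ l, Tendsto k (𝓝[>] 0) (𝓝 l)) : B.Vanishes a₀ (fun x => (φ x : ℂ) * k x) := by
  have o : ∀ {g : ℝ → ℝ} {l : ℝ}, Tendsto g (𝓝[>] 0) (𝓝 l) →
      Tendsto (fun x => (g x : ℂ)) (𝓝[>] 0) (𝓝 l) := fun hg =>
    (Complex.continuous_ofReal.tendsto _).comp hg
  rcases hd.bc with ⟨rfl, hm, hb⟩ | ⟨A, rfl, hm, hb⟩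
  · have hnu : LeftBC.nu a₀ .dirichlet = m - 1 / 2 := by have := hd.nu; linarith
    have h1 : Tendsto (fun x => (modelGrowth m x)⁻¹ • k x) (𝓝[>] 0) (𝓝 0) :=
      tendsto_inv_modelGrowth_smul hm (by filter_upwards [eventually_left] with x hx using hk x hx) h0
    have := h1.mul (o h.left)
    rw [zero_mul] at this
    refine this.congr' ?_
    filter_upwards [eventually_left] with x hx
    have p' : ((x ^ m : ℝ) : ℂ) ≠ 0 := by exact_mod_cast (Real.rpow_pos_of_pos hx.1 m).ne'
    rw [hnu, psiModel_eq m hx.1, Complex.real_smul, Complex.real_smul]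
    push_cast at p' ⊢
    rw [mul_inv]
    field_simp
  · obtain ⟨l, hl⟩ := hlim hm
    have l1 : Tendsto φ (𝓝[>] 0) (𝓝 1) := by simpa [hm] using h.left
    have l2 : Tendsto dφ (𝓝[>] 0) (𝓝 b) := by simpa [hm] using h.slope
    have l3 : Tendsto k' (𝓝[>] 0) (𝓝 0) := by simpa [hm] using h0
    refine ⟨l, b * l, ?_, ?_, ?_⟩
    · simpa using (o l1).mul hl
    · have := ((o l2).mul hl).add ((o l1).mul l3)
      rw [mul_zero, add_zero] at this
      refine this.congr' ?_
      filter_upwards [eventually_left] with x hx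
      exact ((h.hasDerivAt x hx).ofReal_comp.mul (hk x hx)).deriv.symm
    · rw [Complex.real_smul, hb]; push_cast; ring

lemma IsLeftData.vanishes_const_mul (hd : IsLeftData q a₀ B m e η K b V)
    (h : IsRegularSolution m b Q φ dφ φ₁ d₁) (c : ℂ) : B.Vanishes a₀ (fun x => (φ x : ℂ) * c) :=
  hd.vanishes_mul h (k := fun _ => c) (k' := fun _ => 0) (fun x _ => hasDerivAt_const x c)
    (by simp) fun _ => ⟨c, tendsto_const_nhds⟩

lemma IsLeftData.vanishes_greenSol (hd : IsLeftData q a₀ B m e η K b V)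
    (h : IsPositiveSolution m b Q φ dφ φ₁ d₁) (hf : Integrable f unitMeasure) (c : ℂ) :
    B.Vanishes a₀ (IsPositiveSolution.greenSol φ f c) := by
  refine hd.vanishes_mul h.toIsRegularSolution (k := fun x => c + greenTail φ f x)
    (fun x hx => (h.hasDerivAt_greenTail hf hx).const_add c) ?_ fun hm => ?_
  · have hinv := ((Complex.continuous_ofReal.tendsto _).comp h.left).inv₀ (by simp)
    have t := ((hinv.pow 2).mul (h.tendsto_leftIntegral_zero h.m_nonneg hf)).neg
    rw [mul_zero, neg_zero] at t
    refine t.congr' ?_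
    filter_upwards [eventually_left] with x hx
    have p' : ((x ^ m : ℝ) : ℂ) ≠ 0 := by exact_mod_cast (Real.rpow_pos_of_pos hx.1 m).ne'
    have e1 : x ^ (2 * m) = (x ^ m) ^ 2 := by
      rw [← Real.rpow_natCast, ← Real.rpow_mul hx.1.le]; congr 1; push_cast; ring
    have nz : (φ x : ℂ) ≠ 0 := by exact_mod_cast (h.pos x hx).ne'
    rw [e1, Complex.real_smul]
    simp only [Function.comp]
    push_cast at p' ⊢
    field_simp
  -- For m = 0 the solution φ is bounded below near 0, so the tail integrand is bounded and the tail
  -- has a limit.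
  · obtain ⟨R, hR⟩ := isCompact_Icc.exists_bound_of_continuousOn
      (h.continuousOn_leftIntegral h.m_nonneg hf)
    obtain ⟨c', hc', hl⟩ := h.exists_lower_bound
    have hb : ∀ w ∈ Ioo (0 : ℝ) 1, ‖leftIntegral φ f w / (φ w : ℂ) ^ 2‖ ≤ R / c' ^ 2 := by
      intro w hw
      have h1 := hR w (Ioo_subset_Icc_self hw)
      have h2 := hl w hw
      rw [hm, Real.rpow_zero, mul_one] at h2
      rw [norm_div, norm_pow, Complex.norm_real, Real.norm_eq_abs, abs_of_pos (h.pos w hw)]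
      gcongr
      exact (norm_nonneg _).trans h1
    have hi : IntegrableOn (fun w => leftIntegral φ f w / (φ w : ℂ) ^ 2) (Icc 0 1) := by
      rw [integrableOn_Icc_iff_integrableOn_Ioo]
      exact Integrable.of_bound (C := R / c' ^ 2)
        ((h.continuousOn_tail_integrand hf).aestronglyMeasurable measurableSet_Ioo)
        ((ae_restrict_iff' measurableSet_Ioo).2 (Eventually.of_forall hb))
    have hc := intervalIntegral.continuousOn_primitive_interval_left (a := 0) (b := 1)
      (f := fun w => leftIntegral φ f w / (φ w : ℂ) ^ 2) (μ := volume)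
      (by rwa [uIcc_of_le zero_le_one])
    rw [uIcc_of_le zero_le_one] at hc
    exact ⟨_, ((hc 0 (by simp)).mono_left nhdsGT_zero_le).const_add c⟩

/-! ### The resolvent -/

/-- The regular solution as an element of `L²`. -/
def IsRegularSolution.vec (h : IsRegularSolution m b Q φ dφ φ₁ d₁) (hm : 0 ≤ m) : H :=
  (h.memLp hm).toLp

lemma IsRegularSolution.vec_ae (h : IsRegularSolution m b Q φ dφ φ₁ d₁) (hm : 0 ≤ m) :
    h.vec hm =ᵐ[unitMeasure] fun x => (φ x : ℂ) := (h.memLp hm).coeFn_toLp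

lemma IsRegularSolution.inner_vec (h : IsRegularSolution m b Q φ dφ φ₁ d₁) (hm : 0 ≤ m) (f : H) :
    inner ℂ (h.vec hm) f = leftIntegral φ f 1 := by
  rw [L2.inner_def, leftIntegral, ← setIntegral_Ioo_eq _ zero_le_one]
  refine integral_congr_ae ?_
  filter_upwards [h.vec_ae hm] with x hx
  rw [hx]
  simp [mul_comm]

lemma IsRegularSolution.vec_ne_zero (h : IsRegularSolution m b Q φ dφ φ₁ d₁) (hm : 0 ≤ m) :
    h.vec hm ≠ 0 := by
  intro h0
  have h1 := h.vec_ae hm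
  rw [h0] at h1
  have h2 : (fun x => (φ x : ℂ)) =ᵐ[unitMeasure] fun _ => (0 : ℂ) :=
    h1.symm.trans (Lp.coeFn_zero _ _ _)
  have h3 := Measure.eqOn_open_of_ae_eq h2 isOpen_Ioo
    (Complex.continuous_ofReal.comp_continuousOn h.continuousOn) continuousOn_const
  obtain ⟨x, hx, hx0⟩ := ((h.left.eventually_const_lt one_pos).and eventually_left).exists
  have h4 : (φ x : ℂ) = 0 := h3 hx0
  rw [Complex.ofReal_eq_zero] at h4
  rw [h4, zero_div] at hx
  exact lt_irrefl _ hx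

lemma mem_opGraph_iff {p : H × H} : p ∈ opGraph q a₀ B a ↔ ∃ u : ℝ → ℂ,
    (p.1 : ℝ → ℂ) =ᵐ[unitMeasure] u ∧ IsMaximalPair q u p.2 ∧ B.Vanishes a₀ u ∧ RightVanishes a u :=
  Iff.rfl

lemma IsMaximalPair.congr {u g g' : ℝ → ℂ} (h : IsMaximalPair q u g) (hg : g' =ᵐ[unitMeasure] g) :
    IsMaximalPair q u g' :=
  ⟨h.differentiable, h.absCont, by filter_upwards [h.equation, hg] with x h1 h2; rwa [h2]⟩

/-- The solutions of `L f = -y f`. -/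
lemma IsLeftData.eigen_of_mem (hd : IsLeftData q a₀ B m e η K b V) (hm : 0 ≤ m)
    (hQ : ContinuousOn Q (Ioo 0 1)) (hq : ∀ x ∈ Ioo (0 : ℝ) 1, Q x = q x + y)
    (h : IsRegularSolution m b Q φ dφ φ₁ d₁) {f : H}
    (hf : (f, (-(y : ℂ)) • f) ∈ opGraph q a₀ B a) :
    ∃ c : ℂ, f = c • h.vec hm ∧ c * ((d₁ + a * φ₁ : ℝ) : ℂ) = 0 := by
  obtain ⟨u, hu, mu, lu, ru⟩ := mem_opGraph_iff.1 hf
  have mu' : IsMaximalPair q u (fun x => -(y : ℂ) * u x) := by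
    refine mu.congr ?_
    filter_upwards [Lp.coeFn_smul (-(y : ℂ)) f, hu] with x h1 h2
    rw [h1, Pi.smul_apply, smul_eq_mul]
    exact congrArg _ h2.symm
  have hder : ∀ x ∈ Ioo (0 : ℝ) 1, HasDerivAt u (deriv u x) x := fun x hx =>
    (mu.differentiable x hx).hasDerivAt
  obtain ⟨c, hc⟩ := hd.exists_eq_const_mul hQ h hder (fun x hx => mu'.hasDerivAt_deriv hQ hq hx) lu
  refine ⟨c, ?_, ?_⟩
  · refine Lp.ext ?_
    filter_upwards [hu, Lp.coeFn_smul c (h.vec hm), h.vec_ae hm, ae_restrict_mem measurableSet_Ioo]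
      with x h1 h2 h3 hx
    rw [h2, Pi.smul_apply, h3, smul_eq_mul, ← hc x hx]
    exact h1
  · obtain ⟨β, γ, hβ, hγ, hs⟩ := ru
    have o : ∀ {g : ℝ → ℝ} {l : ℝ}, Tendsto g (𝓝[<] 1) (𝓝 l) →
        Tendsto (fun x => (g x : ℂ)) (𝓝[<] 1) (𝓝 l) := fun hg =>
      (Complex.continuous_ofReal.tendsto _).comp hg
    have e1 : Tendsto u (𝓝[<] 1) (𝓝 (c * φ₁)) := by
      refine ((o h.right).const_mul c).congr' ?_
      filter_upwards [eventually_right] with x hx using (hc x hx).symm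
    have e2 : Tendsto (deriv u) (𝓝[<] 1) (𝓝 (c * d₁)) := by
      refine ((o h.right').const_mul c).congr' ?_
      filter_upwards [eventually_right] with x hx
      have : u =ᶠ[𝓝 x] fun x => c * φ x := by
        filter_upwards [Ioo_mem_nhds hx.1 hx.2] with t ht using hc t ht
      rw [this.deriv_eq]
      exact ((h.hasDerivAt x hx).ofReal_comp.const_mul c).deriv.symm
    rw [tendsto_nhds_unique hβ e1, tendsto_nhds_unique hγ e2, Complex.real_smul] at hs
    push_cast
    linear_combination hs

lemma IsLeftData.mem_of_eigen (hd : IsLeftData q a₀ B m e η K b V) (hm : 0 ≤ m)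
    (hQ : ContinuousOn Q (Ioo 0 1)) (hq : ∀ x ∈ Ioo (0 : ℝ) 1, Q x = q x + y)
    (h : IsRegularSolution m b Q φ dφ φ₁ d₁) (hF : d₁ + a * φ₁ = 0) :
    (h.vec hm, (-(y : ℂ)) • h.vec hm) ∈ opGraph q a₀ B a := by
  have hdφ : EqOn (deriv fun x => (φ x : ℂ)) (fun x => (dφ x : ℂ)) (Ioo 0 1) := fun x hx =>
    (h.hasDerivAt x hx).ofReal_comp.deriv
  have cd : ContinuousOn (fun x => ((Q x * φ x : ℝ) : ℂ)) (Ioo 0 1) :=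
    Complex.continuous_ofReal.comp_continuousOn (hQ.mul h.continuousOn)
  refine mem_opGraph_iff.2 ⟨fun x => (φ x : ℂ), h.vec_ae hm, ⟨fun x hx =>
    (h.hasDerivAt x hx).ofReal_comp.differentiableAt, fun x hx y hy => ?_, ?_⟩, ?_, ?_⟩
  · have key := absolutelyContinuousOnInterval_of_hasDerivAt
      (fun x hx => (h.hasDerivAt' x hx).ofReal_comp) cd hx hy
    have hsub : uIcc x y ⊆ Ioo (0 : ℝ) 1 := ordConnected_Ioo.uIcc_subset hx hy
    refine Tendsto.congr' ?_ key
    refine eventually_inf_principal.2 (Eventually.of_forall fun E hE => ?_)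
    refine Finset.sum_congr rfl fun i hi => ?_
    rw [hdφ (hsub (hE.1 i hi).1), hdφ (hsub (hE.1 i hi).2)]
  · filter_upwards [Lp.coeFn_smul (-(y : ℂ)) (h.vec hm), h.vec_ae hm,
      ae_restrict_mem measurableSet_Ioo] with x h1 h2 hx
    have h3 : deriv (fun x => (φ x : ℂ)) =ᶠ[𝓝 x] fun x => (dφ x : ℂ) := by
      filter_upwards [Ioo_mem_nhds hx.1 hx.2] with t ht using hdφ ht
    refine ((h.hasDerivAt' x hx).ofReal_comp.congr_of_eventuallyEq h3).congr_deriv ?_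
    simp only [h1, Pi.smul_apply, h2, hq x hx, smul_eq_mul]
    push_cast
    ring
  · simpa using hd.vanishes_const_mul h 1
  · have o : ∀ {g : ℝ → ℝ} {l : ℝ}, Tendsto g (𝓝[<] 1) (𝓝 l) →
        Tendsto (fun x => (g x : ℂ)) (𝓝[<] 1) (𝓝 l) := fun hg =>
      (Complex.continuous_ofReal.tendsto _).comp hg
    refine ⟨φ₁, d₁, o h.right, (o h.right').congr' ?_, ?_⟩
    · filter_upwards [eventually_right] with x hx using (hdφ hx).symm
    · rw [Complex.real_smul]; exact_mod_cast hF

variable {C : ℝ}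

open InnerProductSpace in
/-- The resolvent: the sum of an operator of rank one and of `P* P`, where `P` has the kernel
`φ(x) / φ(w)`, `x < w`. -/
def greenOp (h : IsPositiveSolution m b Q φ dφ φ₁ d₁) (hκ : IsBoundedKernel (greenKernel φ) C)
    (a : ℝ) : H →L[ℂ] H :=
  (((φ₁ * (d₁ + a * φ₁))⁻¹ : ℝ) : ℂ) •
      rankOne ℂ (h.vec h.m_nonneg) (h.vec h.m_nonneg) +
    ContinuousLinearMap.adjoint hκ.toCLM ∘L hκ.toCLM

lemma greenOp_apply (h : IsPositiveSolution m b Q φ dφ φ₁ d₁)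
    (hκ : IsBoundedKernel (greenKernel φ) C) (a : ℝ) (f : H) : greenOp h hκ a f =
    (((φ₁ * (d₁ + a * φ₁))⁻¹ : ℝ) : ℂ) • inner ℂ (h.vec h.m_nonneg) f • h.vec h.m_nonneg +
      ContinuousLinearMap.adjoint hκ.toCLM (hκ.toCLM f) := by
  simp [greenOp]

/-- P sends f to φ(w)⁻¹∫₀ʷ φf, and P* sends g to φ(x)∫ₓ¹ g/φ. Their composition is φ times the tail,
and the rank one term supplies the constant c. -/
lemma greenOp_ae (h : IsPositiveSolution m b Q φ dφ φ₁ d₁)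
    (hκ : IsBoundedKernel (greenKernel φ) C) (a : ℝ) (f : H) :
    greenOp h hκ a f =ᵐ[unitMeasure] IsPositiveSolution.greenSol φ f
      ((((φ₁ * (d₁ + a * φ₁))⁻¹ : ℝ) : ℂ) * leftIntegral φ f 1) := by
  rw [greenOp_apply, hκ.adjoint_toCLM, h.inner_vec, smul_smul]
  filter_upwards [Lp.coeFn_add ((((((φ₁ * (d₁ + a * φ₁))⁻¹ : ℝ) : ℂ)) * leftIntegral φ f 1) •
      h.vec h.m_nonneg) (hκ.swap.toCLM (hκ.toCLM f)),
    Lp.coeFn_smul ((((φ₁ * (d₁ + a * φ₁))⁻¹ : ℝ) : ℂ) * leftIntegral φ f 1) (h.vec h.m_nonneg),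
    h.vec_ae h.m_nonneg, hκ.swap.toCLM_ae (hκ.toCLM f), ae_restrict_mem measurableSet_Ioo]
    with x h1 h2 h3 h4 hx
  rw [h1, Pi.add_apply, h2, Pi.smul_apply, h3, h4, kernelFun_greenKernel_swap _ hx, smul_eq_mul,
    IsPositiveSolution.greenSol, greenTail]
  have : ∫ w in x..1, hκ.toCLM f w / (φ w : ℂ) = ∫ w in x..1, leftIntegral φ f w / (φ w : ℂ) ^ 2 := by
    rw [← setIntegral_Ioo_eq _ hx.2.le, ← setIntegral_Ioo_eq _ hx.2.le]
    refine setIntegral_congr_ae measurableSet_Ioo ?_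
    have h5 := hκ.toCLM_ae f
    rw [Filter.EventuallyEq, ae_restrict_iff' measurableSet_Ioo] at h5
    filter_upwards [h5] with w hw hwx
    have hw' : w ∈ Ioo (0 : ℝ) 1 := ⟨hx.1.trans hwx.1, hwx.2⟩
    rw [hw hw', kernelFun_greenKernel _ hw', div_div, ← pow_two]
  rw [this]
  ring

lemma IsLeftData.greenOp_mem (hd : IsLeftData q a₀ B m e η K b V)
    (hQ : ContinuousOn Q (Ioo 0 1)) (hq : ∀ x ∈ Ioo (0 : ℝ) 1, Q x = q x + y)
    (h : IsPositiveSolution m b Q φ dφ φ₁ d₁) (hκ : IsBoundedKernel (greenKernel φ) C)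
    (hF : d₁ + a * φ₁ ≠ 0) (g : H) :
    (greenOp h hκ a g, g + (-(y : ℂ)) • greenOp h hκ a g) ∈ opGraph q a₀ B a := by
  have hg := integrable_coe g
  refine mem_opGraph_iff.2 ⟨_, greenOp_ae h hκ a g, ?_, hd.vanishes_greenSol h hg _, ?_⟩
  · refine h.isMaximalPair_greenSol _ hQ hg hq ?_
    filter_upwards [Lp.coeFn_add g ((-(y : ℂ)) • greenOp h hκ a g),
      Lp.coeFn_smul (-(y : ℂ)) (greenOp h hκ a g), greenOp_ae h hκ a g] with x h1 h2 h3
    rw [h1, Pi.add_apply, h2, Pi.smul_apply, h3, smul_eq_mul]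
    ring
  · refine h.rightVanishes_greenSol _ hg ?_
    have : ((φ₁ * (d₁ + a * φ₁) : ℝ) : ℂ) ≠ 0 := by
      exact_mod_cast mul_ne_zero h.pos_one.ne' hF
    rw [mul_comm, ← mul_assoc, Complex.ofReal_inv]
    push_cast at this ⊢
    rw [mul_inv_cancel₀ this, one_mul]

/-- `greenOp` is the resolvent at `-y`. -/
lemma IsLeftData.greenOp_spec (hd : IsLeftData q a₀ B m e η K b V)
    (hQ : ContinuousOn Q (Ioo 0 1)) (hq : ∀ x ∈ Ioo (0 : ℝ) 1, Q x = q x + y)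
    (h : IsPositiveSolution m b Q φ dφ φ₁ d₁) (hκ : IsBoundedKernel (greenKernel φ) C)
    (hF : d₁ + a * φ₁ ≠ 0) (f g : H) :
    (f, g + (-(y : ℂ)) • f) ∈ (op q a₀ B a).graph ↔ greenOp h hκ a g = f := by
  rw [op_graph]
  refine ⟨fun hfg => ?_, fun hfg => ?_⟩
  -- Uniqueness: the difference of two solutions is an eigenvector at -y, and there is none because
  -- R₁φ ≠ 0.
  · have h1 := (opGraph q a₀ B a).sub_mem hfg (hd.greenOp_mem hQ hq h hκ hF g)
    have h2 : (f, g + (-(y : ℂ)) • f) -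
        (greenOp h hκ a g, g + (-(y : ℂ)) • greenOp h hκ a g) =
        (f - greenOp h hκ a g, (-(y : ℂ)) • (f - greenOp h hκ a g)) := by
      ext1
      · rfl
      · simp only [Prod.snd_sub, smul_sub]; abel
    rw [h2] at h1
    obtain ⟨c, hc, hc2⟩ := hd.eigen_of_mem h.m_nonneg hQ hq h.toIsRegularSolution h1
    have : ((d₁ + a * φ₁ : ℝ) : ℂ) ≠ 0 := by exact_mod_cast hF
    rw [(mul_eq_zero.1 hc2).resolve_right this, zero_smul, sub_eq_zero] at hc
    exact hc.symm
  · rw [← hfg]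
    exact hd.greenOp_mem hQ hq h hκ hF g

lemma isCompactOperator_greenOp (h : IsPositiveSolution m b Q φ dφ φ₁ d₁)
    (hκ : IsBoundedKernel (greenKernel φ) C) (a : ℝ) : IsCompactOperator (greenOp h hκ a) := by
  have e : ⇑(greenOp h hκ a) = ((((φ₁ * (d₁ + a * φ₁))⁻¹ : ℝ) : ℂ) •
      ⇑(InnerProductSpace.rankOne ℂ (h.vec h.m_nonneg) (h.vec h.m_nonneg) : H →L[ℂ] H)) +
      (⇑(ContinuousLinearMap.adjoint hκ.toCLM) ∘ ⇑hκ.toCLM) := rfl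
  have h1 : IsCompactOperator ((((φ₁ * (d₁ + a * φ₁))⁻¹ : ℝ) : ℂ) •
      ⇑(InnerProductSpace.rankOne ℂ (h.vec h.m_nonneg) (h.vec h.m_nonneg) : H →L[ℂ] H)) :=
    IsCompactOperator.smul (isCompactOperator_rankOne (h.vec h.m_nonneg) (h.vec h.m_nonneg)) _
  have h2 : IsCompactOperator (⇑(ContinuousLinearMap.adjoint hκ.toCLM) ∘ ⇑hκ.toCLM) :=
    IsCompactOperator.clm_comp hκ.isCompactOperator _
  rw [e]
  exact h1.add h2

lemma inner_greenOp (h : IsPositiveSolution m b Q φ dφ φ₁ d₁)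
    (hκ : IsBoundedKernel (greenKernel φ) C) (a : ℝ) (f g : H) :
    inner ℂ f (greenOp h hκ a g) = (((φ₁ * (d₁ + a * φ₁))⁻¹ : ℝ) : ℂ) *
      (inner ℂ f (h.vec h.m_nonneg) * inner ℂ (h.vec h.m_nonneg) g) +
        inner ℂ (hκ.toCLM f) (hκ.toCLM g) := by
  rw [greenOp_apply, inner_add_right, ContinuousLinearMap.adjoint_inner_right, inner_smul_right,
    inner_smul_right]
  ring

lemma isSymmetric_greenOp (h : IsPositiveSolution m b Q φ dφ φ₁ d₁)
    (hκ : IsBoundedKernel (greenKernel φ) C) (a : ℝ) : (greenOp h hκ a).IsSymmetric := by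
  intro f g
  have h1 := inner_greenOp h hκ a f g
  have h2 := inner_greenOp h hκ a g f
  change inner ℂ (greenOp h hκ a f) g = inner ℂ f (greenOp h hκ a g)
  rw [h1, ← inner_conj_symm, h2]
  simp only [map_add, map_mul, inner_conj_symm, Complex.conj_ofReal]
  ring

/-- Both terms are squares when the coefficient is positive. This gives nonnegativity of the
resolvent, and summation over an eigenbasis gives its trace. -/
lemma inner_self_greenOp (h : IsPositiveSolution m b Q φ dφ φ₁ d₁)
    (hκ : IsBoundedKernel (greenKernel φ) C) (a : ℝ) (f : H) :
    inner ℂ f (greenOp h hκ a f) = (((φ₁ * (d₁ + a * φ₁))⁻¹ *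
      ‖inner ℂ (h.vec h.m_nonneg) f‖ ^ 2 + ‖hκ.toCLM f‖ ^ 2 : ℝ) : ℂ) := by
  rw [inner_greenOp, ← inner_conj_symm f, mul_comm (starRingEnd ℂ _), Complex.mul_conj,
    Complex.normSq_eq_norm_sq, inner_self_eq_norm_sq_to_K]
  push_cast
  simp

end

section

/-! ### Operators with compact self-adjoint resolvent and simple spectrum -/

variable {E : Type*} [NormedAddCommGroup E] [InnerProductSpace ℂ E] [CompleteSpace E]
  {A : E →ₗ.[ℂ] E} {y : ℝ} {S : E →L[ℂ] E}

/-- `S` is the resolvent `(A + y)⁻¹`; it is compact, self-adjoint and nonnegative. -/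
structure IsCompactResolvent (A : E →ₗ.[ℂ] E) (y : ℝ) (S : E →L[ℂ] E) : Prop where
  compact : IsCompactOperator S
  symm : S.IsSymmetric
  graph_iff : ∀ f g : E, (f, g + (-(y : ℂ)) • f) ∈ A.graph ↔ S g = f
  nonneg : ∀ f : E, 0 ≤ (inner ℂ f (S f)).re

namespace IsCompactResolvent

lemma eq_zero_of_apply (h : IsCompactResolvent A y S) {g : E} (hg : S g = 0) : g = 0 := by
  have h1 := (h.graph_iff 0 g).2 hg
  rw [smul_zero, add_zero] at h1
  have h0 : ((0 : E), (0 : E)) ∈ A.graph := A.graph.zero_mem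
  exact A.mem_graph_snd_inj h1 h0 rfl

lemma graph_iff_apply (h : IsCompactResolvent A y S) (f g : E) (z : ℂ) :
    (f, g + z • f) ∈ A.graph ↔ S (g + (z + y) • f) = f := by
  rw [← h.graph_iff]
  have : g + (z + y) • f + (-(y : ℂ)) • f = g + z • f := by
    rw [add_assoc, ← add_smul]; congr 2; ring
  rw [this]

lemma eigen_iff (h : IsCompactResolvent A y S) (f : E) (z : ℂ) :
    (f, z • f) ∈ A.graph ↔ (z + y) • S f = f := by
  have := h.graph_iff_apply f 0 z
  rwa [zero_add, zero_add, map_smul] at this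

lemma apply_of_eigen (h : IsCompactResolvent A y S) {f : E} {z : ℂ} (hf : (f, z • f) ∈ A.graph) :
    S f = (z + y)⁻¹ • f := by
  have h1 := (h.eigen_iff f z).1 hf
  by_cases hz : z + y = 0
  · rw [hz, zero_smul] at h1
    rw [← h1, map_zero, smul_zero]
  · nth_rewrite 2 [← h1]
    rw [smul_smul, inv_mul_cancel₀ hz, one_smul]

/-- An eigenvector of A at z is one of S at (z + y)⁻¹; this number is real by symmetry, nonnegative
by positivity, and nonzero since z + y ≠ 0. -/
lemma real_of_eigen (h : IsCompactResolvent A y S) {f : E} (hf0 : f ≠ 0) {z : ℂ}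
    (hf : (f, z • f) ∈ A.graph) : ∃ l : ℝ, z = l ∧ 0 < l + y := by
  have h1 := (h.eigen_iff f z).1 hf
  have hz : z + y ≠ 0 := fun hz => hf0 (by rw [← h1, hz, zero_smul])
  have h2 := h.apply_of_eigen hf
  have h3 := h.nonneg f
  have h4 : inner ℂ (S f) f = inner ℂ f (S f) := h.symm f f
  have n0 : inner ℂ f f ≠ 0 := inner_self_ne_zero.2 hf0
  rw [h2, inner_smul_left, inner_smul_right] at h4
  have h5 := mul_right_cancel₀ n0 h4
  obtain ⟨r, hr⟩ := Complex.conj_eq_iff_real.1 h5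
  rw [h2, inner_smul_right, hr, inner_self_eq_norm_sq_to_K] at h3
  have h6 : (0 : ℝ) ≤ r * ‖f‖ ^ 2 := by
    have e : ((r : ℂ) * (((‖f‖ : ℝ) : ℂ)) ^ 2).re = r * ‖f‖ ^ 2 := by
      rw [← Complex.ofReal_pow, ← Complex.ofReal_mul, Complex.ofReal_re]
    rw [← e]; exact h3
  have hf2 : 0 < ‖f‖ ^ 2 := by positivity
  have r0 : 0 ≤ r := nonneg_of_mul_nonneg_left h6 hf2
  have rne : r ≠ 0 := by
    rintro rfl
    rw [Complex.ofReal_zero, inv_eq_zero] at hr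
    exact hz hr
  refine ⟨r⁻¹ - y, ?_, ?_⟩
  · have : z + y = (r : ℂ)⁻¹ := by rw [← hr, inv_inv]
    push_cast
    rw [← this]; ring
  · rw [sub_add_cancel]
    exact inv_pos.2 (lt_of_le_of_ne r0 rne.symm)

/-- By the Fredholm alternative for S, a point z ≠ -y either gives the eigenvalue (z + y)⁻¹ of S or
makes (z + y)⁻¹ - S invertible, which produces the resolvent of A at z. The point -y is always in
the resolvent set. -/
lemma mem_spec_iff (h : IsCompactResolvent A y S) (z : ℂ) :
    z ∈ spec A ↔ ∃ f : E, f ≠ 0 ∧ (f, z • f) ∈ A.graph := by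
  constructor
  · intro hz
    by_contra! hne
    apply hz
    by_cases hzy : z + y = 0
    · refine ⟨S, fun f g => ?_⟩
      rw [← h.graph_iff, eq_neg_of_add_eq_zero_left hzy]
    · have hμ : (z + y)⁻¹ ≠ 0 := inv_ne_zero hzy
      rcases h.compact.hasEigenvalue_or_mem_resolventSet hμ with he | hr
      · exfalso
        obtain ⟨f, hf1, hf2⟩ := he.exists_hasEigenvector
        refine hne f hf2 ((h.eigen_iff f z).2 ?_)
        have h1 : S f = (z + y)⁻¹ • f := Module.End.mem_eigenspace_iff.1 hf1
        rw [h1, smul_smul, mul_inv_cancel₀ hzy, one_smul]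
      · obtain ⟨u, hu⟩ := hr
        have hu' : ∀ x, (u : E →L[ℂ] E) x = (z + y)⁻¹ • x - S x := by
          intro x
          rw [hu]
          simp [Algebra.algebraMap_eq_smul_one]
        have l1 : ∀ x, (u⁻¹ : (E →L[ℂ] E)ˣ).1 ((u : E →L[ℂ] E) x) = x := fun x => by
          exact DFunLike.congr_fun u.inv_mul x
        have l2 : ∀ x, (u : E →L[ℂ] E) ((u⁻¹ : (E →L[ℂ] E)ˣ).1 x) = x := fun x => by
          exact DFunLike.congr_fun u.mul_inv x
        refine ⟨(z + y)⁻¹ • ((u⁻¹ : (E →L[ℂ] E)ˣ).1 ∘L S), fun f g => ?_⟩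
        rw [h.graph_iff_apply]
        -- The resolvent equation divided by z + y: ((z + y)⁻¹ - S)f = (z + y)⁻¹ S g.
        have key : S (g + (z + y) • f) = f ↔ (u : E →L[ℂ] E) f = (z + y)⁻¹ • S g := by
          rw [map_add, map_smul, hu']
          constructor
          · intro e
            nth_rewrite 1 [← e]
            rw [smul_add, smul_smul, inv_mul_cancel₀ hzy, one_smul, add_sub_cancel_right]
          · intro e
            have := congrArg (fun x => (z + y) • x) e
            simp only [smul_sub, smul_smul, mul_inv_cancel₀ hzy, one_smul] at this
            rw [← this]; abel
        rw [key]
        simp only [smul_apply, ContinuousLinearMap.comp_apply]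
        constructor
        · intro e
          rw [← l1 f, e, map_smul]
        · intro e
          rw [← e, map_smul, l2]
  · rintro ⟨f, hf0, hf⟩ ⟨T, hT⟩
    have h1 := (hT f 0).1 (by rwa [zero_add])
    rw [map_zero] at h1
    exact hf0 h1.symm

end IsCompactResolvent

/-- The eigenvalues of `A` are the elements of `Λ`; they are real and simple, with eigenvectors
`v`. -/
structure HasSimpleSpectrum (A : E →ₗ.[ℂ] E) (Λ : Set ℝ) (v : ℝ → E) : Prop where
  ne_zero : ∀ l ∈ Λ, v l ≠ 0
  mem : ∀ l ∈ Λ, (v l, (l : ℂ) • v l) ∈ A.graph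
  eq_smul : ∀ (l : ℝ) (f : E), f ≠ 0 → (f, (l : ℂ) • f) ∈ A.graph → l ∈ Λ ∧ ∃ c : ℂ, f = c • v l

namespace HasSimpleSpectrum

variable {Λ : Set ℝ} {v : ℝ → E}

lemma spec_eq (hs : HasSimpleSpectrum A Λ v) (h : IsCompactResolvent A y S) :
    spec A = (fun l : ℝ => (l : ℂ)) '' Λ := by
  ext z
  rw [h.mem_spec_iff]
  constructor
  · rintro ⟨f, hf0, hf⟩
    obtain ⟨l, rfl, -⟩ := h.real_of_eigen hf0 hf
    exact ⟨l, (hs.eq_smul l f hf0 hf).1, rfl⟩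
  · rintro ⟨l, hl, rfl⟩
    exact ⟨v l, hs.ne_zero l hl, hs.mem l hl⟩

lemma add_pos (hs : HasSimpleSpectrum A Λ v) (h : IsCompactResolvent A y S) {l : ℝ} (hl : l ∈ Λ) :
    0 < l + y := by
  obtain ⟨l', h1, h2⟩ := h.real_of_eigen (hs.ne_zero l hl) (hs.mem l hl)
  rw [Complex.ofReal_inj] at h1
  rwa [h1]

lemma eigenspace_eq (hs : HasSimpleSpectrum A Λ v) {l : ℝ} (hl : l ∈ Λ) :
    eigenspace A l = Submodule.span ℂ {v l} := by
  ext f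
  rw [Submodule.mem_span_singleton]
  change (f, (l : ℂ) • f) ∈ A.graph ↔ _
  constructor
  · intro hf
    by_cases hf0 : f = 0
    · exact ⟨0, by rw [hf0, zero_smul]⟩
    · obtain ⟨-, c, hc⟩ := hs.eq_smul l f hf0 hf
      exact ⟨c, hc.symm⟩
  · rintro ⟨c, rfl⟩
    have := A.graph.smul_mem c (hs.mem l hl)
    rwa [Prod.smul_mk, smul_comm] at this

lemma finrank_eigenspace (hs : HasSimpleSpectrum A Λ v) {l : ℝ} (hl : l ∈ Λ) :
    Module.finrank ℂ (eigenspace A l) = 1 := by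
  rw [hs.eigenspace_eq hl]
  exact finrank_span_singleton (hs.ne_zero l hl)

/-- The normalized eigenvectors. -/
def unitVec (v : ℝ → E) (Λ : Set ℝ) (l : Λ) : E := ((‖v l‖⁻¹ : ℝ) : ℂ) • v l

lemma unitVec_mem (hs : HasSimpleSpectrum A Λ v) (l : Λ) :
    (unitVec v Λ l, ((l : ℝ) : ℂ) • unitVec v Λ l) ∈ A.graph := by
  have := A.graph.smul_mem ((‖v l‖⁻¹ : ℝ) : ℂ) (hs.mem l l.2)
  rwa [Prod.smul_mk, smul_comm] at this

lemma apply_unitVec (hs : HasSimpleSpectrum A Λ v) (h : IsCompactResolvent A y S) (l : Λ) :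
    S (unitVec v Λ l) = ((((l : ℝ) + y)⁻¹ : ℝ) : ℂ) • unitVec v Λ l := by
  rw [h.apply_of_eigen (hs.unitVec_mem l)]
  push_cast
  rfl

lemma orthonormal (hs : HasSimpleSpectrum A Λ v) (h : IsCompactResolvent A y S) :
    Orthonormal ℂ (unitVec v Λ) := by
  refine ⟨fun l => ?_, fun l l' hne => ?_⟩
  · have := norm_ne_zero_iff.2 (hs.ne_zero l l.2)
    rw [unitVec, norm_smul, Complex.norm_real, norm_inv, norm_norm, inv_mul_cancel₀ this]
  · have h1 : inner ℂ (S (unitVec v Λ l)) (unitVec v Λ l') =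
      inner ℂ (unitVec v Λ l) (S (unitVec v Λ l')) := h.symm _ _
    rw [hs.apply_unitVec h, hs.apply_unitVec h, inner_smul_left, inner_smul_right,
      Complex.conj_ofReal] at h1
    by_contra h0
    have h2 := mul_right_cancel₀ h0 h1
    rw [Complex.ofReal_inj, inv_inj] at h2
    exact hne (Subtype.ext (by linarith))

/-- The spectral theorem gives completeness of the eigenspaces of S. Each of them lies in the span
of an eigenvector of A, because S is injective and the eigenvalues are simple. -/
lemma span_orthogonal (hs : HasSimpleSpectrum A Λ v) (h : IsCompactResolvent A y S) :
    (Submodule.span ℂ (range (unitVec v Λ)))ᗮ = ⊥ := by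
  rw [eq_bot_iff, ← ContinuousLinearMap.orthogonalComplement_iSup_eigenspaces_eq_bot h.compact h.symm]
  refine Submodule.orthogonal_le (iSup_le fun μ g hg => ?_)
  have h1 : S g = μ • g := Module.End.mem_eigenspace_iff.1 hg
  by_cases hg0 : g = 0
  · rw [hg0]; exact Submodule.zero_mem _
  have hμ : μ ≠ 0 := fun h0 => hg0 (h.eq_zero_of_apply (by rw [h1, h0, zero_smul]))
  -- The eigenvalue μ of S corresponds to the eigenvalue 1/μ - y of A.
  have h2 : (g, (μ⁻¹ - y) • g) ∈ A.graph := by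
    rw [h.eigen_iff, sub_add_cancel, h1, smul_smul, inv_mul_cancel₀ hμ, one_smul]
  obtain ⟨l, hl, -⟩ := h.real_of_eigen hg0 h2
  rw [hl] at h2
  obtain ⟨hlΛ, c, hc⟩ := hs.eq_smul l g hg0 h2
  have hn := norm_ne_zero_iff.2 (hs.ne_zero l hlΛ)
  have : g = (c * ((‖v l‖ : ℝ) : ℂ)) • unitVec v Λ ⟨l, hlΛ⟩ := by
    rw [unitVec, smul_smul, hc]
    congr 1
    have hn' : ((‖v l‖ : ℝ) : ℂ) ≠ 0 := by exact_mod_cast hn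
    push_cast
    field_simp
  rw [this]
  exact Submodule.smul_mem _ _ (Submodule.subset_span ⟨_, rfl⟩)

/-- The orthonormal basis of eigenvectors. -/
def basis (hs : HasSimpleSpectrum A Λ v) (h : IsCompactResolvent A y S) : HilbertBasis Λ ℂ E :=
  HilbertBasis.mkOfOrthogonalEqBot (hs.orthonormal h) (hs.span_orthogonal h)

lemma basis_apply (hs : HasSimpleSpectrum A Λ v) (h : IsCompactResolvent A y S) (l : Λ) :
    hs.basis h l = unitVec v Λ l := by
  rw [basis, HilbertBasis.coe_mkOfOrthogonalEqBot]

lemma apply_basis (hs : HasSimpleSpectrum A Λ v) (h : IsCompactResolvent A y S) (l : Λ) :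
    S (hs.basis h l) = ((((l : ℝ) + y)⁻¹ : ℝ) : ℂ) • hs.basis h l := by
  rw [basis_apply, hs.apply_unitVec h]

lemma inner_apply_basis (hs : HasSimpleSpectrum A Λ v) (h : IsCompactResolvent A y S) (l : Λ) :
    inner ℂ (hs.basis h l) (S (hs.basis h l)) = ((((l : ℝ) + y)⁻¹ : ℝ) : ℂ) := by
  rw [hs.apply_basis h, inner_smul_right, inner_self_eq_norm_sq_to_K, (hs.basis h).orthonormal.1 l]
  simp

end HasSimpleSpectrum

end

section

/-! ### The spectrum of the Sturm–Liouville operator -/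

variable {m b e η K a y : ℝ} {q a₀ V : ℝ → ℝ} {B : LeftBC}

/-- The potential of the equation at the spectral parameter `-y`. -/
def shiftedPot (m : ℝ) (V : ℝ → ℝ) (y x : ℝ) : ℝ := m * (m - 1) / x ^ 2 + (V x + y)

/-- The boundary value `φ'(1)` of the regular solution at the spectral parameter `-y`. -/
def dregOne (hp : IsPerturbation m e η K V) (b y : ℝ) : ℝ := dregSolOne (hp.shift y) b

/-- The boundary value `φ(1)` of the regular solution at the spectral parameter `-y`. -/
def regOne (hp : IsPerturbation m e η K V) (b y : ℝ) : ℝ := ext (regFactor (hp.shift y) b) 1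

/-- The characteristic function: `R₁ φ` for the regular solution at the spectral parameter `-y`. -/
def charFun (hp : IsPerturbation m e η K V) (b a y : ℝ) : ℝ := dregOne hp b y + a * regOne hp b y

lemma analyticOnNhd_charFun (hp : IsPerturbation m e η K V) (b a : ℝ) :
    AnalyticOnNhd ℝ (charFun hp b a) univ := fun y hy =>
  (analyticOnNhd_dregSolOne hp b y hy).add
    (analyticAt_const.mul (analyticOnNhd_regSolOne hp b y hy))

lemma isRegularSolution_shift (hp : IsPerturbation m e η K V) (hb : b * m = 0) (y : ℝ) :
    IsRegularSolution m b (shiftedPot m V y) (regSol (hp.shift y) b) (dregSol (hp.shift y) b)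
      (regOne hp b y) (dregOne hp b y) := isRegularSolution_regSol (hp.shift y) hb

lemma continuousOn_shiftedPot (hp : IsPerturbation m e η K V) (y : ℝ) :
    ContinuousOn (shiftedPot m V y) (Ioo 0 1) := by
  refine ContinuousOn.add (ContinuousOn.div continuousOn_const (by fun_prop) ?_)
    (hp.cont.add continuousOn_const)
  exact fun x hx => pow_ne_zero 2 hx.1.ne'

/-- Parseval's identity. -/
lemma hasSum_norm_inner_sq {E : Type*} [NormedAddCommGroup E] [InnerProductSpace ℂ E] {ι : Type*}
    (bs : HilbertBasis ι ℂ E) (v : E) : HasSum (fun i => ‖inner ℂ v (bs i)‖ ^ 2) (‖v‖ ^ 2) := by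
  have h2 := bs.hasSum_inner_mul_inner v v
  have h3 : ∀ l, inner ℂ v (bs l) * inner ℂ (bs l) v = ((‖inner ℂ v (bs l)‖ ^ 2 : ℝ) : ℂ) := by
    intro l
    rw [← inner_conj_symm (bs l), Complex.mul_conj, Complex.normSq_eq_norm_sq]
  simp_rw [h3] at h2
  rw [inner_self_eq_norm_sq_to_K] at h2
  refine Complex.hasSum_ofReal.1 ?_
  simpa using h2

namespace IsLeftData

lemma shiftedPot_eq (hd : IsLeftData q a₀ B m e η K b V) (y : ℝ) :
    ∀ x ∈ Ioo (0 : ℝ) 1, shiftedPot m V y x = q x + y := by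
  intro x hx
  rw [shiftedPot, hd.eq_q x hx]; ring

lemma sol (hd : IsLeftData q a₀ B m e η K b V) (y : ℝ) :
    IsRegularSolution m b (shiftedPot m V y) (regSol (hd.pert.shift y) b)
      (dregSol (hd.pert.shift y) b) (regOne hd.pert b y) (dregOne hd.pert b y) :=
  isRegularSolution_shift hd.pert hd.b_mul_m y

/-- The regular solution for the spectral parameter `l` as an element of `L²`. -/
def solVec (hd : IsLeftData q a₀ B m e η K b V) (l : ℝ) : H := (hd.sol (-l)).vec hd.pert.m_nonneg

/-- The set of eigenvalues. -/
def eigenvalues (hd : IsLeftData q a₀ B m e η K b V) (a : ℝ) : Set ℝ :=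
  {l | charFun hd.pert b a (-l) = 0}

lemma hasSimpleSpectrum (hd : IsLeftData q a₀ B m e η K b V) (a : ℝ) :
    HasSimpleSpectrum (op q a₀ B a) (hd.eigenvalues a) hd.solVec where
  ne_zero l _ := (hd.sol (-l)).vec_ne_zero _
  mem l hl := by
    rw [op_graph]
    have := hd.mem_of_eigen hd.pert.m_nonneg (continuousOn_shiftedPot hd.pert _)
      (hd.shiftedPot_eq (-l)) (hd.sol (-l)) (a := a) hl
    rwa [Complex.ofReal_neg, neg_neg] at this
  eq_smul l f hf0 hf := by
    rw [op_graph] at hf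
    have hf' : (f, (-(((-l : ℝ)) : ℂ)) • f) ∈ opGraph q a₀ B a := by
      rwa [Complex.ofReal_neg, neg_neg]
    obtain ⟨c, hc, hc2⟩ := hd.eigen_of_mem hd.pert.m_nonneg (continuousOn_shiftedPot hd.pert _)
      (hd.shiftedPot_eq (-l)) (hd.sol (-l)) hf'
    refine ⟨?_, c, hc⟩
    have hc0 : c ≠ 0 := by
      rintro rfl
      exact hf0 (by rw [hc, zero_smul])
    exact_mod_cast (mul_eq_zero.1 hc2).resolve_left hc0

/-- At the spectral parameter `-y` the regular solution and its value under `R₁` are positive. -/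
structure IsPositiveAt (hd : IsLeftData q a₀ B m e η K b V) (a y : ℝ) : Prop where
  pos : ∀ x ∈ Ioo (0 : ℝ) 1, 0 < regSol (hd.pert.shift y) b x
  pos_one : 0 < regOne hd.pert b y
  char_pos : 0 < charFun hd.pert b a y

lemma IsPositiveAt.positiveSol {hd : IsLeftData q a₀ B m e η K b V} (h : hd.IsPositiveAt a y) :
    IsPositiveSolution m b (shiftedPot m V y) (regSol (hd.pert.shift y) b)
      (dregSol (hd.pert.shift y) b) (regOne hd.pert b y) (dregOne hd.pert b y) :=
  ⟨hd.sol y, hd.pert.m_nonneg, h.pos, h.pos_one⟩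

lemma IsPositiveAt.isCompactResolvent {hd : IsLeftData q a₀ B m e η K b V}
    (h : hd.IsPositiveAt a y) {C : ℝ}
    (hκ : IsBoundedKernel (greenKernel (regSol (hd.pert.shift y) b)) C) :
    IsCompactResolvent (op q a₀ B a) y (greenOp h.positiveSol hκ a) where
  compact := isCompactOperator_greenOp _ _ _
  symm := isSymmetric_greenOp _ _ _
  graph_iff := hd.greenOp_spec (continuousOn_shiftedPot hd.pert _) (hd.shiftedPot_eq y)
    h.positiveSol hκ h.char_pos.ne'
  nonneg f := by
    rw [inner_self_greenOp, Complex.ofReal_re]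
    have : 0 < dregOne hd.pert b y + a * regOne hd.pert b y := h.char_pos
    have := h.pos_one
    positivity

/-- The trace of the resolvent. -/
def resolventTrace (hd : IsLeftData q a₀ B m e η K b V) (a y : ℝ) : ℝ :=
  (regOne hd.pert b y * charFun hd.pert b a y)⁻¹ *
      ‖(hd.sol y).vec hd.pert.m_nonneg‖ ^ 2 +
    ∫ w, ∫ x, greenKernel (regSol (hd.pert.shift y) b) w x ^ 2 ∂unitMeasure ∂unitMeasure

/-- The quadratic form of the resolvent at a unit eigenvector is 1/(λ + y). Summing its two squares
over the eigenbasis, the rank one part is evaluated by Parseval and P*P by the Hilbert–Schmidt norm.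
-/
lemma IsPositiveAt.hasSum_inv {hd : IsLeftData q a₀ B m e η K b V} (h : hd.IsPositiveAt a y) :
    (∀ l ∈ hd.eigenvalues a, 0 < l + y) ∧
      HasSum (fun l : hd.eigenvalues a => ((l : ℝ) + y)⁻¹) (hd.resolventTrace a y) := by
  obtain ⟨C, hκ⟩ := h.positiveSol.exists_isBoundedKernel
  have hr := h.isCompactResolvent hκ
  have hs := hd.hasSimpleSpectrum a
  have hpos : ∀ l ∈ hd.eigenvalues a, 0 < l + y := fun l hl => hs.add_pos hr hl
  refine ⟨hpos, ?_⟩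
  have e : ∀ l : hd.eigenvalues a, ((l : ℝ) + y)⁻¹ =
      (regOne hd.pert b y * charFun hd.pert b a y)⁻¹ *
        ‖inner ℂ ((hd.sol y).vec hd.pert.m_nonneg) (hs.basis hr l)‖ ^ 2 +
      ‖hκ.toCLM (hs.basis hr l)‖ ^ 2 := by
    intro l
    have h1 := hs.inner_apply_basis hr l
    rw [inner_self_greenOp, Complex.ofReal_inj] at h1
    rw [← h1, norm_inner_symm]
    rfl
  have t1 := (hasSum_norm_inner_sq (hs.basis hr) ((hd.sol y).vec hd.pert.m_nonneg)).mul_left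
    (regOne hd.pert b y * charFun hd.pert b a y)⁻¹
  have t2 := hκ.summable_norm_sq_toCLM (hs.basis hr).orthonormal
  have hsum : Summable fun l : hd.eigenvalues a => ((l : ℝ) + y)⁻¹ :=
    (t1.summable.add t2).congr fun l => (e l).symm
  have := countable_of_summable_inv (fun l : hd.eigenvalues a => hpos l l.2) hsum
  have t3 := t1.add (hκ.hasSum_norm_sq_toCLM (hs.basis hr))
  exact (funext e : (fun l : hd.eigenvalues a => ((l : ℝ) + y)⁻¹) = _) ▸ t3

end IsLeftData

end

section

/-! ### The trace of the resolvent is the logarithmic derivative of the characteristic function -/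

/-- The integral of `φ χ` over `(0,x)`. -/
def prodIntegral (φ χ : ℝ → ℝ) (x : ℝ) : ℝ := ∫ t in 0..x, φ t * χ t

variable {m b φ₁ d₁ χ₁ e₁ δ ε : ℝ} {Q φ dφ χ dχ : ℝ → ℝ}

lemma rpow_two_mul {x : ℝ} (hx : 0 < x) (m : ℝ) : x ^ (2 * m) = x ^ m * x ^ m := by
  rw [← Real.rpow_add hx]; ring_nf

namespace IsRegularSolution

lemma exists_mul_bound (h : IsRegularSolution m b Q φ dφ φ₁ d₁) :
    ∃ C, 0 ≤ C ∧ ∀ (ε : ℝ) (χ : ℝ → ℝ), (∀ x ∈ Ioo (0 : ℝ) 1, |χ x| ≤ ε * x ^ m) →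
      ∀ x ∈ Ioo (0 : ℝ) 1, |φ x * χ x| ≤ C * ε * x ^ (2 * m) := by
  obtain ⟨C, hC, hu⟩ := h.exists_upper_bound
  refine ⟨C, hC, fun ε χ hχ x hx => ?_⟩
  rw [abs_mul, rpow_two_mul hx.1]
  calc |φ x| * |χ x| ≤ (C * x ^ m) * (ε * x ^ m) :=
        mul_le_mul (hu x hx) (hχ x hx) (abs_nonneg _) ((abs_nonneg _).trans (hu x hx))
    _ = _ := by ring

lemma mul_bound_self (h : IsRegularSolution m b Q φ dφ φ₁ d₁) {Q' : ℝ → ℝ}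
    (h' : IsRegularSolution m b Q' χ dχ χ₁ e₁) :
    ∃ C, ∀ x ∈ Ioo (0 : ℝ) 1, |φ x * χ x| ≤ C * x ^ (2 * m) := by
  obtain ⟨C, -, hu⟩ := h.exists_mul_bound
  obtain ⟨R, -, hR⟩ := h'.exists_upper_bound
  exact ⟨C * R, hu R χ hR⟩

/-- Both solutions have the same normalization and the same slope b at 0, so the limits cancel. -/
lemma tendsto_wronskian_zero (h : IsRegularSolution m b Q φ dφ φ₁ d₁) {Q' : ℝ → ℝ}
    (h' : IsRegularSolution m b Q' χ dχ χ₁ e₁) :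
    Tendsto (fun x => φ x * dχ x - dφ x * χ x) (𝓝[>] 0) (𝓝 0) := by
  have := (h.left.mul h'.slope).sub (h'.left.mul h.slope)
  rw [one_mul, sub_self] at this
  refine this.congr' ?_
  filter_upwards [self_mem_nhdsWithin] with x hx
  have : x ^ m ≠ 0 := (Real.rpow_pos_of_pos hx m).ne'
  field_simp
  ring

lemma hasDerivAt_prodIntegral (hm : 0 ≤ m) (h : IsRegularSolution m b Q φ dφ φ₁ d₁) {Q' : ℝ → ℝ}
    (h' : IsRegularSolution m b Q' χ dχ χ₁ e₁) {x : ℝ} (hx : x ∈ Ioo (0 : ℝ) 1) :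
    HasDerivAt (prodIntegral φ χ) (φ x * χ x) x := by
  obtain ⟨C, hC⟩ := h.mul_bound_self h'
  exact hasDerivAt_integral_of_power_bound (by linarith) (h.continuousOn.mul h'.continuousOn) hC hx

lemma intervalIntegrable_mul (hm : 0 ≤ m) (h : IsRegularSolution m b Q φ dφ φ₁ d₁) {Q' : ℝ → ℝ}
    (h' : IsRegularSolution m b Q' χ dχ χ₁ e₁) {x : ℝ} (hx : x ∈ Icc (0 : ℝ) 1) :
    IntervalIntegrable (fun t => φ t * χ t) volume 0 x := by
  obtain ⟨C, hC⟩ := h.mul_bound_self h'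
  exact intervalIntegrable_of_power_bound (by linarith) (h.continuousOn.mul h'.continuousOn) hC hx

/-- The derivative of the Wronskian is (Q' - Q)φχ = δφχ, integrated from its zero limit at 0. -/
lemma wronskian_eq_mul_prodIntegral (hm : 0 ≤ m) (h : IsRegularSolution m b Q φ dφ φ₁ d₁)
    {Q' : ℝ → ℝ} (h' : IsRegularSolution m b Q' χ dχ χ₁ e₁)
    (hQ : ∀ x ∈ Ioo (0 : ℝ) 1, Q' x = Q x + δ) :
    (∀ x ∈ Ioo (0 : ℝ) 1, φ x * dχ x - dφ x * χ x = δ * prodIntegral φ χ x) ∧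
      φ₁ * e₁ - d₁ * χ₁ = δ * prodIntegral φ χ 1 := by
  have hd : ∀ x ∈ Ioo (0 : ℝ) 1,
      HasDerivAt (fun x => φ x * dχ x - dφ x * χ x) (δ * (φ x * χ x)) x := by
    intro x hx
    refine (((h.hasDerivAt x hx).mul (h'.hasDerivAt' x hx)).sub
      ((h.hasDerivAt' x hx).mul (h'.hasDerivAt x hx))).congr_deriv ?_
    rw [hQ x hx]; ring
  have h0 := h.tendsto_wronskian_zero h'
  constructor
  · intro x hx
    have := intervalIntegral.integral_eq_sub_of_hasDerivAt_of_tendsto hx.1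
      (fun t ht => hd t ⟨ht.1, ht.2.trans hx.2⟩)
      ((intervalIntegrable_mul hm h h' ⟨hx.1.le, hx.2.le⟩).const_mul δ) h0
      ((hd x hx).continuousAt.tendsto.mono_left nhdsWithin_le_nhds)
    rw [intervalIntegral.integral_const_mul, sub_zero] at this
    exact this.symm
  · have := intervalIntegral.integral_eq_sub_of_hasDerivAt_of_tendsto one_pos hd
      ((intervalIntegrable_mul hm h h' (by simp)).const_mul δ) h0
      ((h.right.mul h'.right').sub (h.right'.mul h'.right))
    rw [intervalIntegral.integral_const_mul, sub_zero] at this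
    exact this.symm

lemma norm_vec_sq (h : IsRegularSolution m b Q φ dφ φ₁ d₁) (hm : 0 ≤ m) :
    ‖h.vec hm‖ ^ 2 = prodIntegral φ φ 1 := by
  have h1 := h.inner_vec hm (h.vec hm)
  rw [inner_self_eq_norm_sq_to_K, leftIntegral, ← setIntegral_Ioo_eq _ zero_le_one] at h1
  have h2 : ∫ x in Ioo (0 : ℝ) 1, (φ x : ℂ) * h.vec hm x =
      ∫ x in Ioo (0 : ℝ) 1, ((φ x * φ x : ℝ) : ℂ) := by
    refine integral_congr_ae ?_
    filter_upwards [h.vec_ae hm] with x hx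
    rw [hx]; push_cast; rfl
  rw [h2, integral_complex_ofReal, ← integral_Ioc_eq_integral_Ioo,
    ← intervalIntegral.integral_of_le zero_le_one] at h1
  apply Complex.ofReal_injective
  rw [prodIntegral, ← h1]
  push_cast
  rfl

end IsRegularSolution

namespace IsPositiveSolution

lemma continuousOn_prodIntegral_div (h : IsPositiveSolution m b Q φ dφ φ₁ d₁) {Q' : ℝ → ℝ}
    (h' : IsRegularSolution m b Q' χ dχ χ₁ e₁) :
    ContinuousOn (fun x => prodIntegral φ χ x / φ x ^ 2) (Ioo 0 1) := by
  refine ContinuousOn.div (fun x hx => ?_) (h.continuousOn.pow 2) fun x hx =>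
    pow_ne_zero 2 (h.pos x hx).ne'
  exact (h.toIsRegularSolution.hasDerivAt_prodIntegral h.m_nonneg h'
    hx).continuousAt.continuousWithinAt

/-- A bound for `φ⁻² ∫ φ χ` by the size of `χ`. -/
lemma exists_prodIntegral_bound (h : IsPositiveSolution m b Q φ dφ φ₁ d₁) :
    ∃ M, 0 ≤ M ∧ ∀ (ε : ℝ) (χ : ℝ → ℝ), 0 ≤ ε → (∀ x ∈ Ioo (0 : ℝ) 1, |χ x| ≤ ε * x ^ m) →
      (∀ x ∈ Ioo (0 : ℝ) 1, |prodIntegral φ χ x / φ x ^ 2| ≤ M * ε) ∧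
      |prodIntegral φ χ 1| ≤ M * ε := by
  obtain ⟨C, hC, hu⟩ := h.exists_mul_bound
  obtain ⟨c, hc, hl⟩ := h.exists_lower_bound
  have hm := h.m_nonneg
  refine ⟨C / c ^ 2 + C, by positivity, fun ε χ hε hχ => ?_⟩
  have key : ∀ s ∈ Icc (0 : ℝ) 1, |prodIntegral φ χ s| ≤ C * ε * s ^ (2 * m + 1) := by
    intro s hs
    have h1 := abs_integral_le_of_power_bound (p := 2 * m) (by linarith) (hu ε χ hχ) hs
    refine h1.trans (div_le_self ?_ (by linarith))
    have := Real.rpow_nonneg hs.1 (2 * m + 1)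
    positivity
  constructor
  · intro x hx
    have h1 := key x ⟨hx.1.le, hx.2.le⟩
    have h2 := hl x hx
    have p := Real.rpow_pos_of_pos hx.1 m
    have fp := h.pos x hx
    have e1 : x ^ (2 * m + 1) = x ^ m * x ^ m * x := by
      rw [Real.rpow_add_one hx.1.ne', rpow_two_mul hx.1]
    rw [abs_div, abs_of_pos (by positivity : 0 < φ x ^ 2), div_le_iff₀ (by positivity)]
    have h3 : (c * x ^ m) ^ 2 ≤ φ x ^ 2 := pow_le_pow_left₀ (by positivity) h2 2
    calc |prodIntegral φ χ x| ≤ C * ε * (x ^ m * x ^ m * x) := by rwa [← e1]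
      _ ≤ C * ε * (x ^ m * x ^ m * 1) := by
          have := hx.2.le
          gcongr
      _ = C / c ^ 2 * ε * (c * x ^ m) ^ 2 := by field_simp
      _ ≤ C / c ^ 2 * ε * φ x ^ 2 := by gcongr
      _ ≤ (C / c ^ 2 + C) * ε * φ x ^ 2 := by gcongr; linarith
  · have h1 := key 1 (by simp)
    rw [Real.one_rpow, mul_one] at h1
    refine h1.trans ?_
    gcongr
    have : 0 ≤ C / c ^ 2 := by positivity
    linarith

lemma intervalIntegrable_prodIntegral_div (h : IsPositiveSolution m b Q φ dφ φ₁ d₁) {Q' : ℝ → ℝ}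
    (h' : IsRegularSolution m b Q' χ dχ χ₁ e₁) :
    IntervalIntegrable (fun x => prodIntegral φ χ x / φ x ^ 2) volume 0 1 := by
  obtain ⟨M, -, hM⟩ := h.exists_prodIntegral_bound
  obtain ⟨R, hR0, hR⟩ := h'.exists_upper_bound
  refine intervalIntegrable_of_power_bound (C := M * R) (p := 0) (by norm_num)
    (h.continuousOn_prodIntegral_div h') ?_ (by simp)
  simpa using (hM R χ hR0 hR).1

/-- Integrates (χ/φ)' = W/φ² from 0, where the quotient is 1, with the Wronskian W = δ∫φχ. -/
lemma div_sub_one_eq (h : IsPositiveSolution m b Q φ dφ φ₁ d₁) {Q' : ℝ → ℝ}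
    (h' : IsRegularSolution m b Q' χ dχ χ₁ e₁) (hQ : ∀ x ∈ Ioo (0 : ℝ) 1, Q' x = Q x + δ) :
    χ₁ / φ₁ - 1 = δ * ∫ x in 0..1, prodIntegral φ χ x / φ x ^ 2 := by
  have hw := (h.toIsRegularSolution.wronskian_eq_mul_prodIntegral h.m_nonneg h' hQ).1
  have hd : ∀ x ∈ Ioo (0 : ℝ) 1,
      HasDerivAt (fun x => χ x / φ x) (δ * (prodIntegral φ χ x / φ x ^ 2)) x := by
    intro x hx
    refine ((h'.hasDerivAt x hx).div (h.hasDerivAt x hx) (h.pos x hx).ne').congr_deriv ?_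
    rw [← mul_div_assoc, ← hw x hx]
    ring
  have l0 : Tendsto (fun x => χ x / φ x) (𝓝[>] 0) (𝓝 1) := by
    have := h'.left.div h.left one_ne_zero
    rw [div_one] at this
    refine this.congr' ?_
    filter_upwards [self_mem_nhdsWithin] with x hx
    have : x ^ m ≠ 0 := (Real.rpow_pos_of_pos hx m).ne'
    simp only [Pi.div_apply]
    field_simp
  have := intervalIntegral.integral_eq_sub_of_hasDerivAt_of_tendsto one_pos hd
    ((h.intervalIntegrable_prodIntegral_div h').const_mul δ) l0
    (h'.right.div h.right h.pos_one.ne')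
  rw [intervalIntegral.integral_const_mul] at this
  exact this.symm

/-- The difference quotient of the characteristic function, up to a small error. -/
lemma exists_char_bound (h : IsPositiveSolution m b Q φ dφ φ₁ d₁) (a : ℝ) :
    ∃ M, 0 ≤ M ∧ ∀ (δ ε : ℝ) (Q' χ dχ : ℝ → ℝ) (χ₁ e₁ : ℝ),
      IsRegularSolution m b Q' χ dχ χ₁ e₁ → (∀ x ∈ Ioo (0 : ℝ) 1, Q' x = Q x + δ) → 0 ≤ ε →
      (∀ x ∈ Ioo (0 : ℝ) 1, |χ x - φ x| ≤ ε * x ^ m) →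
      |e₁ + a * χ₁ - (d₁ + a * φ₁) - δ * ((d₁ + a * φ₁) *
        (∫ x in 0..1, prodIntegral φ φ x / φ x ^ 2) + prodIntegral φ φ 1 / φ₁)| ≤
        |δ| * (M * ε) := by
  obtain ⟨M, hM0, hM⟩ := h.exists_prodIntegral_bound
  have p1 := h.pos_one
  refine ⟨|d₁ + a * φ₁| * M + M / φ₁, by positivity, ?_⟩
  intro δ ε Q' χ dχ χ₁ e₁ h' hQ hε hχ
  obtain ⟨k1, k2⟩ := hM ε (fun x => χ x - φ x) hε hχ
  have hr := h.toIsRegularSolution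
  have hsub : ∀ x ∈ Icc (0 : ℝ) 1, prodIntegral φ (fun x => χ x - φ x) x =
      prodIntegral φ χ x - prodIntegral φ φ x := by
    intro x hx
    simp only [prodIntegral, mul_sub]
    exact intervalIntegral.integral_sub (hr.intervalIntegrable_mul h.m_nonneg h' hx)
      (hr.intervalIntegrable_mul h.m_nonneg hr hx)
  rw [hsub 1 (by simp)] at k2
  have k3 : |(∫ x in 0..1, prodIntegral φ χ x / φ x ^ 2) -
      ∫ x in 0..1, prodIntegral φ φ x / φ x ^ 2| ≤ M * ε := by
    rw [← intervalIntegral.integral_sub (h.intervalIntegrable_prodIntegral_div h')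
      (h.intervalIntegrable_prodIntegral_div hr)]
    have := abs_integral_le_of_power_bound (p := 0) (C := M * ε) (by norm_num) (f := fun x =>
      prodIntegral φ χ x / φ x ^ 2 - prodIntegral φ φ x / φ x ^ 2) (fun x hx => by
        have := k1 x hx
        rw [hsub x ⟨hx.1.le, hx.2.le⟩, sub_div] at this
        simpa using this) (s := 1) (by simp)
    simpa using this
  have w1 := (hr.wronskian_eq_mul_prodIntegral h.m_nonneg h' hQ).2
  have w2 := h.div_sub_one_eq h' hQ
  set I' := ∫ x in 0..1, prodIntegral φ χ x / φ x ^ 2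
  set I := ∫ x in 0..1, prodIntegral φ φ x / φ x ^ 2
  -- An exact difference formula: the identities χ₁ = φ₁(1 + δI') and φ₁e₁ = d₁χ₁ + δ∫φχ are
  -- inserted. Only then is χ replaced by φ in the integrals.
  have e : e₁ + a * χ₁ - (d₁ + a * φ₁) - δ * ((d₁ + a * φ₁) * I + prodIntegral φ φ 1 / φ₁) =
      δ * ((d₁ + a * φ₁) * (I' - I) + (prodIntegral φ χ 1 - prodIntegral φ φ 1) / φ₁) := by
    have w2' : χ₁ = φ₁ * (1 + δ * I') := by rw [← w2]; field_simp; ring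
    have w1' : e₁ = (d₁ * χ₁ + δ * prodIntegral φ χ 1) / φ₁ := by
      rw [eq_div_iff p1.ne']; linarith
    rw [w1', w2']
    field_simp
    ring
  rw [e, abs_mul]
  refine mul_le_mul_of_nonneg_left ?_ (abs_nonneg _)
  refine (abs_add_le _ _).trans ?_
  rw [abs_mul, abs_div, abs_of_pos p1, add_mul, mul_assoc, div_mul_eq_mul_div]
  gcongr

lemma integral_greenKernel_sq (φ : ℝ → ℝ) :
    ∫ w, ∫ x, greenKernel φ w x ^ 2 ∂unitMeasure ∂unitMeasure =
      ∫ w in 0..1, prodIntegral φ φ w / φ w ^ 2 := by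
  rw [intervalIntegral.integral_of_le zero_le_one, integral_Ioc_eq_integral_Ioo]
  refine setIntegral_congr_fun measurableSet_Ioo fun w hw => ?_
  have e : ∀ x, greenKernel φ w x ^ 2 =
      (Ioo 0 w).indicator (fun x => φ x * φ x / φ w ^ 2) x := by
    intro x
    rw [greenKernel]
    by_cases hx : x ∈ Ioo 0 w
    · rw [indicator_of_mem hx, indicator_of_mem (mem_triangle hx.1 hx.2 hw.2)]
      ring
    · rw [indicator_of_notMem hx, indicator_of_notMem fun hp => hx ⟨hp.1, hp.2.1⟩]
      simp
  simp only [e]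
  rw [integral_indicator measurableSet_Ioo, Measure.restrict_restrict_of_subset
    (Ioo_subset_Ioo_right hw.2.le), integral_div, prodIntegral,
    intervalIntegral.integral_of_le hw.1.le, integral_Ioc_eq_integral_Ioo]

end IsPositiveSolution

namespace IsLeftData

variable {e η K a y : ℝ} {q a₀ V : ℝ → ℝ} {B : LeftBC}

/-- The derivative is read off from the exact difference formula; by norm continuity of the factor r
in y, the error is o(y' - y). The double integral of the squared Green kernel is the integral of
φ⁻²∫φ², which identifies the result with the trace. -/
lemma IsPositiveAt.hasDerivAt_charFun {hd : IsLeftData q a₀ B m e η K b V}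
    (h : hd.IsPositiveAt a y) :
    HasDerivAt (charFun hd.pert b a) (charFun hd.pert b a y * hd.resolventTrace a y) y := by
  have hp := h.positiveSol
  obtain ⟨M, hM0, hM⟩ := hp.exists_char_bound a
  have hc : charFun hd.pert b a y = dregOne hd.pert b y + a * regOne hd.pert b y := rfl
  have e1 : charFun hd.pert b a y * hd.resolventTrace a y =
      charFun hd.pert b a y * (∫ x in 0..1, prodIntegral (regSol (hd.pert.shift y) b)
        (regSol (hd.pert.shift y) b) x / regSol (hd.pert.shift y) b x ^ 2) +
      prodIntegral (regSol (hd.pert.shift y) b) (regSol (hd.pert.shift y) b) 1 /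
        regOne hd.pert b y := by
    rw [resolventTrace, IsPositiveSolution.integral_greenKernel_sq,
      hp.toIsRegularSolution.norm_vec_sq hd.pert.m_nonneg]
    have h1 := h.pos_one.ne'
    have h2 := h.char_pos.ne'
    field_simp
    ring
  rw [hasDerivAt_iff_isLittleO, Asymptotics.isLittleO_iff]
  intro c hc0
  have hcont : Tendsto (fun y' => M * ‖regFactor (hd.pert.shift y') b -
      regFactor (hd.pert.shift y) b‖) (𝓝 y) (𝓝 0) := by
    have h1 := (analyticOnNhd_regFactor hd.pert b y (mem_univ _)).continuousAt
    have h2 := ((h1.tendsto.sub_const (regFactor (hd.pert.shift y) b)).norm).const_mul M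
    simpa using h2
  filter_upwards [hcont.eventually (gt_mem_nhds hc0)] with y' hy'
  have := hM (y' - y) ‖regFactor (hd.pert.shift y') b - regFactor (hd.pert.shift y) b‖ _ _ _ _ _
    (hd.sol y') (fun x _ => by simp only [shiftedPot]; ring) (norm_nonneg _) (fun x hx => by
      have p := Real.rpow_pos_of_pos hx.1 m
      rw [regSol, regSol, ← mul_sub, abs_mul, abs_of_pos p, ← ext_sub, mul_comm]
      exact mul_le_mul_of_nonneg_right (abs_ext_le _ _) p.le)
  rw [e1, Real.norm_eq_abs, Real.norm_eq_abs, smul_eq_mul]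
  refine (this.trans ?_)
  rw [mul_comm c]
  exact mul_le_mul_of_nonneg_left hy'.le (abs_nonneg _)

end IsLeftData

end

section

/-! ### Product formula for the characteristic function -/

section logProd

variable {ι : Type*} {lam : ι → ℝ}

lemma hasDerivAt_logProd (hpos : ∀ i, 0 < lam i) (hs : Summable fun i => (lam i)⁻¹) {y : ℝ}
    (hy : 0 < y) : HasDerivAt (logProd lam) (∑' i, (lam i + y)⁻¹) y := by
  have hd : ∀ i, ∀ z ∈ Ioi (0 : ℝ), HasDerivAt (fun z => Real.log (1 + z / lam i)) (lam i + z)⁻¹ z := by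
    intro i z (hz : 0 < z)
    have h1 := hpos i
    have h2 : 0 < 1 + z / lam i := by positivity
    refine ((((hasDerivAt_id z).div_const (lam i)).const_add 1).log h2.ne').congr_deriv ?_
    simp only [id]
    field_simp
  refine hasDerivAt_tsum_of_isPreconnected hs isOpen_Ioi isPreconnected_Ioi hd
    (fun i z (hz : 0 < z) => ?_) hy (summable_log_one_add_div hpos hs hy.le) hy
  have h1 := hpos i
  rw [Real.norm_eq_abs, abs_of_pos (by positivity)]
  exact inv_anti₀ h1 (by linarith)

/-- The regularized product `∏ (1 + y / lam i)`. -/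
def regProd (lam : ι → ℝ) (y : ℝ) : ℝ := (∏' i, (1 + (y : ℂ) / lam i)).re

lemma regProd_zero : regProd lam 0 = 1 := by simp [regProd]

lemma regProd_eq_exp (hpos : ∀ i, 0 < lam i) (hs : Summable fun i => (lam i)⁻¹) {y : ℝ}
    (hy : 0 ≤ y) : regProd lam y = Real.exp (logProd lam y) := by
  have h1 : ∀ i, 0 < 1 + y / lam i := fun i => by
    have := div_nonneg hy (hpos i).le
    linarith
  have h2 := Real.hasProd_of_hasSum_log h1 (summable_log_one_add_div hpos hs hy).hasSum
  have h3 := (h2.map Complex.ofRealHom Complex.continuous_ofReal).tprod_eq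
  simp only [Function.comp_def, Complex.ofRealHom_eq_coe, Complex.ofReal_add, Complex.ofReal_one,
    Complex.ofReal_div] at h3
  rw [regProd, h3, Complex.ofReal_re]
  rfl

/-- The partial products converge locally uniformly in the complex plane, so the product is entire;
restricting to the real line and taking the real part preserves analyticity. -/
lemma analyticOnNhd_regProd (hpos : ∀ i, 0 < lam i) (hs : Summable fun i => (lam i)⁻¹) :
    AnalyticOnNhd ℝ (regProd lam) univ := by
  intro y _
  set R := |y| + 1
  have ho : IsOpen (Metric.ball (0 : ℂ) R) := Metric.isOpen_ball
  have h1 := Summable.hasProdLocallyUniformlyOn_one_add (f := fun i (z : ℂ) => z / lam i) ho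
    (hs.mul_left R) (Eventually.of_forall fun i z hz => ?_) fun i => by fun_prop
  · rw [hasProdLocallyUniformlyOn_iff_tendstoLocallyUniformlyOn] at h1
    have h2 := h1.differentiableOn (Eventually.of_forall fun s => by fun_prop) ho
    have hy : (y : ℂ) ∈ Metric.ball (0 : ℂ) R := by simp [R]
    have h3 := (h2.analyticAt (ho.mem_nhds hy)).restrictScalars (𝕜 := ℝ)
    have h4 := AnalyticAt.fun_comp (f := fun x : ℝ => (x : ℂ)) h3 (Complex.ofRealCLM.analyticAt y)
    exact AnalyticAt.fun_comp (g := Complex.re) (Complex.reCLM.analyticAt _) h4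
  · rw [norm_div, Complex.norm_real, Real.norm_eq_abs, abs_of_pos (hpos i), div_eq_mul_inv]
    refine mul_le_mul_of_nonneg_right ?_ (inv_nonneg.2 (hpos i).le)
    simpa using (mem_ball_zero_iff.1 hz).le

end logProd

/-- The positive elements of `Λ`. -/
def positives (Λ : Set ℝ) : Set ℝ := {l | l ∈ Λ ∧ 0 < l}

/-- The elements of `Λ` that are not positive. -/
def nonpositives (Λ : Set ℝ) : Set ℝ := {l | l ∈ Λ ∧ l ≤ 0}

/-- `F` is a characteristic function of the spectrum `Λ`. -/
structure IsSpectralDet (F : ℝ → ℝ) (Λ : Set ℝ) (y₀ : ℝ) : Prop where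
  base_pos : 0 < y₀
  analytic : AnalyticOnNhd ℝ F univ
  pos : ∀ y, y₀ ≤ y → 0 < F y
  add_pos : ∀ y, y₀ ≤ y → ∀ l ∈ Λ, 0 < l + y
  trace : ∀ y, y₀ ≤ y → ∃ T, HasSum (fun l : Λ => ((l : ℝ) + y)⁻¹) T ∧ HasDerivAt F (F y * T) y

namespace IsSpectralDet

variable {F : ℝ → ℝ} {Λ : Set ℝ} {y₀ y : ℝ}

/-- The terms of the convergent series Σ 1/(l + y₀) tend to 0. -/
lemma finite_le (h : IsSpectralDet F Λ y₀) (R : ℝ) : {l | l ∈ Λ ∧ l ≤ R}.Finite := by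
  obtain ⟨T, hT, -⟩ := h.trace y₀ le_rfl
  have h0 := hT.summable.tendsto_cofinite_zero
  have hp : (0 : ℝ) < (|R| + y₀)⁻¹ := inv_pos.2 (by have := h.base_pos; positivity)
  have h1 := h0.eventually (gt_mem_nhds hp)
  rw [Filter.eventually_cofinite] at h1
  refine (h1.image Subtype.val).subset ?_
  rintro l ⟨hl, hR⟩
  refine ⟨⟨l, hl⟩, ?_, rfl⟩
  simp only [mem_ofPred_eq, not_lt]
  exact inv_anti₀ (h.add_pos y₀ le_rfl l hl) (by linarith [le_abs_self R])

lemma finite_nonpositives (h : IsSpectralDet F Λ y₀) : (nonpositives Λ).Finite := h.finite_le 0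

lemma summable_positives (h : IsSpectralDet F Λ y₀) :
    Summable fun l : positives Λ => (l : ℝ)⁻¹ := by
  obtain ⟨T, hT, -⟩ := h.trace y₀ le_rfl
  have h1 : Summable fun l : positives Λ => ((l : ℝ) + y₀)⁻¹ :=
    hT.summable.comp_injective (i := fun l : positives Λ => (⟨l, l.2.1⟩ : Λ))
      fun l l' hll => by simpa [Subtype.ext_iff] using hll
  -- For l > y₀ one has l + y₀ < 2l, and only finitely many l are excluded.
  refine (h1.mul_left 2).of_norm_bounded_eventually ?_
  have h2 : {l : positives Λ | (l : ℝ) ≤ y₀}.Finite :=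
    Set.Finite.of_finite_image ((h.finite_le y₀).subset (by
      rintro _ ⟨l, hl, rfl⟩
      exact ⟨l.2.1, hl⟩)) Subtype.val_injective.injOn
  refine h2.subset fun l hl => ?_
  by_contra hlt
  simp only [mem_ofPred_eq, not_le] at hlt
  refine hl ?_
  have := l.2.2
  have := h.base_pos
  simp only [mem_ofPred_eq]
  rw [Real.norm_eq_abs, abs_of_pos (by positivity), ← div_eq_mul_inv, inv_eq_one_div,
    div_le_div_iff₀ (by positivity) (by positivity)]
  linarith

lemma pos_positives (l : positives Λ) : (0 : ℝ) < l := l.2.2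

lemma tsum_split (h : IsSpectralDet F Λ y₀) (hy : y₀ ≤ y) :
    ∑' l : Λ, ((l : ℝ) + y)⁻¹ = ∑ l ∈ h.finite_nonpositives.toFinset, (l + y)⁻¹ +
      ∑' l : positives Λ, ((l : ℝ) + y)⁻¹ := by
  obtain ⟨T, hT, -⟩ := h.trace y hy
  have hu : Λ = nonpositives Λ ∪ positives Λ := by
    ext l
    constructor
    · intro hl
      rcases le_or_gt l 0 with h0 | h0
      · exact Or.inl ⟨hl, h0⟩
      · exact Or.inr ⟨hl, h0⟩
    · rintro (hl | hl) <;> exact hl.1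
  have hd : Disjoint (nonpositives Λ) (positives Λ) :=
    Set.disjoint_left.2 fun l h1 h2 => not_lt.2 h1.2 h2.2
  have hsub : ∀ s ⊆ Λ, Summable ((fun l : ℝ => (l + y)⁻¹) ∘ ((↑) : s → ℝ)) := fun s hs =>
    hT.summable.comp_injective (i := fun l : s => (⟨l, hs l.2⟩ : Λ))
      fun l l' hll => by simpa [Subtype.ext_iff] using hll
  have h1 := Summable.tsum_union_disjoint (f := fun l : ℝ => (l + y)⁻¹) hd
    (hsub _ fun l hl => hl.1) (hsub _ fun l hl => hl.1)
  rw [← hu] at h1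
  rw [h1, ← Finset.tsum_subtype]
  congr 1
  exact tsum_congr_set_coe (fun l : ℝ => (l + y)⁻¹) (by simp)

/-- For y > y₀ both sides have logarithmic derivative Σ 1/(l + y), so they differ by a constant C.
The exponentiated identity is between real analytic functions, hence holds on the whole line, in
particular at 0, where the logarithms of the factors l + y need not make sense. -/
lemma exists_const (h : IsSpectralDet F Λ y₀) : ∃ C : ℝ,
    (∀ y, y₀ < y → Real.log (F y) = C + (∑ l ∈ h.finite_nonpositives.toFinset, Real.log (l + y) +
      logProd (fun l : positives Λ => (l : ℝ)) y)) ∧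
    F 0 = Real.exp C * ∏ l ∈ h.finite_nonpositives.toFinset, l := by
  set S := h.finite_nonpositives.toFinset with hS
  have hSΛ : ∀ l ∈ S, l ∈ Λ := fun l hl => (h.finite_nonpositives.mem_toFinset.1 hl).1
  set G : ℝ → ℝ := fun y => ∑ l ∈ S, Real.log (l + y) +
    logProd (fun l : positives Λ => (l : ℝ)) y with hG
  have dG : ∀ y, y₀ < y → HasDerivAt G (∑' l : Λ, ((l : ℝ) + y)⁻¹) y := by
    intro y hy
    rw [h.tsum_split hy.le]
    refine HasDerivAt.add ?_ (hasDerivAt_logProd pos_positives h.summable_positives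
      (h.base_pos.trans hy))
    refine HasDerivAt.fun_sum fun l hl => ?_
    refine (((hasDerivAt_id y).const_add l).log (h.add_pos y hy.le l (hSΛ l hl)).ne').congr_deriv ?_
    simp
  have dF : ∀ y, y₀ < y → HasDerivAt (fun y => Real.log (F y)) (∑' l : Λ, ((l : ℝ) + y)⁻¹) y := by
    intro y hy
    obtain ⟨T, hT, hD⟩ := h.trace y hy.le
    have hp := (h.pos y hy.le).ne'
    refine (hD.log hp).congr_deriv ?_
    rw [hT.tsum_eq]; field_simp
  obtain ⟨C, hC⟩ := isOpen_Ioi.exists_eq_add_of_deriv_eq (s := Ioi y₀) isPreconnected_Ioi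
    (fun y hy => (dF y hy).differentiableAt.differentiableWithinAt)
    (fun y hy => (dG y hy).differentiableAt.differentiableWithinAt)
    (fun y hy => (dF y hy).deriv.trans (dG y hy).deriv.symm)
  have hC' : ∀ y, y₀ < y → Real.log (F y) = C + G y := fun y hy => (hC hy).trans (add_comm _ _)
  refine ⟨C, hC', ?_⟩
  have key : F = fun y => Real.exp C * (∏ l ∈ S, (l + y)) *
      regProd (fun l : positives Λ => (l : ℝ)) y := by
    refine h.analytic.eq_of_eventuallyEq (z₀ := y₀ + 1) (fun y _ => ?_) ?_
    · refine (analyticAt_const.mul ?_).mul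
        (analyticOnNhd_regProd pos_positives h.summable_positives y (mem_univ _))
      exact Finset.analyticAt_fun_prod S fun l _ => analyticAt_const.add analyticAt_id
    · filter_upwards [Ioi_mem_nhds (lt_add_one y₀)] with y (hy : y₀ < y)
      rw [regProd_eq_exp pos_positives h.summable_positives (h.base_pos.trans hy).le,
        ← Real.exp_log (h.pos y hy.le), hC' y hy, hG, Real.exp_add, Real.exp_add, Real.exp_sum,
        mul_assoc]
      congr 2
      exact Finset.prod_congr rfl fun l hl => Real.exp_log (h.add_pos y hy.le l (hSΛ l hl))
  rw [key]
  simp [regProd_zero]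

lemma abs_log_add_sub_log_le {l y : ℝ} (hy : 0 < y) (hl : 2 * |l| ≤ y) :
    |Real.log (l + y) - Real.log y| ≤ 2 * |l| / y := by
  have h1 := neg_abs_le l
  have h2 := le_abs_self l
  have p : 0 < l + y := by linarith
  rw [abs_le]
  constructor
  · have := Real.log_le_sub_one_of_pos (div_pos hy p)
    rw [Real.log_div hy.ne' p.ne'] at this
    have h3 : y / (l + y) - 1 ≤ 2 * |l| / y := by
      have e : y / (l + y) - 1 = -l / (l + y) := by field_simp; ring
      rw [e, div_le_div_iff₀ p hy]
      nlinarith [abs_nonneg l]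
    linarith
  · have := Real.log_le_sub_one_of_pos (div_pos p hy)
    rw [Real.log_div p.ne' hy.ne'] at this
    have h3 : (l + y) / y - 1 ≤ 2 * |l| / y := by
      have e : (l + y) / y - 1 = l / y := by field_simp; ring
      rw [e]
      gcongr
      linarith [abs_nonneg l]
    linarith

/-- The growth of the product over the positive spectrum, read off from that of `F`. -/
lemma exists_hasLogExpansion (h : IsSpectralDet F Λ y₀) {β L θ M : ℝ} (hθ : 0 < θ) (hθ1 : θ ≤ 1)
    (hF : ∀ y, y₀ ≤ y → |Real.log (F y) - (√y + β * Real.log y + L)| ≤ M * y ^ (-θ)) :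
    ∃ C : ℝ, HasLogExpansion (fun l : positives Λ => (l : ℝ)) 1
      (β - h.finite_nonpositives.toFinset.card) (L - C) ∧
      F 0 = Real.exp C * ∏ l ∈ h.finite_nonpositives.toFinset, l := by
  obtain ⟨C, hC, hF0⟩ := h.exists_const
  refine ⟨C, ⟨pos_positives, h.summable_positives, ?_⟩, hF0⟩
  set S := h.finite_nonpositives.toFinset with hS
  -- Each nonpositive l contributes log(l + y) = log y + O(1/y), which lowers β by one. The
  -- threshold ensures 2|l| ≤ y.
  refine ⟨θ, M + ∑ l ∈ S, 2 * |l|, 1 + y₀ + ∑ l ∈ S, 2 * |l|, hθ, ?_, fun y hy => ?_⟩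
  · have : 0 ≤ ∑ l ∈ S, 2 * |l| := Finset.sum_nonneg fun _ _ => by positivity
    linarith [h.base_pos]
  · have s0 : 0 ≤ ∑ l ∈ S, 2 * |l| := Finset.sum_nonneg fun _ _ => by positivity
    have y0 := h.base_pos
    have y1 : 1 ≤ y := by linarith
    have h1 := hC y (by linarith)
    have h2 := hF y (by linarith)
    have h3 : |∑ l ∈ S, (Real.log (l + y) - Real.log y)| ≤ (∑ l ∈ S, 2 * |l|) * y ^ (-θ) := by
      refine (Finset.abs_sum_le_sum_abs _ _).trans ?_
      rw [Finset.sum_mul]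
      refine Finset.sum_le_sum fun l hl => ?_
      have : 2 * |l| ≤ ∑ l ∈ S, 2 * |l| :=
        Finset.single_le_sum (f := fun l => 2 * |l|) (fun _ _ => by positivity) hl
      refine (abs_log_add_sub_log_le (by linarith) (by linarith)).trans ?_
      rw [div_eq_mul_inv]
      refine mul_le_mul_of_nonneg_left ?_ (by positivity)
      rw [← Real.rpow_neg_one]
      exact Real.rpow_le_rpow_of_exponent_le y1 (by linarith)
    rw [Finset.sum_sub_distrib, Finset.sum_const, nsmul_eq_mul] at h3
    rw [add_mul]
    have e : logProd (fun l : positives Λ => (l : ℝ)) y -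
        (1 * √y + (β - S.card) * Real.log y + (L - C)) =
        (Real.log (F y) - (√y + β * Real.log y + L)) -
          (∑ l ∈ S, Real.log (l + y) - S.card * Real.log y) := by
      rw [h1]; ring
    rw [e]
    exact (abs_sub _ _).trans (add_le_add h2 h3)

end IsSpectralDet

end

section

/-! ### The zeta function of an operator with simple real spectrum -/

/-- The nonzero elements of `Λ` as complex numbers. -/
def nonzeroEquiv {Λ : Set ℝ} {T : Set ℂ} (hT : T = (fun l : ℝ => (l : ℂ)) '' Λ) :
    {l : ℝ | l ∈ Λ ∧ l ≠ 0} ≃ {z : ℂ // z ∈ T ∧ z ≠ 0} :=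
  Equiv.ofBijective
    (fun l => ⟨((l : ℝ) : ℂ), by rw [hT]; exact ⟨l, l.2.1, rfl⟩, by exact_mod_cast l.2.2⟩) <| by
    constructor
    · intro l l' h
      simpa [Subtype.ext_iff] using h
    · rintro ⟨z, hz, hz0⟩
      obtain ⟨l, hl, rfl⟩ := hT ▸ hz
      exact ⟨⟨l, hl, by simpa using hz0⟩, rfl⟩

lemma hasDerivAt_cpow_neg {z : ℂ} (hz : z ≠ 0) (s : ℂ) :
    HasDerivAt (fun s => z ^ (-s)) (-(z ^ (-s) * Complex.log z)) s := by
  have := (hasDerivAt_neg s).const_cpow (c := z) (Or.inl hz)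
  exact this.congr_deriv (by ring)

/-- The finitely many negative eigenvalues add an entire function of s, whose derivative at 0 is
minus the sum of their logarithms; the eigenvalue 0, if present, is left out. -/
lemma exists_isZetaFunction {E : Type*} [NormedAddCommGroup E] [NormedSpace ℂ E]
    {A : E →ₗ.[ℂ] E} {Λ : Set ℝ} (hspec : spec A = (fun l : ℝ => (l : ℂ)) '' Λ)
    (hdim : ∀ l ∈ Λ, Module.finrank ℂ (eigenspace A l) = 1) (hfin : (nonpositives Λ).Finite)
    {α β γ : ℝ} (h : HasLogExpansion (fun l : positives Λ => (l : ℝ)) α β γ) :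
    ∃ Z, IsZetaFunction A Z ∧
      -deriv Z 0 = -γ + ∑ l ∈ hfin.toFinset.filter (· ≠ 0), Complex.log l := by
  obtain ⟨Z, hmer, han, hder, hsum⟩ := h.exists_zeta
  set N := hfin.toFinset.filter (· ≠ 0) with hN
  have hNmem : ∀ l, l ∈ N ↔ (l ∈ Λ ∧ l ≤ 0) ∧ l ≠ 0 := fun l => by
    rw [hN, Finset.mem_filter, Finite.mem_toFinset]; rfl
  have hN0 : ∀ l ∈ N, (l : ℂ) ≠ 0 := fun l hl => by exact_mod_cast ((hNmem l).1 hl).2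
  have hda : ∀ s : ℂ, HasDerivAt (fun s : ℂ => ∑ l ∈ N, (l : ℂ) ^ (-s))
      (∑ l ∈ N, -((l : ℂ) ^ (-s) * Complex.log l)) s := fun s =>
    HasDerivAt.fun_sum fun l hl => hasDerivAt_cpow_neg (hN0 l hl) s
  have hana : ∀ s : ℂ, AnalyticAt ℂ (fun s : ℂ => ∑ l ∈ N, (l : ℂ) ^ (-s)) s := fun s =>
    Differentiable.analyticAt (fun s => (hda s).differentiableAt) s
  refine ⟨fun s : ℂ => (∑ l ∈ N, (l : ℂ) ^ (-s)) + Z s, ⟨?_, (hana 0).add han, 1 / 2, ?_⟩, ?_⟩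
  · obtain ⟨ε, hε, hm⟩ := hmer
    exact ⟨ε, hε, fun s hs => (hana s).meromorphicAt.add (hm s hs)⟩
  · intro s hs
    have h1 := (N.hasSum fun l : ℝ => (l : ℂ) ^ (-s)).add_disjoint (t := positives Λ)
      (Set.disjoint_left.2 fun l h1 h2 => not_lt.2 ((hNmem l).1 h1).1.2 h2.2) (hsum s hs)
    have hu : (N : Set ℝ) ∪ positives Λ = {l : ℝ | l ∈ Λ ∧ l ≠ 0} := by
      ext l
      simp only [mem_union, Finset.mem_coe, hNmem, positives, mem_ofPred_eq]
      constructor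
      · rintro (⟨⟨h1, -⟩, h3⟩ | ⟨h1, h2⟩)
        · exact ⟨h1, h3⟩
        · exact ⟨h1, h2.ne'⟩
      · rintro ⟨h1, h2⟩
        rcases lt_or_gt_of_ne h2 with h3 | h3
        · exact Or.inl ⟨⟨h1, h3.le⟩, h2⟩
        · exact Or.inr ⟨h1, h3⟩
    rw [hu] at h1
    rw [← (nonzeroEquiv hspec).hasSum_iff]
    convert! h1 using 1
    ext l
    simp only [Function.comp]
    change (Module.finrank ℂ (eigenspace A ((l : ℝ) : ℂ)) : ℂ) * ((l : ℝ) : ℂ) ^ (-s) = _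
    rw [hdim l l.2.1, Nat.cast_one, one_mul]
  · have := ((hda 0).add han.differentiableAt.hasDerivAt).deriv
    rw [hder] at this
    have e : deriv (fun s : ℂ => (∑ l ∈ N, (l : ℂ) ^ (-s)) + Z s) 0 = _ := this
    rw [e]
    simp only [neg_zero, Complex.cpow_zero, one_mul, Finset.sum_neg_distrib]
    ring

lemma clog_ofReal_of_neg {l : ℝ} (hl : l < 0) :
    Complex.log l = Real.log l + Real.pi * Complex.I := by
  rw [Complex.log, Complex.norm_real, Complex.arg_ofReal_of_neg hl, Real.norm_eq_abs, Real.log_abs]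

namespace IsSpectralDet

variable {F : ℝ → ℝ} {Λ : Set ℝ} {y₀ y : ℝ}

/-- The zeta-regularized determinant in terms of the characteristic function. -/
theorem exists_zeta_logDet (h : IsSpectralDet F Λ y₀) {β L θ M : ℝ} (hθ : 0 < θ) (hθ1 : θ ≤ 1)
    (hF : ∀ y, y₀ ≤ y → |Real.log (F y) - (√y + β * Real.log y + L)| ≤ M * y ^ (-θ))
    {E : Type*} [NormedAddCommGroup E] [NormedSpace ℂ E] {A : E →ₗ.[ℂ] E}
    (hspec : spec A = (fun l : ℝ => (l : ℂ)) '' Λ)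
    (hdim : ∀ l ∈ Λ, Module.finrank ℂ (eigenspace A l) = 1) :
    (∃ Z, IsZetaFunction A Z) ∧ (0 ∉ Λ →
      logDet A = ((Real.log (F 0) - L : ℝ) : ℂ) +
        h.finite_nonpositives.toFinset.card * (Real.pi * Complex.I) ∧
      0 < (-1) ^ h.finite_nonpositives.toFinset.card * F 0) := by
  obtain ⟨C, hexp, hF0⟩ := h.exists_hasLogExpansion hθ hθ1 hF
  obtain ⟨Z, hZ, hder⟩ := exists_isZetaFunction hspec hdim h.finite_nonpositives hexp
  refine ⟨⟨Z, hZ⟩, fun h0 => ?_⟩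
  set S := h.finite_nonpositives.toFinset
  have hneg : ∀ l ∈ S, l < 0 := fun l hl => by
    obtain ⟨h1, h2⟩ := h.finite_nonpositives.mem_toFinset.1 hl
    exact lt_of_le_of_ne h2 fun h3 => h0 (h3 ▸ h1)
  constructor
  -- `Real.log` is the logarithm of the absolute value; each negative eigenvalue gives log|l| + πi,
  -- and C with the product of the l recombines to log|F(0)|.
  · rw [hZ.logDet_eq, hder, Finset.filter_true_of_mem fun l hl => (hneg l hl).ne,
      Finset.sum_congr rfl fun l hl => clog_ofReal_of_neg (hneg l hl), Finset.sum_add_distrib,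
      Finset.sum_const, nsmul_eq_mul, hF0, Real.log_mul (Real.exp_ne_zero _)
      (Finset.prod_ne_zero_iff.2 fun l hl => (hneg l hl).ne), Real.log_exp,
      Real.log_prod fun l hl => (hneg l hl).ne]
    push_cast
    ring
  · rw [hF0, mul_left_comm, ← Finset.prod_neg]
    exact mul_pos (Real.exp_pos _) (Finset.prod_pos fun l hl => by
      have := hneg l hl
      linarith)

end IsSpectralDet

end

section

/-! ### The regularized determinant of the Sturm–Liouville operator -/

variable {m b e η K a y : ℝ} {q a₀ V : ℝ → ℝ} {B : LeftBC}

namespace IsLeftData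

/-- The characteristic function is a spectral determinant with the expected growth. -/
theorem exists_isSpectralDet (hd : IsLeftData q a₀ B m e η K b V) : ∃ L : ℝ, ∀ a : ℝ,
    ∃ y₀ M : ℝ, (∀ y, y₀ ≤ y → hd.IsPositiveAt a y) ∧
      IsSpectralDet (charFun hd.pert b a) (hd.eigenvalues a) y₀ ∧
      ∀ y, y₀ ≤ y → |Real.log (charFun hd.pert b a y) -
        (√y + (1 - m) / 2 * Real.log y + L)| ≤ M * y ^ (-(η / 4)) := by
  obtain ⟨L, M, z₀, hM, hz₀, hz⟩ := exists_regular_asymptotics hd.pert hd.e_or_b hd.b_mul_m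
  refine ⟨L, fun a => ?_⟩
  -- A threshold for √y, hence y₀ = Y². The second entry keeps (φ'(1)/φ(1) + a)/√y within 1/2 of 1.
  set Y := max z₀ (2 * (M + |a|)) with hY
  have hY1 : 1 ≤ Y := hz₀.trans (le_max_left _ _)
  have key : ∀ y, Y ^ 2 ≤ y → hd.IsPositiveAt a y ∧ |Real.log (charFun hd.pert b a y) -
      (√y + (1 - m) / 2 * Real.log y + L)| ≤ (M + 2 * (M + |a|)) * y ^ (-(η / 4)) := by
    intro y hy
    have y0 : 0 < y := lt_of_lt_of_le (by positivity) hy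
    have hs : Y ≤ √y := Real.le_sqrt_of_sq_le hy
    have hs0 : 0 ≤ √y := Real.sqrt_nonneg y
    have hsq : (√y) ^ 2 = y := Real.sq_sqrt y0.le
    have hsol := hd.sol ((√y) ^ 2)
    obtain ⟨p1, p2, p3, p4⟩ := hz (√y) ((le_max_left _ _).trans hs) _ _ _ _ hsol
    rw [hsq] at p1 p2 p3 p4
    obtain ⟨c1, c2⟩ := log_char_asymptotics (m := m) (L := L) (θ := η / 2) (a := a)
      (by linarith [hd.pert.eta_le]) hM (hY1.trans hs) ((le_max_right _ _).trans hs) p2 p3 p4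
    refine ⟨⟨p1, p2, c1⟩, ?_⟩
    have e1 : Real.log (√y) = Real.log y / 2 := Real.log_sqrt y0.le
    have e2 : √y ^ (-(η / 2)) = y ^ (-(η / 4)) := by
      rw [Real.sqrt_eq_rpow, ← Real.rpow_mul y0.le]; congr 1; ring
    rw [e1, e2] at c2
    refine le_trans (le_of_eq ?_) c2
    rw [charFun]
    ring_nf
  refine ⟨Y ^ 2, M + 2 * (M + |a|), fun y hy => (key y hy).1, ⟨by positivity,
    analyticOnNhd_charFun hd.pert b a, fun y hy => (key y hy).1.char_pos,
    fun y hy => (key y hy).1.hasSum_inv.1, fun y hy => ⟨hd.resolventTrace a y,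
      (key y hy).1.hasSum_inv.2, (key y hy).1.hasDerivAt_charFun⟩⟩, fun y hy => (key y hy).2⟩

lemma zero_mem_eigenvalues_iff (hd : IsLeftData q a₀ B m e η K b V) :
    0 ∈ hd.eigenvalues a ↔ charFun hd.pert b a 0 = 0 := by
  rw [eigenvalues, mem_ofPred_eq, neg_zero]

lemma spec_op_eq (hd : IsLeftData q a₀ B m e η K b V) (a : ℝ) :
    spec (op q a₀ B a) = (fun l : ℝ => (l : ℂ)) '' hd.eigenvalues a := by
  obtain ⟨L, hL⟩ := hd.exists_isSpectralDet
  obtain ⟨y₀, M, hpos, -⟩ := hL a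
  have hp := hpos y₀ le_rfl
  obtain ⟨C, hκ⟩ := hp.positiveSol.exists_isBoundedKernel
  exact (hd.hasSimpleSpectrum a).spec_eq (hp.isCompactResolvent hκ)

lemma charFun_ne_zero_of_isInvertible (hd : IsLeftData q a₀ B m e η K b V)
    (hinv : IsInvertible (op q a₀ B a)) : charFun hd.pert b a 0 ≠ 0 := by
  intro h0
  have : (0 : ℂ) ∈ spec (op q a₀ B a) := by
    rw [hd.spec_op_eq]
    exact ⟨0, hd.zero_mem_eigenvalues_iff.2 h0, Complex.ofReal_zero⟩
  exact this hinv

/-- The number of nonpositive eigenvalues. -/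
def negCount (hd : IsLeftData q a₀ B m e η K b V) (a : ℝ) : ℕ :=
  (nonpositives (hd.eigenvalues a)).ncard

lemma finite_nonpositives (hd : IsLeftData q a₀ B m e η K b V) (a : ℝ) :
    (nonpositives (hd.eigenvalues a)).Finite := by
  obtain ⟨L, hL⟩ := hd.exists_isSpectralDet
  obtain ⟨y₀, M, -, h, -⟩ := hL a
  exact h.finite_nonpositives

theorem exists_zeta_logDet (hd : IsLeftData q a₀ B m e η K b V) : ∃ L : ℝ, ∀ a : ℝ,
    (∃ Z, IsZetaFunction (op q a₀ B a) Z) ∧ (charFun hd.pert b a 0 ≠ 0 →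
      logDet (op q a₀ B a) = ((Real.log (charFun hd.pert b a 0) - L : ℝ) : ℂ) +
        hd.negCount a * (Real.pi * Complex.I) ∧
      0 < (-1) ^ hd.negCount a * charFun hd.pert b a 0) := by
  obtain ⟨L, hL⟩ := hd.exists_isSpectralDet
  refine ⟨L, fun a => ?_⟩
  obtain ⟨y₀, M, hpos, h, hb⟩ := hL a
  have := h.exists_zeta_logDet (by linarith [hd.pert.eta_pos]) (by linarith [hd.pert.eta_le]) hb
    (hd.spec_op_eq a) fun l hl => (hd.hasSimpleSpectrum a).finrank_eigenspace hl
  rw [← ncard_eq_toFinset_card _ h.finite_nonpositives] at this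
  exact ⟨this.1, fun h0 => this.2 fun h1 => h0 (hd.zero_mem_eigenvalues_iff.1 h1)⟩

/-! ### Interlacing of the eigenvalues for different boundary conditions -/

/-- The identity W(φ_y, φ_{y'})(1) = (y' - y)∫φ_yφ_{y'}, divided by y' - y in the limit y' → y. -/
lemma hasDerivAt_wronskian_one (hd : IsLeftData q a₀ B m e η K b V) (y : ℝ) :
    HasDerivAt (fun z => regOne hd.pert b y * dregOne hd.pert b z -
      dregOne hd.pert b y * regOne hd.pert b z) (‖hd.solVec (-y)‖ ^ 2) y := by
  have h := hd.sol y
  have e0 : ‖hd.solVec (-y)‖ ^ 2 = prodIntegral (regSol (hd.pert.shift y) b)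
      (regSol (hd.pert.shift y) b) 1 := by
    rw [solVec, (hd.sol (- -y)).norm_vec_sq, neg_neg]
  obtain ⟨C, hC0, hC⟩ := h.exists_mul_bound
  have hm := hd.pert.m_nonneg
  rw [hasDerivAt_iff_isLittleO, Asymptotics.isLittleO_iff]
  intro c hc0
  have hcont : Tendsto (fun y' => C * ‖regFactor (hd.pert.shift y') b -
      regFactor (hd.pert.shift y) b‖) (𝓝 y) (𝓝 0) := by
    have h1 := (analyticOnNhd_regFactor hd.pert b y (mem_univ _)).continuousAt
    have h2 := ((h1.tendsto.sub_const (regFactor (hd.pert.shift y) b)).norm).const_mul C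
    simpa using h2
  filter_upwards [hcont.eventually (gt_mem_nhds hc0)] with y' hy'
  have h' := hd.sol y'
  have w := (h.wronskian_eq_mul_prodIntegral hm h' (δ := y' - y)
    (fun x _ => by simp only [shiftedPot]; ring)).2
  have hsub : prodIntegral (regSol (hd.pert.shift y) b) (regSol (hd.pert.shift y') b) 1 -
      prodIntegral (regSol (hd.pert.shift y) b) (regSol (hd.pert.shift y) b) 1 =
      ∫ x in 0..1, regSol (hd.pert.shift y) b x *
        (regSol (hd.pert.shift y') b x - regSol (hd.pert.shift y) b x) := by
    simp only [prodIntegral, mul_sub]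
    exact (intervalIntegral.integral_sub (h.intervalIntegrable_mul hm h' (by simp))
      (h.intervalIntegrable_mul hm h (by simp))).symm
  have hbd := abs_integral_le_of_power_bound (p := 2 * m) (by linarith)
    (hC ‖regFactor (hd.pert.shift y') b - regFactor (hd.pert.shift y) b‖
    (fun x => regSol (hd.pert.shift y') b x - regSol (hd.pert.shift y) b x) (fun x hx => by
      have p := Real.rpow_pos_of_pos hx.1 m
      rw [regSol, regSol, ← mul_sub, abs_mul, abs_of_pos p, ← ext_sub, mul_comm]
      exact mul_le_mul_of_nonneg_right (abs_ext_le _ _) p.le)) (s := 1) (by simp)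
  rw [← hsub, Real.one_rpow, mul_one] at hbd
  have hbd' := hbd.trans (div_le_self (by positivity) (by linarith))
  have e1 : regOne hd.pert b y * dregOne hd.pert b y' - dregOne hd.pert b y * regOne hd.pert b y' -
      (regOne hd.pert b y * dregOne hd.pert b y - dregOne hd.pert b y * regOne hd.pert b y) -
      (y' - y) * ‖hd.solVec (-y)‖ ^ 2 = (y' - y) *
      (prodIntegral (regSol (hd.pert.shift y) b) (regSol (hd.pert.shift y') b) 1 -
      prodIntegral (regSol (hd.pert.shift y) b) (regSol (hd.pert.shift y) b) 1) := by
    rw [e0, w]; ring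
  rw [smul_eq_mul, e1, Real.norm_eq_abs, Real.norm_eq_abs, abs_mul, mul_comm c]
  exact mul_le_mul_of_nonneg_left (hbd'.trans hy'.le) (abs_nonneg _)

/-- The Wronskian of two characteristic functions has no zeros. -/
lemma charFun_wronskian_ne_zero (hd : IsLeftData q a₀ B m e η K b V) {a a' : ℝ} (haa : a ≠ a')
    (y : ℝ) : deriv (charFun hd.pert b a) y * charFun hd.pert b a' y -
      charFun hd.pert b a y * deriv (charFun hd.pert b a') y ≠ 0 := by
  have d1 := (analyticOnNhd_dregSolOne hd.pert b y (mem_univ _)).differentiableAt.hasDerivAt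
  have d2 := (analyticOnNhd_regSolOne hd.pert b y (mem_univ _)).differentiableAt.hasDerivAt
  have hD : ∀ a, deriv (charFun hd.pert b a) y =
      deriv (dregOne hd.pert b) y + a * deriv (regOne hd.pert b) y := fun a =>
    (d1.add (d2.const_mul a)).deriv
  have hw := (hd.hasDerivAt_wronskian_one y).unique
    ((d1.const_mul (regOne hd.pert b y)).sub (d2.const_mul (dregOne hd.pert b y)))
  have hpos : 0 < ‖hd.solVec (-y)‖ ^ 2 := by
    have := norm_pos_iff.2 ((hd.sol (- -y)).vec_ne_zero hd.pert.m_nonneg)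
    exact pow_pos this 2
  -- Both characteristic functions are affine in the boundary parameter, so their Wronskian is (a' -
  -- a) times that of the boundary values, which is ‖φ‖².
  have e : deriv (charFun hd.pert b a) y * charFun hd.pert b a' y -
      charFun hd.pert b a y * deriv (charFun hd.pert b a') y =
      (a' - a) * ‖hd.solVec (-y)‖ ^ 2 := by
    rw [hD, hD, hw, charFun, charFun]
    change _ = (a' - a) * (regOne hd.pert b y * deriv (dregOne hd.pert b) y -
      dregOne hd.pert b y * deriv (regOne hd.pert b) y)
    ring
  rw [e]
  exact mul_ne_zero (sub_ne_zero.2 haa.symm) hpos.ne'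

/-- If F_{a'} had no zero between two zeros of F_a, Rolle's theorem for F_a/F_{a'} would give a zero
of the Wronskian of the two functions. At the end points themselves a common zero is excluded by the
same Wronskian. -/
lemma exists_eigenvalue_between (hd : IsLeftData q a₀ B m e η K b V) {a a' : ℝ} (haa : a ≠ a')
    {x z : ℝ} (hx : x ∈ hd.eigenvalues a) (hz : z ∈ hd.eigenvalues a) (hxz : x < z) :
    ∃ l ∈ hd.eigenvalues a', x < l ∧ l < z := by
  by_contra! hne
  have hx0 : charFun hd.pert b a (-x) = 0 := hx
  have hz0 : charFun hd.pert b a (-z) = 0 := hz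
  have nz : ∀ y ∈ Icc (-z) (-x), charFun hd.pert b a' y ≠ 0 := by
    intro y hy h0
    have hw := hd.charFun_wronskian_ne_zero haa y
    have hy' : -y ∈ hd.eigenvalues a' := by rwa [eigenvalues, mem_ofPred_eq, neg_neg]
    rcases eq_or_lt_of_le hy.1 with h1 | h1
    · rw [← h1] at hw h0
      rw [h0, hz0] at hw
      simp at hw
    rcases eq_or_lt_of_le hy.2 with h2 | h2
    · rw [h2] at hw h0
      rw [h0, hx0] at hw
      simp at hw
    · exact not_lt.2 (hne (-y) hy' (by linarith)) (by linarith)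
  have hdd : ∀ a y, HasDerivAt (charFun hd.pert b a) (deriv (charFun hd.pert b a) y) y := fun a y =>
    (analyticOnNhd_charFun hd.pert b a y (mem_univ _)).differentiableAt.hasDerivAt
  have hder : ∀ y ∈ Icc (-z) (-x), HasDerivAt
      (fun y => charFun hd.pert b a y / charFun hd.pert b a' y) _ y := fun y hy =>
    (hdd a y).div (hdd a' y) (nz y hy)
  obtain ⟨c, hc, hc0⟩ := exists_hasDerivAt_eq_zero (neg_lt_neg hxz)
    (fun y hy => (hder y hy).continuousAt.continuousWithinAt) (by simp only [hx0, hz0, zero_div])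
    fun y hy => hder y (Ioo_subset_Icc_self hy)
  have hc' := Ioo_subset_Icc_self hc
  rw [div_eq_zero_iff] at hc0
  rcases hc0 with h0 | h0
  · exact hd.charFun_wronskian_ne_zero haa c h0
  · exact nz c hc' (pow_eq_zero_iff two_ne_zero |>.1 h0)

/-- Between two nonpositive eigenvalues for a lies one for a', again nonpositive; interleaved finite
sets differ in size by at most one in this direction. -/
lemma negCount_le (hd : IsLeftData q a₀ B m e η K b V) (a a' : ℝ) :
    hd.negCount a ≤ hd.negCount a' + 1 := by
  rcases eq_or_ne a a' with rfl | haa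
  · exact Nat.le_succ _
  rw [negCount, negCount, ncard_eq_toFinset_card _ (hd.finite_nonpositives a),
    ncard_eq_toFinset_card _ (hd.finite_nonpositives a')]
  refine Finset.card_le_of_interleaved fun x hx z hz hxz _ => ?_
  rw [Finite.mem_toFinset] at hx hz
  obtain ⟨l, hl, h1, h2⟩ := hd.exists_eigenvalue_between haa hx.1 hz.1 hxz
  exact ⟨l, (Finite.mem_toFinset _).2 ⟨hl, h2.le.trans hz.2⟩, h1, h2⟩

/-- The number of negative eigenvalues is determined by the sign of the characteristic function. -/
lemma negCount_eq (hd : IsLeftData q a₀ B m e η K b V) {a a' : ℝ}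
    (h : 0 < charFun hd.pert b a 0 * charFun hd.pert b a' 0) : hd.negCount a = hd.negCount a' := by
  obtain ⟨L, hL⟩ := hd.exists_zeta_logDet
  have h1 := ((hL a).2 (left_ne_zero_of_mul h.ne')).2
  have h2 := ((hL a').2 (right_ne_zero_of_mul h.ne')).2
  have l1 := hd.negCount_le a a'
  have l2 := hd.negCount_le a' a
  by_contra hne
  -- The counts could differ only by exactly one, but then the two sign relations would give values
  -- at 0 of opposite sign.
  have hcase : hd.negCount a = hd.negCount a' + 1 ∨ hd.negCount a' = hd.negCount a + 1 := by omega
  have h3 := mul_pos h1 h2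
  have hs : ∀ n : ℕ, ((-1 : ℝ)) ^ n * (-1) ^ (n + 1) = -1 := fun n => by
    rw [pow_succ, ← mul_assoc, ← mul_pow]; simp
  rcases hcase with hc | hc <;> rw [hc] at h3
  · have := hs (hd.negCount a')
    nlinarith
  · have := hs (hd.negCount a)
    nlinarith

end IsLeftData

end

section

/-! ### Regular singular potentials -/

variable {m b e η K a : ℝ} {q a₀ a₁ V : ℝ → ℝ} {B : LeftBC} {N : ℕ}

namespace RegularSingular

lemma rpow_mem (hq : RegularSingular N a₀ a₁ q) {x : ℝ} (hx : x ∈ Ioo (0 : ℝ) 1) :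
    x ^ (1 / (N : ℝ)) ∈ Ioo (0 : ℝ) 1 := by
  have hN : (0 : ℝ) < N := by exact_mod_cast hq.pos
  exact ⟨Real.rpow_pos_of_pos hx.1 _, Real.rpow_lt_one hx.1.le hx.2 (by positivity)⟩

lemma continuousOn (hq : RegularSingular N a₀ a₁ q) : ContinuousOn q (Ioo 0 1) := by
  have h1 : ContinuousOn (fun x : ℝ => a₀ (x ^ (1 / (N : ℝ))) / x ^ 2) (Ioo 0 1) := by
    refine ContinuousOn.div (hq.smooth_left.continuousOn.comp ?_ fun x hx =>
      Ioo_subset_Ico_self (hq.rpow_mem hx)) (by fun_prop) fun x hx => pow_ne_zero 2 hx.1.ne'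
    exact continuousOn_id.rpow_const fun x hx => Or.inl (ne_of_gt hx.1)
  exact h1.congr hq.eq_left

/-- Here m = ν₀ + 1/2 gives m(m - 1) = a₀(0). The remainder V = (a₀(x^{1/N}) - a₀(0))/x² is
O(x^{1/N-2}) at 0, since a₀ is differentiable at 0, and it is bounded at 1 by continuity of q there.
-/
lemma exists_isLeftData_dirichlet (hq : RegularSingular N a₀ a₁ q) (h1 : ContinuousAtOne q) :
    ∃ m e η K b V, IsLeftData q a₀ .dirichlet m e η K b V := by
  have hN : (1 : ℝ) ≤ N := by exact_mod_cast hq.pos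
  have hN0 : (0 : ℝ) < N := by linarith
  set p : ℝ := 1 / N with hp
  have p0 : 0 < p := by positivity
  have p1 : p ≤ 1 := by rw [hp, div_le_one hN0]; exact hN
  set ν := √(a₀ 0 + 1 / 4) with hν
  have hν0 : 0 ≤ ν := Real.sqrt_nonneg _
  have hνsq : ν ^ 2 = a₀ 0 + 1 / 4 := Real.sq_sqrt (by linarith [hq.bound_left])
  set V : ℝ → ℝ := fun x => q x - a₀ 0 / x ^ 2 with hV
  have cV : ContinuousOn V (Ioo 0 1) := hq.continuousOn.sub
    (continuousOn_const.div (by fun_prop) fun x hx => pow_ne_zero 2 hx.1.ne')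
  have cpow : ∀ r : ℝ, ContinuousOn (fun x : ℝ => x ^ r) (Ioo 0 1) := fun r =>
    continuousOn_id.rpow_const fun x hx => Or.inl (ne_of_gt hx.1)
  have lpow : ∀ r : ℝ, Tendsto (fun x : ℝ => x ^ r) (𝓝[<] 1) (𝓝 1) := fun r => by
    have := (Real.continuousAt_rpow_const 1 r (Or.inl one_ne_zero)).tendsto
    rw [Real.one_rpow] at this
    exact this.mono_left nhdsWithin_le_nhds
  obtain ⟨c, hc⟩ := h1
  have hright : Tendsto (fun x => V x * x ^ (2 - p)) (𝓝[<] 1) (𝓝 ((c - a₀ 0 / 1 ^ 2) * 1)) := by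
    refine (hc.sub (tendsto_const_nhds.div ?_ (by norm_num))).mul (lpow _)
    have : ContinuousAt (fun x : ℝ => x ^ 2) 1 := by fun_prop
    exact this.tendsto.mono_left nhdsWithin_le_nhds
  have hdiff := (hq.smooth_left.differentiableOn (by simp) 0 (by simp)).hasDerivWithinAt
  rw [hasDerivWithinAt_iff_tendsto_slope] at hdiff
  have hto : Tendsto (fun x : ℝ => x ^ p) (𝓝[>] 0) (𝓝[Ico 0 1 \ {0}] 0) := by
    refine tendsto_nhdsWithin_iff.2 ⟨?_, ?_⟩
    · have := (Real.continuousAt_rpow_const 0 p (Or.inr p0.le)).tendsto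
      rw [Real.zero_rpow p0.ne'] at this
      exact this.mono_left nhdsWithin_le_nhds
    · filter_upwards [eventually_left] with x hx
      have := hq.rpow_mem hx
      exact ⟨Ioo_subset_Ico_self this, this.1.ne'⟩
  have hleft : Tendsto (fun x => V x * x ^ (2 - p)) (𝓝[>] 0) (𝓝 (derivWithin a₀ (Ico 0 1) 0)) := by
    refine (hdiff.comp hto).congr' ?_
    filter_upwards [eventually_left] with x hx
    have e1 : x ^ (2 - p) = x ^ 2 / x ^ p := by
      rw [Real.rpow_sub hx.1]; norm_num
    have n1 := (Real.rpow_pos_of_pos hx.1 p).ne'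
    have n2 := hx.1.ne'
    simp only [Function.comp, slope_def_field, hV, e1, hq.eq_left x hx]
    rw [← hp]
    field_simp
    ring
  obtain ⟨R, hR⟩ := exists_bound_of_tendsto (cV.mul (cpow (2 - p))) hleft hright
  -- The exponent -1 - e + η must equal p - 2 with p = 1/N. Splitting p evenly gives e < 1 and η > 0
  -- at once.
  refine ⟨ν + 1 / 2, 1 - p / 2, p / 2, R, 0, V,
    ⟨by linarith, by linarith, by linarith, by linarith, by linarith, cV, fun x hx => ?_⟩,
    fun x hx => ?_, Or.inr rfl, zero_mul _, by rw [LeftBC.nu],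
    Or.inl ⟨rfl, by linarith, rfl⟩⟩
  · have : |V x * x ^ (2 - p)| ≤ R := hR x hx
    have p2 := Real.rpow_pos_of_pos hx.1 (2 - p)
    rw [abs_mul, abs_of_pos p2, ← le_div_iff₀ p2] at this
    refine this.trans (le_of_eq ?_)
    rw [div_eq_mul_inv, ← Real.rpow_neg hx.1.le]
    congr 2; ring
  · have : (ν + 1 / 2) * (ν + 1 / 2 - 1) = a₀ 0 := by linear_combination hνsq
    rw [this, hV]; ring

lemma exists_isLeftData_neumann (hq : RegularSingular N a₀ a₁ q) (h1 : ContinuousAtOne q)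
    (h0 : ContinuousAtZero q) (A : ℝ) :
    ∃ m e η K b V, IsLeftData q a₀ (.neumann A) m e η K b V := by
  obtain ⟨c, hc⟩ := h1
  obtain ⟨c', hc'⟩ := h0
  obtain ⟨R, hR⟩ := exists_bound_of_tendsto hq.continuousOn hc' hc
  -- The potential is bounded, so -1 - e + η = 0; the slope b = -A expresses φ'(0) + Aφ(0) = 0 for
  -- φ(0) = 1.
  refine ⟨0, 0, 1, R, -A, q, ⟨le_rfl, one_pos, by norm_num, one_pos, le_rfl, hq.continuousOn,
    fun x hx => by simpa using hR x hx⟩, fun x hx => by simp, Or.inl rfl, mul_zero _,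
    by norm_num [LeftBC.nu], Or.inr ⟨A, rfl, rfl, rfl⟩⟩

lemma exists_isLeftData (hq : RegularSingular N a₀ a₁ q) (h1 : ContinuousAtOne q)
    (hB : B.Admissible q) : ∃ m e η K b V, IsLeftData q a₀ B m e η K b V := by
  cases B with
  | dirichlet => exact hq.exists_isLeftData_dirichlet h1
  | neumann A => exact hq.exists_isLeftData_neumann h1 hB A

end RegularSingular

/-! ### Normalized solutions -/

lemma LeftBC.Vanishes.ofReal {f : ℝ → ℝ} (hf : ∀ x ∈ Ioo (0 : ℝ) 1, DifferentiableAt ℝ f x)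
    (h : B.Vanishes a₀ f) : B.Vanishes a₀ (fun x => (f x : ℂ)) := by
  have o : ∀ {g : ℝ → ℝ} {l : ℝ}, Tendsto g (𝓝[>] 0) (𝓝 l) →
      Tendsto (fun x => (g x : ℂ)) (𝓝[>] 0) (𝓝 (l : ℂ)) := fun hg =>
    (Complex.continuous_ofReal.tendsto _).comp hg
  cases B with
  | dirichlet =>
    have := o h
    rw [Complex.ofReal_zero] at this
    refine this.congr fun x => ?_
    rw [smul_eq_mul, Complex.real_smul, Complex.ofReal_mul]
  | neumann A =>
    obtain ⟨c, d, h1, h2, h3⟩ := h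
    refine ⟨c, d, o h1, (o h2).congr' ?_, ?_⟩
    · filter_upwards [eventually_left] with x hx
      exact ((hf x hx).hasDerivAt.ofReal_comp).deriv.symm
    · rw [smul_eq_mul] at h3
      rw [Complex.real_smul]
      exact_mod_cast h3

namespace IsLeftData

/-- The normalized solution at `0` is the regular solution. -/
lemma eqOn_regSol (hd : IsLeftData q a₀ B m e η K b V) {φ : ℝ → ℝ}
    (hφ : IsNormalizedAtZero q a₀ B φ) : EqOn φ (regSol (hd.pert.shift 0) b) (Ioo 0 1) := by
  obtain ⟨hs, hv, hlim⟩ := hφ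
  have hQ := hd.shiftedPot_eq 0
  obtain ⟨c, hc⟩ := hd.exists_eq_const_mul (continuousOn_shiftedPot hd.pert 0) (hd.sol 0)
    (v := fun x => (φ x : ℂ)) (v' := fun x => ((deriv φ x : ℝ) : ℂ))
    (fun x hx => (hs x hx).1.hasDerivAt.ofReal_comp)
    (fun x hx => (hs x hx).2.ofReal_comp.congr_deriv (by
      rw [hQ x hx, add_zero]; push_cast; rfl))
    (hv.ofReal fun x hx => (hs x hx).1)
  rw [hd.nu] at hlim
  have l1 := (Complex.continuous_ofReal.tendsto _).comp hlim
  have l2 := ((Complex.continuous_ofReal.tendsto _).comp (hd.sol 0).left).const_mul c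
  have hc1 : ((1 : ℝ) : ℂ) = c * ((1 : ℝ) : ℂ) := by
    refine tendsto_nhds_unique l1 (l2.congr' ?_)
    filter_upwards [eventually_left] with x hx
    simp only [Function.comp, Complex.ofReal_div]
    rw [hc x hx, mul_div_assoc]
  rw [Complex.ofReal_one, mul_one] at hc1
  intro x hx
  have := hc x hx
  rw [← hc1, one_mul] at this
  exact_mod_cast this

/-- The Wronskian of the normalized solutions is the characteristic function at `0`. -/
lemma wronskian_eq (hd : IsLeftData q a₀ B m e η K b V) {φ ψ : ℝ → ℝ}
    (hφ : IsNormalizedAtZero q a₀ B φ) (hψ : IsNormalizedAtOne q a ψ) {x : ℝ}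
    (hx : x ∈ Ioo (0 : ℝ) 1) : wronskian ψ φ x = charFun hd.pert b a 0 := by
  have hsol := hd.sol 0
  have heq := hd.eqOn_regSol hφ
  have hder : ∀ x ∈ Ioo (0 : ℝ) 1, deriv φ x = dregSol (hd.pert.shift 0) b x := fun x hx =>
    (heq.eventuallyEq_of_mem (Ioo_mem_nhds hx.1 hx.2)).deriv_eq.trans (hsol.hasDerivAt x hx).deriv
  have hW : ∀ x ∈ Ioo (0 : ℝ) 1, HasDerivAt (wronskian ψ φ) 0 x := by
    intro x hx
    obtain ⟨p1, p2⟩ := hφ.1 x hx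
    obtain ⟨s1, s2⟩ := hψ.1 x hx
    exact ((s1.hasDerivAt.mul p2).sub (s2.mul p1.hasDerivAt)).congr_deriv (by ring)
  obtain ⟨W, hconst⟩ := isOpen_Ioo.exists_is_const_of_deriv_eq_zero isPreconnected_Ioo
    (fun t ht => (hW t ht).differentiableAt.differentiableWithinAt) (fun t ht => (hW t ht).deriv)
  rw [hconst x hx]
  obtain ⟨-, ⟨c, d, h1, h2, h3⟩, h4⟩ := hψ
  obtain rfl := tendsto_nhds_unique h1 h4
  rw [smul_eq_mul, mul_one] at h3
  -- The constant Wronskian is evaluated at 1, where ψ → 1 and ψ' → -a.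
  have hl := (h4.mul hsol.right').sub (h2.mul hsol.right)
  have hl' : Tendsto (fun _ : ℝ => W) (𝓝[<] 1)
      (𝓝 (1 * dregOne hd.pert b 0 - d * regOne hd.pert b 0)) := by
    refine hl.congr' ?_
    filter_upwards [eventually_right] with t ht
    rw [← hconst t ht, wronskian, hder t ht, heq ht]
  rw [tendsto_nhds_unique tendsto_const_nhds hl', charFun]
  linear_combination (-regOne hd.pert b 0) * h3

lemma continuous_charFun_zero (hd : IsLeftData q a₀ B m e η K b V) :
    Continuous fun a => charFun hd.pert b a 0 := by
  unfold charFun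
  fun_prop

end IsLeftData

/-- While x keeps the sign of x₀, the imaginary part of the principal logarithm stays equal to arg
x₀, also on the negative axis. -/
lemma clog_ofReal_eq {x x₀ : ℝ} (h : 0 < x * x₀) :
    Complex.log x = Real.log x + Complex.arg x₀ * Complex.I := by
  rcases lt_or_gt_of_ne (right_ne_zero_of_mul h.ne') with h0 | h0
  · rw [Complex.arg_ofReal_of_neg h0, clog_ofReal_of_neg (neg_of_mul_pos_left h h0.le)]
  · rw [Complex.arg_ofReal_of_nonneg h0.le, Complex.ofReal_log (pos_of_mul_pos_left h h0.le).le]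
    simp

end

end SturmLiouville

end

/-! ### The variation formula. -/

theorem proposition3p6 (N : ℕ) (a₀ a₁ q : ℝ → ℝ)
    (hq : SturmLiouville.RegularSingular N a₀ a₁ q)
    (hq_one : SturmLiouville.ContinuousAtOne q)
    (B : SturmLiouville.LeftBC) (hB : B.Admissible q)
    (I : Set ℝ) (hI : I.OrdConnected) (hI' : I.Nontrivial)
    (a : ℝ → ℝ) (ha : ContDiffOn ℝ ∞ a I)
    (φ ψ : ℝ → ℝ → ℝ)
    (hφ : ∀ t ∈ I, SturmLiouville.IsNormalizedAtZero q a₀ B (φ t))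
    (hψ : ∀ t ∈ I, SturmLiouville.IsNormalizedAtOne q (a t) (ψ t)) :
    (∀ t ∈ I, ∃ Z : ℂ → ℂ,
      SturmLiouville.IsZetaFunction (SturmLiouville.op q a₀ B (a t)) Z) ∧
    ∀ t ∈ I, SturmLiouville.IsInvertible (SturmLiouville.op q a₀ B (a t)) →
      (∀ x ∈ Ioo (0 : ℝ) 1, SturmLiouville.wronskian (ψ t) (φ t) x ≠ 0) ∧
      ∃ D : ℂ,
        HasDerivWithinAt
          (fun s => SturmLiouville.logDet (SturmLiouville.op q a₀ B (a s))) D I t ∧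
        ∀ x ∈ Ioo (0 : ℝ) 1,
          HasDerivWithinAt
            (fun s => Complex.log (SturmLiouville.wronskian (ψ s) (φ s) x : ℂ)) D I t := by
  obtain ⟨m, e, η, K, b, V, hd⟩ := hq.exists_isLeftData hq_one hB
  obtain ⟨L, hL⟩ := hd.exists_zeta_logDet
  refine ⟨fun t _ => (hL (a t)).1, fun t ht hinv => ?_⟩
  have hF0 := hd.charFun_ne_zero_of_isInvertible hinv
  set F : ℝ → ℝ := fun s => SturmLiouville.charFun hd.pert b (a s) 0 with hF
  have hW : ∀ s ∈ I, ∀ x ∈ Ioo (0 : ℝ) 1, SturmLiouville.wronskian (ψ s) (φ s) x = F s :=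
    fun s hs x hx => hd.wronskian_eq (hφ s hs) (hψ s hs) hx
  refine ⟨fun x hx => by rw [hW t ht x hx]; exact hF0, ?_⟩
  have hat := (ha.differentiableOn (by simp) t ht).hasDerivWithinAt
  -- Near t the sign of F is constant, which fixes both the number of negative eigenvalues and the
  -- argument in the principal logarithm.
  have hsign : ∀ᶠ s in 𝓝[I] t, 0 < F s * F t := by
    have h1 : Tendsto F (𝓝[I] t) (𝓝 (F t)) :=
      (hd.continuous_charFun_zero.tendsto _).comp hat.continuousWithinAt
    exact (h1.mul_const (F t)).eventually_const_lt (mul_self_pos.2 hF0)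
  -- F depends affinely on a(s), so only differentiability of a at t within I is used. The
  -- derivative of log|F| is the common value D.
  have hlog : HasDerivWithinAt (fun s => ((Real.log (F s) : ℝ) : ℂ)) _ I t :=
    (((hat.mul_const (SturmLiouville.regOne hd.pert b 0)).const_add
      (SturmLiouville.dregOne hd.pert b 0)).log hF0).ofReal_comp
  refine ⟨_, (hlog.add_const (-(L : ℂ) + hd.negCount (a t) *
    (Real.pi * Complex.I))).congr_of_eventuallyEq_of_mem ?_ ht, fun x hx =>
    (hlog.add_const (Complex.arg (F t) * Complex.I)).congr_of_eventuallyEq_of_mem ?_ ht⟩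
  · filter_upwards [hsign] with s hs
    rw [((hL (a s)).2 (left_ne_zero_of_mul hs.ne')).1, hd.negCount_eq hs]
    push_cast
    ring
  · filter_upwards [hsign, self_mem_nhdsWithin] with s hs hsI
    rw [hW s hsI x hx, SturmLiouville.clog_ofReal_eq hs]
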